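/- **Setting.** We work in the synchronous multiparty session $\pi$-calculus with crash-stop failures. *Types*: basic types $B$ (unit, bool, int, real, string, with $\mathrm{int}<:\mathrm{real}$); session types $T$ built from external choices $p\&\{\ell_i(S_i).T_i\}_{i\in I}$, internal choices $p\oplus\{\ell_i(S_i).T_i\}_{i\in I}$ ($I$ finite and non-empty, labels pairwise distinct, payloads $S_i$ basic or session types, the label $\mathsf{crash}$ allowed only in external choices and carrying $\mathrm{unit}$ when its payload is omitted), closed guarded recursion $\mu t.T$, and $\mathsf{end}$; and the type $\mathsf{stop}$ of a crashed endpoint. Subtyping $\leqslant$ is coinductive (a subtype has wider internal and narrower external choices; $\mathsf{stop}\leqslant\mathsf{stop}$; an external choice whose only branch is $\mathsf{crash}$ has no supertype with more branches). *Processes*: $\mathbf 0$, $(\nu s)P$, $P|Q$, selection $c[q]\oplus\ell\langle d\rangle.P$ ($\ell\ne\mathsf{crash}$), branching $c[q]\&\{\ell_i(x_i).P_i\}_{i\in I}$, definitions $\mathsf{def}\,X(\tilde x:\tilde S)=Q\,\mathsf{in}\,P$, calls $X\langle\tilde d\rangle$, $\mathsf{err}$, and crashed endpoints $s[p]\lightning$.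 Processes are taken up to $\alpha$-conversion. They reduce modulo structural congruence $\equiv$ (in whose axiom $\mathsf{def}\,D\,\mathsf{in}\,\mathbf 0\equiv\mathbf 0$ the declaration $D$ has no free channels and no free variables): by communication (or to $\mathsf{err}$ on a label mismatch); by unfolding calls; by crashing a selection or branching into the parallel composition of $s'[r]\lightning$ for all its free endpoints $s'[r]$; by losing a message sent to a crashed endpoint (an endpoint in the payload then crashes); and by taking a $\mathsf{crash}$ branch when the peer is crashed. $P\not\to$ means that $P$ has no reduction derivable without the crash rules. $\mathcal C$ ranges over reduction contexts and $w$ over basic values and endpoints. *Typing.* $\Gamma\vdash P$ is the linear typing judgement: arguments of calls and payloads of selections have types $\not\leqslant\mathsf{end}$; the body of a definition is typed using only its parameters; $s[p]\lightning$ is typed by $s[p]:\mathsf{stop}$; and $(\nu s':\Gamma')P$ requires $\Gamma'$ to be $(s';R')$-safe for some $R'$. $\mathrm{end}(\Gamma)$ means that all entries of $\Gamma$ are basic or $\leqslant\mathsf{end}$. *Contexts.* They have transitions: $p$ sends $\ell(S)$ to $q$; $q$ receives $\ell(S)$ from $p$; $\ell$ is transmitted from $p$ to $q$ (also if $q$ has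 crashed, the message being lost); $q$ detects that $p$ crashed (taking a $\mathsf{crash}(\mathrm{unit})$ branch); $p$ crashes ($s[p]:T$ with $T\not\leqslant\mathsf{end}$ becomes $s[p]:\mathsf{stop}$); and $p$ signals that it has stopped. $\Gamma\to\Gamma'$ is a transmission or a detection (on any session); $\Gamma\to_{s;R}\Gamma'$ is a transmission or detection on session $s$, or a crash of some $s[p]$ with $p\notin R$. $\Gamma$ is *$(s;R)$-safe* if it lies in a set $\varphi$ of contexts closed under $\to_{s;R}$ such that for all $\Gamma'\in\varphi$ and all $p,q$: if in $\Gamma'$ on $s$ both $p$ can send $\ell(S)$ to $q$ and $q$ can receive some message from $p$, then $\ell$ can be transmitted from $p$ to $q$; and if $p$ has stopped and $q$ can receive some message from $p$, then $q$ can detect the crash of $p$. *Type-level properties.* $\Gamma$ is * *$(s;R)$-deadlock-free* if $\Gamma\to_{s;R}^*\Gamma'\not\to$ implies that for every $s[p]\in\mathrm{dom}(\Gamma')$: $\Gamma'(s[p])\leqslant\mathsf{end}$, or $\Gamma'(s[p])=\mathsf{stop}$, or $\Gamma'(s[p])\leqslant q\&\mathsf{crash}.T'$ for some $q,T'$; *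 *$(s;R)$-terminating* if it is $(s;R)$-deadlock-free and there is $j$ such that for all $n\ge j$, $\Gamma=\Gamma_0\to_{s;R}\cdots\to_{s;R}\Gamma_n$ implies $\Gamma_n\not\to$; * *$(s;R)$-never-terminating* if $\Gamma\to_{s;R}^*\Gamma'$ implies $\Gamma'\to$; * *$(s;R)$-live* if whenever $\Gamma\to_{s;R}^*\Gamma'$, every finite or infinite path $\Gamma'=\Gamma_0\to\Gamma_1\to\cdots$ that is fair for $s$ is live for $s$. *Fair*: whenever a transmission from $p$ to $q$ on $s$ is enabled at $\Gamma_n$, some transmission from $p$ to $q$ occurs on the path at or after $n$; and the same for detections by $p$ of the crash of $q$. *Live*: whenever at $\Gamma_n$ role $p$ can send to $q$ on $s$, a transmission from $p$ to $q$ occurs at or after $n$; and whenever $q$ can receive a label other than $\mathsf{crash}$ from $p$, a transmission from $p$ to $q$ or a detection by $q$ of the crash of $p$ occurs at or after $n$. *Assumption-abiding reduction.* Let $\Gamma\vdash P$ and let sets $R_{s'}$ of reliable roles be given for $s'\in\Gamma$, with $\Gamma$ $(s';R_{s'})$-safe. Write $P\to_{s';R'}P'$ if $P\to P'$ and $P'\not\equiv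 Q\,|\,s'[p]\lightning$ for all $p\in R'$ and all $Q$. Then $P\mathrel{\dot\to}P'$ holds if $P\to P'$; $P\to_{s';R_{s'}}P'$ for every $s'\in\Gamma$; and whenever $P\equiv(\nu s':\Gamma')Q$ with the right-hand side well-typed, $P'\equiv(\nu s')Q'$ and $Q\to Q'$, there is $R'$ such that $\Gamma'$ is $(s';R')$-safe and $Q\to_{s';R'}Q'$. *Process properties.* $P$ is * *deadlock-free* if $P\mathrel{\dot\to}^*P'\not\to$ implies that $P'\equiv\mathbf 0\,|\,\prod_i s_i[p_i]\lightning\,|\,\prod_j\mathsf{def}\,D_{j,1}\,\mathsf{in}\cdots\mathsf{def}\,D_{j,n_j}\,\mathsf{in}\ s_j[p_j][q_j]\&\mathsf{crash}.Q_j$ (with $\prod$ denoting parallel composition); * *terminating* if it is deadlock-free and there is $j$ such that for all $n\ge j$, $P=P_0\mathrel{\dot\to}\cdots\mathrel{\dot\to}P_n$ implies $P_n\not\to$; * *never-terminating* if $P\mathrel{\dot\to}^*P'$ implies that $P'$ reduces without the crash rules; * *live* if whenever $P\mathrel{\dot\to}^*P'\equiv\mathcal C[Q]$: (i) if $Q=c[q]\oplus\ell\langle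 w\rangle.Q'$ then $P'\to^*\mathcal C'[Q']$ for some $\mathcal C'$; (ii) if $Q=c[q]\&\{\ell_i(x_i).Q_i\}_{i\in I}$ with $\{\ell_i\}_{i\in I}\ne\{\mathsf{crash}\}$ then $P'\to^*\mathcal C'[Q_k\{w/x_k\}]$ for some $\mathcal C'$, $k\in I$ and $w$. *Single role.* $P$ *only plays $p$ in $s$, by $\Gamma$* if $\Gamma\vdash P$; in the body of every definition in $P$, a parameter $x_i$ of session type is passed to a call only below a selection or branching on $x_i$; $P$ has no free variables; $\Gamma=\Gamma_0,\,s[p]:S$ with $S\not\leqslant\mathsf{end}$ and $\mathrm{end}(\Gamma_0)$; and every restriction $(\nu s':\Gamma')P'$ in $P$ has $\mathrm{end}(\Gamma')$. $P$ *has guarded recursion* if, for every definition of a process variable $X$ in $P$, the calls of $X$ in its own body occur only below a selection or branching. **Theorem (Verification of Process Properties).** Assume $\Gamma\vdash P$, where $\Gamma$ is $(s;R)$-safe, $P\equiv\prod_{p\in I}P_p$ and $\Gamma=\bigcup_{p\in I}\Gamma_p$ for a finite set $I$ of roles, such that for each $p\in I$: $\Gamma_p\vdash P_p$, and either $P_p\equiv\mathbf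 0$ or $P_p$ only plays $p$ in $s$, by $\Gamma_p$. Let $(R_{s'})_{s'}$ be sets of reliable roles with $R_s=R$ and $\Gamma$ $(s';R_{s'})$-safe for every session $s'$ in $\Gamma$; the process properties refer to these sets. Then 1. if $\Gamma$ is $(s;R)$-deadlock-free, then $P$ is deadlock-free; 2. if $\Gamma$ is $(s;R)$-terminating, and each $P_p\not\equiv\mathbf 0$ has guarded recursion, then $P$ is terminating; 3. if $\Gamma$ is $(s;R)$-never-terminating, then $P$ is never-terminating; 4. if $\Gamma$ is $(s;R)$-live, then $P$ is live. -/

import Mathlib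

namespace MPST

/-! ## Names, basic types and basic values

Roles and message labels are named by natural numbers.  Binders are represented by de Bruijn indices,
so that terms are identified up to alpha-conversion: there are three index spaces for processes
(variables, sessions, process variables) and one for recursion variables of types.  A free session
of a process is an index that is not captured by any enclosing restriction. -/

abbrev Role := ℕ

/-- Labels of messages that can be sent (they differ from the crash label by construction). -/
abbrev MsgLabel := ℕ

/-- Labels of external choices: message labels and the distinguished crash label. -/
inductive Label where
  | msg (l : MsgLabel)
  | crash

inductive BasicTy where
  | unit | bool | int | real | string

/-- Basic subtyping: reflexivity and `int <: real`. -/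
def BasicTy.Sub (G G' : BasicTy) : Prop := G = G' ∨ (G = .int ∧ G' = .real)

inductive Value where
  | unit
  | bool (b : Bool)
  | int (z : ℤ)
  | real (x : ℝ)
  | string (t : String)

/-- Membership `v ∈ G`; integers are also reals, in accordance with `int <: real`. -/
inductive Value.HasTy : Value → BasicTy → Prop
  | unit : HasTy .unit .unit
  | bool (b) : HasTy (.bool b) .bool
  | int (z) : HasTy (.int z) .int
  | intReal (z) : HasTy (.int z) .real
  | real (x) : HasTy (.real x) .real
  | string (t) : HasTy (.string t) .string

/-! ## Types -/

/-- Raw types: basic types, session types (external choice `brn`, internal choice `sel`, recursion,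
recursion variable, termination) and the crash type `crashed`.  The index set of a choice is `Fin n`.
The sorts and side conditions of the grammar are in `SessWF`, `PayWF` and `TyWF`. -/
inductive Ty where
  | basic (G : BasicTy)
  | brn (q : Role) (n : ℕ) (lab : Fin n → Label) (S : Fin n → Ty) (T : Fin n → Ty)
  | sel (q : Role) (n : ℕ) (lab : Fin n → MsgLabel) (S : Fin n → Ty) (T : Fin n → Ty)
  | mu (T : Ty)
  | var (i : ℕ)
  | done
  | crashed

namespace Ty

def IsBasic : Ty → Prop
  | basic _ => True
  | _ => False

/-- Recursion variable `i` occurs in the type outside of every choice. -/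
def Unguarded : ℕ → Ty → Prop
  | i, var j => j = i
  | i, mu T => Unguarded (i + 1) T
  | _, _ => False

/-- Session types with recursion variables among `0, …, k - 1`: choices are non-empty with pairwise
distinct labels, payloads are basic or session types, recursion is guarded. -/
def SessWF : ℕ → Ty → Prop
  | _, basic _ => False
  | k, brn _ n lab S T =>
      n ≠ 0 ∧ Function.Injective lab ∧
        (∀ i, (S i).IsBasic ∨ SessWF k (S i)) ∧ ∀ i, SessWF k (T i)
  | k, sel _ n lab S T =>
      n ≠ 0 ∧ Function.Injective lab ∧
        (∀ i, (S i).IsBasic ∨ SessWF k (S i)) ∧ ∀ i, SessWF k (T i)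
  | k, mu T => ¬ Unguarded 0 T ∧ SessWF (k + 1) T
  | k, var i => i < k
  | _, done => True
  | _, crashed => False

/-- Closed session types (the sort `T`). -/
def IsSession (T : Ty) : Prop := SessWF 0 T

/-- Payload types (the sort `S`): basic types or closed session types. -/
def PayWF (S : Ty) : Prop := S.IsBasic ∨ S.IsSession

/-- All types that may occur in a typing context: payload types and the crash type. -/
def TyWF (U : Ty) : Prop := U.PayWF ∨ U = crashed

/-- Substitution of a *closed* type `R` for recursion variable `k`
(no shifting is needed since `R` is closed). -/
def subst (R : Ty) : ℕ → Ty → Ty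
  | _, basic G => basic G
  | k, brn q n lab S T => brn q n lab (fun i => subst R k (S i)) (fun i => subst R k (T i))
  | k, sel q n lab S T => sel q n lab (fun i => subst R k (S i)) (fun i => subst R k (T i))
  | k, mu T => mu (subst R (k + 1) T)
  | k, var i => if i = k then R else var i
  | _, done => done
  | _, crashed => crashed

/-- Unfolding of `mu T`. -/
def unfold (T : Ty) : Ty := subst (mu T) 0 T

/-- One layer of the rules of session subtyping, with premises in `R`. -/
inductive SubStep (R : Ty → Ty → Prop) : Ty → Ty → Prop
  | basic {G G'} : G.Sub G' → SubStep R (basic G) (basic G')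
  | done : SubStep R done done
  | crashed : SubStep R crashed crashed
  | sel {q n m lab lab' S S' T T'} :
      (∀ j : Fin m, ∃ i : Fin n, lab i = lab' j ∧ R (S' j) (S i) ∧ R (T i) (T' j)) →
      SubStep R (sel q n lab S T) (sel q m lab' S' T')
  | brn {q n m lab lab' S S' T T'} :
      (∀ i : Fin n, ∃ j : Fin m, lab i = lab' j ∧ R (S i) (S' j) ∧ R (T i) (T' j)) →
      (n = 1 → (∀ i, lab i ≠ Label.crash) ∨ m = 1) →
      SubStep R (brn q n lab S T) (brn q m lab' S' T')
  | muL {T T'} : R (unfold T) T' → SubStep R (mu T) T'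
  | muR {T T'} : R T (unfold T') → SubStep R T (mu T')

/-- Session subtyping: the largest relation on (well-formed) types closed backwards under the rules. -/
def Sub (S S' : Ty) : Prop :=
  S.TyWF ∧ S'.TyWF ∧ ∃ R : Ty → Ty → Prop, (∀ a b, R a b → SubStep R a b) ∧ R S S'

end Ty

/-! ## Channels and typing contexts -/

/-- A variable, or a channel with role `s[p]`. -/
inductive Chan where
  | var (x : ℕ)
  | ep (s : ℕ) (p : Role)
  deriving DecidableEq

/-- Typing contexts: partial maps from channels to types. -/
abbrev Ctx := Chan → Option Ty

/-- The sort discipline of contexts: variables have payload types,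
channels with roles have session types (here without the crash type). -/
def Chan.PaySort : Chan → Ty → Prop
  | var _, S => S.PayWF
  | ep _ _, S => S.IsSession

namespace Ctx

def empty : Ctx := fun _ => none

/-- The singleton context `c : U`. -/
def single (c : Chan) (U : Ty) : Ctx := fun c' => if c' = c then some U else none

/-- `set Γ c U` is `Γ, c : U` (used where `c` is not in the domain of `Γ`). -/
def set (Γ : Ctx) (c : Chan) (U : Ty) : Ctx := fun c' => if c' = c then some U else Γ c'

/-- `Comp Γ₁ Γ₂ Γ`: the domains of `Γ₁`, `Γ₂` are disjoint and `Γ = Γ₁, Γ₂`. -/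
def Comp (Γ₁ Γ₂ Γ : Ctx) : Prop :=
  ∀ c, (Γ₁ c = none ∧ Γ c = Γ₂ c) ∨ (Γ₂ c = none ∧ Γ c = Γ₁ c)

/-- The sessions that occur in a context. -/
def sessions (Γ : Ctx) : Set ℕ := {s | ∃ p, Γ (.ep s p) ≠ none}

/-- `end(Γ)`: a finite context all of whose entries are basic (variables) or subtypes of `end`. -/
def End (Γ : Ctx) : Prop :=
  {c | Γ c ≠ none}.Finite ∧
    ∀ c S, Γ c = some S → ((∃ x, c = .var x) ∧ S.IsBasic) ∨ S.Sub .done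

/-- Enter the scope of one bound variable, of type `S`. -/
def consVar (S : Ty) (Γ : Ctx) : Ctx
  | .var 0 => some S
  | .var (x + 1) => Γ (.var x)
  | .ep s p => Γ (.ep s p)

/-- The context `x₁ : S₁, …, xₙ : Sₙ`. -/
def ofParams (Ss : List Ty) : Ctx
  | .var x => Ss[x]?
  | .ep _ _ => none

/-- The context of a single session, with index `0`, given by a map from roles to types. -/
def ofSession (A : Role → Option Ty) : Ctx
  | .ep 0 p => A p
  | _ => none

/-- Enter the scope of a restricted session whose endpoints are typed by `A`. -/
def consSession (A : Role → Option Ty) (Γ : Ctx) : Ctx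
  | .var x => Γ (.var x)
  | .ep 0 p => A p
  | .ep (s + 1) p => Γ (.ep s p)

end Ctx

/-! ## Semantics of typing contexts -/

/-- Transition labels; the first argument is the session. -/
inductive Act where
  /-- `p` receives `l(S)` from `q` -/
  | inp (s : ℕ) (p q : Role) (l : Label) (S : Ty)
  /-- `p` sends `l(S)` to `q` -/
  | out (s : ℕ) (p q : Role) (l : MsgLabel) (S : Ty)
  /-- `l` is transmitted from `p` to `q` -/
  | comm (s : ℕ) (p q : Role) (l : MsgLabel)
  /-- `p` crashes -/
  | crash (s : ℕ) (p : Role)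
  /-- `p` has detected that `q` has crashed -/
  | detect (s : ℕ) (p q : Role)
  /-- `p` has stopped due to a crash -/
  | stopped (s : ℕ) (p : Role)

namespace Ctx

inductive Step : Ctx → Act → Ctx → Prop
  | out {s p q n lab S T} (k : Fin n) :
      Step (single (.ep s p) (.sel q n lab S T)) (.out s p q (lab k) (S k)) (single (.ep s p) (T k))
  | inp {s p q n lab S T} (k : Fin n) :
      Step (single (.ep s p) (.brn q n lab S T)) (.inp s p q (lab k) (S k)) (single (.ep s p) (T k))
  | comm {Γ₁ Γ₁' Γ₂ Γ₂' Γ Γ' s p q l S S'} :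
      Step Γ₁ (.out s p q l S) Γ₁' → Step Γ₂ (.inp s q p (.msg l) S') Γ₂' → S.Sub S' →
      Comp Γ₁ Γ₂ Γ → Comp Γ₁' Γ₂' Γ' → Step Γ (.comm s p q l) Γ'
  | recur {s p T α Γ'} :
      Step (single (.ep s p) T.unfold) α Γ' → Step (single (.ep s p) (.mu T)) α Γ'
  | frame {Γ α Γ' c U} :
      Step Γ α Γ' → Γ c = none → Γ' c = none → Step (Γ.set c U) α (Γ'.set c U)
  | crash {s p T} : T.IsSession → ¬ T.Sub .done →
      Step (single (.ep s p) T) (.crash s p) (single (.ep s p) .crashed)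
  | stopped {s p} :
      Step (single (.ep s p) .crashed) (.stopped s p) (single (.ep s p) .crashed)
  /-- crash detection: the crash label carries the (omitted) payload type `unit` -/
  | detect {Γ₁ Γ₁' Γ₂ Γ₂' Γ Γ' s p q} :
      Step Γ₁ (.inp s q p .crash (.basic .unit)) Γ₁' → Step Γ₂ (.stopped s p) Γ₂' →
      Comp Γ₁ Γ₂ Γ → Comp Γ₁' Γ₂' Γ' → Step Γ (.detect s q p) Γ'
  /-- a message sent to a crashed endpoint is lost -/
  | lost {Γ₁ Γ₁' Γ₂ Γ₂' Γ Γ' s p q l S} :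
      Step Γ₁ (.out s p q l S) Γ₁' → Step Γ₂ (.stopped s q) Γ₂' →
      Comp Γ₁ Γ₂ Γ → Comp Γ₁' Γ₂' Γ' → Step Γ (.comm s p q l) Γ'

/-- `Γ` has a transition with label `α`. -/
def Can (Γ : Ctx) (α : Act) : Prop := ∃ Γ', Step Γ α Γ'

/-- Reduction of contexts without crashes (`Γ → Γ'`). -/
def Red (Γ Γ' : Ctx) : Prop :=
  ∃ s p q, (∃ l, Step Γ (.comm s p q l) Γ') ∨ Step Γ (.detect s q p) Γ'

/-- `Γ ↛`. -/
def Stuck (Γ : Ctx) : Prop := ¬ ∃ Γ', Red Γ Γ'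

/-- Reduction on session `s`, possibly by crashing a role that is not in the reliable set `R`. -/
def RedOn (s : ℕ) (R : Set Role) (Γ Γ' : Ctx) : Prop :=
  (∃ q r l, Step Γ (.comm s q r l) Γ') ∨ (∃ q r, Step Γ (.detect s q r) Γ') ∨
    ∃ p, p ∉ R ∧ Step Γ (.crash s p) Γ'

/-- `φ` is an `(s; R)`-safety property. -/
structure IsSafety (s : ℕ) (R : Set Role) (φ : Ctx → Prop) : Prop where
  comm : ∀ Γ, φ Γ → ∀ p q l l' S S', Γ.Can (.out s p q l S) → Γ.Can (.inp s q p l' S') →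
    Γ.Can (.comm s p q l)
  crash : ∀ Γ, φ Γ → ∀ p q l S, Γ.Can (.stopped s p) → Γ.Can (.inp s q p l S) →
    Γ.Can (.detect s q p)
  move : ∀ Γ, φ Γ → ∀ Γ', RedOn s R Γ Γ' → φ Γ'

/-- `Γ` is `(s; R)`-safe. -/
def Safe (s : ℕ) (R : Set Role) (Γ : Ctx) : Prop := ∃ φ, IsSafety s R φ ∧ φ Γ

end Ctx

/-- `Path r n a b`: there are `a = a₀ r a₁ r … r aₙ = b`. -/
def Path {α : Type} (r : α → α → Prop) (n : ℕ) (a b : α) : Prop :=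
  ∃ f : ℕ → α, f 0 = a ∧ f n = b ∧ ∀ i < n, r (f i) (f (i + 1))

/-! ## Properties of typing contexts -/

namespace Ctx

def DeadlockFree (s : ℕ) (R : Set Role) (Γ : Ctx) : Prop :=
  ∀ Γ', Relation.ReflTransGen (RedOn s R) Γ Γ' → Γ'.Stuck →
    ∀ p U, Γ' (.ep s p) = some U →
      U.Sub .done ∨ U = .crashed ∨
        ∃ q T, U.Sub (.brn q 1 (fun _ => .crash) (fun _ => .basic .unit) (fun _ => T))

def Terminating (s : ℕ) (R : Set Role) (Γ : Ctx) : Prop :=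
  Γ.DeadlockFree s R ∧ ∃ j, ∀ n ≥ j, ∀ Γ', Path (RedOn s R) n Γ Γ' → Γ'.Stuck

def NeverTerminating (s : ℕ) (R : Set Role) (Γ : Ctx) : Prop :=
  ∀ Γ', Relation.ReflTransGen (RedOn s R) Γ Γ' → ∃ Γ'', Red Γ' Γ''

/-- A non-crashing path `(f n)_{n ∈ N}`; `N` is `{0, …, m}` or all of `ℕ`. -/
structure IsPath (N : Set ℕ) (f : ℕ → Ctx) : Prop where
  zero : 0 ∈ N
  down : ∀ n, n + 1 ∈ N → n ∈ N
  step : ∀ n, n + 1 ∈ N → Red (f n) (f (n + 1))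

def FairFor (s : ℕ) (N : Set ℕ) (f : ℕ → Ctx) : Prop :=
  ∀ n ∈ N,
    (∀ p q l, (f n).Can (.comm s p q l) →
      ∃ k l', n ≤ k ∧ k + 1 ∈ N ∧ Step (f k) (.comm s p q l') (f (k + 1))) ∧
    (∀ p q, (f n).Can (.detect s p q) →
      ∃ k, n ≤ k ∧ k + 1 ∈ N ∧ Step (f k) (.detect s p q) (f (k + 1)))

def LiveFor (s : ℕ) (N : Set ℕ) (f : ℕ → Ctx) : Prop :=
  ∀ n ∈ N,
    (∀ p q l S, (f n).Can (.out s p q l S) →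
      ∃ k l', n ≤ k ∧ k + 1 ∈ N ∧ Step (f k) (.comm s p q l') (f (k + 1))) ∧
    (∀ p q l S, (f n).Can (.inp s q p l S) → l ≠ .crash →
      ∃ k, n ≤ k ∧ k + 1 ∈ N ∧
        ((∃ l', Step (f k) (.comm s p q l') (f (k + 1))) ∨ Step (f k) (.detect s q p) (f (k + 1))))

def Live (s : ℕ) (R : Set Role) (Γ : Ctx) : Prop :=
  ∀ Γ', Relation.ReflTransGen (RedOn s R) Γ Γ' →
    ∀ N f, IsPath N f → f 0 = Γ' → FairFor s N f → LiveFor s N f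

end Ctx

/-! ## Processes -/

/-- Payloads and arguments: basic values, variables, channels with roles. -/
inductive Pay where
  | val (v : Value)
  | chan (c : Chan)

/-- Payloads that are not variables: basic values and channels with roles. -/
def Pay.Ground : Pay → Prop
  | val _ => True
  | chan (.var _) => False
  | chan (.ep _ _) => True

/-- Processes.
* `res A P` restricts a session (index `0` in `P`), annotated with the types `A` of its endpoints;
* `brn c q n lab P` is a branching with index set `Fin n`; each `P i` binds one variable
  (index `0`), the crash branch binding a dummy variable;
* `defn Ss Q P` is `def X(x₁:S₁,…,xₙ:Sₙ) = Q in P`; it binds the process variable `0` in `Q` and `P`,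
  and the variables `0, …, n-1` in `Q`;
* `crashed s p` is the crashed endpoint `s[p]`. -/
inductive Proc where
  | nil
  | res (A : Role → Option Ty) (P : Proc)
  | par (P Q : Proc)
  | sel (c : Chan) (q : Role) (l : MsgLabel) (d : Pay) (P : Proc)
  | brn (c : Chan) (q : Role) (n : ℕ) (lab : Fin n → Label) (P : Fin n → Proc)
  | defn (Ss : List Ty) (Q P : Proc)
  | call (X : ℕ) (ds : List Pay)
  | err
  | crashed (s : ℕ) (p : Role)

/-- Extend a renaming under one binder. -/
def upRen (ρ : ℕ → ℕ) : ℕ → ℕ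
  | 0 => 0
  | i + 1 => ρ i + 1

/-- The renaming that exchanges `0` and `1`. -/
def swapRen : ℕ → ℕ
  | 0 => 1
  | 1 => 0
  | i => i

namespace Chan

def renS (ρ : ℕ → ℕ) : Chan → Chan
  | var x => var x
  | ep s p => ep (ρ s) p

end Chan

namespace Pay

def renS (ρ : ℕ → ℕ) : Pay → Pay
  | val v => val v
  | chan c => chan (c.renS ρ)

/-- Shift all variables by `n`. -/
def shiftV (n : ℕ) : Pay → Pay
  | chan (.var x) => chan (.var (x + n))
  | d => d

/-- Apply a substitution of payloads for variables. -/
def sub (σ : ℕ → Pay) : Pay → Pay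
  | chan (.var x) => σ x
  | d => d

/-- Extend a substitution under `n` variable binders. -/
def up (n : ℕ) (σ : ℕ → Pay) : ℕ → Pay :=
  fun x => if x < n then chan (.var x) else (σ (x - n)).shiftV n

/-- The substitution of `ws` for the variables `0, …, ws.length - 1`. -/
def inst (ws : List Pay) : ℕ → Pay :=
  fun x => ws.getD x (chan (.var (x - ws.length)))

/-- The endpoints that occur in a payload. -/
def fc : Pay → Set (ℕ × Role)
  | chan (.ep s p) => {(s, p)}
  | _ => ∅

/-- The variables that occur in a payload. -/
def fv : Pay → Set ℕ
  | chan (.var x) => {x}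
  | _ => ∅

end Pay

namespace Proc

/-- Rename sessions. -/
def renS : (ℕ → ℕ) → Proc → Proc
  | _, nil => nil
  | ρ, res A P => res A (renS (upRen ρ) P)
  | ρ, par P Q => par (renS ρ P) (renS ρ Q)
  | ρ, sel c q l d P => sel (c.renS ρ) q l (d.renS ρ) (renS ρ P)
  | ρ, brn c q n lab P => brn (c.renS ρ) q n lab (fun i => renS ρ (P i))
  | ρ, defn Ss Q P => defn Ss (renS ρ Q) (renS ρ P)
  | ρ, call X ds => call X (ds.map (Pay.renS ρ))
  | _, err => err
  | ρ, crashed s p => crashed (ρ s) p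

/-- Rename process variables. -/
def renX : (ℕ → ℕ) → Proc → Proc
  | _, nil => nil
  | ρ, res A P => res A (renX ρ P)
  | ρ, par P Q => par (renX ρ P) (renX ρ Q)
  | ρ, sel c q l d P => sel c q l d (renX ρ P)
  | ρ, brn c q n lab P => brn c q n lab (fun i => renX ρ (P i))
  | ρ, defn Ss Q P => defn Ss (renX (upRen ρ) Q) (renX (upRen ρ) P)
  | ρ, call X ds => call (ρ X) ds
  | _, err => err
  | _, crashed s p => crashed s p

/-- Capture-avoiding substitution of payloads for variables.  Putting a basic value in the place of
the subject of a selection or branching does not give a process; this never happens in a well-typed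
process, and the result is set to `err`. -/
def sub : (ℕ → Pay) → Proc → Proc
  | _, nil => nil
  | σ, res A P => res A (sub (fun x => (σ x).renS Nat.succ) P)
  | σ, par P Q => par (sub σ P) (sub σ Q)
  | σ, sel c q l d P =>
      match (Pay.chan c).sub σ with
      | .chan c' => sel c' q l (d.sub σ) (sub σ P)
      | .val _ => err
  | σ, brn c q n lab P =>
      match (Pay.chan c).sub σ with
      | .chan c' => brn c' q n lab (fun i => sub (Pay.up 1 σ) (P i))
      | .val _ => err
  | σ, defn Ss Q P => defn Ss (sub (Pay.up Ss.length σ) Q) (sub σ P)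
  | σ, call X ds => call X (ds.map (Pay.sub σ))
  | _, err => err
  | _, crashed s p => crashed s p

/-- Free channels with roles. -/
def fc : Proc → Set (ℕ × Role)
  | nil => ∅
  | res _ P => {e | (e.1 + 1, e.2) ∈ fc P}
  | par P Q => fc P ∪ fc Q
  | sel c _ _ d P => (Pay.chan c).fc ∪ d.fc ∪ fc P
  | brn c _ _ _ P => (Pay.chan c).fc ∪ {e | ∃ i, e ∈ fc (P i)}
  | defn _ Q P => fc Q ∪ fc P
  | call _ ds => {e | ∃ d ∈ ds, e ∈ d.fc}
  | err => ∅
  | crashed s p => {(s, p)}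

/-- Free variables. -/
def fv : Proc → Set ℕ
  | nil => ∅
  | res _ P => fv P
  | par P Q => fv P ∪ fv Q
  | sel c _ _ d P => (Pay.chan c).fv ∪ d.fv ∪ fv P
  | brn c _ _ _ P => (Pay.chan c).fv ∪ {x | ∃ i, x + 1 ∈ fv (P i)}
  | defn Ss Q P => {x | x + Ss.length ∈ fv Q} ∪ fv P
  | call _ ds => {x | ∃ d ∈ ds, x ∈ d.fv}
  | err => ∅
  | crashed _ _ => ∅

/-- Parallel composition of a finite family (`nil` for the empty family). -/
def bigPar : List Proc → Proc
  | [] => nil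
  | P :: Ps => par P (bigPar Ps)

/-! ### Structural congruence -/

/-- Structural congruence.  Side conditions "a name is not free in a subterm" are expressed by the
subterm being a weakening.  `defNil` is for declarations without free channels and with no free
variables other than the parameters; every declaration of a well-typed process is of this form. -/
inductive Cong : Proc → Proc → Prop
  | refl (P) : Cong P P
  | symm {P Q} : Cong P Q → Cong Q P
  | trans {P Q R} : Cong P Q → Cong Q R → Cong P R
  | congRes {A P P'} : Cong P P' → Cong (res A P) (res A P')
  | congPar {P P' Q Q'} : Cong P P' → Cong Q Q' → Cong (par P Q) (par P' Q')
  | congSel {c q l d P P'} : Cong P P' → Cong (sel c q l d P) (sel c q l d P')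
  | congBrn {c q n lab P P'} : (∀ i, Cong (P i) (P' i)) → Cong (brn c q n lab P) (brn c q n lab P')
  | congDefn {Ss Q Q' P P'} : Cong Q Q' → Cong P P' → Cong (defn Ss Q P) (defn Ss Q' P')
  | parComm (P Q) : Cong (par P Q) (par Q P)
  | parAssoc (P Q R) : Cong (par (par P Q) R) (par P (par Q R))
  | parNil (P) : Cong (par P nil) P
  | resNil (A) : Cong (res A nil) nil
  | resSwap (A B P) : Cong (res A (res B P)) (res B (res A (renS swapRen P)))
  | resLift (A P Q) : Cong (res A (par (renS Nat.succ P) Q)) (par P (res A Q))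
  | stopElim (A) (ps : List Role) : Cong (res A (bigPar (ps.map (crashed 0)))) nil
  | defNil (Ss Q) : fc Q = ∅ → (∀ x ∈ fv Q, x < Ss.length) → Cong (defn Ss Q nil) nil
  | defRes (Ss Q A P) : Cong (defn Ss Q (res A P)) (res A (defn Ss (renS Nat.succ Q) P))
  | defPar (Ss Q P R) : Cong (defn Ss Q (par P (renX Nat.succ R))) (par (defn Ss Q P) R)
  | defSwap (Ss Q Ss' Q' P) :
      Cong (defn Ss Q (defn Ss' (renX (upRen Nat.succ) Q') P))
        (defn Ss' Q' (defn Ss (renX (upRen Nat.succ) Q) (renX swapRen P)))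

/-! ### Reduction -/

/-- Reduction; the crash rules are available only if the flag is `true`. -/
inductive Red : Bool → Proc → Proc → Prop
  | comm {b s p q n lab P l w Q} (k : Fin n) : lab k = .msg l → w.Ground →
      Red b (par (brn (.ep s p) q n lab P) (sel (.ep s q) p l w Q))
        (par (sub (Pay.inst [w]) (P k)) Q)
  | errLabel {b s p q n lab P l w Q} : (∀ k, lab k ≠ .msg l) → w.Ground →
      Red b (par (brn (.ep s p) q n lab P) (sel (.ep s q) p l w Q)) err
  | call {b Ss B ws Q} : ws.length = Ss.length → (∀ w ∈ ws, w.Ground) →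
      Red b (defn Ss B (par (call 0 ws) Q)) (defn Ss B (par (sub (Pay.inst ws) B) Q))
  | ctxPar {b P P' Q} : Red b P P' → Red b (par P Q) (par P' Q)
  | ctxRes {b A P P'} : Red b P P' → Red b (res A P) (res A P')
  | ctxDefn {b Ss B P P'} : Red b P P' → Red b (defn Ss B P) (defn Ss B P')
  | congr {b P P' Q Q'} : Cong P' P → Red b P Q → Cong Q Q' → Red b P' Q'
  | crashSel {s p q l w P} (L : List (ℕ × Role)) : w.Ground → L.Nodup →
      (∀ e, e ∈ L ↔ e ∈ fc (sel (.ep s p) q l w P)) →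
      Red true (sel (.ep s p) q l w P) (bigPar (L.map fun e => crashed e.1 e.2))
  | crashBrn {s p q n lab P} (L : List (ℕ × Role)) : L.Nodup →
      (∀ e, e ∈ L ↔ e ∈ fc (brn (.ep s p) q n lab P)) →
      Red true (brn (.ep s p) q n lab P) (bigPar (L.map fun e => crashed e.1 e.2))
  | lostVal {b s p q l v Q} :
      Red b (par (crashed s p) (sel (.ep s q) p l (.val v) Q)) (par (crashed s p) Q)
  | lostChan {b s p q l s' r Q} :
      Red b (par (crashed s p) (sel (.ep s q) p l (.chan (.ep s' r)) Q))
        (par (crashed s p) (par (crashed s' r) Q))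
  /-- crash detection; the dummy variable of the crash branch is replaced by the unit value -/
  | detect {b s p q n lab P} (k : Fin n) : lab k = .crash →
      Red b (par (brn (.ep s p) q n lab P) (crashed s q))
        (par (sub (Pay.inst [.val .unit]) (P k)) (crashed s q))

/-- `P ↛`: `P` has no reduction that is derivable without the crash rules. -/
def Stuck (P : Proc) : Prop := ¬ ∃ P', Red false P P'

end Proc

/-- Reduction contexts. -/
inductive RCtx where
  | hole
  | par (C : RCtx) (P : Proc)
  | res (A : Role → Option Ty) (C : RCtx)
  | defn (Ss : List Ty) (B : Proc) (C : RCtx)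

def RCtx.fill : RCtx → Proc → Proc
  | hole, Q => Q
  | par C P, Q => .par (C.fill Q) P
  | res A C, Q => .res A (C.fill Q)
  | defn Ss B C, Q => .defn Ss B (C.fill Q)

/-! ## Typing -/

/-- `Γ ⊢ d : S`. -/
inductive PayTyped : Ctx → Pay → Ty → Prop
  | val {v G} : Value.HasTy v G → PayTyped Ctx.empty (.val v) (.basic G)
  | chan {c S S'} : c.PaySort S → S.Sub S' → PayTyped (Ctx.single c S) (.chan c) S'

/-- `ArgsTyped Γ ds Ss`: `Γ = Γ₀, Γ₁, …, Γₙ` with `end(Γ₀)`, `Γᵢ ⊢ dᵢ : Sᵢ` and `Sᵢ` not a subtype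
of `end`. -/
inductive ArgsTyped : Ctx → List Pay → List Ty → Prop
  | nil {Γ} : Γ.End → ArgsTyped Γ [] []
  | cons {Γ₁ Γ₂ Γ d ds S Ss} : PayTyped Γ₁ d S → ¬ S.Sub .done → ArgsTyped Γ₂ ds Ss →
      Ctx.Comp Γ₁ Γ₂ Γ → ArgsTyped Γ (d :: ds) (S :: Ss)

/-- The typing judgement `Θ · Γ ⊢ P`; `Θ` lists the argument types of the process variables.  The
endpoint types of a restricted session may include the crash type. -/
inductive Typed : List (List Ty) → Ctx → Proc → Prop
  | nil {Θ Γ} : Γ.End → Typed Θ Γ .nil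
  | call {Θ Γ X ds Ss} : Θ[X]? = some Ss → ArgsTyped Γ ds Ss → Typed Θ Γ (.call X ds)
  | defn {Θ Γ Ss Q P} : Typed (Ss :: Θ) (Ctx.ofParams Ss) Q → Typed (Ss :: Θ) Γ P →
      Typed Θ Γ (.defn Ss Q P)
  | brn {Θ Γ₀ Γ₁ Γ c q n lab S T P} :
      PayTyped Γ₁ (.chan c) (.brn q n lab S T) →
      (∀ i, Typed Θ (Ctx.consVar (S i) (Γ₀.set c (T i))) (P i)) →
      Ctx.Comp Γ₀ Γ₁ Γ → Typed Θ Γ (.brn c q n lab P)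
  | sel {Θ Γ₀ Γ₁ Γ₂ Γ' Γ c q l d S T P} :
      PayTyped Γ₁ (.chan c) (.sel q 1 (fun _ => l) (fun _ => S) (fun _ => T)) →
      PayTyped Γ₂ d S → ¬ S.Sub .done → Typed Θ (Γ₀.set c T) P →
      Ctx.Comp Γ₁ Γ₂ Γ' → Ctx.Comp Γ₀ Γ' Γ → Typed Θ Γ (.sel c q l d P)
  | par {Θ Γ₁ Γ₂ Γ P Q} : Typed Θ Γ₁ P → Typed Θ Γ₂ Q → Ctx.Comp Γ₁ Γ₂ Γ → Typed Θ Γ (.par P Q)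
  | crashed {Θ Γ₀ Γ s p} : Γ₀.End → Ctx.Comp Γ₀ (Ctx.single (.ep s p) .crashed) Γ → Typed Θ Γ (.crashed s p)
  | res {Θ Γ A P} (R : Set Role) : Ctx.Safe 0 R (Ctx.ofSession A) →
      Typed Θ (Ctx.consSession A Γ) P → Typed Θ Γ (.res A P)

/-! ## Guarded definitions and processes that play one role -/

namespace Proc

/-- Some call has variable `i` among its arguments and is not below a prefix with subject `i`. -/
def HasEarlyPass : ℕ → Proc → Prop
  | _, nil => False
  | i, res _ P => HasEarlyPass i P
  | i, par P Q => HasEarlyPass i P ∨ HasEarlyPass i Q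
  | i, sel c _ _ _ P => c ≠ .var i ∧ HasEarlyPass i P
  | i, brn c _ _ _ P => c ≠ .var i ∧ ∃ k, HasEarlyPass (i + 1) (P k)
  | i, defn Ss Q P => HasEarlyPass (i + Ss.length) Q ∨ HasEarlyPass i P
  | i, call _ ds => Pay.chan (.var i) ∈ ds
  | _, err => False
  | _, crashed _ _ => False

/-- Process variable `X` is called outside of every selection and branching. -/
def HasEarlyCall : ℕ → Proc → Prop
  | _, nil => False
  | X, res _ P => HasEarlyCall X P
  | X, par P Q => HasEarlyCall X P ∨ HasEarlyCall X Q
  | _, sel _ _ _ _ _ => False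
  | _, brn _ _ _ _ _ => False
  | X, defn _ Q P => HasEarlyCall (X + 1) Q ∨ HasEarlyCall (X + 1) P
  | X, call Y _ => Y = X
  | _, err => False
  | _, crashed _ _ => False

/-- Guarded definitions: in the body of each definition `X(x₁:S₁,…,xₙ:Sₙ) = Q`, a parameter of session
type is passed to a call only after it has been used for input or output. -/
def GuardedDefs : Proc → Prop
  | nil => True
  | res _ P => GuardedDefs P
  | par P Q => GuardedDefs P ∧ GuardedDefs Q
  | sel _ _ _ _ P => GuardedDefs P
  | brn _ _ _ _ P => ∀ k, GuardedDefs (P k)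
  | defn Ss Q P =>
      (∀ i S, Ss[i]? = some S → S.IsSession → ¬ HasEarlyPass i Q) ∧ GuardedDefs Q ∧ GuardedDefs P
  | call _ _ => True
  | err => True
  | crashed _ _ => True

/-- Guarded recursion: in the body of each definition of a process variable `X`, the recursive calls
of `X` are below a selection or branching (this excludes `def X() = X() in X()`). -/
def GuardedRec : Proc → Prop
  | nil => True
  | res _ P => GuardedRec P
  | par P Q => GuardedRec P ∧ GuardedRec Q
  | sel _ _ _ _ P => GuardedRec P
  | brn _ _ _ _ P => ∀ k, GuardedRec (P k)
  | defn _ Q P => ¬ HasEarlyCall 0 Q ∧ GuardedRec Q ∧ GuardedRec P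
  | call _ _ => True
  | err => True
  | crashed _ _ => True

/-- Every restriction in the process is annotated with a context satisfying `end(·)`. -/
def EndRestrictions : Proc → Prop
  | nil => True
  | res A P => (Ctx.ofSession A).End ∧ EndRestrictions P
  | par P Q => EndRestrictions P ∧ EndRestrictions Q
  | sel _ _ _ _ P => EndRestrictions P
  | brn _ _ _ _ P => ∀ k, EndRestrictions (P k)
  | defn _ Q P => EndRestrictions Q ∧ EndRestrictions P
  | call _ _ => True
  | err => True
  | crashed _ _ => True

/-- `P` only plays role `p` in session `s`, by `Γ`. -/
structure OnlyPlays (s : ℕ) (p : Role) (Γ : Ctx) (P : Proc) : Prop where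
  typed : Typed [] Γ P
  guarded : P.GuardedDefs
  closed : P.fv = ∅
  entry : ∃ Γ₀ S, Γ₀.End ∧ Ctx.Comp Γ₀ (Ctx.single (.ep s p) S) Γ ∧ ¬ S.Sub .done
  endRes : P.EndRestrictions

/-! ## Reliable and assumption-abiding reduction -/

/-- Reduction to a process where no endpoint of `s` with a role in `R` is crashed. -/
def RedReliable (s : ℕ) (R : Set Role) (P P' : Proc) : Prop :=
  Red true P P' ∧ ∀ p ∈ R, ¬ ∃ Q, Cong P' (par Q (crashed s p))

/-- Assumption-abiding reduction, for the sessions `Ses` of the typing context and the sets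
`R s` of reliable roles; restricted sessions are quantified over through the well-typed
representatives of `P` up to congruence. -/
def RedChecked (Ses : Set ℕ) (R : ℕ → Set Role) (P P' : Proc) : Prop :=
  Red true P P' ∧
  (∀ s ∈ Ses, RedReliable s (R s) P P') ∧
  (∀ A Q A' Q', Cong P (res A Q) → (∃ Γ, Typed [] Γ (res A Q)) → Cong P' (res A' Q') →
    Red true Q Q' → ∃ R', Ctx.Safe 0 R' (Ctx.ofSession A) ∧ RedReliable 0 R' Q Q')

/-! ## Properties of processes -/

/-- Pure crash recovery processes `def D₁ in … def Dₙ in s[p] & q : crash . Q`. -/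
inductive IsRecovery : Proc → Prop
  | brn (s p q P) : IsRecovery (brn (.ep s p) q 1 (fun _ => .crash) P)
  | defn (Ss B) {P} : IsRecovery P → IsRecovery (defn Ss B P)

def DeadlockFree (Ses : Set ℕ) (R : ℕ → Set Role) (P : Proc) : Prop :=
  ∀ P', Relation.ReflTransGen (RedChecked Ses R) P P' → P'.Stuck →
    ∃ (E : List (ℕ × Role)) (Js : List Proc), (∀ J ∈ Js, IsRecovery J) ∧
      Cong P' (par nil (par (bigPar (E.map fun e => crashed e.1 e.2)) (bigPar Js)))

def Terminating (Ses : Set ℕ) (R : ℕ → Set Role) (P : Proc) : Prop :=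
  P.DeadlockFree Ses R ∧ ∃ j, ∀ n ≥ j, ∀ P', Path (RedChecked Ses R) n P P' → P'.Stuck

def NeverTerminating (Ses : Set ℕ) (R : ℕ → Set Role) (P : Proc) : Prop :=
  ∀ P', Relation.ReflTransGen (RedChecked Ses R) P P' → ∃ P'', Red false P' P''

def Live (Ses : Set ℕ) (R : ℕ → Set Role) (P : Proc) : Prop :=
  ∀ P', Relation.ReflTransGen (RedChecked Ses R) P P' → ∀ C : RCtx,
    (∀ c q l w Q', w.Ground → Cong P' (C.fill (sel c q l w Q')) →
      ∃ C' : RCtx, Relation.ReflTransGen (Red true) P' (C'.fill Q')) ∧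
    (∀ c q n lab (Q' : Fin n → Proc), Cong P' (C.fill (brn c q n lab Q')) →
      Set.range lab ≠ {Label.crash} →
      ∃ (C' : RCtx) (k : Fin n) (w : Pay), w.Ground ∧
        Relation.ReflTransGen (Red true) P' (C'.fill (sub (Pay.inst [w]) (Q' k))))

end Proc

end MPST

open MPST

namespace MPST

/-! ## Session types: heads, inversion of subtyping -/

namespace Ty

/-! The theorem rests on a two-way correspondence between a process and its typing context. Each
reduction of the process either leaves the context alone or is matched by one context transition.
Conversely, each transition of the context can be followed by the process once the calls standing in
its way have been unfolded.

The judgement `Typed` is not invariant under structural congruence: congruence can introduce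
declarations with untypable bodies and restricted sessions that consist of crashed endpoints. It is
therefore replaced by `J`, a linear judgement for one live session. `J` drops basic and ended
entries, treats every restricted session as dead, accepts declarations that nobody uses, and assigns
an owner role to each thread. `J_cong` shows that it is invariant in both directions, and
`Typed.toJ` derives it for processes that play a single role. Ownership rules out delegation: the
payload of a selection by `p` could only be the endpoint of `p`, which is already in use as the
subject. Hence all messages carry basic values.

The types that a process uses are kept as supertypes of those in the context (`Agree`, `Ok`).
`J_red` is subject reduction. Safety of the context supplies the matching transition and excludes
label errors. For the converse, `J_holder` shows that the thread holding an endpoint is crashed,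
sending, receiving, or a call that passes the endpoint. Guardedness of definitions makes one
unfolding enough to remove such a call (`J_unfold`), and `Conforms.exists_sync` then finds the
synchronization.

Never-termination follows because a context that can move gives a process that can move. For
deadlock-freedom, a stuck process has a stuck context and no active calls, so that only crashed
endpoints and pure crash recoveries remain. `J_finalForm` brings these into the required shape,
moving each declaration to the thread of its owner.

For termination, the context performs a bounded number of transitions: after the bound of the
hypothesis only crashes are possible, and the domain is finite. Between transitions the process can
only unfold calls. Their number is controlled by `Proc.potential`, which is invariant under
congruence, drops with every unfolding, and is finite because guarded recursion spends a prefix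
between nested calls.

For liveness, suppose that a waiting prefix of role `p` never fires. The process can then imitate a
fair schedule of the context forever, or until the context is stuck, with the prefix still in place.
Fair schedules exist because enabled communications stay enabled until performed. Liveness of the
context forces an action of `p` on this path, and imitating that action would fire the prefix. -/

def IsMu : Ty → Prop
  | mu _ => True
  | _ => False

/-- `Unf T H`: unfolding the leading recursions of `T` gives `H`. -/
inductive Unf : Ty → Ty → Prop
  | refl {T} : ¬ T.IsMu → Unf T T
  | step {T H} : Unf T.unfold H → Unf (mu T) H

theorem Unf.not_mu {T H} (h : Unf T H) : ¬ H.IsMu := by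
  induction h <;> assumption

theorem Unf.det {T H H'} (h : Unf T H) (h' : Unf T H') : H = H' := by
  induction h with
  | refl hn => cases h' with
    | refl _ => rfl
    | step _ => exact absurd trivial hn
  | step _ ih => cases h' with
    | refl hn => exact absurd trivial hn
    | step h => exact ih h

theorem Unf.eq {T H} (h : Unf T H) (hn : ¬ T.IsMu) : H = T := h.det (.refl hn)

theorem Unguarded.lt {R : Ty} : ∀ {k j}, SessWF k R → Unguarded j R → j < k := by
  induction R with
  | var i => intro k j h hu; simp only [Unguarded] at hu; subst hu; exact h
  | mu T ih => intro k j h hu; exact Nat.lt_of_succ_lt_succ (ih h.2 hu)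
  | _ => intro k j h hu; exact hu.elim

theorem unguarded_subst {R T : Ty} (hR : SessWF 0 R) :
    ∀ {k j}, Unguarded j (subst R k T) → Unguarded j T := by
  induction T with
  | var i =>
    intro k j h
    simp only [subst] at h
    split at h
    · exact absurd (Unguarded.lt hR h) (by omega)
    · exact h
  | mu T ih => intro k j h; exact ih h
  | _ => intro k j h; exact h

theorem isBasic_subst {R T : Ty} {k} (h : T.IsBasic) : (subst R k T).IsBasic := by
  cases T <;> simp_all [IsBasic, subst]

theorem sessWF_mono {T : Ty} : ∀ {k k'}, k ≤ k' → SessWF k T → SessWF k' T := by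
  induction T with
  | brn q n lab S T ihS ihT =>
    intro k k' hk h
    exact ⟨h.1, h.2.1, fun i => (h.2.2.1 i).imp id (ihS i hk), fun i => ihT i hk (h.2.2.2 i)⟩
  | sel q n lab S T ihS ihT =>
    intro k k' hk h
    exact ⟨h.1, h.2.1, fun i => (h.2.2.1 i).imp id (ihS i hk), fun i => ihT i hk (h.2.2.2 i)⟩
  | mu T ih => intro k k' hk h; exact ⟨h.1, ih (by omega) h.2⟩
  | var i => intro k k' hk h; exact lt_of_lt_of_le h hk
  | _ => intro k k' _ h; exact h

theorem sessWF_subst {R T : Ty} (hR : SessWF 0 R) :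
    ∀ {k}, SessWF (k + 1) T → SessWF k (subst R k T) := by
  induction T with
  | brn q n lab S T ihS ihT =>
    intro k h
    exact ⟨h.1, h.2.1, fun i => (h.2.2.1 i).imp isBasic_subst (ihS i), fun i => ihT i (h.2.2.2 i)⟩
  | sel q n lab S T ihS ihT =>
    intro k h
    exact ⟨h.1, h.2.1, fun i => (h.2.2.1 i).imp isBasic_subst (ihS i), fun i => ihT i (h.2.2.2 i)⟩
  | mu T ih => intro k h; exact ⟨fun hu => h.1 (unguarded_subst hR hu), ih h.2⟩
  | var i =>
    intro k h
    simp only [subst]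
    split
    · exact sessWF_mono (Nat.zero_le _) hR
    · simp only [SessWF] at h ⊢; omega
  | _ => intro k h; exact h

theorem IsSession.unfold {T : Ty} (h : (mu T).IsSession) : T.unfold.IsSession :=
  sessWF_subst h h.2

/-- The number of leading recursions. -/
def mus : Ty → ℕ
  | mu T => mus T + 1
  | _ => 0

/-- Guardedness places the substituted variable below a choice, out of reach of the leading
recursions. Hence unfolding removes exactly one of them. -/
theorem mus_subst {R T : Ty} : ∀ {k}, ¬ Unguarded k T → mus (subst R k T) = mus T := by
  induction T with
  | mu T ih => intro k h; simp only [subst, mus]; rw [ih h]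
  | var i =>
    intro k h
    have h' : ¬ i = k := h
    simp only [subst, if_neg h']
  | _ => intro k h; rfl

/-- Unfolding stops because the number of leading recursions decreases. This makes it possible to
replace the recursion rules for types by a comparison of heads. -/
theorem IsSession.exists_unf {T : Ty} (h : T.IsSession) : ∃ H, Unf T H := by
  obtain ⟨n, hn⟩ : ∃ n, mus T = n := ⟨_, rfl⟩
  induction n generalizing T with
  | zero => exact ⟨T, .refl (by cases T <;> simp_all [mus, IsMu])⟩
  | succ n ih =>
    cases T with
    | mu T =>
      obtain ⟨H, hH⟩ := ih h.unfold (by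
        rw [Ty.unfold, mus_subst h.1]; simpa [mus] using hn)
      exact ⟨H, .step hH⟩
    | _ => simp [mus] at hn

theorem IsSession.unf {T H : Ty} (h : T.IsSession) (hu : Unf T H) : H.IsSession := by
  induction hu with
  | refl _ => exact h
  | step _ ih => exact ih h.unfold

theorem TyWF.unf {T H : Ty} (h : T.TyWF) (hu : Unf T H) : H.TyWF := by
  cases hu with
  | refl _ => exact h
  | step hu =>
    rcases h with (h | h) | h
    · exact h.elim
    · exact .inl (.inr (IsSession.unf h (.step hu)))
    · cases h

theorem TyWF.exists_unf {T : Ty} (h : T.TyWF) : ∃ H, Unf T H := by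
  rcases h with (h | h) | h
  · exact ⟨T, .refl (by cases T <;> simp_all [IsBasic, IsMu])⟩
  · exact h.exists_unf
  · subst h; exact ⟨_, .refl id⟩

theorem TyWF.unfold {T : Ty} (h : (mu T).TyWF) : T.unfold.TyWF := by
  rcases h with (h | h) | h
  · exact h.elim
  · exact .inl (.inr (IsSession.unfold h))
  · cases h

theorem SubStep.mono {R R' : Ty → Ty → Prop} (hR : ∀ a b, R a b → R' a b) {S T}
    (h : SubStep R S T) : SubStep R' S T := by
  cases h with
  | basic h => exact .basic h
  | done => exact .done
  | crashed => exact .crashed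
  | sel h => exact .sel fun j => (h j).imp fun i hi => ⟨hi.1, hR _ _ hi.2.1, hR _ _ hi.2.2⟩
  | brn h h' => exact .brn (fun j => (h j).imp fun i hi => ⟨hi.1, hR _ _ hi.2.1, hR _ _ hi.2.2⟩) h'
  | muL h => exact .muL (hR _ _ h)
  | muR h => exact .muR (hR _ _ h)

/-- The rules for recursion on the left and on the right may be interleaved in any order. A double
induction over the two unfoldings exhausts them all, leaving a structural rule between the heads. -/
theorem subStep_heads {R : Ty → Ty → Prop} (hR : ∀ a b, R a b → SubStep R a b) {S HS}
    (hS : Unf S HS) : ∀ {T HT}, Unf T HT → R S T → SubStep R HS HT := by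
  induction hS with
  | @refl S hn =>
    intro T HT hT
    induction hT with
    | refl hn' => intro h; exact hR _ _ h
    | step _ ih =>
      intro h
      cases hR _ _ h with
      | muL h => exact absurd trivial hn
      | muR h => exact ih h
  | @step S HS _ ih =>
    intro T HT hT
    induction hT with
    | refl hn' =>
      intro h
      cases hR _ _ h with
      | muL h => exact ih (.refl hn') h
      | muR h => exact absurd trivial hn'
    | step hT ihT =>
      intro h
      cases hR _ _ h with
      | muL h => exact ih (.step hT) h
      | muR h => exact ihT h

theorem TyWF.sess_sel {q n lab S T} (h : (sel q n lab S T).TyWF) : (sel q n lab S T).IsSession := by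
  rcases h with (h | h) | h
  · exact h.elim
  · exact h
  · cases h

theorem TyWF.sess_brn {q n lab S T} (h : (brn q n lab S T).TyWF) : (brn q n lab S T).IsSession := by
  rcases h with (h | h) | h
  · exact h.elim
  · exact h
  · cases h

theorem Sub.heads {S T HS HT : Ty} (h : S.Sub T) (hS : Unf S HS) (hT : Unf T HT) :
    SubStep Sub HS HT := by
  obtain ⟨wS, wT, R, hR, h⟩ := h
  have wS := wS.unf hS
  have wT := wT.unf hT
  have key := subStep_heads hR hS hT h
  cases key with
  | basic h => exact .basic h
  | done => exact .done
  | crashed => exact .crashed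
  | sel h =>
    refine .sel fun j => (h j).imp fun i hi => ⟨hi.1, ⟨?_, ?_, R, hR, hi.2.1⟩, ⟨?_, ?_, R, hR, hi.2.2⟩⟩
    · exact .inl (wT.sess_sel.2.2.1 j)
    · exact .inl (wS.sess_sel.2.2.1 i)
    · exact .inl (.inr (wS.sess_sel.2.2.2 i))
    · exact .inl (.inr (wT.sess_sel.2.2.2 j))
  | brn h h' =>
    refine .brn (fun i => (h i).imp fun j hi =>
      ⟨hi.1, ⟨?_, ?_, R, hR, hi.2.1⟩, ⟨?_, ?_, R, hR, hi.2.2⟩⟩) h'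
    · exact .inl (wS.sess_brn.2.2.1 i)
    · exact .inl (wT.sess_brn.2.2.1 j)
    · exact .inl (.inr (wS.sess_brn.2.2.2 i))
    · exact .inl (.inr (wT.sess_brn.2.2.2 j))
  | muL h => exact absurd trivial hS.not_mu
  | muR h => exact absurd trivial hT.not_mu

/-- Coinduction principle for subtyping, by comparison of heads. -/
theorem sub_of_heads {R : Ty → Ty → Prop}
    (hR : ∀ S T, R S T → S.TyWF ∧ T.TyWF ∧ ∃ HS HT, Unf S HS ∧ Unf T HT ∧
      SubStep (fun a b => R a b) HS HT) {S T} (h : R S T) : S.Sub T := by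
  refine ⟨(hR _ _ h).1, (hR _ _ h).2.1,
    -- The witness contains every pair of types with comparable heads. Recursions are removed on the
    -- left, then on the right, and only then is the rule for heads applied.
    fun S T => ∃ HS HT, Unf S HS ∧ Unf T HT ∧ SubStep (fun a b => R a b) HS HT, ?_,
    (hR _ _ h).2.2⟩
  rintro a b ⟨HS, HT, hS, hT, h⟩
  cases hS with
  | step hS => exact .muL ⟨_, _, hS, hT, h⟩
  | refl hn =>
    cases hT with
    | step hT => exact .muR ⟨_, _, .refl hn, hT, h⟩
    | refl hn' => exact h.mono fun a b hab => (hR a b hab).2.2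

theorem Sub.refl {T : Ty} (h : T.TyWF) : T.Sub T := by
  refine sub_of_heads (R := fun a b => a.TyWF ∧ a = b) ?_ ⟨h, rfl⟩
  rintro S _ ⟨w, rfl⟩
  obtain ⟨H, hH⟩ := w.exists_unf
  refine ⟨w, w, H, H, hH, hH, ?_⟩
  have wH := w.unf hH
  cases H with
  | basic G => exact .basic (.inl rfl)
  | brn q n lab S T =>
    exact .brn (fun i => ⟨i, rfl, ⟨.inl (wH.sess_brn.2.2.1 i), rfl⟩,
      ⟨.inl (.inr (wH.sess_brn.2.2.2 i)), rfl⟩⟩) fun h => .inr h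
  | sel q n lab S T =>
    exact .sel (fun i => ⟨i, rfl, ⟨.inl (wH.sess_sel.2.2.1 i), rfl⟩,
      ⟨.inl (.inr (wH.sess_sel.2.2.2 i)), rfl⟩⟩)
  | mu T => exact absurd trivial hH.not_mu
  | var i =>
    rcases wH with (h | h) | h
    · exact h.elim
    · exact absurd h (Nat.not_lt_zero _)
    · cases h
  | done => exact .done
  | crashed => exact .crashed

theorem basicSub_trans {a b c : BasicTy} (h : a.Sub b) (h' : b.Sub c) : a.Sub c := by
  unfold BasicTy.Sub at *
  rcases h with rfl | ⟨rfl, rfl⟩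
  · exact h'
  · rcases h' with rfl | ⟨h, _⟩
    · exact .inr ⟨rfl, rfl⟩
    · cases h

theorem Sub.trans {S T U : Ty} (h : S.Sub T) (h' : T.Sub U) : S.Sub U := by
  refine sub_of_heads (R := fun a c => ∃ b, a.Sub b ∧ b.Sub c) ?_ ⟨T, h, h'⟩
  rintro a c ⟨b, hab, hbc⟩
  obtain ⟨A, hA⟩ := hab.1.exists_unf
  obtain ⟨B, hB⟩ := hab.2.1.exists_unf
  obtain ⟨C, hC⟩ := hbc.2.1.exists_unf
  refine ⟨hab.1, hbc.2.1, A, C, hA, hC, ?_⟩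
  have h1 := hab.heads hA hB
  have h2 := hbc.heads hB hC
  have wB := hab.2.1.unf hB
  cases h1 with
  | basic h1 => cases h2 with
    | basic h2 => exact .basic (basicSub_trans h1 h2)
    | muR _ => exact absurd trivial hC.not_mu
  | done => cases h2 with
    | done => exact .done
    | muR _ => exact absurd trivial hC.not_mu
  | crashed => cases h2 with
    | crashed => exact .crashed
    | muR _ => exact absurd trivial hC.not_mu
  | sel h1 => cases h2 with
    | sel h2 =>
      refine .sel fun j => ?_
      obtain ⟨i, hi, hS, hT⟩ := h2 j
      obtain ⟨i', hi', hS', hT'⟩ := h1 i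
      exact ⟨i', hi'.trans hi, ⟨_, hS, hS'⟩, ⟨_, hT', hT⟩⟩
    | muR _ => exact absurd trivial hC.not_mu
  | brn h1 c1 => cases h2 with
    | brn h2 c2 =>
      refine .brn (fun i => ?_) fun hn => ?_
      · obtain ⟨j, hj, hS, hT⟩ := h1 i
        obtain ⟨j', hj', hS', hT'⟩ := h2 j
        exact ⟨j', hj.trans hj', ⟨_, hS, hS'⟩, ⟨_, hT, hT'⟩⟩
      -- The crash side condition composes. If the middle type has one branch, then either the outer
      -- type has one too, or the middle type has no crash label, and neither has the left type,
      -- whose labels occur in the middle one.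
      · rcases c1 hn with h | h
        · exact .inl h
        · rcases c2 h with h' | h'
          · refine .inl fun i hi => ?_
            obtain ⟨j, hj, _⟩ := h1 i
            exact h' j (hj ▸ hi)
          · exact .inr h'
    | muR _ => exact absurd trivial hC.not_mu
  | muL _ => exact absurd trivial hA.not_mu
  | muR _ => exact absurd trivial hB.not_mu

theorem not_crashed_isSession : ¬ IsSession crashed := id

theorem Sub.unf_done {S : Ty} (h : S.Sub .done) : Unf S .done := by
  obtain ⟨H, hH⟩ := h.1.exists_unf
  have := h.heads hH (.refl id)
  cases this with
  | done => exact hH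
  | muL _ => exact absurd trivial hH.not_mu

theorem Sub.of_unf_done {S : Ty} (w : S.TyWF) (h : Unf S .done) : S.Sub .done := by
  refine sub_of_heads (R := fun a b => a.TyWF ∧ Unf a .done ∧ b = .done) ?_ ⟨w, h, rfl⟩
  rintro a b ⟨wa, ha, rfl⟩
  exact ⟨wa, .inl (.inr trivial), _, _, ha, .refl id, .done⟩

/-- If a subtype of a session type is a subtype of `end`, so is the session type. -/
theorem Sub.done_up {S T : Ty} (h : S.Sub T) (hS : S.Sub .done) : T.Sub .done := by
  obtain ⟨H, hH⟩ := h.2.1.exists_unf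
  have := h.heads hS.unf_done hH
  cases this with
  | done => exact .of_unf_done h.2.1 hH
  | muR _ => exact absurd trivial hH.not_mu

theorem crashed_not_sub_done : ¬ Sub .crashed .done := by
  intro h
  have := h.unf_done
  cases this

theorem basic_not_sub_done {S : Ty} (hS : S.IsBasic) : ¬ S.Sub .done := by
  intro h
  have := h.unf_done
  cases S <;> simp_all [IsBasic]
  cases this

theorem Sub.eq_crashed {S : Ty} (h : S.Sub .crashed) : S = .crashed := by
  obtain ⟨H, hH⟩ := h.1.exists_unf
  have := h.heads hH (.refl id)
  cases this with
  | crashed =>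
    rcases h.1 with (w | w) | w
    · cases S <;> simp_all [IsBasic]
      cases hH
    · exact absurd (IsSession.unf w hH) not_crashed_isSession
    · exact w
  | muL _ => exact absurd trivial hH.not_mu

theorem Sub.crashed_eq {S : Ty} (h : Sub .crashed S) : S = .crashed := by
  obtain ⟨H, hH⟩ := h.2.1.exists_unf
  have := h.heads (.refl id) hH
  cases this with
  | crashed =>
    rcases h.2.1 with (w | w) | w
    · cases S <;> simp_all [IsBasic]
      cases hH
    · exact absurd (IsSession.unf w hH) not_crashed_isSession
    · exact w
  | muR _ => exact absurd trivial hH.not_mu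

theorem Sub.isBasic {S T : Ty} (h : S.Sub T) (hS : S.IsBasic) : T.IsBasic := by
  obtain ⟨H, hH⟩ := h.2.1.exists_unf
  cases S <;> simp_all [IsBasic]
  rcases h.2.1 with (w | w) | w
  · exact w
  · have h1 := h.heads (.refl id) hH
    have h2 := IsSession.unf w hH
    cases h1 with
    | basic _ => exact h2.elim
    | muR _ => exact absurd trivial hH.not_mu
  · subst w
    have := h.eq_crashed
    cases this

theorem Sub.isBasic_left {S T : Ty} (h : S.Sub T) (hT : T.IsBasic) : S.IsBasic := by
  obtain ⟨H, hH⟩ := h.1.exists_unf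
  cases T <;> simp_all [IsBasic]
  rcases h.1 with (w | w) | w
  · exact w
  · have h1 := h.heads hH (.refl id)
    have h2 := IsSession.unf w hH
    cases h1 with
    | basic _ => exact h2.elim
    | muL _ => exact absurd trivial hH.not_mu
  · subst w
    have := h.crashed_eq
    cases this

theorem IsBasic.not_session {S : Ty} (h : S.IsBasic) : ¬ S.IsSession := by
  cases S <;> simp_all [IsBasic, IsSession, SessWF]

theorem Sub.isSession_left {S T : Ty} (h : S.Sub T) (hT : T.IsSession) : S.IsSession := by
  rcases h.1 with (w | w) | w
  · exact absurd hT (h.isBasic w).not_session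
  · exact w
  · subst w
    rw [h.crashed_eq] at hT
    exact hT.elim

theorem Sub.sel_inv {U : Ty} {q m lab S T} (h : U.Sub (sel q m lab S T)) :
    ∃ n lab' S' T', Unf U (sel q n lab' S' T') ∧
      ∀ j : Fin m, ∃ i : Fin n, lab' i = lab j ∧ (S j).Sub (S' i) ∧ (T' i).Sub (T j) := by
  obtain ⟨H, hH⟩ := h.1.exists_unf
  have := h.heads hH (.refl id)
  cases this with
  | sel h => exact ⟨_, _, _, _, hH, h⟩
  | muL _ => exact absurd trivial hH.not_mu

theorem Sub.brn_inv {U : Ty} {q m lab S T} (h : U.Sub (brn q m lab S T)) :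
    ∃ n lab' S' T', Unf U (brn q n lab' S' T') ∧
      (∀ i : Fin n, ∃ j : Fin m, lab' i = lab j ∧ (S' i).Sub (S j) ∧ (T' i).Sub (T j)) ∧
      (n = 1 → (∀ i, lab' i ≠ Label.crash) ∨ m = 1) := by
  obtain ⟨H, hH⟩ := h.1.exists_unf
  have := h.heads hH (.refl id)
  cases this with
  | brn h h' => exact ⟨_, _, _, _, hH, h, h'⟩
  | muL _ => exact absurd trivial hH.not_mu

theorem Sub.not_done_sel {U : Ty} {q m lab S T} (h : U.Sub (sel q m lab S T)) : ¬ U.Sub .done := by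
  intro h'
  obtain ⟨n, lab', S', T', hu, _⟩ := h.sel_inv
  cases hu.det h'.unf_done

theorem Sub.not_done_brn {U : Ty} {q m lab S T} (h : U.Sub (brn q m lab S T)) : ¬ U.Sub .done := by
  intro h'
  obtain ⟨n, lab', S', T', hu, _⟩ := h.brn_inv
  cases hu.det h'.unf_done

end Ty

/-! ## Environments for de Bruijn indices -/

/-- Extend an environment by an entry for index `0`. -/
def scons {α : Type*} (a : α) (f : ℕ → α) : ℕ → α
  | 0 => a
  | i + 1 => f i

theorem scons_upRen {α : Type*} (a : α) (f : ℕ → α) (ρ : ℕ → ℕ) :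
    (fun i => scons a f (upRen ρ i)) = scons a (fun i => f (ρ i)) := by
  funext i; cases i <;> rfl

theorem swapRen_swapRen (i : ℕ) : swapRen (swapRen i) = i := by
  match i with
  | 0 => rfl
  | 1 => rfl
  | _ + 2 => rfl

theorem swapRen_injective : Function.Injective swapRen :=
  Function.LeftInverse.injective swapRen_swapRen

theorem upRen_injective {ρ : ℕ → ℕ} (h : Function.Injective ρ) : Function.Injective (upRen ρ) := by
  intro i j hij
  match i, j with
  | 0, 0 => rfl
  | 0, _ + 1 => cases hij
  | _ + 1, 0 => cases hij
  | i + 1, j + 1 => exact congrArg _ (h (Nat.succ.inj hij))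

theorem upRen_iff {ρ : ℕ → ℕ} {s : ℕ} (h : ∀ x, ρ x = ρ s ↔ x = s) (x : ℕ) :
    upRen ρ x = upRen ρ (s + 1) ↔ x = s + 1 := by
  cases x with
  | zero => simp [upRen]
  | succ x => simp [upRen, h x]

/-! ## Renamings, free names and structural congruence -/

namespace Pay

theorem fv_renS (ρ : ℕ → ℕ) (d : Pay) : (d.renS ρ).fv = d.fv := by
  rcases d with v | (x | ⟨s, p⟩) <;> rfl

theorem mem_fc_renS (ρ : ℕ → ℕ) (d : Pay) (e : ℕ × Role) :
    e ∈ (d.renS ρ).fc ↔ ∃ e' ∈ d.fc, e = (ρ e'.1, e'.2) := by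
  rcases d with v | (x | ⟨s, p⟩) <;> simp [renS, fc, Chan.renS]

end Pay

namespace Proc

theorem fv_renS (ρ : ℕ → ℕ) (P : Proc) : (renS ρ P).fv = P.fv := by
  induction P generalizing ρ with
  | sel c q l d P ih =>
    have := Pay.fv_renS ρ (.chan c)
    simp only [Pay.renS] at this
    simp only [renS, fv, ih, Pay.fv_renS, this]
  | brn c q n lab P ih =>
    have := Pay.fv_renS ρ (.chan c)
    simp only [Pay.renS] at this
    simp only [renS, fv, ih, this]
  | call X ds =>
    ext x
    simp only [renS, fv, List.mem_map, Set.mem_ofPred_eq]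
    constructor
    · rintro ⟨_, ⟨d, hd, rfl⟩, hx⟩
      exact ⟨d, hd, Pay.fv_renS ρ d ▸ hx⟩
    · rintro ⟨d, hd, hx⟩
      exact ⟨_, ⟨d, hd, rfl⟩, (Pay.fv_renS ρ d).symm ▸ hx⟩
  | _ => simp_all [renS, fv]

theorem mem_fc_renS (P : Proc) : ∀ (ρ : ℕ → ℕ) (e : ℕ × Role),
    e ∈ (renS ρ P).fc ↔ ∃ e' ∈ P.fc, e = (ρ e'.1, e'.2) := by
  induction P with
  | nil => simp [renS, fc]
  | err => simp [renS, fc]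
  | crashed s p => simp [renS, fc]
  | res A P ih =>
    intro ρ e
    simp only [renS, fc, Set.mem_ofPred_eq, ih]
    constructor
    · rintro ⟨⟨s, p⟩, h, he⟩
      cases s with
      | zero => simp [upRen] at he
      | succ s =>
        simp only [upRen, Prod.mk.injEq, Nat.add_right_cancel_iff] at he
        exact ⟨(s, p), h, Prod.ext he.1 he.2⟩
    · rintro ⟨⟨s, p⟩, h, rfl⟩
      exact ⟨(s + 1, p), h, rfl⟩
  | par P Q ihP ihQ =>
    intro ρ e
    simp only [renS, fc, Set.mem_union, ihP, ihQ]
    aesop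
  | sel c q l d P ih =>
    intro ρ e
    have := Pay.mem_fc_renS ρ (.chan c) e
    simp only [Pay.renS] at this
    simp only [renS, fc, Set.mem_union, ih, Pay.mem_fc_renS, this]
    aesop
  | brn c q n lab P ih =>
    intro ρ e
    have := Pay.mem_fc_renS ρ (.chan c) e
    simp only [Pay.renS] at this
    simp only [renS, fc, Set.mem_union, ih, Set.mem_ofPred_eq, this]
    aesop
  | defn Ss Q P ihQ ihP =>
    intro ρ e
    simp only [renS, fc, Set.mem_union, ihP, ihQ]
    aesop
  | call X ds =>
    intro ρ e
    simp only [renS, fc, List.mem_map, Set.mem_ofPred_eq]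
    constructor
    · rintro ⟨_, ⟨d, hd, rfl⟩, hx⟩
      obtain ⟨e', h, h'⟩ := (Pay.mem_fc_renS ρ d e).1 hx
      exact ⟨e', ⟨d, hd, h⟩, h'⟩
    · rintro ⟨e', ⟨d, hd, h⟩, h'⟩
      exact ⟨_, ⟨d, hd, rfl⟩, (Pay.mem_fc_renS ρ d e).2 ⟨e', h, h'⟩⟩

theorem fc_renS_eq_empty (ρ : ℕ → ℕ) (P : Proc) : (renS ρ P).fc = ∅ ↔ P.fc = ∅ := by
  simp only [Set.eq_empty_iff_forall_notMem, mem_fc_renS]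
  constructor
  · intro h e he; exact h _ ⟨e, he, rfl⟩
  · rintro h e ⟨e', he, _⟩; exact h _ he

theorem fv_renX (ρ : ℕ → ℕ) (P : Proc) : (renX ρ P).fv = P.fv := by
  induction P generalizing ρ <;> simp_all [renX, fv]

theorem fc_renX (ρ : ℕ → ℕ) (P : Proc) : (renX ρ P).fc = P.fc := by
  induction P generalizing ρ <;> simp_all [renX, fc]

theorem fc_bigPar_crashed (ps : List Role) :
    ∀ e ∈ (bigPar (ps.map (crashed 0))).fc, e.1 = 0 := by
  induction ps with
  | nil => simp [bigPar, fc]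
  | cons p ps ih =>
    intro e he
    rcases he with he | he
    · cases he; rfl
    · exact ih e he

theorem fv_bigPar_crashed (ps : List Role) : (bigPar (ps.map (crashed 0))).fv = ∅ := by
  induction ps with
  | nil => simp [bigPar, fv]
  | cons p ps ih => simp only [List.map, bigPar, fv, ih, Set.union_empty]

theorem Cong.fv_eq {P Q : Proc} (h : Cong P Q) : P.fv = Q.fv := by
  induction h with
  | refl => rfl
  | symm _ ih => exact ih.symm
  | trans _ _ ih ih' => exact ih.trans ih'
  | parComm P Q => exact Set.union_comm _ _
  | parAssoc P Q R => exact Set.union_assoc _ _ _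
  | stopElim A ps => simp only [fv, fv_bigPar_crashed]
  | defNil Ss Q _ h =>
    simp only [fv, Set.union_empty, Set.eq_empty_iff_forall_notMem]
    intro x hx
    have := h _ hx
    omega
  | resLift => simp only [fv, fv_renS]
  | resSwap => simp only [fv, fv_renS]
  | defRes => simp only [fv, fv_renS]
  | defPar => simp only [fv, fv_renX, Set.union_assoc]
  | defSwap => simp only [fv, fv_renX]; ac_rfl
  | _ => simp_all [fv]

theorem Cong.fc_eq {P Q : Proc} (h : Cong P Q) : P.fc = Q.fc := by
  induction h with
  | refl => rfl
  | symm _ ih => exact ih.symm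
  | trans _ _ ih ih' => exact ih.trans ih'
  | parComm P Q => exact Set.union_comm _ _
  | parAssoc P Q R => exact Set.union_assoc _ _ _
  | stopElim A ps =>
    simp only [fc, Set.eq_empty_iff_forall_notMem, Set.mem_ofPred_eq]
    intro e he
    exact absurd (fc_bigPar_crashed ps _ he) (by simp)
  | defNil Ss Q h _ => simp only [fc, h, Set.union_empty]
  | resLift A P Q =>
    ext e
    simp [fc, mem_fc_renS, Prod.ext_iff]
  | resSwap A B P =>
    ext e
    simp only [fc, mem_fc_renS, Set.mem_ofPred_eq, Prod.ext_iff]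
    constructor
    · intro h; exact ⟨_, h, rfl, rfl⟩
    · rintro ⟨e', h, h1, h2⟩
      have : e' = (e.1 + 1 + 1, e.2) := by
        refine Prod.ext (swapRen_injective ?_) h2.symm
        rw [← h1]; rfl
      exact this ▸ h
  | defRes Ss Q A P =>
    ext e
    simp [fc, mem_fc_renS, Prod.ext_iff]
  | defPar => simp only [fc, fc_renX, Set.union_assoc]
  | defSwap => simp only [fc, fc_renX]; ac_rfl
  | _ => simp_all [fc]

/-! ### Early passing of parameters -/

theorem hasEarlyPass_renS (P : Proc) : ∀ (ρ : ℕ → ℕ) (i : ℕ),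
    HasEarlyPass i (renS ρ P) ↔ HasEarlyPass i P := by
  have hc : ∀ (ρ : ℕ → ℕ) (c : Chan) i, c.renS ρ = .var i ↔ c = .var i := by
    rintro ρ (x | ⟨s, p⟩) i <;> simp [Chan.renS]
  induction P with
  | call X ds =>
    intro ρ i
    simp only [renS, HasEarlyPass, List.mem_map]
    constructor
    · rintro ⟨d, hd, h⟩
      rcases d with v | (x | ⟨s, p⟩) <;> simp_all [Pay.renS, Chan.renS]
    · intro h; exact ⟨_, h, rfl⟩
  | _ => simp_all [renS, HasEarlyPass]

theorem hasEarlyPass_renX (P : Proc) : ∀ (ρ : ℕ → ℕ) (i : ℕ),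
    HasEarlyPass i (renX ρ P) ↔ HasEarlyPass i P := by
  induction P <;> simp_all [renX, HasEarlyPass]

theorem HasEarlyPass.mem_fv {P : Proc} : ∀ {i}, HasEarlyPass i P → i ∈ P.fv := by
  induction P with
  | nil => intro i h; exact h
  | err => intro i h; exact h
  | crashed s p => intro i h; exact h
  | res A P ih => intro i h; exact ih h
  | par P Q ihP ihQ => intro i h; exact h.imp ihP ihQ
  | sel c q l d P ih => intro i h; exact .inr (ih h.2)
  | brn c q n lab P ih => intro i h; exact .inr (h.2.imp fun k hk => ih k hk)
  | defn Ss Q P ihQ ihP => intro i h; exact h.imp ihQ ihP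
  | call X ds => intro i h; exact ⟨_, h, rfl⟩

theorem hasEarlyPass_bigPar_crashed (ps : List Role) (i : ℕ) :
    ¬ HasEarlyPass i (bigPar (ps.map (crashed 0))) := by
  intro h
  have := h.mem_fv
  rw [fv_bigPar_crashed] at this
  exact this

/-- Invariance depends on the side condition of `defNil`: a declaration that can be discarded
mentions no variables besides its parameters, so it cannot pass an outer variable. -/
theorem Cong.hasEarlyPass {P Q : Proc} (h : Cong P Q) : ∀ i, HasEarlyPass i P ↔ HasEarlyPass i Q := by
  induction h with
  | refl => intro i; rfl
  | symm _ ih => intro i; exact (ih i).symm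
  | trans _ _ ih ih' => intro i; exact (ih i).trans (ih' i)
  | parComm P Q => intro i; exact or_comm
  | parAssoc P Q R => intro i; exact or_assoc
  | stopElim A ps => intro i; simp [HasEarlyPass, hasEarlyPass_bigPar_crashed]
  | defNil Ss Q _ h =>
    intro i
    simp only [HasEarlyPass, or_false, iff_false]
    intro hx
    have := h _ hx.mem_fv
    omega
  | resLift => intro i; simp only [HasEarlyPass, hasEarlyPass_renS]
  | resSwap => intro i; simp only [HasEarlyPass, hasEarlyPass_renS]
  | defRes => intro i; simp only [HasEarlyPass, hasEarlyPass_renS]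
  | defPar => intro i; simp only [HasEarlyPass, hasEarlyPass_renX, or_assoc]
  | defSwap =>
    intro i; simp only [HasEarlyPass, hasEarlyPass_renX]
    exact or_left_comm
  | _ => simp_all [HasEarlyPass]

/-! ### A potential for the unfolding of calls -/

/-- Approximations of the cost of a call, by the number of admitted nested calls. -/
def costIter (F : ℕ → (ℕ → ℕ → ℕ) → ℕ) (e : ℕ → ℕ → ℕ) : ℕ → ℕ → ℕ
  | 0 => fun _ => 0
  | n + 1 => fun j => 1 + F j (scons (costIter F e n) e)

/-- Cost of a call of a process variable whose body has cost `F`. -/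
def callCost (F : ℕ → (ℕ → ℕ → ℕ) → ℕ) (e : ℕ → ℕ → ℕ) (k : ℕ) : ℕ := costIter F e (k + 1) k

/-- `potential P k e` bounds the number of unfoldings of calls in reductions of `P` with at most `k`
uses of prefixes, where a call of `X` costs `e X k`. -/
def potential : Proc → ℕ → (ℕ → ℕ → ℕ) → ℕ
  | nil, _, _ => 0
  | res _ P, k, e => potential P k e
  | par P Q, k, e => potential P k e + potential Q k e
  | sel _ _ _ _ P, k, e => match k with
    | 0 => 0
    | k + 1 => potential P k e
  | brn _ _ _ _ P, k, e => match k with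
    | 0 => 0
    | k + 1 => ∑ i, potential (P i) k e
  | defn _ Q P, k, e => potential P k (scons (callCost (potential Q) e) e)
  | call X _, k, e => e X k
  | err, _, _ => 0
  | crashed _ _, _, _ => 0

theorem potential_renS (P : Proc) : ∀ ρ, potential (renS ρ P) = potential P := by
  induction P with
  | sel c q l d P ih => intro ρ; funext k e; cases k <;> simp [renS, potential, ih]
  | brn c q n lab P ih => intro ρ; funext k e; cases k <;> simp [renS, potential, ih]
  | _ => intro ρ; funext k e; simp_all [renS, potential]

theorem costIter_congr {F G : ℕ → (ℕ → ℕ → ℕ) → ℕ} {e e' : ℕ → ℕ → ℕ}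
    (h : ∀ k c, F k (scons c e) = G k (scons c e')) : ∀ n, costIter F e n = costIter G e' n := by
  intro n
  induction n with
  | zero => rfl
  | succ n ih => funext j; simp only [costIter, ih, h]

theorem callCost_congr {F G : ℕ → (ℕ → ℕ → ℕ) → ℕ} {e e' : ℕ → ℕ → ℕ}
    (h : ∀ k c, F k (scons c e) = G k (scons c e')) : callCost F e = callCost G e' := by
  funext k; simp only [callCost, costIter_congr h]

theorem potential_renX (P : Proc) : ∀ ρ k e,
    potential (renX ρ P) k e = potential P k (fun X => e (ρ X)) := by
  induction P with
  | sel c q l d P ih => intro ρ k e; cases k <;> simp [renX, potential, ih]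
  | brn c q n lab P ih => intro ρ k e; cases k <;> simp [renX, potential, ih]
  | defn Ss Q P ihQ ihP =>
    intro ρ k e
    simp only [renX, potential, ihP, scons_upRen]
    rw [callCost_congr (G := potential Q) (e' := fun X => e (ρ X))]
    intro k c
    rw [ihQ, scons_upRen]
  | _ => intro ρ k e; simp_all [renX, potential]

theorem potential_bigPar_crashed (ps : List (ℕ × Role)) (k e) :
    potential (bigPar (ps.map fun e => crashed e.1 e.2)) k e = 0 := by
  induction ps with
  | nil => rfl
  | cons p ps ih => simp only [List.map, bigPar, potential, ih]

/-- A declaration costs nothing in itself, as only calls are counted. Discarding, moving or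
exchanging declarations therefore has no effect. -/
theorem Cong.potential_eq {P Q : Proc} (h : Cong P Q) : potential P = potential Q := by
  induction h with
  | refl => rfl
  | symm _ ih => exact ih.symm
  | trans _ _ ih ih' => exact ih.trans ih'
  | congSel _ ih => funext k e; cases k <;> simp [potential, ih]
  | congBrn _ ih => funext k e; cases k <;> simp [potential, ih]
  | parComm P Q => funext k e; exact Nat.add_comm _ _
  | parAssoc P Q R => funext k e; exact Nat.add_assoc _ _ _
  | stopElim A ps =>
    funext k e
    have := potential_bigPar_crashed (ps.map fun p => (0, p)) k e
    rw [List.map_map] at this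
    exact this
  | resLift => funext k e; simp only [potential, potential_renS]
  | resSwap => funext k e; simp only [potential, potential_renS]
  | defRes => funext k e; simp only [potential, potential_renS]
  | defPar => funext k e; simp only [potential, potential_renX]; rfl
  | defSwap Ss Q Ss' Q' P =>
    funext k e
    simp only [potential, potential_renX]
    -- A body weakened by the other declaration does not see its cost, so each of the two costs can
    -- be computed in the outer environment.
    have h1 : ∀ (R : Proc) a, callCost (potential (renX (upRen Nat.succ) R)) (scons a e) =
        callCost (potential R) e := by
      intro R a
      refine callCost_congr fun k c => ?_
      rw [potential_renX, scons_upRen]; rfl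
    rw [h1, h1]
    congr 1
    funext X
    match X with
    | 0 => rfl
    | 1 => rfl
    | _ + 2 => rfl
  | _ => funext k e; simp_all [potential]

/-- The cost of a call of the process variable `0` in its own body matters only for smaller budgets. -/
def GuardedBody (Q : Proc) : Prop :=
  ∀ k (c c' : ℕ → ℕ) e, (∀ j < k, c j = c' j) →
    potential Q k (scons c e) = potential Q k (scons c' e)

/-- This is the reason for a semantic notion of guardedness. The syntactic `HasEarlyCall` is not
invariant: `defNil` may discard a declaration whose body contains early calls. -/
theorem Cong.guardedBody {P Q : Proc} (h : Cong P Q) : GuardedBody P ↔ GuardedBody Q := by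
  unfold GuardedBody; rw [h.potential_eq]

theorem guardedBody_renS (ρ : ℕ → ℕ) (P : Proc) : GuardedBody (renS ρ P) ↔ GuardedBody P := by
  unfold GuardedBody; rw [potential_renS]

theorem guardedBody_renX {ρ : ℕ → ℕ} (hρ : Function.Injective ρ) (P : Proc) :
    GuardedBody (renX (upRen ρ) P) ↔ GuardedBody P := by
  unfold GuardedBody
  simp only [potential_renX, scons_upRen]
  constructor
  · intro h k c c' e hc
    -- Injectivity of `ρ` makes every environment `e` the pullback of some environment along `ρ`.
    have := h k c c' (fun X => e (Function.invFun ρ X)) hc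
    simpa only [Function.leftInverse_invFun hρ _] using this
  · intro h k c c' e hc
    exact h k c c' _ hc

/-- Each nested call has a strictly smaller budget, so the approximation at budget `j` is stable as
soon as more than `j` nested calls are admitted. The depth `k + 1` in `callCost` is thus sufficient,
and the cost satisfies its fixed-point equation. The summand `1` is what an unfolding gains. -/
theorem GuardedBody.callCost_eq {Q : Proc} (h : GuardedBody Q) (e : ℕ → ℕ → ℕ) (k : ℕ) :
    callCost (potential Q) e k = 1 + potential Q k (scons (callCost (potential Q) e) e) := by
  have stable : ∀ j n m, j < n → j < m →
      costIter (potential Q) e n j = costIter (potential Q) e m j := by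
    intro j
    induction j using Nat.strong_induction_on with
    | _ j ih =>
      intro n m hn hm
      obtain ⟨n, rfl⟩ : ∃ n', n = n' + 1 := ⟨n - 1, by omega⟩
      obtain ⟨m, rfl⟩ : ∃ m', m = m' + 1 := ⟨m - 1, by omega⟩
      simp only [costIter]
      rw [h j _ _ e fun i hi => ih i hi n m (by omega) (by omega)]
  conv_lhs => simp only [callCost, costIter]
  rw [h k _ _ e fun j hj => ?_]
  exact stable j _ _ hj (Nat.lt_succ_self _)

theorem costIter_mono {F G : ℕ → (ℕ → ℕ → ℕ) → ℕ} {e e' : ℕ → ℕ → ℕ}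
    (h : ∀ k c c', (∀ j, c j ≤ c' j) → F k (scons c e) ≤ G k (scons c' e')) :
    ∀ n j, costIter F e n j ≤ costIter G e' n j := by
  intro n
  induction n with
  | zero => intro j; exact le_rfl
  | succ n ih => intro j; exact Nat.add_le_add_left (h _ _ _ ih) 1

theorem potential_mono (P : Proc) : ∀ k (e e' : ℕ → ℕ → ℕ), (∀ X j, e X j ≤ e' X j) →
    potential P k e ≤ potential P k e' := by
  have hs : ∀ {c c' : ℕ → ℕ} {e e' : ℕ → ℕ → ℕ}, (∀ j, c j ≤ c' j) → (∀ X j, e X j ≤ e' X j) →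
      ∀ X j, scons c e X j ≤ scons c' e' X j := by
    intro c c' e e' hc he X j
    cases X with
    | zero => exact hc j
    | succ X => exact he X j
  induction P with
  | sel c q l d P ih =>
    intro k e e' h
    cases k with
    | zero => exact le_rfl
    | succ k => exact ih k e e' h
  | brn c q n lab P ih =>
    intro k e e' h
    cases k with
    | zero => exact le_rfl
    | succ k => exact Finset.sum_le_sum fun i _ => ih i k e e' h
  | defn Ss Q P ihQ ihP =>
    intro k e e' h
    exact ihP k _ _ (hs (fun j => costIter_mono (fun k c c' hc => ihQ k _ _ (hs hc h)) _ _) h)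
  | par P Q ihP ihQ => intro k e e' h; exact Nat.add_le_add (ihP k e e' h) (ihQ k e e' h)
  | res A P ih => intro k e e' h; exact ih k e e' h
  | call X ds => intro k e e' h; exact h X k
  | _ => intro k e e' h; exact le_rfl

/-- Monotonicity in the budget, for costs that are monotone in the budget. -/
theorem potential_mono_budget (P : Proc) : ∀ (e : ℕ → ℕ → ℕ), (∀ X, Monotone (e X)) →
    ∀ k k', k ≤ k' → potential P k e ≤ potential P k' e := by
  have hs : ∀ {c : ℕ → ℕ} {e : ℕ → ℕ → ℕ}, Monotone c → (∀ X, Monotone (e X)) →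
      ∀ X, Monotone (scons c e X) := by
    intro c e hc he X
    cases X with
    | zero => exact hc
    | succ X => exact he X
  have hc : ∀ {Q : Proc}, (∀ (e : ℕ → ℕ → ℕ), (∀ X, Monotone (e X)) →
      ∀ k k', k ≤ k' → potential Q k e ≤ potential Q k' e) → ∀ {e : ℕ → ℕ → ℕ},
      (∀ X, Monotone (e X)) → Monotone (callCost (potential Q) e) := by
    intro Q ih e he
    have h1 : ∀ n, Monotone (costIter (potential Q) e n) := by
      intro n
      induction n with
      | zero => intro j j' _; exact le_rfl
      | succ n ihn => intro j j' hj; exact Nat.add_le_add_left (ih _ (hs ihn he) j j' hj) 1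
    have h2 : ∀ n j, costIter (potential Q) e n j ≤ costIter (potential Q) e (n + 1) j := by
      intro n
      induction n with
      | zero => intro j; exact Nat.zero_le _
      | succ n ihn =>
        intro j
        refine Nat.add_le_add_left (potential_mono Q j _ _ fun X i => ?_) 1
        cases X with
        | zero => exact ihn i
        | succ X => exact le_rfl
    have h3 : ∀ j, Monotone fun n => costIter (potential Q) e n j :=
      fun j => monotone_nat_of_le_succ fun n => h2 n j
    intro k k' hk
    -- Both the budget and the admitted depth grow along the diagonal that defines `callCost`, and
    -- the approximations are monotone in each.
    exact (h1 _ hk).trans (h3 k' (Nat.succ_le_succ hk))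
  induction P with
  | sel c q l d P ih =>
    intro e he k k' hk
    match k, k' with
    | 0, _ => exact Nat.zero_le _
    | k + 1, k' + 1 => exact ih e he k k' (by omega)
  | brn c q n lab P ih =>
    intro e he k k' hk
    match k, k' with
    | 0, _ => exact Nat.zero_le _
    | k + 1, k' + 1 => exact Finset.sum_le_sum fun i _ => ih i e he k k' (by omega)
  | defn Ss Q P ihQ ihP => intro e he k k' hk; exact ihP _ (hs (hc ihQ he) he) k k' hk
  | par P Q ihP ihQ =>
    intro e he k k' hk; exact Nat.add_le_add (ihP e he k k' hk) (ihQ e he k k' hk)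
  | res A P ih => intro e he k k' hk; exact ih e he k k' hk
  | call X ds => intro e he k k' hk; exact he X hk
  | _ => intro e he k k' hk; exact le_rfl

/-- The cost of a call is the potential of the process that declares the variable and calls it once.
-/
theorem callCost_monotone (Q : Proc) {e : ℕ → ℕ → ℕ} (he : ∀ X, Monotone (e X)) :
    Monotone (callCost (potential Q) e) := by
  intro k k' hk
  exact potential_mono_budget (defn [] Q (call 0 [])) e he k k' hk

/-- The potential depends on costs only up to the budget, and at the process variable `X` only
strictly below the budget, if `X` is not called early. -/
theorem potential_congr (P : Proc) : ∀ k (e e' : ℕ → ℕ → ℕ),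
    (∀ Y, (∀ j < k, e Y j = e' Y j) ∧ (HasEarlyCall Y P → e Y k = e' Y k)) →
    potential P k e = potential P k e' := by
  induction P with
  | sel c q l d P ih =>
    intro k e e' h
    cases k with
    | zero => rfl
    | succ k =>
      exact ih k e e' fun Y => ⟨fun j hj => (h Y).1 j (by omega), fun _ => (h Y).1 k (by omega)⟩
  | brn c q n lab P ih =>
    intro k e e' h
    cases k with
    | zero => rfl
    | succ k =>
      exact Finset.sum_congr rfl fun i _ => ih i k e e' fun Y =>
        ⟨fun j hj => (h Y).1 j (by omega), fun _ => (h Y).1 k (by omega)⟩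
  | defn Ss Q P ihQ ihP =>
    intro k e e' h
    -- At a budget below `k` the two environments agree outright. At budget `k` itself the values of
    -- outer variables matter only where the body calls them early.
    have hit : ∀ n j, j ≤ k → (j = k → ∀ Y, HasEarlyCall (Y + 1) Q → e Y k = e' Y k) →
        costIter (potential Q) e n j = costIter (potential Q) e' n j := by
      intro n
      induction n with
      | zero => intro j _ _; rfl
      | succ n ihn =>
        intro j hj hk
        refine congrArg (1 + ·) (ihQ j _ _ fun Y => ?_)
        cases Y with
        | zero => exact ⟨fun i hi => ihn i (by omega) (by omega), fun _ => ihn j hj hk⟩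
        | succ Y =>
          refine ⟨fun i hi => (h Y).1 i (by omega), fun hc => ?_⟩
          rcases hj.lt_or_eq with hlt | rfl
          · exact (h Y).1 j hlt
          · exact hk rfl Y hc
    refine ihP k _ _ fun Y => ?_
    cases Y with
    | zero =>
      exact ⟨fun j hj => hit _ j (by omega) (by omega),
        fun _ => hit _ k le_rfl fun _ Y hY => (h Y).2 (.inl hY)⟩
    | succ Y => exact ⟨(h Y).1, fun hc => (h Y).2 (.inr hc)⟩
  | par P Q ihP ihQ =>
    intro k e e' h
    exact congrArg₂ (· + ·) (ihP k e e' fun Y => ⟨(h Y).1, fun hc => (h Y).2 (.inl hc)⟩)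
      (ihQ k e e' fun Y => ⟨(h Y).1, fun hc => (h Y).2 (.inr hc)⟩)
  | res A P ih => intro k e e' h; exact ih k e e' h
  | call X ds => intro k e e' h; exact (h X).2 rfl
  | _ => intro k e e' h; rfl

theorem guardedBody_of_not_hasEarlyCall {Q : Proc} (h : ¬ HasEarlyCall 0 Q) : GuardedBody Q := by
  intro k c c' e hc
  refine potential_congr Q k _ _ fun Y => ?_
  cases Y with
  | zero => exact ⟨hc, fun h' => absurd h' h⟩
  | succ Y => exact ⟨fun _ _ => rfl, fun _ => rfl⟩

end Proc

/-! ## Typing modulo unused declarations and dead sessions -/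

/-- The linear resources of a process: endpoints of the live session and variables. -/
inductive Key where
  | role (p : Role)
  | var (x : ℕ)

/-- Linear contexts for one live session. -/
abbrev LCtx := Key → Option Ty

/-- The resource denoted by a channel, for the live session `s`. -/
def Chan.key (s : ℕ) : Chan → Option Key
  | var x => some (.var x)
  | ep s' p => if s' = s then some (.role p) else none

open Classical in
/-- The linear part of a type assignment: basic types and subtypes of `end` are dropped. -/
noncomputable def Ty.lin (U : Ty) : Option Ty := if U.IsBasic ∨ U.Sub .done then none else some U

theorem Ty.lin_eq_some {U V : Ty} : U.lin = some V ↔ U = V ∧ ¬ U.IsBasic ∧ ¬ U.Sub .done := by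
  unfold Ty.lin
  split
  · rename_i h
    exact ⟨fun h' => (by cases h'), fun h' => absurd h (not_or.2 h'.2)⟩
  · rename_i h
    exact ⟨fun h' => ⟨Option.some.inj h', not_or.1 h⟩, fun h' => congrArg some h'.1⟩

theorem Ty.lin_eq_none {U : Ty} : U.lin = none ↔ U.IsBasic ∨ U.Sub .done := by
  unfold Ty.lin
  split
  · rename_i h
    exact ⟨fun _ => h, fun _ => rfl⟩
  · rename_i h
    exact ⟨fun h' => (by cases h'), fun h' => absurd h' h⟩

namespace LCtx

/-- The empty linear context. -/
def nil : LCtx := fun _ => none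

open Classical in
/-- Overwrite one entry. -/
noncomputable def upd (L : LCtx) (k : Key) (u : Option Ty) : LCtx := fun k' => if k' = k then u else L k'

/-- `Split L₁ L₂ L`: the context `L` is the disjoint union of `L₁` and `L₂`. -/
def Split (L₁ L₂ L : LCtx) : Prop :=
  ∀ k, (L₁ k = none ∧ L k = L₂ k) ∨ (L₂ k = none ∧ L k = L₁ k)

/-- All resources in `L` belong to role `r`, where `w` is the owner of all variables. -/
def Own (w r : Role) (L : LCtx) : Prop :=
  (∀ p, L (.role p) ≠ none → p = r) ∧ ∀ x, L (.var x) ≠ none → r = w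

/-- Enter the scope of a variable of type `S`. -/
noncomputable def cons (S : Ty) (L : LCtx) : LCtx
  | .var 0 => S.lin
  | .var (x + 1) => L (.var x)
  | .role p => L (.role p)

/-- The linear context of a list of parameters. -/
noncomputable def params (Ss : List Ty) : LCtx
  | .var x => Ss[x]?.bind Ty.lin
  | .role _ => none

@[simp] theorem upd_same (L : LCtx) (k : Key) (u : Option Ty) : L.upd k u k = u := if_pos rfl

theorem upd_ne (L : LCtx) {k k' : Key} (u : Option Ty) (h : k' ≠ k) : L.upd k u k' = L k' :=
  if_neg h

theorem Split.symm {L₁ L₂ L : LCtx} (h : Split L₁ L₂ L) : Split L₂ L₁ L := fun k => (h k).symm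

theorem Split.nil_left {L₁ L₂ : LCtx} : Split nil L₁ L₂ ↔ L₂ = L₁ := by
  constructor
  · intro h
    funext k
    rcases h k with ⟨_, h⟩ | ⟨h, h'⟩
    · exact h
    · rw [h, h']; rfl
  · rintro rfl k; exact .inl ⟨rfl, rfl⟩

theorem Split.assoc {L₁ L₂ L₁₂ L₃ L : LCtx} (h : Split L₁ L₂ L₁₂) (h' : Split L₁₂ L₃ L) :
    ∃ L₂₃, Split L₂ L₃ L₂₃ ∧ Split L₁ L₂₃ L := by
  classical
  refine ⟨fun k => if L₂ k = none then L₃ k else L₂ k, fun k => ?_, fun k => ?_⟩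
  · have h1 := h k
    have h2 := h' k
    by_cases hk : L₂ k = none
    · simp [hk]
    · simp only [hk, if_false]
      rcases h1 with ⟨_, h1⟩ | ⟨h1, _⟩
      · rcases h2 with ⟨h2, _⟩ | ⟨h2, _⟩
        · rw [h2] at h1; exact absurd h1.symm hk
        · exact .inr (by simp [h2])
      · exact absurd h1 hk
  · have h1 := h k
    have h2 := h' k
    by_cases hk : L₂ k = none
    · simp only [hk, if_true]
      rcases h1 with ⟨h0, h1⟩ | ⟨_, h1⟩
      · rcases h2 with ⟨_, h2⟩ | ⟨h3, h2⟩
        · exact .inl ⟨h0, h2⟩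
        · exact .inl ⟨h0, by rw [h2, h1, hk, h3]⟩
      · rcases h2 with ⟨h3, h2⟩ | ⟨h3, h2⟩
        · exact .inl ⟨by rw [← h1, h3], h2⟩
        · exact .inr ⟨h3, by rw [h2, h1]⟩
    · simp only [hk, if_false]
      rcases h1 with ⟨h0, h1⟩ | ⟨h1, _⟩
      · rcases h2 with ⟨h2, _⟩ | ⟨h2, h3⟩
        · rw [h2] at h1; exact absurd h1.symm hk
        · exact .inl ⟨h0, by rw [h3, h1]⟩
      · exact absurd h1 hk

theorem Split.ne_none {L₁ L₂ L : LCtx} (h : Split L₁ L₂ L) {k : Key} :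
    L k ≠ none ↔ L₁ k ≠ none ∨ L₂ k ≠ none := by
  rcases h k with ⟨h1, h2⟩ | ⟨h1, h2⟩ <;> simp [h1, h2]

theorem Split.some_left {L₁ L₂ L : LCtx} (h : Split L₁ L₂ L) {k : Key} {U} (hk : L₁ k = some U) :
    L k = some U ∧ L₂ k = none := by
  rcases h k with ⟨h1, h2⟩ | ⟨h1, h2⟩
  · rw [hk] at h1; cases h1
  · exact ⟨h2.trans hk, h1⟩

theorem Split.some_right {L₁ L₂ L : LCtx} (h : Split L₁ L₂ L) {k : Key} {U} (hk : L₂ k = some U) :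
    L k = some U ∧ L₁ k = none := h.symm.some_left hk

end LCtx

/-- Environments for process variables: owner role and parameter types. -/
abbrev TEnv := ℕ → Role → List Ty → Prop

/-- The process variables owned by `r`. -/
def TEnv.only (r : Role) (Θ : TEnv) : TEnv := fun X o Ss => Θ X o Ss ∧ o = r

/-- The entry of a usable process variable. -/
def entry (r : Role) (Ss : List Ty) : Role → List Ty → Prop := fun o Ss' => o = r ∧ Ss' = Ss

/-- The entry of a process variable that may not be used. -/
def noEntry : Role → List Ty → Prop := fun _ _ => False

/-- Sets of indices. -/
abbrev VSet := ℕ → Prop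

/-- The basic parameters. -/
def basicParams (Ss : List Ty) : VSet := fun x => ∃ S, Ss[x]? = some S ∧ S.IsBasic

/-- Typing of payloads; the linear context is used up. -/
def PayJ (s : ℕ) (Δ : VSet) (L : LCtx) (d : Pay) (S : Ty) : Prop :=
  (S.IsBasic ∧ L = LCtx.nil ∧ ((∃ v, d = .val v) ∨ ∃ x, d = .chan (.var x) ∧ Δ x)) ∨
  ∃ c k U, d = .chan c ∧ c.key s = some k ∧ S.IsSession ∧ ¬ S.Sub .done ∧ U.Sub S ∧
    L = LCtx.nil.upd k (some U)

/-- Typing of argument lists. -/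
def ArgsJ (s : ℕ) (Δ : VSet) : LCtx → List Pay → List Ty → Prop
  | L, [], [] => L = LCtx.nil
  | L, d :: ds, S :: Ss => ∃ L₁ L₂, PayJ s Δ L₁ d S ∧ ArgsJ s Δ L₂ ds Ss ∧ LCtx.Split L₁ L₂ L
  | _, _, _ => False

/-- Typing of processes that use endpoints of a single live session `s`, in a form that is invariant
under structural congruence: `D` are the dead sessions, of which only crashed endpoints may occur,
`Θ` the usable process variables, `Δ` the basic variables in scope and `L` the linear resources,
all of which are used. Every thread has an owner role; `w` is the owner of all variables in `L`.  With the flag `g`, the bodies of definitions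
are required to have guarded recursion. -/
def J (g : Prop) : Role → ℕ → VSet → TEnv → VSet → LCtx → Proc → Prop
  | _, _, _, _, _, L, .nil => L = LCtx.nil
  | w, s, D, Θ, Δ, L, .res _ P => J g w (s + 1) (scons True D) Θ Δ L P
  | w, s, D, Θ, Δ, L, .par P Q =>
      ∃ L₁ L₂, J g w s D Θ Δ L₁ P ∧ J g w s D Θ Δ L₂ Q ∧ LCtx.Split L₁ L₂ L
  | w, s, _, Θ, Δ, L, .sel c q l d P =>
      ∃ r k U S T L₀ L₂, c.key s = some k ∧ L.Own w r ∧ LCtx.Split L₀ L₂ L ∧ L₀ k = some U ∧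
        U.Sub (.sel q 1 (fun _ => l) (fun _ => S) (fun _ => T)) ∧ PayJ s Δ L₂ d S ∧
        J g r s (fun _ => False) (TEnv.only r Θ) Δ (L₀.upd k T.lin) P
  | w, s, _, Θ, Δ, L, .brn c q n lab P =>
      ∃ r k U S T, c.key s = some k ∧ L.Own w r ∧ L k = some U ∧ U.Sub (.brn q n lab S T) ∧
        ∀ i, J g r s (fun _ => False) (TEnv.only r Θ) (scons (S i).IsBasic Δ)
          (LCtx.cons (S i) (L.upd k (T i).lin)) (P i)
  | w, s, D, Θ, Δ, L, .defn Ss Q P =>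
      (∃ r, (∀ i S, Ss[i]? = some S → S.IsSession → ¬ Proc.HasEarlyPass i Q) ∧
        (g → Proc.GuardedBody Q) ∧
        J g r s (fun _ => False) (scons (entry r Ss) (TEnv.only r Θ)) (basicParams Ss)
          (LCtx.params Ss) Q ∧
        J g w s D (scons (entry r Ss) Θ) Δ L P) ∨
      (Proc.fc Q = ∅ ∧ (∀ x ∈ Proc.fv Q, x < Ss.length) ∧ J g w s D (scons noEntry Θ) Δ L P)
  | w, s, _, Θ, Δ, L, .call X ds => ∃ r Ss, Θ X r Ss ∧ L.Own w r ∧ ArgsJ s Δ L ds Ss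
  | _, _, _, _, _, _, .err => False
  | _, s, D, _, _, L, .crashed s' p =>
      (s' = s ∧ L = LCtx.nil.upd (.role p) (some .crashed)) ∨ (s' ≠ s ∧ D s' ∧ L = LCtx.nil)

/-! ### Renaming -/

theorem key_renS {ρ : ℕ → ℕ} {s : ℕ} (h : ∀ x, ρ x = ρ s ↔ x = s) (c : Chan) :
    (c.renS ρ).key (ρ s) = c.key s := by
  rcases c with x | ⟨s', p⟩ <;> simp [Chan.renS, Chan.key, h]

theorem payJ_renS {ρ : ℕ → ℕ} {s : ℕ} (h : ∀ x, ρ x = ρ s ↔ x = s) (Δ L d S) :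
    PayJ (ρ s) Δ L (d.renS ρ) S ↔ PayJ s Δ L d S := by
  rcases d with v | c
  · simp [PayJ, Pay.renS]
  · have h1 := key_renS h c
    rcases c with x | ⟨s', p⟩ <;> simp_all [PayJ, Pay.renS, Chan.renS]

theorem argsJ_renS {ρ : ℕ → ℕ} {s : ℕ} (h : ∀ x, ρ x = ρ s ↔ x = s) (Δ) :
    ∀ ds L Ss, ArgsJ (ρ s) Δ L (ds.map (Pay.renS ρ)) Ss ↔ ArgsJ s Δ L ds Ss := by
  intro ds
  induction ds with
  | nil => intro L Ss; cases Ss <;> rfl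
  | cons d ds ih =>
    intro L Ss
    cases Ss with
    | nil => rfl
    | cons S Ss => simp only [List.map, ArgsJ, payJ_renS h, ih]

/-- The renaming may identify dead sessions with each other. It only has to keep the live session
apart from all others. -/
theorem J_renS {g : Prop} (P : Proc) : ∀ {w : Role} {ρ : ℕ → ℕ} {s : ℕ} {D D' : VSet} {Θ Δ L},
    (∀ x, ρ x = ρ s ↔ x = s) → (∀ x, D' (ρ x) ↔ D x) →
    (J g w (ρ s) D' Θ Δ L (P.renS ρ) ↔ J g w s D Θ Δ L P) := by
  induction P with
  | nil => intros; rfl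
  | err => intros; rfl
  | res A P ih =>
    intro w ρ s D D' Θ Δ L h hD
    refine ih (ρ := upRen ρ) (s := s + 1) (upRen_iff h) fun x => ?_
    cases x with
    | zero => rfl
    | succ x => exact hD x
  | par P Q ihP ihQ =>
    intro w ρ s D D' Θ Δ L h hD
    simp only [Proc.renS, J, ihP h hD, ihQ h hD]
  | sel c q l d P ih =>
    intro w ρ s D D' Θ Δ L h hD
    simp only [Proc.renS, J, key_renS h, payJ_renS h, ih h (fun _ => Iff.rfl)]
  | brn c q n lab P ih =>
    intro w ρ s D D' Θ Δ L h hD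
    simp only [Proc.renS, J, key_renS h, fun i w Θ Δ L => @ih i w ρ s (fun _ => False) (fun _ => False) Θ Δ L h (fun _ => Iff.rfl)]
  | defn Ss Q P ihQ ihP =>
    intro w ρ s D D' Θ Δ L h hD
    simp only [Proc.renS, J, ihP h hD, ihQ h (fun _ => Iff.rfl), Proc.hasEarlyPass_renS,
      Proc.guardedBody_renS, Proc.fc_renS_eq_empty, Proc.fv_renS]
  | call X ds =>
    intro w ρ s D D' Θ Δ L h hD
    simp only [Proc.renS, J, argsJ_renS h]
  | crashed s' p =>
    intro w ρ s D D' Θ Δ L h hD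
    simp only [Proc.renS, J, h, hD, ne_eq]

/-- Entries outside the range of `ρ` are arbitrary, so this serves as both weakening and
strengthening. Injectivity is needed for the guardedness of bodies, which quantifies over all
environments of costs. -/
theorem J_renX {g : Prop} (P : Proc) : ∀ {w : Role} {ρ : ℕ → ℕ} {s : ℕ} {D : VSet} {Θ Θ' : TEnv} {Δ L},
    Function.Injective ρ → (∀ X, Θ' (ρ X) = Θ X) →
    (J g w s D Θ' Δ L (P.renX ρ) ↔ J g w s D Θ Δ L P) := by
  have honly : ∀ {ρ : ℕ → ℕ} {Θ Θ' : TEnv} {r}, (∀ X, Θ' (ρ X) = Θ X) →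
      ∀ X, TEnv.only r Θ' (ρ X) = TEnv.only r Θ X := by
    intro ρ Θ Θ' r h X; funext o Ss; simp only [TEnv.only, h]
  have hcons : ∀ {ρ : ℕ → ℕ} {Θ Θ' : TEnv} {θ}, (∀ X, Θ' (ρ X) = Θ X) →
      ∀ X, (scons θ Θ' : TEnv) (upRen ρ X) = (scons θ Θ : TEnv) X := by
    intro ρ Θ Θ' θ h X
    cases X with
    | zero => rfl
    | succ X => exact h X
  induction P with
  | nil => intros; rfl
  | err => intros; rfl
  | crashed s' p => intros; rfl
  | res A P ih => intro w ρ s D Θ Θ' Δ L h hΘ; exact ih h hΘ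
  | par P Q ihP ihQ =>
    intro w ρ s D Θ Θ' Δ L h hΘ
    simp only [Proc.renX, J, ihP h hΘ, ihQ h hΘ]
  | sel c q l d P ih =>
    intro w ρ s D Θ Θ' Δ L h hΘ
    simp only [Proc.renX, J, ih h (honly hΘ)]
  | brn c q n lab P ih =>
    intro w ρ s D Θ Θ' Δ L h hΘ
    simp only [Proc.renX, J, fun i w r Δ L => @ih i w ρ s (fun _ => False) (TEnv.only r Θ)
      (TEnv.only r Θ') Δ L h (honly hΘ)]
  | defn Ss Q P ihQ ihP =>
    intro w ρ s D Θ Θ' Δ L h hΘ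
    simp only [Proc.renX, J, Proc.hasEarlyPass_renX, Proc.guardedBody_renX h, Proc.fc_renX,
      Proc.fv_renX, fun θ => @ihP w (upRen ρ) s D (scons θ Θ) (scons θ Θ') Δ L (upRen_injective h)
        (hcons hΘ),
      fun r => @ihQ r (upRen ρ) s (fun _ => False) (scons (entry r Ss) (TEnv.only r Θ))
        (scons (entry r Ss) (TEnv.only r Θ')) (basicParams Ss) (LCtx.params Ss) (upRen_injective h)
        (hcons (honly hΘ))]
  | call X ds =>
    intro w ρ s D Θ Θ' Δ L h hΘ
    simp only [Proc.renX, J, hΘ]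

/-! ### Invariance under structural congruence -/

/-- Crashed endpoints of a dead session consume no resources. This matches the axiom `stopElim` and
is the purpose of the component `D` of the judgement. -/
theorem J_bigPar_dead {g : Prop} {w s D Θ Δ L} (ps : List Role) :
    J g w (s + 1) (scons True D) Θ Δ L (Proc.bigPar (ps.map (Proc.crashed 0))) ↔ L = LCtx.nil := by
  induction ps generalizing L with
  | nil => rfl
  | cons p ps ih =>
    have h0 : (0 : ℕ) ≠ s + 1 := (Nat.succ_ne_zero s).symm
    have h1 : (scons True D : VSet) 0 := trivial
    constructor
    · rintro ⟨L₁, L₂, h, h', hs⟩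
      rcases h with ⟨h, _⟩ | ⟨_, _, rfl⟩
      · exact absurd h h0
      · rw [ih.1 h', LCtx.Split.nil_left] at hs
        exact hs
    · rintro rfl
      exact ⟨LCtx.nil, LCtx.nil, .inr ⟨h0, h1, rfl⟩, ih.2 rfl, LCtx.Split.nil_left.2 rfl⟩

theorem J_defSwap {g : Prop} {w s D Θ Δ L Ss Q Ss' Q' P}
    (h : J g w s D Θ Δ L (.defn Ss Q (.defn Ss' (Proc.renX (upRen Nat.succ) Q') P))) :
    J g w s D Θ Δ L (.defn Ss' Q' (.defn Ss (Proc.renX (upRen Nat.succ) Q)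
      (Proc.renX swapRen P))) := by
  have hinj := upRen_injective Nat.succ_injective
  have body : ∀ (Q : Proc) (r : Role) (Ss : List Ty) (θ : Role → List Ty → Prop),
      J g r s (fun _ => False) (scons (entry r Ss) (TEnv.only r (scons θ Θ))) (basicParams Ss)
        (LCtx.params Ss) (Proc.renX (upRen Nat.succ) Q) ↔
      J g r s (fun _ => False) (scons (entry r Ss) (TEnv.only r Θ)) (basicParams Ss)
        (LCtx.params Ss) Q := by
    intro Q r Ss θ
    refine J_renX Q hinj fun X => ?_
    cases X <;> rfl
  have main : ∀ (θ θ' : Role → List Ty → Prop), J g w s D (scons θ' (scons θ Θ)) Δ L P ↔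
      J g w s D (scons θ (scons θ' Θ)) Δ L (Proc.renX swapRen P) := by
    intro θ θ'
    refine (J_renX P swapRen_injective fun X => ?_).symm
    match X with
    | 0 => rfl
    | 1 => rfl
    | _ + 2 => rfl
  simp only [J, body, main, Proc.hasEarlyPass_renX, Proc.guardedBody_renX Nat.succ_injective,
    Proc.fc_renX, Proc.fv_renX] at h ⊢
  rcases h with ⟨r, h1, h2, h3, ⟨r', h1', h2', h3', h⟩ | ⟨h1', h2', h⟩⟩ |
    ⟨h1, h2, ⟨r', h1', h2', h3', h⟩ | ⟨h1', h2', h⟩⟩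
  · exact .inl ⟨r', h1', h2', h3', .inl ⟨r, h1, h2, h3, h⟩⟩
  · exact .inr ⟨h1', h2', .inl ⟨r, h1, h2, h3, h⟩⟩
  · exact .inl ⟨r', h1', h2', h3', .inr ⟨h1, h2, h⟩⟩
  · exact .inr ⟨h1', h2', .inr ⟨h1, h2, h⟩⟩

theorem renX_renX (P : Proc) : ∀ (ρ ρ' : ℕ → ℕ),
    Proc.renX ρ (Proc.renX ρ' P) = Proc.renX (fun i => ρ (ρ' i)) P := by
  have hup : ∀ (ρ ρ' : ℕ → ℕ), (fun i => upRen ρ (upRen ρ' i)) = upRen fun i => ρ (ρ' i) := by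
    intro ρ ρ'; funext i; cases i <;> rfl
  induction P <;> intro ρ ρ' <;> simp_all [Proc.renX]

theorem renX_id (P : Proc) : ∀ {ρ : ℕ → ℕ}, (∀ i, ρ i = i) → Proc.renX ρ P = P := by
  have hup : ∀ {ρ : ℕ → ℕ}, (∀ i, ρ i = i) → ∀ i, upRen ρ i = i := by
    intro ρ h i
    cases i with
    | zero => rfl
    | succ i => exact congrArg _ (h i)
  induction P <;> intro ρ h <;> simp_all [Proc.renX]

/-- The judgement is designed for this equivalence. Annotations of restrictions are ignored,
restricted sessions count as dead, and a declaration may be left untyped provided that it has no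
free names and is never called. The last option accounts for `defNil` read from right to left. -/
theorem J_cong {g : Prop} {P Q : Proc} (h : Proc.Cong P Q) :
    ∀ w s D Θ Δ L, J g w s D Θ Δ L P ↔ J g w s D Θ Δ L Q := by
  have hS : ∀ (P : Proc) {w s D Θ Δ L}, J g w (s + 1) (scons True D) Θ Δ L (P.renS Nat.succ) ↔
      J g w s D Θ Δ L P := fun P w s D Θ Δ L =>
    J_renS P (ρ := Nat.succ) (fun x => Nat.succ_inj) fun x => Iff.rfl
  have hS' : ∀ (P : Proc) {w s Θ Δ L}, J g w (s + 1) (fun _ => False) Θ Δ L (P.renS Nat.succ) ↔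
      J g w s (fun _ => False) Θ Δ L P := fun P w s Θ Δ L =>
    J_renS P (ρ := Nat.succ) (fun x => Nat.succ_inj) fun x => Iff.rfl
  have hX : ∀ (P : Proc) {w s D Θ θ Δ L}, J g w s D (scons θ Θ) Δ L (P.renX Nat.succ) ↔
      J g w s D Θ Δ L P := fun P w s D Θ θ Δ L =>
    J_renX P Nat.succ_injective fun X => rfl
  induction h with
  | refl => intros; rfl
  | symm _ ih => intros; exact (ih ..).symm
  | trans _ _ ih ih' => intros; exact (ih ..).trans (ih' ..)
  | congRes _ ih => intros; exact ih ..
  | congPar _ _ ih ih' => intros; simp only [J, ih, ih']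
  | congSel _ ih => intros; simp only [J, ih]
  | congBrn _ ih => intros; simp only [J, ih]
  | congDefn h _ ih ih' =>
    intros
    simp only [J, ih, ih', h.hasEarlyPass, h.guardedBody, h.fc_eq, h.fv_eq]
  | parComm P Q =>
    intros
    exact ⟨fun ⟨L₁, L₂, h, h', hs⟩ => ⟨L₂, L₁, h', h, hs.symm⟩,
      fun ⟨L₁, L₂, h, h', hs⟩ => ⟨L₂, L₁, h', h, hs.symm⟩⟩
  | parAssoc P Q R =>
    intros
    constructor
    · rintro ⟨L₁₂, L₃, ⟨L₁, L₂, h1, h2, hs⟩, h3, hs'⟩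
      obtain ⟨L₂₃, h, h'⟩ := hs.assoc hs'
      exact ⟨L₁, L₂₃, h1, ⟨L₂, L₃, h2, h3, h⟩, h'⟩
    · rintro ⟨L₁, L₂₃, h1, ⟨L₂, L₃, h2, h3, hs⟩, hs'⟩
      obtain ⟨L₂₃, h, h'⟩ := hs.symm.assoc hs'.symm
      exact ⟨L₂₃, L₃, ⟨L₁, L₂, h1, h2, h.symm⟩, h3, h'.symm⟩
  | parNil P =>
    intro w s D Θ Δ L
    constructor
    · rintro ⟨L₁, L₂, h, rfl, hs⟩
      rw [LCtx.Split.nil_left.1 hs.symm]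
      exact h
    · intro h
      exact ⟨L, LCtx.nil, h, rfl, (LCtx.Split.nil_left.2 rfl).symm⟩
  | resNil => intros; rfl
  | resSwap A B P =>
    intro w s D Θ Δ L
    refine (J_renS P (ρ := swapRen) (s := s + 1 + 1) (fun x => swapRen_injective.eq_iff)
      fun x => ?_).symm
    match x with
    | 0 => rfl
    | 1 => rfl
    | _ + 2 => rfl
  | resLift A P Q => intros; simp only [J, hS]
  | stopElim A ps => intros; exact J_bigPar_dead ps
  | defNil Ss Q h h' =>
    intro w s D Θ Δ L
    constructor
    · rintro (⟨r, _, _, _, h⟩ | ⟨_, _, h⟩) <;> exact h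
    · intro hL; exact .inr ⟨h, h', hL⟩
  | defRes Ss Q A P =>
    intros
    simp only [J, hS', Proc.hasEarlyPass_renS, Proc.guardedBody_renS, Proc.fc_renS_eq_empty,
      Proc.fv_renS]
  | defPar Ss Q P R =>
    intro w s D Θ Δ L
    simp only [J, hX]
    constructor
    · rintro (⟨r, h1, h2, h3, L₁, L₂, h, h', hs⟩ | ⟨h1, h2, L₁, L₂, h, h', hs⟩)
      · exact ⟨L₁, L₂, .inl ⟨r, h1, h2, h3, h⟩, h', hs⟩
      · exact ⟨L₁, L₂, .inr ⟨h1, h2, h⟩, h', hs⟩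
    · rintro ⟨L₁, L₂, ⟨r, h1, h2, h3, h⟩ | ⟨h1, h2, h⟩, h', hs⟩
      · exact .inl ⟨r, h1, h2, h3, L₁, L₂, h, h', hs⟩
      · exact .inr ⟨h1, h2, L₁, L₂, h, h', hs⟩
  | defSwap Ss Q Ss' Q' P =>
    intro w s D Θ Δ L
    refine ⟨J_defSwap, fun h => ?_⟩
    -- Exchanging the two declarations twice is the identity up to renaming, so one direction
    -- suffices.
    have := J_defSwap h
    rwa [renX_renX, renX_id P swapRen_swapRen] at this

/-! ### Structural properties -/

/-- The owner `w` concerns variables only, so it may be changed freely in a context without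
variables. -/
theorem J_mono {g : Prop} (P : Proc) : ∀ {w w' s} {D D' : VSet} {Θ Θ' : TEnv} {Δ L},
    (∀ x, D x → D' x) →
    (∀ X o Ss, Θ X o Ss → Θ' X o Ss) → (∀ x, L (.var x) ≠ none → w = w') →
    J g w s D Θ Δ L P → J g w' s D' Θ' Δ L P := by
  have honly : ∀ {Θ Θ' : TEnv} {r}, (∀ X o Ss, Θ X o Ss → Θ' X o Ss) →
      ∀ X o Ss, TEnv.only r Θ X o Ss → TEnv.only r Θ' X o Ss :=
    fun h X o Ss h' => ⟨h _ _ _ h'.1, h'.2⟩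
  have hcons : ∀ {Θ Θ' : TEnv} {θ}, (∀ X o Ss, Θ X o Ss → Θ' X o Ss) →
      ∀ X o Ss, scons θ Θ X o Ss → scons θ Θ' X o Ss := by
    intro Θ Θ' θ h X o Ss h'
    cases X with
    | zero => exact h'
    | succ X => exact h _ _ _ h'
  have hown : ∀ {w w' r} {L : LCtx}, (∀ x, L (.var x) ≠ none → w = w') → L.Own w r → L.Own w' r :=
    fun h h' => ⟨h'.1, fun x hx => (h'.2 x hx).trans (h x hx)⟩
  induction P with
  | nil => intro w w' s D D' Θ Θ' Δ L hD _ _ h; exact h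
  | err => intro w w' s D D' Θ Θ' Δ L hD _ _ h; exact h
  | crashed s' p => intro w w' s D D' Θ Θ' Δ L hD _ _ h; exact h.imp id fun h => ⟨h.1, hD _ h.2.1, h.2.2⟩
  | res A P ih => intro w w' s D D' Θ Θ' Δ L hD h hw hJ; exact ih (fun x hx => by cases x; exacts [trivial, hD _ hx]) h hw hJ
  | par P Q ihP ihQ =>
    rintro w w' s D D' Θ Θ' Δ L hD h hw ⟨L₁, L₂, h1, h2, hs⟩
    exact ⟨L₁, L₂, ihP hD h (fun x hx => hw x (hs.ne_none.2 (.inl hx))) h1,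
      ihQ hD h (fun x hx => hw x (hs.ne_none.2 (.inr hx))) h2, hs⟩
  | sel c q l d P ih =>
    rintro w w' s D D' Θ Θ' Δ L hD h hw ⟨r, k, U, S, T, L₀, L₂, h1, h2, h3, h4, h5, h6, h7⟩
    exact ⟨r, k, U, S, T, L₀, L₂, h1, hown hw h2, h3, h4, h5, h6, ih (fun _ h => h) (honly h) (fun _ _ => rfl) h7⟩
  | brn c q n lab P ih =>
    rintro w w' s D D' Θ Θ' Δ L hD h hw ⟨r, k, U, S, T, h1, h2, h3, h4, h5⟩
    exact ⟨r, k, U, S, T, h1, hown hw h2, h3, h4, fun i => ih i (fun _ h => h) (honly h) (fun _ _ => rfl) (h5 i)⟩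
  | defn Ss Q P ihQ ihP =>
    rintro w w' s D D' Θ Θ' Δ L hD h hw (⟨r, h1, h2, h3, h4⟩ | ⟨h1, h2, h3⟩)
    · exact .inl ⟨r, h1, h2, ihQ (fun _ h => h) (hcons (honly h)) (fun _ _ => rfl) h3, ihP hD (hcons h) hw h4⟩
    · exact .inr ⟨h1, h2, ihP hD (hcons h) hw h3⟩
  | call X ds =>
    rintro w w' s D D' Θ Θ' Δ L hD h hw ⟨r, Ss, h1, h2, h3⟩
    exact ⟨r, Ss, h _ _ _ h1, hown hw h2, h3⟩

theorem PayJ.fc {s Δ L d S} (h : PayJ s Δ L d S) {s' p} (hp : (s', p) ∈ d.fc) :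
    s' = s ∧ L (.role p) ≠ none := by
  rcases h with ⟨_, _, ⟨v, rfl⟩ | ⟨x, rfl, _⟩⟩ | ⟨c, k, U, rfl, hk, _, _, _, rfl⟩
  · exact hp.elim
  · exact hp.elim
  · rcases c with x | ⟨s'', q⟩
    · exact hp.elim
    · cases hp
      simp only [Chan.key] at hk
      split at hk
      · cases hk; simpa
      · cases hk

theorem PayJ.fv {s Δ L d S} (h : PayJ s Δ L d S) {x} (hx : x ∈ d.fv) :
    Δ x ∨ L (.var x) ≠ none := by
  rcases h with ⟨_, _, ⟨v, rfl⟩ | ⟨x, rfl, hΔ⟩⟩ | ⟨c, k, U, rfl, hk, _, _, _, rfl⟩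
  · exact hx.elim
  · cases hx; exact .inl hΔ
  · rcases c with x | ⟨s'', q⟩
    · cases hx; cases hk; simp
    · exact hx.elim

theorem ArgsJ.fc {s Δ} {ds : List Pay} : ∀ {L Ss}, ArgsJ s Δ L ds Ss → ∀ d ∈ ds, ∀ {s' p},
    (s', p) ∈ d.fc → s' = s ∧ L (.role p) ≠ none := by
  induction ds with
  | nil => intro L Ss _ d hd; cases hd
  | cons d ds ih =>
    rintro L (_ | ⟨S, Ss⟩) h
    · exact h.elim
    · obtain ⟨L₁, L₂, h1, h2, hs⟩ := h
      intro d' hd' s' p hp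
      rcases List.mem_cons.1 hd' with rfl | hd'
      · exact (h1.fc hp).imp id fun h => hs.ne_none.2 (.inl h)
      · exact (ih h2 d' hd' hp).imp id fun h => hs.ne_none.2 (.inr h)

theorem ArgsJ.fv {s Δ} {ds : List Pay} : ∀ {L Ss}, ArgsJ s Δ L ds Ss → ∀ d ∈ ds, ∀ {x},
    x ∈ d.fv → Δ x ∨ L (.var x) ≠ none := by
  induction ds with
  | nil => intro L Ss _ d hd; cases hd
  | cons d ds ih =>
    rintro L (_ | ⟨S, Ss⟩) h
    · exact h.elim
    · obtain ⟨L₁, L₂, h1, h2, hs⟩ := h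
      intro d' hd' x hx
      rcases List.mem_cons.1 hd' with rfl | hd'
      · exact (h1.fv hx).imp id fun h => hs.ne_none.2 (.inl h)
      · exact (ih h2 d' hd' hx).imp id fun h => hs.ne_none.2 (.inr h)

theorem upd_ne_none {L : LCtx} {k k' : Key} {u U} (hk : L k = some U) (h : L.upd k u k' ≠ none) :
    L k' ≠ none := by
  by_cases hkk : k' = k
  · subst hkk; simp [hk]
  · rwa [LCtx.upd_ne _ _ hkk] at h

theorem key_ep {s s' p k} (h : (Chan.ep s' p).key s = some k) : s' = s ∧ k = .role p := by
  simp only [Chan.key] at h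
  split at h
  · cases h; exact ⟨‹_›, rfl⟩
  · cases h

/-- Below a prefix the judgement admits no dead sessions, and the body of a typed declaration has no
roles among its resources. A prefix can therefore mention only endpoints of the live session that it
holds. -/
theorem J_fc {g : Prop} (P : Proc) : ∀ {w s D Θ Δ L}, J g w s D Θ Δ L P → ∀ {s' p}, (s', p) ∈ P.fc →
    (s' = s ∧ L (.role p) ≠ none) ∨ (s' ≠ s ∧ D s') := by
  have hsub : ∀ {c : Chan} {s k s' p L U}, c.key s = some k → (L : LCtx) k = some U →
      (s', p) ∈ (Pay.chan c).fc → s' = s ∧ L (.role p) ≠ none := by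
    intro c s k s' p L U hk hL hp
    rcases c with x | ⟨s'', q⟩
    · exact hp.elim
    · cases hp
      obtain ⟨rfl, rfl⟩ := key_ep hk
      exact ⟨rfl, by simp [hL]⟩
  induction P with
  | nil => intro w s D Θ Δ L _ s' p hp; exact hp.elim
  | err => intro w s D Θ Δ L _ s' p hp; exact hp.elim
  | crashed s'' q =>
    intro w s D Θ Δ L h s' p hp
    cases hp
    rcases h with ⟨rfl, rfl⟩ | ⟨h, h', _⟩
    · exact .inl ⟨rfl, by simp⟩
    · exact .inr ⟨h, h'⟩
  | res A P ih =>
    intro w s D Θ Δ L h s' p hp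
    rcases ih h hp with ⟨h1, h2⟩ | ⟨h1, h2⟩
    · exact .inl ⟨Nat.succ.inj h1, h2⟩
    · exact .inr ⟨fun h => h1 (congrArg _ h), h2⟩
  | par P Q ihP ihQ =>
    rintro w s D Θ Δ L ⟨L₁, L₂, h1, h2, hs⟩ s' p (hp | hp)
    · exact (ihP h1 hp).imp (fun h => ⟨h.1, hs.ne_none.2 (.inl h.2)⟩) id
    · exact (ihQ h2 hp).imp (fun h => ⟨h.1, hs.ne_none.2 (.inr h.2)⟩) id
  | sel c q l d P ih =>
    rintro w s D Θ Δ L ⟨r, k, U, S, T, L₀, L₂, h1, h2, h3, h4, h5, h6, h7⟩ s' p ((hp | hp) | hp)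
    · exact .inl ((hsub h1 h4 hp).imp id fun h => h3.ne_none.2 (.inl h))
    · exact .inl ((h6.fc hp).imp id fun h => h3.ne_none.2 (.inr h))
    · rcases ih h7 hp with ⟨rfl, h⟩ | ⟨_, h⟩
      · exact .inl ⟨rfl, h3.ne_none.2 (.inl (upd_ne_none h4 h))⟩
      · exact h.elim
  | brn c q n lab P ih =>
    rintro w s D Θ Δ L ⟨r, k, U, S, T, h1, h2, h3, h4, h5⟩ s' p (hp | ⟨i, hp⟩)
    · exact .inl (hsub h1 h3 hp)
    · rcases ih i (h5 i) hp with ⟨rfl, h⟩ | ⟨_, h⟩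
      · exact .inl ⟨rfl, upd_ne_none (k' := .role p) h3 h⟩
      · exact h.elim
  | defn Ss Q P ihQ ihP =>
    rintro w s D Θ Δ L (⟨r, h1, h2, h3, h4⟩ | ⟨h1, h2, h3⟩) s' p (hp | hp)
    · rcases ihQ h3 hp with ⟨_, h⟩ | ⟨_, h⟩
      · exact absurd rfl h
      · exact h.elim
    · exact ihP h4 hp
    · rw [h1] at hp; exact hp.elim
    · exact ihP h3 hp
  | call X ds =>
    rintro w s D Θ Δ L ⟨r, Ss, h1, h2, h3⟩ s' p ⟨d, hd, hp⟩
    exact .inl (h3.fc d hd hp)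

theorem params_ne_none {Ss : List Ty} {x} (h : LCtx.params Ss (.var x) ≠ none) : x < Ss.length := by
  by_contra hx
  apply h
  simp [LCtx.params, List.getElem?_eq_none (not_lt.1 hx)]

theorem basicParams_lt {Ss : List Ty} {x} (h : basicParams Ss x) : x < Ss.length := by
  obtain ⟨S, h, _⟩ := h
  by_contra hx
  rw [List.getElem?_eq_none (not_lt.1 hx)] at h
  cases h

theorem J_fv {g : Prop} (P : Proc) : ∀ {w s D Θ Δ L}, J g w s D Θ Δ L P → ∀ {x}, x ∈ P.fv →
    Δ x ∨ L (.var x) ≠ none := by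
  have hsub : ∀ {c : Chan} {s k x L U}, c.key s = some k → (L : LCtx) k = some U →
      x ∈ (Pay.chan c).fv → L (.var x) ≠ none := by
    intro c s k x L U hk hL hx
    rcases c with y | ⟨s'', q⟩
    · cases hx; cases hk; simp [hL]
    · exact hx.elim
  induction P with
  | nil => intro w s D Θ Δ L _ x hx; exact hx.elim
  | err => intro w s D Θ Δ L _ x hx; exact hx.elim
  | crashed s'' q => intro w s D Θ Δ L _ x hx; exact hx.elim
  | res A P ih => intro w s D Θ Δ L h x hx; exact ih h hx
  | par P Q ihP ihQ =>
    rintro w s D Θ Δ L ⟨L₁, L₂, h1, h2, hs⟩ x (hx | hx)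
    · exact (ihP h1 hx).imp id fun h => hs.ne_none.2 (.inl h)
    · exact (ihQ h2 hx).imp id fun h => hs.ne_none.2 (.inr h)
  | sel c q l d P ih =>
    rintro w s D Θ Δ L ⟨r, k, U, S, T, L₀, L₂, h1, h2, h3, h4, h5, h6, h7⟩ x ((hx | hx) | hx)
    · exact .inr (h3.ne_none.2 (.inl (hsub h1 h4 hx)))
    · exact (h6.fv hx).imp id fun h => h3.ne_none.2 (.inr h)
    · exact (ih h7 hx).imp id fun h => h3.ne_none.2 (.inl (upd_ne_none h4 h))
  | brn c q n lab P ih =>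
    rintro w s D Θ Δ L ⟨r, k, U, S, T, h1, h2, h3, h4, h5⟩ x (hx | ⟨i, hx⟩)
    · exact .inr (hsub h1 h3 hx)
    · exact (ih i (h5 i) hx).imp id fun h => upd_ne_none (k' := .var x) h3 h
  | defn Ss Q P ihQ ihP =>
    rintro w s D Θ Δ L (⟨r, h1, h2, h3, h4⟩ | ⟨h1, h2, h3⟩) x (hx | hx)
    · have : x + Ss.length < Ss.length := (ihQ h3 hx).elim basicParams_lt params_ne_none
      omega
    · exact ihP h4 hx
    · have := h2 _ hx
      omega
    · exact ihP h3 hx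
  | call X ds =>
    rintro w s D Θ Δ L ⟨r, Ss, h1, h2, h3⟩ x ⟨d, hd, hx⟩
    exact h3.fv d hd hx

/-! ## Substitution -/

theorem Pay.sub_eq_self {σ : ℕ → Pay} {d : Pay} (h : ∀ x ∈ d.fv, σ x = .chan (.var x)) :
    d.sub σ = d := by
  rcases d with v | (x | ⟨s, p⟩)
  · rfl
  · exact h x rfl
  · rfl

theorem Pay.renS_sub (ρ : ℕ → ℕ) (σ : ℕ → Pay) (d : Pay) :
    (d.sub σ).renS ρ = (d.renS ρ).sub (fun x => (σ x).renS ρ) := by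
  rcases d with v | (x | ⟨s, p⟩) <;> rfl

theorem Pay.renS_renS (ρ ρ' : ℕ → ℕ) (d : Pay) :
    (d.renS ρ').renS ρ = d.renS fun i => ρ (ρ' i) := by
  rcases d with v | (x | ⟨s, p⟩) <;> rfl

theorem Pay.renS_up (ρ : ℕ → ℕ) (n : ℕ) (σ : ℕ → Pay) :
    (fun x => (Pay.up n σ x).renS ρ) = Pay.up n fun x => (σ x).renS ρ := by
  funext x
  unfold Pay.up
  split
  · rfl
  · beta_reduce
    rcases σ (x - n) with v | (x | ⟨s, p⟩) <;> rfl

namespace Proc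

theorem sub_eq_self (P : Proc) : ∀ {σ : ℕ → Pay}, (∀ x ∈ P.fv, σ x = .chan (.var x)) →
    P.sub σ = P := by
  have hup : ∀ {n : ℕ} {σ : ℕ → Pay} {x : ℕ}, (∀ y, x = y + n → σ y = .chan (.var y)) →
      Pay.up n σ x = .chan (.var x) := by
    intro n σ x h
    unfold Pay.up
    split
    · rfl
    · rw [h (x - n) (by omega)]
      simp only [Pay.shiftV]
      rw [Nat.sub_add_cancel (by omega)]
  induction P with
  | nil => intros; rfl
  | err => intros; rfl
  | crashed s p => intros; rfl
  | res A P ih =>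
    intro σ h
    simp only [sub]
    rw [ih fun x hx => by rw [h x hx]; rfl]
  | par P Q ihP ihQ =>
    intro σ h
    simp only [sub]
    rw [ihP fun x hx => h x (.inl hx), ihQ fun x hx => h x (.inr hx)]
  | sel c q l d P ih =>
    intro σ h
    simp only [sub]
    rw [Pay.sub_eq_self fun x hx => h x (.inl (.inl hx)),
      Pay.sub_eq_self fun x hx => h x (.inl (.inr hx)), ih fun x hx => h x (.inr hx)]
  | brn c q n lab P ih =>
    intro σ h
    simp only [sub]
    rw [Pay.sub_eq_self fun x hx => h x (.inl hx)]
    simp only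
    congr 1
    funext i
    exact ih i fun x hx => hup fun y hy => h y (.inr ⟨i, hy ▸ hx⟩)
  | defn Ss Q P ihQ ihP =>
    intro σ h
    simp only [sub]
    rw [ihP fun x hx => h x (.inr hx), ihQ fun x hx => hup fun y hy => h y (.inl (by subst hy; exact hx))]
  | call X ds =>
    intro σ h
    simp only [sub]
    congr 1
    refine (List.map_congr_left fun d hd => ?_).trans (List.map_id _)
    exact Pay.sub_eq_self fun x hx => h x ⟨d, hd, hx⟩

theorem renS_sub (P : Proc) : ∀ (ρ : ℕ → ℕ) (σ : ℕ → Pay),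
    (P.sub σ).renS ρ = (P.renS ρ).sub fun x => (σ x).renS ρ := by
  have hsub : ∀ (ρ : ℕ → ℕ) (σ : ℕ → Pay) (c : Chan), (Pay.chan (c.renS ρ)).sub
      (fun x => (σ x).renS ρ) = ((Pay.chan c).sub σ).renS ρ :=
    fun ρ σ c => (Pay.renS_sub ρ σ (.chan c)).symm
  have hren : ∀ (ρ : ℕ → ℕ) (c : Chan), (Pay.chan c).renS ρ = .chan (c.renS ρ) := fun _ _ => rfl
  induction P with
  | nil => intros; rfl
  | err => intros; rfl
  | crashed s p => intros; rfl
  | res A P ih =>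
    intro ρ σ
    simp only [sub, renS, ih, Pay.renS_renS]
    rfl
  | par P Q ihP ihQ => intro ρ σ; simp only [sub, renS, ihP, ihQ]
  | sel c q l d P ih =>
    intro ρ σ
    simp only [sub, renS, hsub]
    rcases (Pay.chan c).sub σ with v | c'
    · rfl
    · simp only [renS, ih, Pay.renS_sub, hren]
  | brn c q n lab P ih =>
    intro ρ σ
    simp only [sub, renS, hsub]
    rcases (Pay.chan c).sub σ with v | c'
    · rfl
    · simp only [renS, ih, Pay.renS_up, hren]
  | defn Ss Q P ihQ ihP => intro ρ σ; simp only [sub, renS, ihP, ihQ, Pay.renS_up]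
  | call X ds =>
    intro ρ σ
    simp only [sub, renS, List.map_map]
    congr 1
    exact List.map_congr_left fun d _ => Pay.renS_sub ρ σ d

theorem renX_sub (P : Proc) : ∀ (ρ : ℕ → ℕ) (σ : ℕ → Pay),
    (P.sub σ).renX ρ = (P.renX ρ).sub σ := by
  induction P with
  | sel c q l d P ih =>
    intro ρ σ
    simp only [sub, renX]
    rcases (Pay.chan c).sub σ with v | c'
    · rfl
    · simp only [renX, ih]
  | brn c q n lab P ih =>
    intro ρ σ
    simp only [sub, renX]
    rcases (Pay.chan c).sub σ with v | c'
    · rfl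
    · simp only [renX, ih]
  | _ => intros; simp_all [sub, renX]

/-- The potential ignores channels and arguments. It can decrease only where a value replaces the
subject of a prefix, which turns the prefix into `err`. -/
theorem potential_sub_le (P : Proc) : ∀ (σ : ℕ → Pay) k e,
    potential (P.sub σ) k e ≤ potential P k e := by
  induction P with
  | sel c q l d P ih =>
    intro σ k e
    simp only [sub]
    rcases (Pay.chan c).sub σ with v | c'
    · exact Nat.zero_le _
    · cases k with
      | zero => exact le_rfl
      | succ k => exact ih _ _ _
  | brn c q n lab P ih =>
    intro σ k e
    simp only [sub]
    rcases (Pay.chan c).sub σ with v | c'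
    · exact Nat.zero_le _
    · cases k with
      | zero => exact le_rfl
      | succ k => exact Finset.sum_le_sum fun i _ => ih i _ _ _
  | defn Ss Q P ihQ ihP =>
    intro σ k e
    refine (ihP _ _ _).trans (potential_mono P _ _ _ fun X j => ?_)
    cases X with
    | succ X => exact le_rfl
    | zero =>
      refine costIter_mono (fun k c c' hc => (ihQ _ _ _).trans (potential_mono Q _ _ _ ?_)) _ _
      intro X j
      cases X with
      | zero => exact hc j
      | succ X => exact le_rfl
  | par P Q ihP ihQ => intro σ k e; exact Nat.add_le_add (ihP _ _ _) (ihQ _ _ _)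
  | res A P ih => intro σ k e; exact ih _ _ _
  | _ => intro σ k e; exact le_rfl

end Proc

/-! ### Substitution and typing -/

/-- Weaken a resource under one variable binder. -/
def Key.shift : Key → Key
  | role p => role p
  | var x => var (x + 1)

/-- Extend a map of resources under one variable binder. -/
def Key.up (κ : Key → Key) : Key → Key
  | .var 0 => .var 0
  | .var (x + 1) => (κ (.var x)).shift
  | .role p => (κ (.role p)).shift

/-- The substitution `σ` replaces basic variables in `Δ` by values or basic variables in `Δ'`, and it
acts on the resources in `L` as the injective map `κ`, with result `L'`. -/
structure SubstOK (s : ℕ) (σ : ℕ → Pay) (κ : Key → Key) (Δ Δ' : VSet) (L L' : LCtx) : Prop where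
  basic : ∀ x, Δ x → (∃ v, σ x = .val v) ∨ ∃ y, σ x = .chan (.var y) ∧ Δ' y
  var : ∀ x, L (.var x) ≠ none → ∃ c, σ x = .chan c ∧ c.key s = some (κ (.var x))
  role : ∀ p, L (.role p) ≠ none → κ (.role p) = .role p
  push : ∀ k, L k ≠ none → L' (κ k) = L k
  pull : ∀ k', L' k' ≠ none → ∃ k, L k ≠ none ∧ κ k = k'
  inj : ∀ k k', L k ≠ none → L k' ≠ none → κ k = κ k' → k = k'

namespace SubstOK

variable {s : ℕ} {σ : ℕ → Pay} {κ : Key → Key} {Δ Δ' : VSet} {L L' : LCtx}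

theorem eq_nil (h : SubstOK s σ κ Δ Δ' LCtx.nil L') : L' = LCtx.nil := by
  funext k'
  by_contra hk
  obtain ⟨k, hk, _⟩ := h.pull k' hk
  exact hk rfl

theorem chan (h : SubstOK s σ κ Δ Δ' L L') {c : Chan} {k} (hk : c.key s = some k)
    (hL : L k ≠ none) : ∃ c', (Pay.chan c).sub σ = .chan c' ∧ c'.key s = some (κ k) := by
  rcases c with x | ⟨s', p⟩
  · cases hk
    exact h.var x hL
  · obtain ⟨rfl, rfl⟩ := key_ep hk
    exact ⟨_, rfl, by rw [h.role p hL]; exact hk⟩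

/-- The target is divided into the images of the two parts. They are disjoint because `κ` is
injective on the resources of `L`, and they cover `L'` by `pull`. -/
theorem split (h : SubstOK s σ κ Δ Δ' L L') {L₁ L₂ : LCtx} (hs : LCtx.Split L₁ L₂ L) :
    ∃ L₁' L₂', LCtx.Split L₁' L₂' L' ∧ SubstOK s σ κ Δ Δ' L₁ L₁' ∧ SubstOK s σ κ Δ Δ' L₂ L₂' := by
  classical
  have part : ∀ {L₁ L₂ : LCtx}, LCtx.Split L₁ L₂ L → SubstOK s σ κ Δ Δ' L₁
      (fun k' => if ∃ k, L₁ k ≠ none ∧ κ k = k' then L' k' else none) := by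
    intro L₁ L₂ hs
    have h0 : ∀ k, L₁ k ≠ none → L k ≠ none := fun k hk => hs.ne_none.2 (.inl hk)
    refine ⟨h.basic, fun x hx => h.var x (h0 _ hx), fun p hp => h.role p (h0 _ hp), fun k hk => ?_,
      fun k' hk' => ?_, fun k k' hk hk' => h.inj k k' (h0 _ hk) (h0 _ hk')⟩
    · rw [if_pos ⟨k, hk, rfl⟩, h.push k (h0 _ hk)]
      rcases hs k with ⟨h1, _⟩ | ⟨_, h1⟩
      · exact absurd h1 hk
      · exact h1
    · by_contra hn
      rw [if_neg hn] at hk'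
      exact hk' rfl
  refine ⟨_, _, fun k' => ?_, part hs, part hs.symm⟩
  by_cases h1 : ∃ k, L₁ k ≠ none ∧ κ k = k'
  · refine .inr ⟨if_neg ?_, by rw [if_pos h1]⟩
    rintro ⟨k2, hk2, he⟩
    obtain ⟨k, hk, rfl⟩ := h1
    have := h.inj _ _ (hs.ne_none.2 (.inr hk2)) (hs.ne_none.2 (.inl hk)) he
    subst this
    rcases hs k2 with ⟨h1, _⟩ | ⟨h1, _⟩
    · exact hk h1
    · exact hk2 h1
  · refine .inl ⟨if_neg h1, ?_⟩
    by_cases h2 : ∃ k, L₂ k ≠ none ∧ κ k = k'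
    · rw [if_pos h2]
    · rw [if_neg h2]
      by_contra hk'
      obtain ⟨k, hk, rfl⟩ := h.pull k' hk'
      rcases hs.ne_none.1 hk with hk | hk
      · exact h1 ⟨k, hk, rfl⟩
      · exact h2 ⟨k, hk, rfl⟩

theorem upd (h : SubstOK s σ κ Δ Δ' L L') {k : Key} (hk : L k ≠ none) (u : Option Ty) :
    SubstOK s σ κ Δ Δ' (L.upd k u) (L'.upd (κ k) u) := by
  have h0 : ∀ k', L.upd k u k' ≠ none → L k' ≠ none := by
    intro k' hk'
    by_cases hkk : k' = k
    · exact hkk ▸ hk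
    · rwa [LCtx.upd_ne _ _ hkk] at hk'
  refine ⟨h.basic, fun x hx => h.var x (h0 _ hx), fun p hp => h.role p (h0 _ hp), fun k' hk' => ?_,
      fun k' hk' => ?_, fun k k' hk hk' => h.inj k k' (h0 _ hk) (h0 _ hk')⟩
  · by_cases hkk : k' = k
    · subst hkk; simp
    · rw [LCtx.upd_ne _ _ hkk, LCtx.upd_ne, h.push k' (h0 _ hk')]
      exact fun he => hkk (h.inj _ _ (h0 _ hk') hk he)
  · by_cases hkk : k' = κ k
    · subst hkk
      exact ⟨k, by simpa using hk', rfl⟩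
    · rw [LCtx.upd_ne _ _ hkk] at hk'
      obtain ⟨k2, hk2, rfl⟩ := h.pull k' hk'
      exact ⟨k2, by rwa [LCtx.upd_ne]; rintro rfl; exact hkk rfl, rfl⟩

theorem cons (h : SubstOK s σ κ Δ Δ' L L') (b : Prop) (S : Ty) :
    SubstOK s (Pay.up 1 σ) (Key.up κ) (scons b Δ) (scons b Δ') (LCtx.cons S L)
      (LCtx.cons S L') := by
  have hup : ∀ x, Pay.up 1 σ (x + 1) = (σ x).shiftV 1 := fun x => rfl
  have hshift : ∀ k, LCtx.cons S L' k.shift = L' k := fun k => by cases k <;> rfl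
  have hinj : ∀ {k k' : Key}, k.shift = k'.shift → k = k' := by
    rintro (x | x) (y | y) <;> simp [Key.shift]
  have h0 : ∀ {k : Key}, k.shift ≠ .var 0 := by rintro (x | x) <;> simp [Key.shift]
  refine ⟨fun x hx => ?_, fun x hx => ?_, fun p hp => ?_, fun k hk => ?_, fun k' hk' => ?_,
    fun k k' hk hk' he => ?_⟩
  · cases x with
    | zero => exact .inr ⟨0, rfl, hx⟩
    | succ x =>
      rw [hup]
      rcases h.basic x hx with ⟨v, hv⟩ | ⟨y, hy, hΔ⟩
      · exact .inl ⟨v, by rw [hv]; rfl⟩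
      · exact .inr ⟨y + 1, by rw [hy]; rfl, hΔ⟩
  · cases x with
    | zero => exact ⟨_, rfl, rfl⟩
    | succ x =>
      rw [hup]
      obtain ⟨c, hc, hk⟩ := h.var x hx
      rw [hc]
      rcases c with y | ⟨s', p⟩
      · have hk : κ (.var x) = .var y := (Option.some.inj hk).symm
        exact ⟨_, rfl, by simp only [Key.up, hk]; rfl⟩
      · refine ⟨_, rfl, ?_⟩
        obtain ⟨rfl, hk'⟩ := key_ep hk
        simp only [Key.up, hk', Chan.key]; rfl
  · have := h.role p hp
    simp only [Key.up, this]; rfl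
  · rcases k with p | (_ | x)
    · exact (hshift _).trans (h.push (.role p) hk)
    · rfl
    · exact (hshift _).trans (h.push (.var x) hk)
  · rcases k' with p | (_ | x)
    · obtain ⟨k, hk, he⟩ := h.pull (.role p) hk'
      rcases k with q | x
      · exact ⟨.role q, hk, by simp only [Key.up, he]; rfl⟩
      · exact ⟨.var (x + 1), hk, by simp only [Key.up, he]; rfl⟩
    · exact ⟨.var 0, hk', rfl⟩
    · obtain ⟨k, hk, he⟩ := h.pull (.var x) hk'
      rcases k with q | y
      · exact ⟨.role q, hk, by simp only [Key.up, he]; rfl⟩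
      · exact ⟨.var (y + 1), hk, by simp only [Key.up, he]; rfl⟩
  · rcases k with p | (_ | x) <;> rcases k' with q | (_ | y)
    · exact h.inj _ _ hk hk' (hinj he)
    · exact absurd he h0
    · exact absurd (h.inj (.role p) (.var y) hk hk' (hinj he)) (by simp)
    · exact absurd he.symm h0
    · rfl
    · exact absurd he.symm h0
    · exact absurd (h.inj (.var x) (.role q) hk hk' (hinj he)) (by simp)
    · exact absurd he h0
    · have := h.inj (.var x) (.var y) hk hk' (hinj he)
      cases this; rfl

theorem renS (h : SubstOK s σ κ Δ Δ' L L') :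
    SubstOK (s + 1) (fun x => (σ x).renS Nat.succ) κ Δ Δ' L L' := by
  refine ⟨fun x hx => ?_, fun x hx => ?_, h.role, h.push, h.pull, h.inj⟩
  · rcases h.basic x hx with ⟨v, hv⟩ | ⟨y, hy, hΔ⟩
    · exact .inl ⟨v, by rw [hv]; rfl⟩
    · exact .inr ⟨y, by rw [hy]; rfl, hΔ⟩
  · obtain ⟨c, hc, hk⟩ := h.var x hx
    exact ⟨c.renS Nat.succ, by rw [hc]; rfl,
      (key_renS (ρ := Nat.succ) (fun x => Nat.succ_inj) c).trans hk⟩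

theorem own (h : SubstOK s σ κ Δ Δ' L L') {w r : Role} (ho : L.Own w r)
    (hL : ∀ p, L' (.role p) ≠ none → (∃ x, L (.var x) ≠ none ∧ κ (.var x) = .role p) → p = w) :
    L'.Own w r := by
  refine ⟨fun p hp => ?_, fun x hx => ?_⟩
  · obtain ⟨k, hk, he⟩ := h.pull _ hp
    rcases k with q | x
    · rw [h.role q hk] at he
      cases he
      exact ho.1 _ hk
    · rw [hL p hp ⟨x, hk, he⟩, ho.2 x hk]
  · obtain ⟨k, hk, he⟩ := h.pull _ hx
    rcases k with q | y
    · rw [h.role q hk] at he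
      cases he
    · exact ho.2 y hk

theorem payJ (h : SubstOK s σ κ Δ Δ' L L') {d S} (hd : PayJ s Δ L d S) :
    PayJ s Δ' L' (d.sub σ) S := by
  rcases hd with ⟨hS, rfl, hd⟩ | ⟨c, k, U, rfl, hk, hS, hS', hU, rfl⟩
  · refine .inl ⟨hS, h.eq_nil, ?_⟩
    rcases hd with ⟨v, rfl⟩ | ⟨x, rfl, hx⟩
    · exact .inl ⟨v, rfl⟩
    · exact h.basic x hx
  · have hne : (LCtx.nil.upd k (some U)) k ≠ none := by simp
    obtain ⟨c', hc', hk'⟩ := h.chan hk hne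
    refine .inr ⟨c', κ k, U, hc', hk', hS, hS', hU, ?_⟩
    funext k'
    by_cases hkk : k' = κ k
    · subst hkk; rw [h.push k hne]; simp
    · rw [LCtx.upd_ne _ _ hkk]
      by_contra hn
      obtain ⟨k2, hk2, rfl⟩ := h.pull _ hn
      by_cases hkk2 : k2 = k
      · exact hkk (by rw [hkk2])
      · rw [LCtx.upd_ne _ _ hkk2] at hk2
        exact hk2 rfl

theorem argsJ {ds : List Pay} : ∀ {L L' : LCtx} {Ss}, SubstOK s σ κ Δ Δ' L L' →
    ArgsJ s Δ L ds Ss → ArgsJ s Δ' L' (ds.map (Pay.sub σ)) Ss := by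
  induction ds with
  | nil =>
    rintro L L' (_ | ⟨S, Ss⟩) h hd
    · cases hd; exact h.eq_nil
    · exact hd.elim
  | cons d ds ih =>
    rintro L L' (_ | ⟨S, Ss⟩) h hd
    · exact hd.elim
    · obtain ⟨L₁, L₂, h1, h2, hs⟩ := hd
      obtain ⟨L₁', L₂', hs', ok1, ok2⟩ := h.split hs
      exact ⟨L₁', L₂', ok1.payJ h1, ih ok2 h2, hs'⟩

end SubstOK

theorem Key.up_role {κ : Key → Key} {x : ℕ} {p : Role}
    (h : Key.up κ (.var x) = .role p) : ∃ y, x = y + 1 ∧ κ (.var y) = .role p := by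
  cases x with
  | zero => cases h
  | succ y =>
    refine ⟨y, rfl, ?_⟩
    rcases hk : κ (.var y) with q | z <;> simp only [Key.up, hk, Key.shift] at h
    · exact h
    · cases h

/-- On linear resources a substitution acts as an injective renaming. Ownership survives because a
variable may be replaced only by the endpoint of the role `w` that owns the variables. -/
theorem J_sub {g : Prop} (P : Proc) : ∀ {w s D Θ Δ Δ' σ κ} {L L' : LCtx},
    SubstOK s σ κ Δ Δ' L L' → (∀ x p, L (.var x) ≠ none → κ (.var x) = .role p → p = w) →
    J g w s D Θ Δ L P → J g w s D Θ Δ' L' (P.sub σ) := by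
  induction P with
  | nil => intro w s D Θ Δ Δ' σ κ L L' ok _ h; cases h; exact ok.eq_nil
  | err => intro w s D Θ Δ Δ' σ κ L L' ok _ h; exact h
  | crashed s' p =>
    intro w s D Θ Δ Δ' σ κ L L' ok _ h
    rcases h with ⟨rfl, rfl⟩ | ⟨h, h', rfl⟩
    · refine .inl ⟨rfl, ?_⟩
      have hne : (LCtx.nil.upd (.role p) (some .crashed)) (.role p) ≠ none := by simp
      funext k'
      by_cases hkk : k' = .role p
      · subst hkk
        rw [← ok.role p hne, ok.push _ hne, ok.role p hne]
      · rw [LCtx.upd_ne _ _ hkk]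
        by_contra hn
        obtain ⟨k, hk, rfl⟩ := ok.pull _ hn
        by_cases hk2 : k = .role p
        · subst hk2; exact hkk (ok.role p hne)
        · rw [LCtx.upd_ne _ _ hk2] at hk; exact hk rfl
    · exact .inr ⟨h, h', ok.eq_nil⟩
  | res A P ih => intro w s D Θ Δ Δ' σ κ L L' ok hw h; exact ih ok.renS hw h
  | par P Q ihP ihQ =>
    rintro w s D Θ Δ Δ' σ κ L L' ok hw ⟨L₁, L₂, h1, h2, hs⟩
    obtain ⟨L₁', L₂', hs', ok1, ok2⟩ := ok.split hs
    exact ⟨L₁', L₂', ihP ok1 (fun x p hx => hw x p (hs.ne_none.2 (.inl hx))) h1,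
      ihQ ok2 (fun x p hx => hw x p (hs.ne_none.2 (.inr hx))) h2, hs'⟩
  | sel c q l d P ih =>
    rintro w s D Θ Δ Δ' σ κ L L' ok hw ⟨r, k, U, S, T, L₀, L₂, h1, h2, h3, h4, h5, h6, h7⟩
    have ho := ok.own h2 fun p _ ⟨x, hx, he⟩ => hw x p hx he
    obtain ⟨L₀', L₂', hs', ok0, ok2⟩ := ok.split h3
    have hne : L₀ k ≠ none := by simp [h4]
    obtain ⟨c', hc', hk'⟩ := ok0.chan h1 hne
    simp only [Proc.sub, hc']
    refine ⟨r, κ k, U, S, T, L₀', L₂', hk', ho, hs', (ok0.push k hne).trans h4, h5, ok2.payJ h6,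
      ih (ok0.upd hne _) (fun x p hx he => ?_) h7⟩
    have hx : L (.var x) ≠ none := h3.ne_none.2 (.inl (upd_ne_none h4 hx))
    rw [hw x p hx he, h2.2 x hx]
  | brn c q n lab P ih =>
    rintro w s D Θ Δ Δ' σ κ L L' ok hw ⟨r, k, U, S, T, h1, h2, h3, h4, h5⟩
    have ho := ok.own h2 fun p _ ⟨x, hx, he⟩ => hw x p hx he
    have hne : L k ≠ none := by simp [h3]
    obtain ⟨c', hc', hk'⟩ := ok.chan h1 hne
    simp only [Proc.sub, hc']
    refine ⟨r, κ k, U, S, T, hk', ho, (ok.push k hne).trans h3, h4, fun i =>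
      ih i ((ok.upd hne _).cons _ _) (fun x p hx he => ?_) (h5 i)⟩
    obtain ⟨y, rfl, he'⟩ := Key.up_role he
    have hx : L (.var y) ≠ none := upd_ne_none (k' := .var y) h3 hx
    rw [hw y p hx he', h2.2 y hx]
  | defn Ss Q P ihQ ihP =>
    intro w s D Θ Δ Δ' σ κ L L' ok hw h
    -- A body mentions only its own parameters, so that the substitution does not reach it.
    have hQ : (∀ x ∈ Q.fv, x < Ss.length) → Q.sub (Pay.up Ss.length σ) = Q :=
      fun hx => Proc.sub_eq_self Q fun x hx' => if_pos (hx x hx')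
    rcases h with ⟨r, h1, h2, h3, h4⟩ | ⟨h1, h2, h3⟩
    · simp only [Proc.sub]
      rw [hQ fun x hx => (J_fv Q h3 hx).elim basicParams_lt params_ne_none]
      exact .inl ⟨r, h1, h2, h3, ihP ok hw h4⟩
    · simp only [Proc.sub]
      rw [hQ h2]
      exact .inr ⟨h1, h2, ihP ok hw h3⟩
  | call X ds =>
    rintro w s D Θ Δ Δ' σ κ L L' ok hw ⟨r, Ss, h1, h2, h3⟩
    exact ⟨r, Ss, h1, ok.own h2 fun p _ ⟨x, hx, he⟩ => hw x p hx he, ok.argsJ h3⟩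

/-! ## Closed processes -/

/-- No resources that are variables. -/
def LCtx.Closed (L : LCtx) : Prop := ∀ x, L (.var x) = none

/-- The empty set of indices. -/
abbrev VSet.empty : VSet := fun _ => False

namespace LCtx

theorem Closed.left {L₁ L₂ L : LCtx} (h : L.Closed) (hs : Split L₁ L₂ L) : L₁.Closed := by
  intro x
  by_contra hx
  exact hs.ne_none.2 (.inl hx) (h x)

theorem Closed.right {L₁ L₂ L : LCtx} (h : L.Closed) (hs : Split L₁ L₂ L) : L₂.Closed :=
  h.left hs.symm

theorem Closed.upd {L : LCtx} (h : L.Closed) (p : Role) (u : Option Ty) :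
    (L.upd (.role p) u).Closed := fun x => by rw [upd_ne _ _ (by simp)]; exact h x

theorem Closed.of_ne_none {L : LCtx} (h : L.Closed) {k : Key} (hk : L k ≠ none) :
    ∃ p, k = .role p := by
  rcases k with p | x
  · exact ⟨p, rfl⟩
  · exact absurd (h x) hk

theorem Split.upd {L₁ L₂ L : LCtx} (hs : Split L₁ L₂ L) {k : Key} (hk : L₁ k ≠ none)
    (u : Option Ty) : Split (L₁.upd k u) L₂ (L.upd k u) := by
  intro k'
  by_cases hkk : k' = k
  · subst hkk
    rcases hs k' with ⟨h, _⟩ | ⟨h, _⟩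
    · exact absurd h hk
    · exact .inr ⟨h, by simp⟩
  · rw [upd_ne _ _ hkk, upd_ne _ _ hkk]
    exact hs k'

end LCtx

/-- `ArgAt s ds Ss i k S`: argument `i` is the resource `k`, passed for a parameter of type `S`. -/
def ArgAt (s : ℕ) (ds : List Pay) (Ss : List Ty) (i : ℕ) (k : Key) (S : Ty) : Prop :=
  Ss[i]? = some S ∧ S.IsSession ∧ ¬ S.Sub .done ∧ ∃ c, ds[i]? = some (.chan c) ∧ c.key s = some k

namespace ArgsJ

variable {s : ℕ} {Δ : VSet}

theorem length_eq {ds : List Pay} : ∀ {L Ss}, ArgsJ s Δ L ds Ss → ds.length = Ss.length := by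
  induction ds with
  | nil => rintro L (_ | ⟨S, Ss⟩) h; exacts [rfl, h.elim]
  | cons d ds ih =>
    rintro L (_ | ⟨S, Ss⟩) h
    · exact h.elim
    · obtain ⟨L₁, L₂, _, h2, _⟩ := h
      exact congrArg Nat.succ (ih h2)

theorem exists_argAt {ds : List Pay} : ∀ {L Ss}, ArgsJ s Δ L ds Ss → ∀ {k U}, L k = some U →
    ∃ i S, ArgAt s ds Ss i k S ∧ U.Sub S := by
  induction ds with
  | nil =>
    rintro L (_ | ⟨S, Ss⟩) h k U hk
    · cases h; cases hk
    · exact h.elim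
  | cons d ds ih =>
    rintro L (_ | ⟨S, Ss⟩) h k U hk
    · exact h.elim
    · obtain ⟨L₁, L₂, h1, h2, hs⟩ := h
      rcases hs k with ⟨_, h⟩ | ⟨_, h⟩
      · rw [hk] at h
        obtain ⟨i, S', hi, hU⟩ := ih h2 h.symm
        exact ⟨i + 1, S', hi, hU⟩
      · rw [hk] at h
        rcases h1 with ⟨_, rfl, _⟩ | ⟨c, k', U', rfl, hk', hS, hS', hU, rfl⟩
        · cases h
        · by_cases hkk : k = k'
          · subst hkk
            rw [LCtx.upd_same] at h
            cases h
            exact ⟨0, S, ⟨rfl, hS, hS', c, rfl, hk'⟩, hU⟩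
          · rw [LCtx.upd_ne _ _ hkk] at h
            cases h

theorem ne_none {ds : List Pay} : ∀ {L Ss}, ArgsJ s Δ L ds Ss → ∀ {i k S}, ArgAt s ds Ss i k S →
    L k ≠ none := by
  induction ds with
  | nil =>
    rintro L Ss _ i k S ⟨_, _, _, c, hc, _⟩
    cases hc
  | cons d ds ih =>
    rintro L (_ | ⟨S', Ss⟩) h i k S hi
    · exact h.elim
    · obtain ⟨L₁, L₂, h1, h2, hs⟩ := h
      cases i with
      | succ i => exact hs.ne_none.2 (.inr (ih h2 hi))
      | zero =>
        obtain ⟨hS, hS1, _, c, hc, hk⟩ := hi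
        cases hS
        cases hc
        rcases h1 with ⟨hb, _⟩ | ⟨c', k', U', hc', hk', _, _, _, rfl⟩
        · exact absurd hS1 hb.not_session
        · cases hc'
          rw [hk] at hk'
          cases hk'
          exact hs.ne_none.2 (.inl (by simp))

theorem argAt_inj {ds : List Pay} : ∀ {L Ss}, ArgsJ s Δ L ds Ss → ∀ {i j k S S'},
    ArgAt s ds Ss i k S → ArgAt s ds Ss j k S' → i = j := by
  induction ds with
  | nil =>
    rintro L Ss _ i j k S S' ⟨_, _, _, c, hc, _⟩
    cases hc
  | cons d ds ih =>
    rintro L (_ | ⟨S₀, Ss⟩) h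
    · exact h.elim
    · obtain ⟨L₁, L₂, h1, h2, hs⟩ := h
      have key : ∀ {j k S S'}, ArgAt s (d :: ds) (S₀ :: Ss) 0 k S →
          ¬ ArgAt s (d :: ds) (S₀ :: Ss) (j + 1) k S' := by
        rintro j k S S' ⟨hS, hS1, _, c, hc, hk⟩ hj
        cases hS
        cases hc
        have h3 : L₂ k ≠ none := ne_none h2 (i := j) hj
        rcases h1 with ⟨hb, _⟩ | ⟨c', k', U', hc', hk', _, _, _, rfl⟩
        · exact absurd hS1 hb.not_session
        · cases hc'
          rw [hk] at hk'
          cases hk'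
          rcases hs k with ⟨h, _⟩ | ⟨h, _⟩
          · simp at h
          · exact h3 h
      intro i j k S S' hi hj
      cases i <;> cases j
      · rfl
      · exact absurd hj (key hi)
      · exact absurd hi (key hj)
      · exact congrArg _ (ih h2 hi hj)

theorem arg {ds : List Pay} : ∀ {L Ss}, ArgsJ s Δ L ds Ss → ∀ {i S}, Ss[i]? = some S →
    (S.IsBasic ∧ ((∃ v, ds[i]? = some (.val v)) ∨ ∃ y, ds[i]? = some (.chan (.var y)) ∧ Δ y)) ∨
      ∃ k, ArgAt s ds Ss i k S := by
  induction ds with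
  | nil =>
    rintro L (_ | ⟨S, Ss⟩) h i S hi
    · cases hi
    · exact h.elim
  | cons d ds ih =>
    rintro L (_ | ⟨S', Ss⟩) h i S hi
    · exact h.elim
    · obtain ⟨L₁, L₂, h1, h2, hs⟩ := h
      cases i with
      | succ i => exact ih h2 hi
      | zero =>
        cases hi
        rcases h1 with ⟨hb, _, h⟩ | ⟨c, k, U, rfl, hk, hS, hS', _, _⟩
        · refine .inl ⟨hb, ?_⟩
          rcases h with ⟨v, rfl⟩ | ⟨y, rfl, hy⟩
          · exact .inl ⟨v, rfl⟩
          · exact .inr ⟨y, rfl, hy⟩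
        · exact .inr ⟨k, rfl, hS, hS', c, rfl, hk⟩

theorem closed_arg {ds : List Pay} {L Ss} (h : ArgsJ s VSet.empty L ds Ss) (hL : L.Closed) :
    ∀ d ∈ ds, (∃ v, d = .val v) ∨ ∃ p, d = .chan (.ep s p) ∧ L (.role p) ≠ none := by
  intro d hd
  obtain ⟨i, hi, rfl⟩ := List.mem_iff_getElem.1 hd
  have hi' : i < Ss.length := h.length_eq ▸ hi
  rcases h.arg (List.getElem?_eq_getElem hi') with ⟨_, ⟨v, hv⟩ | ⟨y, _, hy⟩⟩ | ⟨k, hk⟩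
  · rw [List.getElem?_eq_getElem hi] at hv
    exact .inl ⟨v, Option.some.inj hv⟩
  · exact hy.elim
  · have hne := h.ne_none hk
    obtain ⟨p, rfl⟩ := hL.of_ne_none hne
    obtain ⟨_, _, _, c, hc, hk⟩ := hk
    rw [List.getElem?_eq_getElem hi] at hc
    rw [Option.some.inj hc]
    rcases c with y | ⟨s', q⟩
    · cases hk
    · obtain ⟨rfl, hk'⟩ := key_ep hk
      cases hk'
      exact .inr ⟨p, rfl, hne⟩

end ArgsJ

/-- Passage to supertypes. -/
def LCtx.Coarse (L L' : LCtx) : Prop :=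
  ∀ k, L' k = L k ∨ ∃ U S, L k = some U ∧ L' k = some S ∧ U.Sub S ∧ ¬ S.Sub .done

theorem LCtx.Coarse.ne_none {L L' : LCtx} (h : L.Coarse L') {k : Key} : L' k ≠ none ↔ L k ≠ none := by
  rcases h k with h | ⟨U, S, h, h', _⟩
  · rw [h]
  · simp [h, h']

theorem LCtx.Coarse.closed {L L' : LCtx} (h : L.Coarse L') (hL : L.Closed) : L'.Closed := by
  intro x
  by_contra hx
  exact h.ne_none.1 hx (hL x)

theorem LCtx.Coarse.split {L₁ L₁' L₂ L : LCtx} (h : L₁.Coarse L₁') (hs : LCtx.Split L₁ L₂ L) :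
    ∃ L', LCtx.Split L₁' L₂ L' ∧ L.Coarse L' := by
  classical
  refine ⟨fun k => if L₁ k = none then L₂ k else L₁' k, fun k => ?_, fun k => ?_⟩
  · by_cases hk : L₁ k = none
    · have : L₁' k = none := by by_contra h'; exact h.ne_none.1 h' hk
      exact .inl ⟨this, if_pos hk⟩
    · rcases hs k with ⟨h', _⟩ | ⟨h', _⟩
      · exact absurd h' hk
      · exact .inr ⟨h', if_neg hk⟩
  · by_cases hk : L₁ k = none
    · rcases hs k with ⟨_, h'⟩ | ⟨h1, h'⟩
      · exact .inl (by simp [hk, h'])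
      · exact .inl (by simp [hk, h', h1])
    · rcases hs k with ⟨h', _⟩ | ⟨_, h'⟩
      · exact absurd h' hk
      · simpa [hk, h'] using h k

/-- Substitution of a value for a variable of basic type. -/
theorem J_inst_val {g : Prop} {P : Proc} {w s D Θ L S} (v : Value) (hL : L.Closed) (hS : S.IsBasic)
    (h : J g w s D Θ (scons S.IsBasic VSet.empty) (LCtx.cons S L) P) :
    J g w s D Θ VSet.empty L (P.sub (Pay.inst [.val v])) := by
  have hv : ∀ x, LCtx.cons S L (.var x) = none := by
    intro x
    cases x with
    | zero => exact Ty.lin_eq_none.2 (.inl hS)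
    | succ x => exact hL x
  refine J_sub P (κ := id) ⟨fun x hx => ?_, fun x hx => absurd (hv x) hx, fun p _ => rfl,
    fun k hk => ?_, fun k hk => ⟨k, ?_, rfl⟩, fun k k' _ _ h => h⟩
    (fun x p hx => absurd (hv x) hx) h
  · cases x with
    | zero => exact .inl ⟨v, rfl⟩
    | succ x => exact hx.elim
  · rcases k with p | x
    · rfl
    · exact absurd (hv x) hk
  · rcases k with p | x
    · exact hk
    · exact absurd (hL x) hk

/-- Substitution of arguments for parameters. -/
theorem J_inst_args {g : Prop} {B : Proc} {w r s D Θ L Ss ws} (ho : L.Own w r)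
    (hws : ArgsJ s VSet.empty L ws Ss) (h : J g r s D Θ (basicParams Ss) (LCtx.params Ss) B) :
    ∃ L', L.Coarse L' ∧ J g r s D Θ VSet.empty L' (B.sub (Pay.inst ws)) := by
  classical
  -- A session parameter is sent to the resource passed for it. The value at other variables is a
  -- dummy, because they carry no resource.
  let κ : Key → Key := fun k => match k with
    | .role p => .role p
    | .var x => if h : ∃ k S, ArgAt s ws Ss x k S then h.choose else .var x
  have hpar : ∀ {x U}, LCtx.params Ss (.var x) = some U → ArgAt s ws Ss x (κ (.var x)) U := by
    intro x U hU
    simp only [LCtx.params, Option.bind_eq_some_iff] at hU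
    obtain ⟨S, hS, hU⟩ := hU
    rw [Ty.lin_eq_some] at hU
    obtain ⟨rfl, hb, _⟩ := hU
    rcases hws.arg hS with ⟨hb', _⟩ | ⟨k, hk⟩
    · exact absurd hb' hb
    · have hex : ∃ k S, ArgAt s ws Ss x k S := ⟨k, S, hk⟩
      obtain ⟨S', h'⟩ := hex.choose_spec
      have : S' = S := Option.some.inj (h'.1.symm.trans hS)
      subst this
      simp only [κ, dif_pos hex]
      exact h'
  have hrole : ∀ p, LCtx.params Ss (.role p) = none := fun p => rfl
  -- A passed resource takes the declared type of its parameter, which is a supertype of its former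
  -- type. The choice is unambiguous because linearity prevents a resource from being passed twice.
  let L' : LCtx := fun k => if h : ∃ i S, ArgAt s ws Ss i k S then some h.choose_spec.choose else none
  have hL' : ∀ {i k S}, ArgAt s ws Ss i k S → L' k = some S := by
    intro i k S hi
    have hex : ∃ i S, ArgAt s ws Ss i k S := ⟨i, S, hi⟩
    have h' := hex.choose_spec.choose_spec
    have heq := hws.argAt_inj hi h'
    simp only [L', dif_pos hex]
    exact h'.1.symm.trans (heq ▸ hi.1)
  have hL'' : ∀ {k}, L' k ≠ none → ∃ i S, ArgAt s ws Ss i k S := by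
    intro k hk
    by_contra hn
    exact hk (dif_neg hn)
  have hparam : ∀ {i k S}, ArgAt s ws Ss i k S → LCtx.params Ss (.var i) = some S := by
    intro i k S hi
    simp only [LCtx.params, hi.1, Option.bind_some]
    exact Ty.lin_eq_some.2 ⟨rfl, fun hb => hb.not_session hi.2.1, hi.2.2.1⟩
  have hinst : ∀ {x d}, ws[x]? = some d → Pay.inst ws x = d := by
    intro x d hd
    simp [Pay.inst, List.getD, hd]
  have hcoarse : L.Coarse L' := by
    intro k
    cases hk : L k with
    | none =>
      refine .inl ?_
      by_contra hn
      obtain ⟨i, S, hi⟩ := hL'' hn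
      exact hws.ne_none hi hk
    | some U =>
      obtain ⟨i, S, hi, hU⟩ := hws.exists_argAt hk
      exact .inr ⟨U, S, rfl, hL' hi, hU, hi.2.2.1⟩
  refine ⟨L', hcoarse, J_sub B (κ := κ) ⟨fun x hx => ?_, fun x hx => ?_, fun p _ => rfl,
    fun k hk => ?_, fun k hk => ?_, fun k k' hk hk' he => ?_⟩ (fun x p hx he => ?_) h⟩
  · obtain ⟨S, hS, hb⟩ := hx
    rcases hws.arg hS with ⟨_, ⟨v, hv⟩ | ⟨y, _, hy⟩⟩ | ⟨k, hk⟩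
    · exact .inl ⟨v, hinst hv⟩
    · exact hy.elim
    · exact absurd hk.2.1 hb.not_session
  · obtain ⟨U, hU⟩ := Option.ne_none_iff_exists'.1 hx
    obtain ⟨_, _, _, c, hc, hk⟩ := hpar hU
    exact ⟨c, hinst hc, hk⟩
  · rcases k with p | x
    · exact absurd (hrole p) hk
    · obtain ⟨U, hU⟩ := Option.ne_none_iff_exists'.1 hk
      rw [hU]
      exact hL' (hpar hU)
  · obtain ⟨i, S, hi⟩ := hL'' hk
    have hp := hparam hi
    refine ⟨.var i, by simp [hp], ?_⟩
    obtain ⟨_, _, _, c, hc, hk'⟩ := hpar hp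
    obtain ⟨_, _, _, c', hc', hk''⟩ := hi
    rw [hc] at hc'
    cases hc'
    exact Option.some.inj (hk'.symm.trans hk'')
  · rcases k with p | x
    · exact absurd (hrole p) hk
    rcases k' with q | y
    · exact absurd (hrole q) hk'
    obtain ⟨U, hU⟩ := Option.ne_none_iff_exists'.1 hk
    obtain ⟨U', hU'⟩ := Option.ne_none_iff_exists'.1 hk'
    rw [hws.argAt_inj (hpar hU) (he ▸ hpar hU')]
  · obtain ⟨U, hU⟩ := Option.ne_none_iff_exists'.1 hx
    exact ho.1 p (hws.ne_none (he ▸ hpar hU))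

section Closed

variable {g : Prop} {w : Role} {s : ℕ} {D : VSet} {Θ : TEnv} {L : LCtx}

/-- Inversion for a closed selection: there is no delegation. -/
theorem J_sel_closed {c q l d P} (hL : L.Closed) (h : J g w s D Θ VSet.empty L (.sel c q l d P)) :
    ∃ p U S T v, c = .ep s p ∧ d = .val v ∧ (∀ k, L k ≠ none → k = .role p) ∧
      L (.role p) = some U ∧ U.Sub (.sel q 1 (fun _ => l) (fun _ => S) (fun _ => T)) ∧ S.IsBasic ∧
      J g p s VSet.empty (TEnv.only p Θ) VSet.empty (L.upd (.role p) T.lin) P := by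
  obtain ⟨r, k, U, S, T, L₀, L₂, h1, h2, h3, h4, h5, h6, h7⟩ := h
  obtain ⟨p, rfl⟩ := (hL.left h3).of_ne_none (k := k) (by simp [h4])
  rcases c with x | ⟨s', p'⟩
  · cases h1
  obtain ⟨rfl, h1'⟩ := key_ep h1
  cases h1'
  have hk := h3.some_left h4
  have hp : p = r := h2.1 p (by simp [hk.1])
  subst hp
  rcases h6 with ⟨hb, rfl, ⟨v, rfl⟩ | ⟨x, _, hx⟩⟩ | ⟨c, k, U', rfl, hc, _, _, _, rfl⟩
  · obtain rfl := LCtx.Split.nil_left.1 h3.symm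
    refine ⟨p, U, S, T, v, rfl, rfl, fun k hk => ?_, h4, h5, hb, h7⟩
    obtain ⟨q, rfl⟩ := hL.of_ne_none hk
    rw [h2.1 q hk]
  · exact hx.elim
  -- A delegated endpoint would belong to the owner of the thread, hence coincide with the subject,
  -- which the split excludes.
  · obtain ⟨q', rfl⟩ := (hL.right h3).of_ne_none (k := k) (by simp)
    have : q' = p := h2.1 q' (h3.ne_none.2 (.inr (by simp)))
    subst this
    simp at hk

/-- Inversion for a closed branching. -/
theorem J_brn_closed {c q n lab P} (hL : L.Closed)
    (h : J g w s D Θ VSet.empty L (.brn c q n lab P)) :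
    ∃ p U S T, c = .ep s p ∧ (∀ k, L k ≠ none → k = .role p) ∧ L (.role p) = some U ∧
      U.Sub (.brn q n lab S T) ∧
      ∀ i, J g p s VSet.empty (TEnv.only p Θ) (scons (S i).IsBasic VSet.empty)
          (LCtx.cons (S i) (L.upd (.role p) (T i).lin)) (P i) := by
  obtain ⟨r, k, U, S, T, h1, h2, h3, h4, h5⟩ := h
  obtain ⟨p, rfl⟩ := hL.of_ne_none (k := k) (by simp [h3])
  rcases c with x | ⟨s', p'⟩
  · cases h1
  obtain ⟨rfl, h1'⟩ := key_ep h1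
  cases h1'
  have hp : p = r := h2.1 p (by simp [h3])
  subst hp
  refine ⟨p, U, S, T, rfl, fun k hk => ?_, h3, h4, h5⟩
  obtain ⟨q, rfl⟩ := hL.of_ne_none hk
  rw [h2.1 q hk]

/-- A continuation may be placed in the context of its prefix. -/
theorem J_lift {P r L'} (hL : L'.Closed) (h : J g r s VSet.empty (TEnv.only r Θ) VSet.empty L' P) :
    J g w s D Θ VSet.empty L' P :=
  J_mono P (fun _ h => h.elim) (fun _ _ _ h => h.1) (fun x hx => absurd (hL x) hx) h

end Closed

/-! ## Labelled transitions of processes -/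

/-- Actions of a role in the live session. -/
inductive LAct where
  | out (p q : Role) (l : MsgLabel) (v : Value)
  | inp (p q : Role) (l : Label) (v : Value)
  | dead (p : Role)

/-- The role that acts. -/
def LAct.subj : LAct → Role
  | out p _ _ _ => p
  | inp p _ _ _ => p
  | dead p => p

/-- Pairs of actions that synchronize. -/
inductive LAct.Compat : LAct → LAct → Prop
  | comm (p q l v) : Compat (out p q l v) (inp q p (.msg l) v)
  | lost (p q l v) : Compat (out p q l v) (dead q)
  | detect (p q) : Compat (inp q p .crash .unit) (dead p)

/-- Actions of prefixes and crashed endpoints. -/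
inductive Leaf : ℕ → LAct → Proc → Proc → Prop
  | sel {s p q l v P} : Leaf s (.out p q l v) (.sel (.ep s p) q l (.val v) P) P
  | brn {s p q n lab P} (k : Fin n) (v) :
      Leaf s (.inp p q (lab k) v) (.brn (.ep s p) q n lab P) ((P k).sub (Pay.inst [.val v]))
  | dead {s p} : Leaf s (.dead p) (.crashed s p) (.crashed s p)

/-- Actions of processes. -/
inductive Lts : ℕ → LAct → Proc → Proc → Prop
  | leaf {s a P P'} : Leaf s a P P' → Lts s a P P'
  | parL {s a P P' Q} : Lts s a P P' → Lts s a (.par P Q) (.par P' Q)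
  | parR {s a P Q Q'} : Lts s a Q Q' → Lts s a (.par P Q) (.par P Q')
  | res {s a A P P'} : Lts (s + 1) a P P' → Lts s a (.res A P) (.res A P')
  | defn {s a Ss B P P'} : Lts s a P P' → Lts s a (.defn Ss B P) (.defn Ss B P')

/-- Synchronization of two actions. -/
inductive Sync : ℕ → LAct → LAct → Proc → Proc → Prop
  | lr {s a b P P' Q Q'} : Lts s a P P' → Lts s b Q Q' → Sync s a b (.par P Q) (.par P' Q')
  | rl {s a b P P' Q Q'} : Lts s b P P' → Lts s a Q Q' → Sync s a b (.par P Q) (.par P' Q')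
  | parL {s a b P P' Q} : Sync s a b P P' → Sync s a b (.par P Q) (.par P' Q)
  | parR {s a b P Q Q'} : Sync s a b Q Q' → Sync s a b (.par P Q) (.par P Q')
  | res {s a b A P P'} : Sync (s + 1) a b P P' → Sync s a b (.res A P) (.res A P')
  | defn {s a b Ss B P P'} : Sync s a b P P' → Sync s a b (.defn Ss B P) (.defn Ss B P')

theorem renS_inst (ρ : ℕ → ℕ) (ws : List Pay) :
    (fun x => (Pay.inst ws x).renS ρ) = Pay.inst (ws.map (Pay.renS ρ)) := by
  funext x
  simp only [Pay.inst, List.getD, List.getElem?_map, List.length_map]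
  cases ws[x]? <;> rfl

theorem Leaf.renS {s a P P'} (h : Leaf s a P P') (ρ : ℕ → ℕ) :
    Leaf (ρ s) a (P.renS ρ) (P'.renS ρ) := by
  cases h with
  | sel => exact .sel
  | dead => exact .dead
  | brn k v =>
    rw [Proc.renS_sub, renS_inst]
    exact .brn (lab := _) k v

theorem Leaf.renX {s a P P'} (h : Leaf s a P P') (ρ : ℕ → ℕ) :
    Leaf s a (P.renX ρ) (P'.renX ρ) := by
  cases h with
  | sel => exact .sel
  | dead => exact .dead
  | brn k v =>
    rw [Proc.renX_sub]
    exact .brn (lab := _) k v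

theorem Lts.renS {s a P P'} (h : Lts s a P P') : ∀ (ρ : ℕ → ℕ),
    Lts (ρ s) a (P.renS ρ) (P'.renS ρ) := by
  induction h with
  | leaf h => intro ρ; exact .leaf (h.renS ρ)
  | parL _ ih => intro ρ; exact .parL (ih ρ)
  | parR _ ih => intro ρ; exact .parR (ih ρ)
  | res _ ih => intro ρ; exact .res (ih (upRen ρ))
  | defn _ ih => intro ρ; exact .defn (ih ρ)

theorem Lts.renX {s a P P'} (h : Lts s a P P') : ∀ (ρ : ℕ → ℕ),
    Lts s a (P.renX ρ) (P'.renX ρ) := by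
  induction h with
  | leaf h => intro ρ; exact .leaf (h.renX ρ)
  | parL _ ih => intro ρ; exact .parL (ih ρ)
  | parR _ ih => intro ρ; exact .parR (ih ρ)
  | res _ ih => intro ρ; exact .res (ih ρ)
  | defn _ ih => intro ρ; exact .defn (ih _)

theorem cong_par_assoc_swap (P Q R : Proc) : Proc.Cong (.par (.par P Q) R) (.par (.par P R) Q) :=
  (Proc.Cong.parAssoc P Q R).trans (((Proc.Cong.refl P).congPar (Proc.Cong.parComm Q R)).trans
    (Proc.Cong.parAssoc P R Q).symm)

theorem cong_par_res (A) (P Q : Proc) :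
    Proc.Cong (.par (.res A P) Q) (.res A (.par P (Q.renS Nat.succ))) :=
  (Proc.Cong.parComm _ _).trans ((Proc.Cong.resLift A Q P).symm.trans (Proc.Cong.congRes (Proc.Cong.parComm _ _)))

theorem cong_par_defn (Ss B) (P Q : Proc) :
    Proc.Cong (.par (.defn Ss B P) Q) (.defn Ss B (.par P (Q.renX Nat.succ))) :=
  (Proc.Cong.defPar Ss B P Q).symm

/-- Reduction below a context that is extruded on the left of a parallel composition. -/
theorem red_parL_parL {b P P' Q R R'} (h : Proc.Red b (.par P Q) (.par P' R')) :
    Proc.Red b (.par (.par P R) Q) (.par (.par P' R) R') :=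
  .congr (cong_par_assoc_swap _ _ _) (.ctxPar h) (cong_par_assoc_swap _ _ _)

theorem red_parL_parR {b P P' Q R R'} (h : Proc.Red b (.par P Q) (.par P' R')) :
    Proc.Red b (.par (.par R P) Q) (.par (.par R P') R') :=
  .congr ((Proc.Cong.parComm _ _).congPar (.refl _)) (red_parL_parL h) ((Proc.Cong.parComm _ _).congPar (.refl _))

theorem red_par_comm {b P P' Q Q'} (h : Proc.Red b (.par P Q) (.par P' Q')) :
    Proc.Red b (.par Q P) (.par Q' P') :=
  .congr (Proc.Cong.parComm _ _) h (Proc.Cong.parComm _ _)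

/-- The context around the second partner is extruded by congruence until the two prefixes are
adjacent. The first partner is weakened by the binders that it passes. -/
theorem Leaf.red {s a b P P' Q Q'} (hc : LAct.Compat a b) (h : Leaf s a P P') (h' : Lts s b Q Q') :
    Proc.Red false (.par P Q) (.par P' Q') := by
  induction h' generalizing P P' with
  | leaf h' =>
    cases hc with
    | comm p q l v =>
      cases h
      generalize hl : Label.msg l = l' at h'
      cases h' with
      | brn k => exact red_par_comm (Proc.Red.comm k hl.symm trivial)
    | lost p q l v => cases h; cases h'; exact red_par_comm Proc.Red.lostVal
    | detect p q =>
      cases h'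
      generalize hl : Label.crash = l' at h
      cases h with
      | brn k => exact Proc.Red.detect k hl.symm
  | parL _ ih => exact red_par_comm (red_parL_parL (red_par_comm (ih hc h)))
  | parR _ ih => exact red_par_comm (red_parL_parR (red_par_comm (ih hc h)))
  | res _ ih =>
    exact red_par_comm (.congr (cong_par_res _ _ _) (.ctxRes (red_par_comm (ih hc (h.renS Nat.succ))))
      (cong_par_res _ _ _).symm)
  | defn _ ih =>
    exact red_par_comm (.congr (cong_par_defn _ _ _ _) (.ctxDefn (red_par_comm (ih hc (h.renX Nat.succ))))
      (cong_par_defn _ _ _ _).symm)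

theorem Lts.red {s a b P P' Q Q'} (hc : LAct.Compat a b) (h : Lts s a P P') (h' : Lts s b Q Q') :
    Proc.Red false (.par P Q) (.par P' Q') := by
  induction h generalizing Q Q' with
  | leaf h => exact h.red hc h'
  | parL _ ih => exact red_parL_parL (ih hc h')
  | parR _ ih => exact red_parL_parR (ih hc h')
  | res _ ih =>
    exact .congr (cong_par_res _ _ _) (.ctxRes (ih hc (h'.renS Nat.succ))) (cong_par_res _ _ _).symm
  | defn _ ih =>
    exact .congr (cong_par_defn _ _ _ _) (.ctxDefn (ih hc (h'.renX Nat.succ)))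
      (cong_par_defn _ _ _ _).symm

theorem Sync.red {s a b P P'} (hc : LAct.Compat a b) (h : Sync s a b P P') : Proc.Red false P P' := by
  induction h with
  | lr h h' => exact h.red hc h'
  | rl h h' => exact red_par_comm (h'.red hc h)
  | parL _ ih => exact .ctxPar (ih hc)
  | parR _ ih => exact .congr (Proc.Cong.parComm _ _) (.ctxPar (ih hc)) (Proc.Cong.parComm _ _)
  | res _ ih => exact .ctxRes (ih hc)
  | defn _ ih => exact .ctxDefn (ih hc)

theorem Sync.seq {s a b P P'} (h : Sync s a b P P') : ∃ P₁, Lts s a P P₁ ∧ Lts s b P₁ P' := by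
  induction h with
  | lr h h' => exact ⟨_, .parL h, .parR h'⟩
  | rl h h' => exact ⟨_, .parR h', .parL h⟩
  | parL _ ih => obtain ⟨P₁, h, h'⟩ := ih; exact ⟨_, .parL h, .parL h'⟩
  | parR _ ih => obtain ⟨P₁, h, h'⟩ := ih; exact ⟨_, .parR h, .parR h'⟩
  | res _ ih => obtain ⟨P₁, h, h'⟩ := ih; exact ⟨_, .res h, .res h'⟩
  | defn _ ih => obtain ⟨P₁, h, h'⟩ := ih; exact ⟨_, .defn h, .defn h'⟩

theorem Leaf.subj_eq {s a b P P' P''} (h : Leaf s a P P') (h' : Leaf s b P P'') :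
    a.subj = b.subj := by
  cases h <;> cases h' <;> rfl

/-- Actions of different roles come from different leaves, so their paths diverge at some parallel
composition. There the two actions synchronize. -/
theorem Sync.exists {s a b P P'} (h : Lts s a P P') : ∀ {P''}, Lts s b P P'' → a.subj ≠ b.subj →
    ∃ R, Sync s a b P R := by
  induction h with
  | leaf h =>
    intro P'' h' hne
    cases h' with
    | leaf h' => exact absurd (h.subj_eq h') hne
    | _ => cases h
  | parL h ih =>
    intro P'' h' hne
    cases h' with
    | leaf h' => cases h'
    | parL h' => obtain ⟨R, hR⟩ := ih h' hne; exact ⟨_, .parL hR⟩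
    | parR h' => exact ⟨_, .lr h h'⟩
  | parR h ih =>
    intro P'' h' hne
    cases h' with
    | leaf h' => cases h'
    | parL h' => exact ⟨_, .rl h' h⟩
    | parR h' => obtain ⟨R, hR⟩ := ih h' hne; exact ⟨_, .parR hR⟩
  | res h ih =>
    intro P'' h' hne
    cases h' with
    | leaf h' => cases h'
    | res h' => obtain ⟨R, hR⟩ := ih h' hne; exact ⟨_, .res hR⟩
  | defn h ih =>
    intro P'' h' hne
    cases h' with
    | leaf h' => cases h'
    | defn h' => obtain ⟨R, hR⟩ := ih h' hne; exact ⟨_, .defn hR⟩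

/-! ### Typing of transitions -/

section Typing

variable {g : Prop}

theorem J_lts_out {s p q l v P P'} (h : Lts s (.out p q l v) P P') : ∀ {w D Θ L}, L.Closed →
    J g w s D Θ VSet.empty L P → ∃ U S T, L (.role p) = some U ∧
      U.Sub (.sel q 1 (fun _ => l) (fun _ => S) (fun _ => T)) ∧ S.IsBasic ∧
      J g w s D Θ VSet.empty (L.upd (.role p) T.lin) P' := by
  generalize ha : LAct.out p q l v = a at h
  induction h with
  | leaf h =>
    subst ha
    cases h
    intro w D Θ L hL h
    obtain ⟨p', U, S, T, v, hc, hd, _, hU, hsub, hS, h⟩ := J_sel_closed hL h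
    cases hc
    exact ⟨U, S, T, hU, hsub, hS, J_lift (hL.upd _ _) h⟩
  | parL _ ih =>
    rintro w D Θ L hL ⟨L₁, L₂, h1, h2, hs⟩
    obtain ⟨U, S, T, hU, hsub, hS, h⟩ := ih ha (hL.left hs) h1
    exact ⟨U, S, T, (hs.some_left hU).1, hsub, hS, _, _, h, h2, hs.upd (by simp [hU]) _⟩
  | parR _ ih =>
    rintro w D Θ L hL ⟨L₁, L₂, h1, h2, hs⟩
    obtain ⟨U, S, T, hU, hsub, hS, h⟩ := ih ha (hL.right hs) h2
    exact ⟨U, S, T, (hs.some_right hU).1, hsub, hS, _, _, h1, h, (hs.symm.upd (by simp [hU]) _).symm⟩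
  | res _ ih => intro w D Θ L hL h; exact ih ha hL h
  | defn _ ih =>
    rintro w D Θ L hL (⟨r, h1, h2, h3, h⟩ | ⟨h1, h2, h⟩)
    · obtain ⟨U, S, T, hU, hsub, hS, h⟩ := ih ha hL h
      exact ⟨U, S, T, hU, hsub, hS, .inl ⟨r, h1, h2, h3, h⟩⟩
    · obtain ⟨U, S, T, hU, hsub, hS, h⟩ := ih ha hL h
      exact ⟨U, S, T, hU, hsub, hS, .inr ⟨h1, h2, h⟩⟩

/-- The input transition admits any value. Whether the payload type is basic is not known to the
receiver, hence the typing of the continuation is conditional, to be discharged by the sender. -/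
theorem J_lts_inp {s p q l v P P'} (h : Lts s (.inp p q l v) P P') : ∀ {w D Θ L}, L.Closed →
    J g w s D Θ VSet.empty L P → ∃ U n lab S T, L (.role p) = some U ∧
      U.Sub (.brn q n lab S T) ∧ ∃ i, lab i = l ∧ ((S i).IsBasic →
      J g w s D Θ VSet.empty (L.upd (.role p) (T i).lin) P') := by
  generalize ha : LAct.inp p q l v = a at h
  induction h with
  | leaf h =>
    subst ha
    cases h with
    | brn k =>
      intro w D Θ L hL h
      obtain ⟨p', U, S, T, hc, _, hU, hsub, h⟩ := J_brn_closed hL h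
      cases hc
      exact ⟨U, _, _, S, T, hU, hsub, k, rfl, fun hS =>
        J_lift (hL.upd _ _) (J_inst_val v (hL.upd _ _) hS (h k))⟩
  | parL _ ih =>
    rintro w D Θ L hL ⟨L₁, L₂, h1, h2, hs⟩
    obtain ⟨U, n, lab, S, T, hU, hsub, i, hi, h⟩ := ih ha (hL.left hs) h1
    exact ⟨U, n, lab, S, T, (hs.some_left hU).1, hsub, i, hi, fun hS =>
      ⟨_, _, h hS, h2, hs.upd (by simp [hU]) _⟩⟩
  | parR _ ih =>
    rintro w D Θ L hL ⟨L₁, L₂, h1, h2, hs⟩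
    obtain ⟨U, n, lab, S, T, hU, hsub, i, hi, h⟩ := ih ha (hL.right hs) h2
    exact ⟨U, n, lab, S, T, (hs.some_right hU).1, hsub, i, hi, fun hS =>
      ⟨_, _, h1, h hS, (hs.symm.upd (by simp [hU]) _).symm⟩⟩
  | res _ ih => intro w D Θ L hL h; exact ih ha hL h
  | defn _ ih =>
    rintro w D Θ L hL (⟨r, h1, h2, h3, h⟩ | ⟨h1, h2, h⟩)
    · obtain ⟨U, n, lab, S, T, hU, hsub, i, hi, h⟩ := ih ha hL h
      exact ⟨U, n, lab, S, T, hU, hsub, i, hi, fun hS => .inl ⟨r, h1, h2, h3, h hS⟩⟩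
    · obtain ⟨U, n, lab, S, T, hU, hsub, i, hi, h⟩ := ih ha hL h
      exact ⟨U, n, lab, S, T, hU, hsub, i, hi, fun hS => .inr ⟨h1, h2, h hS⟩⟩

theorem J_lts_dead {s p P P'} (h : Lts s (.dead p) P P') : ∀ {w D Θ L},
    J g w s D Θ VSet.empty L P → L (.role p) = some .crashed ∧ P' = P := by
  generalize ha : LAct.dead p = a at h
  induction h with
  | leaf h =>
    subst ha
    cases h
    rintro w D Θ L (⟨_, rfl⟩ | ⟨h, _⟩)
    · exact ⟨by simp, rfl⟩
    · exact absurd rfl h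
  | parL _ ih =>
    rintro w D Θ L ⟨L₁, L₂, h1, h2, hs⟩
    obtain ⟨h', rfl⟩ := ih ha h1
    exact ⟨(hs.some_left h').1, rfl⟩
  | parR _ ih =>
    rintro w D Θ L ⟨L₁, L₂, h1, h2, hs⟩
    obtain ⟨h', rfl⟩ := ih ha h2
    exact ⟨(hs.some_right h').1, rfl⟩
  | res _ ih =>
    intro w D Θ L h
    obtain ⟨h', rfl⟩ := ih ha h
    exact ⟨h', rfl⟩
  | defn _ ih =>
    rintro w D Θ L (⟨_, _, _, _, h⟩ | ⟨_, _, h⟩) <;>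
    · obtain ⟨h', rfl⟩ := ih ha h
      exact ⟨h', rfl⟩

/-! ### Active calls -/

/-- Some call outside of all prefixes and bodies has arguments satisfying `φ`. -/
def ActCall (φ : ℕ → List Pay → Prop) : ℕ → Proc → Prop
  | s, .res _ P => ActCall φ (s + 1) P
  | s, .par P Q => ActCall φ s P ∨ ActCall φ s Q
  | s, .defn _ _ P => ActCall φ s P
  | s, .call _ ds => φ s ds
  | _, _ => False

/-- The endpoint of role `p` is among the arguments. -/
def Passes (p : Role) (s : ℕ) (ds : List Pay) : Prop := Pay.chan (.ep s p) ∈ ds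

theorem ActCall.mem_fc {p P} : ∀ {s}, ActCall (Passes p) s P → (s, p) ∈ P.fc := by
  induction P with
  | res A P ih => intro s h; exact ih (s := s + 1) h
  | par P Q ihP ihQ => intro s h; exact h.imp ihP ihQ
  | defn Ss Q P _ ih => intro s h; exact .inr (ih h)
  | call X ds => intro s h; exact ⟨_, h, rfl⟩
  | _ => intro s h; exact h.elim

theorem J_actCall {w s D Θ Δ L p P} (h : J g w s D Θ Δ L P) (h' : ActCall (Passes p) s P) :
    L (.role p) ≠ none := by
  rcases J_fc P h h'.mem_fc with h | h
  · exact h.2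
  · exact absurd rfl h.1

/-- `Ext X ws P P'`: removing an active call of `X` with arguments `ws` from `P` gives `P'`. -/
inductive Ext : ℕ → List Pay → Proc → Proc → Prop
  | call {X ws} : Ext X ws (.call X ws) .nil
  | parL {X ws P P' Q} : Ext X ws P P' → Ext X ws (.par P Q) (.par P' Q)
  | parR {X ws P Q Q'} : Ext X ws Q Q' → Ext X ws (.par P Q) (.par P Q')
  | res {X ws A P P'} : Ext X (ws.map (Pay.renS Nat.succ)) P P' → Ext X ws (.res A P) (.res A P')
  | defn {X ws Ss B P P'} : Ext (X + 1) ws P P' → Ext X ws (.defn Ss B P) (.defn Ss B P')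

theorem Ext.cong {X ws P P'} (h : Ext X ws P P') : Proc.Cong P (.par P' (.call X ws)) := by
  induction h with
  | call => exact (Proc.Cong.parNil _).symm.trans (Proc.Cong.parComm _ _)
  | parL _ ih => exact (ih.congPar (.refl _)).trans (cong_par_assoc_swap _ _ _)
  | parR _ ih => exact ((Proc.Cong.refl _).congPar ih).trans (Proc.Cong.parAssoc _ _ _).symm
  | res _ ih => exact (Proc.Cong.congRes ih).trans (cong_par_res _ _ (.call _ _)).symm
  | defn _ ih => exact (Proc.Cong.congDefn (.refl _) ih).trans (cong_par_defn _ _ _ (.call _ _)).symm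

theorem Ext.actCall {X ws P P'} (h : Ext X ws P P') : ∀ {φ s}, ActCall φ s P' → ActCall φ s P := by
  induction h with
  | call => intro φ s h; exact h.elim
  | parL _ ih => intro φ s h; exact h.imp ih id
  | parR _ ih => intro φ s h; exact h.imp id ih
  | res _ ih => intro φ s h; exact ih (s := s + 1) h
  | defn _ ih => intro φ s h; exact ih (s := s) h

/-- Unfolding of one active call whose arguments satisfy `φ`. -/
inductive Unfold (φ : ℕ → List Pay → Prop) : ℕ → Proc → Proc → Prop
  | here {s Ss B P P' ws} : φ s ws → Ext 0 ws P P' →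
      Unfold φ s (.defn Ss B P) (.defn Ss B (.par P' (B.sub (Pay.inst ws))))
  | parL {s P P' Q} : Unfold φ s P P' → Unfold φ s (.par P Q) (.par P' Q)
  | parR {s P Q Q'} : Unfold φ s Q Q' → Unfold φ s (.par P Q) (.par P Q')
  | res {s A P P'} : Unfold φ (s + 1) P P' → Unfold φ s (.res A P) (.res A P')
  | defn {s Ss B P P'} : Unfold φ s P P' → Unfold φ s (.defn Ss B P) (.defn Ss B P')

theorem Ext.passes {X ws P P'} (h : Ext X ws P P') {p : Role} : ∀ {s}, Passes p s ws →
    ActCall (Passes p) s P := by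
  induction h with
  | call => intro s h; exact h
  | parL _ ih => intro s h; exact .inl (ih h)
  | parR _ ih => intro s h; exact .inr (ih h)
  | res _ ih => intro s h; exact ih (s := s + 1) (List.mem_map.2 ⟨_, h, rfl⟩)
  | defn _ ih => intro s h; exact ih (s := s) h

theorem Unfold.actCall {φ s P P'} (h : Unfold φ s P P') {p : Role}
    (hp : ∀ s ws, φ s ws → Passes p s ws) : ActCall (Passes p) s P := by
  induction h with
  | here hφ h => exact h.passes (hp _ _ hφ)
  | parL _ ih => exact .inl ih
  | parR _ ih => exact .inr ih
  | res _ ih => exact ih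
  | defn _ ih => exact ih

/-- An endpoint passed by an active call of an instantiated body was substituted for a parameter
passed early, or else it occurred in the body already. Guarded definitions exclude the first
possibility, typing of bodies the second. -/
theorem actCall_sub {p : Role} (B : Proc) : ∀ {s : ℕ} {σ : ℕ → Pay},
    ActCall (Passes p) s (B.sub σ) →
    (∃ j, Proc.HasEarlyPass j B ∧ σ j = .chan (.ep s p)) ∨ (s, p) ∈ B.fc := by
  induction B with
  | res A P ih =>
    intro s σ h
    rcases ih (s := s + 1) h with ⟨j, hj, hσ⟩ | h
    · refine .inl ⟨j, hj, ?_⟩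
      rcases h' : σ j with v | (x | ⟨s', q⟩) <;> rw [h'] at hσ <;>
        simp only [Pay.renS, Chan.renS, reduceCtorEq] at hσ
      · cases hσ
      · cases hσ; rfl
    · exact .inr h
  | par P Q ihP ihQ =>
    rintro s σ (h | h)
    · exact (ihP h).imp (fun ⟨j, h, h'⟩ => ⟨j, .inl h, h'⟩) .inl
    · exact (ihQ h).imp (fun ⟨j, h, h'⟩ => ⟨j, .inr h, h'⟩) .inr
  | defn Ss Q P _ ih =>
    intro s σ h
    exact (ih (s := s) h).imp (fun ⟨j, h, h'⟩ => ⟨j, .inr h, h'⟩) .inr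
  | call X ds =>
    intro s σ h
    obtain ⟨d, hd, h⟩ := List.mem_map.1 h
    rcases d with v | (x | ⟨s', q⟩)
    · cases h
    · exact .inl ⟨x, hd, h⟩
    · cases h
      exact .inr ⟨_, hd, rfl⟩
  | sel c q l d P _ =>
    intro s σ h
    simp only [Proc.sub] at h
    split at h <;> exact h.elim
  | brn c q n lab P _ =>
    intro s σ h
    simp only [Proc.sub] at h
    split at h <;> exact h.elim
  | _ => intro s σ h; exact h.elim

/-- Typing of the unfolding of a call. -/
theorem J_unfold_call {w s D Θ L Ss B ws Q} (hL : L.Closed)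
    (h : J g w s D Θ VSet.empty L (.defn Ss B (.par (.call 0 ws) Q))) :
    ws.length = Ss.length ∧ (∀ d ∈ ws, d.Ground) ∧ (g → B.GuardedBody) ∧
      (∀ p, ¬ ActCall (Passes p) s (B.sub (Pay.inst ws))) ∧
      ∃ L', L.Coarse L' ∧
        J g w s D Θ VSet.empty L' (.defn Ss B (.par (B.sub (Pay.inst ws)) Q)) := by
  rcases h with ⟨r, h1, h2, h3, L₁, L₂, ⟨r', Ss', ⟨rfl, rfl⟩, ho, ha⟩, hQ, hs⟩ |
    ⟨_, _, _, _, ⟨r', Ss', h, _⟩, _⟩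
  -- A declaration that is left untyped has no entry in the environment, so it cannot be called.
  swap
  · exact h.elim
  have hB := h3
  obtain ⟨L₁', hco, h4⟩ := J_inst_args ho ha h3
  obtain ⟨L', hs', hco'⟩ := hco.split hs
  refine ⟨ha.length_eq, fun d hd => ?_, h2, fun p hp => ?_, L', hco',
    .inl ⟨r', h1, h2, h3, L₁', L₂, ?_, hQ, hs'⟩⟩
  · rcases ha.closed_arg (hL.left hs) d hd with ⟨v, rfl⟩ | ⟨p, rfl, _⟩ <;> trivial
  -- The unfolded body passes no endpoint actively: a parameter instantiated by an endpoint has a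
  -- session type, and guardedness forbids passing it before use.
  · rcases actCall_sub B hp with ⟨j, hj, hσ⟩ | hp
    · have hlt : j < ws.length := by
        by_contra hlt
        simp [Pay.inst, List.getD, List.getElem?_eq_none (not_lt.1 hlt)] at hσ
      have hlt' : j < Ss'.length := ha.length_eq ▸ hlt
      have hd : ws[j]? = some (.chan (.ep s p)) := by
        rw [← hσ]
        simp [Pay.inst, List.getD, hlt]
      rcases ha.arg (List.getElem?_eq_getElem hlt') with ⟨_, ⟨v, hv⟩ | ⟨y, hy, _⟩⟩ | ⟨k, hk⟩
      · rw [hd] at hv; cases hv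
      · rw [hd] at hy; cases hy
      · exact h1 j _ (List.getElem?_eq_getElem hlt') hk.2.1 hj
    · rcases J_fc B hB hp with h | h
      · exact h.2 rfl
      · exact h.2
  · have hcl := hco.closed (hL.left hs)
    refine J_mono _ (fun _ h => h.elim) (fun X o Ss hX => ?_) (fun x hx => absurd (hcl x) hx) h4
    cases X with
    | zero => exact hX
    | succ X => exact hX.1

/-- Typing and reduction for an unfolding. -/
theorem J_unfold {φ s P P'} (h : Unfold φ s P P') : ∀ {w D Θ L}, L.Closed →
    J g w s D Θ VSet.empty L P → Proc.Red false P P' ∧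
      (∀ p, (∀ s ws, φ s ws → Passes p s ws) → ¬ ActCall (Passes p) s P') ∧
      (∀ p, ActCall (Passes p) s P' → ActCall (Passes p) s P) ∧
      ∃ L', L.Coarse L' ∧ J g w s D Θ VSet.empty L' P' := by
  induction h with
  | @here s Ss B P P' ws hφ h =>
    intro w D Θ L hL hJ
    have hc : Proc.Cong (.defn Ss B P) (.defn Ss B (.par (.call 0 ws) P')) :=
      .congDefn (.refl _) (h.cong.trans (.parComm _ _))
    have hc' : Proc.Cong (.defn Ss B (.par (B.sub (Pay.inst ws)) P'))
        (.defn Ss B (.par P' (B.sub (Pay.inst ws)))) := .congDefn (.refl _) (.parComm _ _)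
    have hJ' := (J_cong hc _ _ _ _ _ _).1 hJ
    obtain ⟨hlen, hgr, _, hact, L', hco, hJ''⟩ := J_unfold_call hL hJ'
    refine ⟨.congr hc (.call hlen hgr) hc', fun p hp hp' => ?_, fun p hp => ?_, L', hco,
      (J_cong hc' _ _ _ _ _ _).1 hJ''⟩
    · rcases hp' with hp' | hp'
      · have hws := hp s ws hφ
        -- The unfolded call owns the endpoint of `p`. By linearity no other active call passes it.
        have key : ∀ {θ}, J g w s D (scons θ Θ) VSet.empty L (.par (.call 0 ws) P') → False := by
          rintro θ ⟨L₁, L₂, ⟨r, Ss', h1, h2, h3⟩, h4, hs⟩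
          have h5 := J_actCall h4 hp'
          have h6 := (h3.fc _ hws (s' := s) (p := p) rfl).2
          rcases hs (.role p) with ⟨h, _⟩ | ⟨h, _⟩
          · exact h6 h
          · exact h5 h
        rcases hJ' with ⟨_, _, _, _, h⟩ | ⟨_, _, h⟩
        · exact key h
        · exact key h
      · exact hact p hp'
    · rcases hp with hp | hp
      · exact h.actCall hp
      · exact absurd hp (hact p)
  | @parL s P P' Q hu ih =>
    rintro w D Θ L hL ⟨L₁, L₂, h1, h2, hs⟩
    obtain ⟨hr, ha, hm, L₁', hco, hJ⟩ := ih (hL.left hs) h1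
    obtain ⟨L', hs', hco'⟩ := hco.split hs
    refine ⟨.ctxPar hr, fun p hp => ?_, fun p hp => hp.imp (hm p) id, L', hco', L₁', L₂, hJ, h2, hs'⟩
    rintro (h | h)
    · exact ha p hp h
    · have h3 := J_actCall h2 h
      have h5 := J_actCall h1 (hu.actCall hp)
      rcases hs (.role p) with ⟨h, _⟩ | ⟨h, _⟩
      · exact h5 h
      · exact h3 h
  | @parR s P Q Q' hu ih =>
    rintro w D Θ L hL ⟨L₁, L₂, h1, h2, hs⟩
    obtain ⟨hr, ha, hm, L₂', hco, hJ⟩ := ih (hL.right hs) h2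
    obtain ⟨L', hs', hco'⟩ := hco.split hs.symm
    refine ⟨.congr (.parComm _ _) (.ctxPar hr) (.parComm _ _), fun p hp => ?_,
      fun p hp => hp.imp id (hm p), L', hco', L₁, L₂', h1, hJ, hs'.symm⟩
    rintro (h | h)
    · have h3 := J_actCall h1 h
      have h5 := J_actCall h2 (hu.actCall hp)
      rcases hs (.role p) with ⟨h, _⟩ | ⟨h, _⟩
      · exact h3 h
      · exact h5 h
    · exact ha p hp h
  | res _ ih =>
    intro w D Θ L hL h
    obtain ⟨hr, ha, hm, L', hco, hJ⟩ := ih hL h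
    exact ⟨.ctxRes hr, ha, hm, L', hco, hJ⟩
  | defn _ ih =>
    rintro w D Θ L hL (⟨r, h1, h2, h3, h⟩ | ⟨h1, h2, h⟩)
    · obtain ⟨hr, ha, hm, L', hco, hJ⟩ := ih hL h
      exact ⟨.ctxDefn hr, ha, hm, L', hco, .inl ⟨r, h1, h2, h3, hJ⟩⟩
    · obtain ⟨hr, ha, hm, L', hco, hJ⟩ := ih hL h
      exact ⟨.ctxDefn hr, ha, hm, L', hco, .inr ⟨h1, h2, hJ⟩⟩

end Typing

/-! ### Threads that hold an endpoint, and calls that can be unfolded -/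

section Typing

variable {g : Prop}

/-- The thread that holds an endpoint is crashed, ready to send, ready to receive, or a call. -/
theorem J_holder {P} : ∀ {w s D Θ L p U}, L.Closed → J g w s D Θ VSet.empty L P →
    L (.role p) = some U →
    (U = .crashed ∧ ∃ P', Lts s (.dead p) P P') ∨
    (∃ q l v P', Lts s (.out p q l v) P P') ∨
    (∃ q n lab S T, U.Sub (.brn q n lab S T) ∧ ∀ i v, ∃ P', Lts s (.inp p q (lab i) v) P P') ∨
    ActCall (Passes p) s P := by
  have map : ∀ {s s' : ℕ} {p U} {P P₂ : Proc} (F : Proc → Proc),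
      (∀ a P', Lts s a P P' → Lts s' a P₂ (F P')) →
      (ActCall (Passes p) s P → ActCall (Passes p) s' P₂) →
      ((U = Ty.crashed ∧ ∃ P', Lts s (.dead p) P P') ∨
      (∃ q l v P', Lts s (.out p q l v) P P') ∨
      (∃ q n lab S T, U.Sub (.brn q n lab S T) ∧ ∀ i v, ∃ P', Lts s (.inp p q (lab i) v) P P') ∨
      ActCall (Passes p) s P) →
      ((U = Ty.crashed ∧ ∃ P', Lts s' (.dead p) P₂ P') ∨
      (∃ q l v P', Lts s' (.out p q l v) P₂ P') ∨
      (∃ q n lab S T, U.Sub (.brn q n lab S T) ∧ ∀ i v, ∃ P', Lts s' (.inp p q (lab i) v) P₂ P') ∨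
      ActCall (Passes p) s' P₂) := by
    rintro s s' p U P P₂ F hF hA (⟨h, P', h'⟩ | ⟨q, l, v, P', h⟩ | ⟨q, n, lab, S, T, hU, h⟩ | h)
    · exact .inl ⟨h, _, hF _ _ h'⟩
    · exact .inr (.inl ⟨q, l, v, _, hF _ _ h⟩)
    · exact .inr (.inr (.inl ⟨q, n, lab, S, T, hU, fun i v => (h i v).imp' F fun P' => hF _ _⟩))
    · exact .inr (.inr (.inr (hA h)))
  induction P with
  | nil => rintro w s D Θ L p U hL rfl hU; cases hU
  | err => intro w s D Θ L p U hL h; exact h.elim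
  | res A P ih =>
    intro w s D Θ L p U hL h hU
    exact map (.res A) (fun a P' h => .res h) id (ih hL h hU)
  | par P Q ihP ihQ =>
    rintro w s D Θ L p U hL ⟨L₁, L₂, h1, h2, hs⟩ hU
    rcases hs (.role p) with ⟨_, h⟩ | ⟨_, h⟩
    · exact map (.par P) (fun a P' h => .parR h) .inr (ihQ (hL.right hs) h2 (h ▸ hU))
    · exact map (fun P' => .par P' Q) (fun a P' h => .parL h) .inl (ihP (hL.left hs) h1 (h ▸ hU))
  | defn Ss B P _ ih =>
    rintro w s D Θ L p U hL (⟨_, _, _, _, h⟩ | ⟨_, _, h⟩) hU <;>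
    exact map (.defn Ss B) (fun a P' h => .defn h) (fun h => h) (ih hL h hU)
  | sel c q l d P _ =>
    intro w s D Θ L p U hL h hU
    obtain ⟨p', U', S, T, v, rfl, rfl, h1, _⟩ := J_sel_closed hL h
    cases h1 (.role p) (by simp [hU])
    exact .inr (.inl ⟨q, l, v, P, .leaf .sel⟩)
  | brn c q n lab P _ =>
    intro w s D Θ L p U hL h hU
    obtain ⟨p', U', S, T, rfl, h1, h2, h3, _⟩ := J_brn_closed hL h
    cases h1 (.role p) (by simp [hU])
    cases hU.symm.trans h2
    exact .inr (.inr (.inl ⟨q, n, lab, S, T, h3, fun i v => ⟨_, .leaf (.brn i v)⟩⟩))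
  | call X ds =>
    rintro w s D Θ L p U hL ⟨r, Ss, _, _, h⟩ hU
    obtain ⟨i, S, ⟨_, _, _, c, hc, hk⟩, _⟩ := h.exists_argAt hU
    rcases c with x | ⟨s', q⟩
    · cases hk
    · obtain ⟨rfl, hk'⟩ := key_ep hk
      cases hk'
      exact .inr (.inr (.inr (List.mem_of_getElem? hc)))
  | crashed s' q =>
    rintro w s D Θ L p U hL (⟨rfl, rfl⟩ | ⟨_, _, rfl⟩) hU
    · by_cases hq : p = q
      · subst hq
        rw [LCtx.upd_same] at hU
        cases hU
        exact .inl ⟨rfl, _, .leaf .dead⟩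
      · rw [LCtx.upd_ne _ _ (by simpa using hq)] at hU
        cases hU
    · cases hU

/-- An active call can be unfolded, or its process variable is free. -/
theorem J_exists_unfold {φ : ℕ → List Pay → Prop}
    (hφ : ∀ s ws, φ (s + 1) (ws.map (Pay.renS Nat.succ)) → φ s ws) {P} :
    ∀ {w s D Θ L}, L.Closed → J g w s D Θ VSet.empty L P → ActCall φ s P →
    (∃ P', Unfold φ s P P') ∨ ∃ X ws P', Ext X ws P P' ∧ φ s ws ∧ (∃ r Ss, Θ X r Ss) ∧
      ∀ d ∈ ws, (∃ v, d = .val v) ∨ ∃ p, d = .chan (.ep s p) := by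
  induction P with
  | res A P ih =>
    intro w s D Θ L hL h ha
    rcases ih hL h ha with ⟨P', h⟩ | ⟨X, ws, P', h1, h2, h3, h4⟩
    · exact .inl ⟨_, .res h⟩
    · have hws : (ws.map (Pay.renS Nat.pred)).map (Pay.renS Nat.succ) = ws := by
        rw [List.map_map]
        conv_rhs => rw [← List.map_id ws]
        refine List.map_congr_left fun d hd => ?_
        rcases h4 d hd with ⟨v, rfl⟩ | ⟨p, rfl⟩ <;> rfl
      refine .inr ⟨X, ws.map (Pay.renS Nat.pred), _, .res (hws.symm ▸ h1), hφ _ _ (hws.symm ▸ h2),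
        h3, fun d hd => ?_⟩
      obtain ⟨d, hd', rfl⟩ := List.mem_map.1 hd
      rcases h4 d hd' with ⟨v, rfl⟩ | ⟨p, rfl⟩
      · exact .inl ⟨v, rfl⟩
      · exact .inr ⟨p, rfl⟩
  | par P Q ihP ihQ =>
    rintro w s D Θ L hL ⟨L₁, L₂, h1, h2, hs⟩ (ha | ha)
    · rcases ihP (hL.left hs) h1 ha with ⟨P', h⟩ | ⟨X, ws, P', h1, h⟩
      · exact .inl ⟨_, .parL h⟩
      · exact .inr ⟨X, ws, _, .parL h1, h⟩
    · rcases ihQ (hL.right hs) h2 ha with ⟨P', h⟩ | ⟨X, ws, P', h1, h⟩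
      · exact .inl ⟨_, .parR h⟩
      · exact .inr ⟨X, ws, _, .parR h1, h⟩
  | defn Ss B P _ ih =>
    rintro w s D Θ L hL (⟨_, _, _, _, h⟩ | ⟨_, _, h⟩) ha <;>
    · rcases ih hL h ha with ⟨P', h⟩ | ⟨_ | X, ws, P', h1, h2, h3, h4⟩
      · exact .inl ⟨_, .defn h⟩
      · exact .inl ⟨_, .here h2 h1⟩
      · exact .inr ⟨X, ws, _, .defn h1, h2, h3, h4⟩
  | call X ds =>
    rintro w s D Θ L hL ⟨r, Ss, h1, _, h⟩ ha
    exact .inr ⟨X, ds, _, .call, ha, ⟨r, Ss, h1⟩, fun d hd =>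
      (h.closed_arg hL d hd).imp_right fun ⟨p, hp, _⟩ => ⟨p, hp⟩⟩
  | _ => intro w s D Θ L _ _ ha; exact ha.elim

end Typing

/-! ## Moves of typing contexts, for one session -/

/-- Types of the endpoints of one session. -/
abbrev Conf := Role → Option Ty

/-- Transitions without observation of payloads. -/
inductive MAct where
  | comm (p q : Role) (l : MsgLabel)
  | detect (q p : Role)
  | crash (p : Role)

namespace Conf

/-- `p` can send `l(S)` to `q`, continuing as `T`. -/
def Out (H : Conf) (p q : Role) (l : MsgLabel) (S T : Ty) : Prop :=
  ∃ U n lab Ss Ts, ∃ k : Fin n, H p = some U ∧ Ty.Unf U (.sel q n lab Ss Ts) ∧ lab k = l ∧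
    Ss k = S ∧ Ts k = T

/-- `q` can receive `l(S)` from `p`, continuing as `T`. -/
def Inp (H : Conf) (q p : Role) (l : Label) (S T : Ty) : Prop :=
  ∃ U n lab Ss Ts, ∃ k : Fin n, H q = some U ∧ Ty.Unf U (.brn p n lab Ss Ts) ∧ lab k = l ∧
    Ss k = S ∧ Ts k = T

/-- Types are inspected after complete unfolding and the configuration is updated in place, so no
rules for recursion or framing are needed. Payload types are not part of the label. -/
inductive Move : Conf → MAct → Conf → Prop
  | comm {H p q l S S' T T'} : Out H p q l S T → Inp H q p (.msg l) S' T' → S.Sub S' →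
      Move H (.comm p q l) (Function.update (Function.update H p (some T)) q (some T'))
  | lost {H p q l S T} : Out H p q l S T → H q = some .crashed →
      Move H (.comm p q l) (Function.update H p (some T))
  | detect {H p q T} : Inp H q p .crash (.basic .unit) T → H p = some .crashed →
      Move H (.detect q p) (Function.update H q (some T))
  | crash {H p T} : H p = some T → T.IsSession → ¬ T.Sub .done →
      Move H (.crash p) (Function.update H p (some .crashed))

/-- The conditions on safe contexts that concern the present state. -/
structure SafeNow (H : Conf) : Prop where
  comm : ∀ {p q l l' S S' T T'}, Out H p q l S T → Inp H q p l' S' T' → ∃ H', Move H (.comm p q l) H'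
  crash : ∀ {p q l S T}, H p = some .crashed → Inp H q p l S T → ∃ H', Move H (.detect q p) H'

/-- Agreement of an actual type with a linear resource. -/
def Ok (h u : Option Ty) : Prop :=
  (∀ U, u = some U → ∃ U', h = some U' ∧ U'.Sub U) ∧ (u = none → ∀ U', h = some U' → U'.Sub .done)

/-- The resources in `L` are accounted for by `H`. -/
def Agree (H : Conf) (L : LCtx) : Prop := ∀ p U, L (.role p) = some U → ∃ U', H p = some U' ∧ U'.Sub U

theorem Agree.left {H : Conf} {L₁ L₂ L : LCtx} (h : Agree H L) (hs : LCtx.Split L₁ L₂ L) :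
    Agree H L₁ := fun p U hU => h p U (hs.some_left hU).1

theorem Agree.right {H : Conf} {L₁ L₂ L : LCtx} (h : Agree H L) (hs : LCtx.Split L₁ L₂ L) :
    Agree H L₂ := h.left hs.symm

theorem Ok.of_sub {T T' : Ty} (h : T.Sub T') (hT : T'.IsSession) : Ok (some T) T'.lin := by
  constructor
  · intro U hU
    obtain ⟨rfl, _⟩ := Ty.lin_eq_some.1 hU
    exact ⟨T, rfl, h⟩
  · intro hn U' hU'
    cases hU'
    rcases Ty.lin_eq_none.1 hn with hb | hd
    · exact absurd hT hb.not_session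
    · exact h.trans hd

theorem Agree.out {H : Conf} {L : LCtx} (h : Agree H L) {p q l S T U} (hU : L (.role p) = some U)
    (hs : U.Sub (.sel q 1 (fun _ => l) (fun _ => S) (fun _ => T))) :
    ∃ S' T', Out H p q l S' T' ∧ S.Sub S' ∧ T'.Sub T := by
  obtain ⟨U', hU', hs'⟩ := h p U hU
  obtain ⟨n, lab, Ss, Ts, hu, h⟩ := (hs'.trans hs).sel_inv
  obtain ⟨i, h1, h2, h3⟩ := h 0
  exact ⟨Ss i, Ts i, ⟨U', n, lab, Ss, Ts, i, hU', hu, h1, rfl, rfl⟩, h2, h3⟩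

theorem Agree.inp {H : Conf} {L : LCtx} (h : Agree H L) {q p n lab S T U} (hU : L (.role q) = some U)
    (hs : U.Sub (.brn p n lab S T)) {l S' T'} (hi : Inp H q p l S' T') :
    ∃ j, lab j = l ∧ S'.Sub (S j) ∧ T'.Sub (T j) := by
  obtain ⟨U', hU', hs'⟩ := h q U hU
  obtain ⟨n', lab', Ss, Ts, hu, h, _⟩ := (hs'.trans hs).brn_inv
  obtain ⟨U'', n'', lab'', Ss', Ts', k, hk, hu', rfl, rfl, rfl⟩ := hi
  cases hU'.symm.trans hk
  cases hu.det hu'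
  obtain ⟨j, h1, h2⟩ := h k
  exact ⟨j, h1.symm, h2⟩

/-- Subtyping may narrow an external choice but never empties it, so the actual type still offers
some branch. Safety can then be applied with that branch. -/
theorem Agree.exists_inp {H : Conf} {L : LCtx} (h : Agree H L) {q p n lab S T U}
    (hU : L (.role q) = some U) (hs : U.Sub (.brn p n lab S T)) : ∃ l S' T', Inp H q p l S' T' := by
  obtain ⟨U', hU', hs'⟩ := h q U hU
  have hs := hs'.trans hs
  obtain ⟨n', lab', Ss, Ts, hu, h, _⟩ := hs.brn_inv
  have h0 : n' ≠ 0 := ((hs.1.unf hu).sess_brn).1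
  exact ⟨_, _, _, U', n', lab', Ss, Ts, ⟨0, Nat.pos_of_ne_zero h0⟩, hU', hu, rfl, rfl, rfl⟩

theorem Out.det {H : Conf} {p q q' l S T S' T'} (h : Out H p q l S T) (h' : Out H p q' l S' T')
    (hw : ∀ U, H p = some U → U.TyWF) : q = q' ∧ S = S' ∧ T = T' := by
  obtain ⟨U, n, lab, Ss, Ts, k, hU, hu, rfl, rfl, rfl⟩ := h
  obtain ⟨U', n', lab', Ss', Ts', k', hU', hu', hk, rfl, rfl⟩ := h'
  cases hU.symm.trans hU'
  have hi := ((hw U hU).unf hu).sess_sel.2.1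
  cases hu.det hu'
  cases hi hk
  exact ⟨rfl, rfl, rfl⟩

theorem Out.not_inp {H : Conf} {p q q' l l' S T S' T'} (h : Out H p q l S T)
    (h' : Inp H p q' l' S' T') : False := by
  obtain ⟨U, n, lab, Ss, Ts, k, hU, hu, _⟩ := h
  obtain ⟨U', n', lab', Ss', Ts', k', hU', hu', _⟩ := h'
  cases hU.symm.trans hU'
  cases hu.det hu'

theorem Out.not_crashed {H : Conf} {p q l S T} (h : Out H p q l S T) : H p ≠ some .crashed := by
  obtain ⟨U, n, lab, Ss, Ts, k, hU, hu, _⟩ := h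
  intro h
  cases hU.symm.trans h
  cases hu.eq id

theorem Inp.not_crashed {H : Conf} {p q l S T} (h : Inp H p q l S T) : H p ≠ some .crashed := by
  obtain ⟨U, n, lab, Ss, Ts, k, hU, hu, _⟩ := h
  intro h
  cases hU.symm.trans h
  cases hu.eq id

end Conf

/-- The transition of the context for a synchronization with first action `a`. -/
def LAct.move : LAct → MAct
  | out p q l _ => .comm p q l
  | inp q p _ _ => .detect q p
  | dead p => .crash p

open Conf

/-- A transition that leaves alone the roles outside of `L` and keeps the roles in `L` in agreement. -/
def Conf.Local (H : Conf) (L : LCtx) (H' : Conf) (L' : LCtx) : Prop :=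
  ∀ r, (H' r = H r ∧ L' (.role r) = L (.role r)) ∨ (L (.role r) ≠ none ∧ Ok (H' r) (L' (.role r)))

theorem LCtx.Coarse.local {H : Conf} {L L' : LCtx} (h : L.Coarse L') (hH : Agree H L) :
    Conf.Local H L H L' := by
  intro r
  rcases h (.role r) with h | ⟨U, S, h1, h2, h3, h4⟩
  · exact .inl ⟨rfl, h⟩
  · refine .inr ⟨by simp [h1], fun V hV => ?_, fun hn => by rw [h2] at hn; cases hn⟩
    cases h2.symm.trans hV
    obtain ⟨U', hU', hs'⟩ := hH r U h1
    exact ⟨U', hU', hs'.trans h3⟩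

/-! ### Subject reduction: contexts follow processes -/

section Typing

variable {g : Prop}

theorem Sync.seq' {s a b P P'} (h : Sync s a b P P') : ∃ P₁, Lts s b P P₁ ∧ Lts s a P₁ P' := by
  induction h with
  | lr h h' => exact ⟨_, .parR h', .parL h⟩
  | rl h h' => exact ⟨_, .parL h, .parR h'⟩
  | parL _ ih => obtain ⟨P₁, h, h'⟩ := ih; exact ⟨_, .parL h, .parL h'⟩
  | parR _ ih => obtain ⟨P₁, h, h'⟩ := ih; exact ⟨_, .parR h, .parR h'⟩
  | res _ ih => obtain ⟨P₁, h, h'⟩ := ih; exact ⟨_, .res h, .res h'⟩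
  | defn _ ih => obtain ⟨P₁, h, h'⟩ := ih; exact ⟨_, .defn h, .defn h'⟩

theorem J_lts_ne_none {s a P P'} (h : Lts s a P P') {w D Θ L} (hL : L.Closed)
    (hJ : J g w s D Θ VSet.empty L P) : L (.role a.subj) ≠ none := by
  cases a with
  | out p q l v =>
    obtain ⟨U, _, _, hU, _⟩ := J_lts_out h hL hJ
    simp [LAct.subj, hU]
  | inp p q l v =>
    obtain ⟨U, _, _, _, _, hU, _⟩ := J_lts_inp h hL hJ
    simp [LAct.subj, hU]
  | dead p => simp [LAct.subj, (J_lts_dead h hJ).1]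

/-- The two partners lie on opposite sides of a parallel composition, whose linear resources are
disjoint. -/
theorem J_sync_ne {s a b P P'} (h : Sync s a b P P') : ∀ {w D Θ L}, L.Closed →
    J g w s D Θ VSet.empty L P → a.subj ≠ b.subj := by
  induction h with
  | lr h h' =>
    rintro w D Θ L hL ⟨L₁, L₂, h1, h2, hs⟩ he
    have h3 := J_lts_ne_none h (hL.left hs) h1
    have h4 := J_lts_ne_none h' (hL.right hs) h2
    rw [← he] at h4
    exact (hs _).elim (fun h => h3 h.1) (fun h => h4 h.1)
  | rl h h' =>
    rintro w D Θ L hL ⟨L₁, L₂, h1, h2, hs⟩ he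
    have h3 := J_lts_ne_none h (hL.left hs) h1
    have h4 := J_lts_ne_none h' (hL.right hs) h2
    rw [he] at h4
    exact (hs _).elim (fun h => h3 h.1) (fun h => h4 h.1)
  | parL _ ih =>
    rintro w D Θ L hL ⟨L₁, L₂, h1, h2, hs⟩
    exact ih (hL.left hs) h1
  | parR _ ih =>
    rintro w D Θ L hL ⟨L₁, L₂, h1, h2, hs⟩
    exact ih (hL.right hs) h2
  | res _ ih => intro w D Θ L hL h; exact ih hL h
  | defn _ ih => rintro w D Θ L hL (⟨_, _, _, _, h⟩ | ⟨_, _, h⟩) <;> exact ih hL h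

/-- Synchronizations of well-typed processes are transitions of the context. -/
theorem J_sync {a b s P P' w D Θ L H} (hc : LAct.Compat a b) (h : Sync s a b P P') (hL : L.Closed)
    (hJ : J g w s D Θ VSet.empty L P) (hH : Agree H L) (hs : SafeNow H) :
    ∃ H' L', Move H a.move H' ∧ L'.Closed ∧ J g w s D Θ VSet.empty L' P' ∧ Conf.Local H L H' L' := by
  have hne := J_sync_ne h hL hJ
  obtain ⟨P₁, h1, h2⟩ := h.seq
  have hrole : ∀ {r r' : Role}, r ≠ r' → Key.role r ≠ .role r' := fun h h' => h (by cases h'; rfl)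
  cases hc with
  | comm p q l v =>
    replace hne : p ≠ q := hne
    obtain ⟨U, S, T, hU, hsub, hS, hJ1⟩ := J_lts_out h1 hL hJ
    obtain ⟨V, n, lab, Sb, Tb, hV, hsub', i, hi, hJ2⟩ := J_lts_inp h2 (hL.upd _ _) hJ1
    rw [LCtx.upd_ne _ _ (hrole hne.symm)] at hV
    obtain ⟨S', T', hout, hSS, hTT⟩ := hH.out hU hsub
    obtain ⟨l₀, S₀, T₀, hinp⟩ := hH.exists_inp hV hsub'
    -- Safety turns the output and an arbitrary branch of the input into a transmission of the label
    -- that the process sends.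
    obtain ⟨H', hm⟩ := hs.comm hout hinp
    cases hm with
    | lost _ hcr => exact absurd hcr hinp.not_crashed
    | @comm _ _ _ S₁ S₂ T₁ T₂ ho hi' hss =>
      obtain ⟨_, rfl, rfl⟩ := ho.det hout fun W hW => by
        obtain ⟨W', hW', hsW⟩ := hH p U hU
        cases hW.symm.trans hW'
        exact hsW.1
      obtain ⟨j, hj, hS2, hT2⟩ := hH.inp hV hsub' hi'
      -- Labels of a choice are distinct, so the branch chosen by the process is the one offered by
      -- the context.
      cases hsub'.2.1.sess_brn.2.1 (hj.trans hi.symm)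
      refine ⟨_, _, .comm ho hi' hss, (hL.upd _ _).upd _ _,
        -- Being basic is carried along subtyping from the type of the payload sent to the type
        -- expected by the receiving branch.
        hJ2 (hS2.isBasic (hss.isBasic (hSS.isBasic hS))), fun r => ?_⟩
      by_cases hrq : r = q
      · subst hrq
        refine .inr ⟨by simp [hV], ?_⟩
        rw [Function.update_self, LCtx.upd_same]
        exact Ok.of_sub hT2 (hsub'.2.1.sess_brn.2.2.2 i)
      · rw [Function.update_of_ne hrq, LCtx.upd_ne _ _ (hrole hrq)]
        by_cases hrp : r = p
        · subst hrp
          refine .inr ⟨by simp [hU], ?_⟩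
          rw [Function.update_self, LCtx.upd_same]
          exact Ok.of_sub hTT (hsub.2.1.sess_sel.2.2.2 0)
        · rw [Function.update_of_ne hrp, LCtx.upd_ne _ _ (hrole hrp)]
          exact .inl ⟨rfl, rfl⟩
  | lost p q l v =>
    replace hne : p ≠ q := hne
    obtain ⟨U, S, T, hU, hsub, hS, hJ1⟩ := J_lts_out h1 hL hJ
    obtain ⟨hV, rfl⟩ := J_lts_dead h2 hJ1
    rw [LCtx.upd_ne _ _ (hrole hne.symm)] at hV
    obtain ⟨V', hV', hVs⟩ := hH q _ hV
    rw [hVs.eq_crashed] at hV'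
    obtain ⟨S', T', hout, hSS, hTT⟩ := hH.out hU hsub
    refine ⟨_, _, .lost hout hV', hL.upd _ _, hJ1, fun r => ?_⟩
    by_cases hrp : r = p
    · subst hrp
      refine .inr ⟨by simp [hU], ?_⟩
      rw [Function.update_self, LCtx.upd_same]
      exact Ok.of_sub hTT (hsub.2.1.sess_sel.2.2.2 0)
    · rw [Function.update_of_ne hrp, LCtx.upd_ne _ _ (hrole hrp)]
      exact .inl ⟨rfl, rfl⟩
  | detect q p =>
    replace hne : p ≠ q := hne
    -- The crashed partner is considered before the receiver: its transition changes nothing,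
    -- whereas the typing after an input is conditional on the payload type.
    obtain ⟨P₂, h3, h4⟩ := h.seq'
    obtain ⟨hU, rfl⟩ := J_lts_dead h3 hJ
    obtain ⟨V, n, lab, Sb, Tb, hV, hsub', i, hi, hJ2⟩ := J_lts_inp h4 hL hJ
    obtain ⟨U', hU', hUs⟩ := hH q _ hU
    rw [hUs.eq_crashed] at hU'
    obtain ⟨l₀, S₀, T₀, hinp⟩ := hH.exists_inp hV hsub'
    obtain ⟨H', hm⟩ := hs.crash hU' hinp
    cases hm with
    | detect hi' hcr =>
      obtain ⟨j, hj, hS2, hT2⟩ := hH.inp hV hsub' hi'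
      cases hsub'.2.1.sess_brn.2.1 (hj.trans hi.symm)
      refine ⟨_, _, .detect hi' hcr, hL.upd _ _, hJ2 (hS2.isBasic trivial), fun r => ?_⟩
      by_cases hrp : r = p
      · subst hrp
        refine .inr ⟨by simp [hV], ?_⟩
        rw [Function.update_self, LCtx.upd_same]
        exact Ok.of_sub hT2 (hsub'.2.1.sess_brn.2.2.2 i)
      · rw [Function.update_of_ne hrp, LCtx.upd_ne _ _ (hrole hrp)]
        exact .inl ⟨rfl, rfl⟩

/-- A thread changes the types of its own roles only, so the resources of its neighbour remain
accounted for and disjoint. This is the frame property used for parallel composition. -/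
theorem Conf.Local.split {H H' : Conf} {L₁ L₁' L₂ L : LCtx} (h : Conf.Local H L₁ H' L₁')
    (hs : LCtx.Split L₁ L₂ L) (hL : L.Closed) (hL' : L₁'.Closed) :
    ∃ L', LCtx.Split L₁' L₂ L' ∧ L'.Closed ∧ Conf.Local H L H' L' := by
  classical
  have hn : ∀ k, L₂ k ≠ none → L₁' k = none := by
    intro k hk
    have h1 : L₁ k = none := (hs k).elim And.left fun h => absurd h.1 hk
    rcases k with r | x
    · rcases h r with ⟨_, h⟩ | ⟨h, _⟩
      · rw [h, h1]
      · exact absurd h1 h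
    · exact hL' x
  refine ⟨fun k => if L₂ k = none then L₁' k else L₂ k, fun k => ?_, fun x => ?_, fun r => ?_⟩
  · by_cases hk : L₂ k = none
    · exact .inr ⟨hk, if_pos hk⟩
    · exact .inl ⟨hn k hk, if_neg hk⟩
  · simp only [hL.right hs x, hL' x, if_true]
  · by_cases hk : L₂ (.role r) = none
    · simp only [hk, if_true]
      rcases h r with ⟨h1, h2⟩ | ⟨h1, h2⟩
      · refine .inl ⟨h1, h2.trans ?_⟩
        rcases hs (.role r) with ⟨h3, h4⟩ | ⟨_, h4⟩
        · rw [h3, h4, hk]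
        · exact h4.symm
      · exact .inr ⟨hs.ne_none.2 (.inl h1), h2⟩
    · simp only [hk, if_false]
      rcases hs (.role r) with ⟨h1, h4⟩ | ⟨h1, _⟩
      · rcases h r with ⟨h2, _⟩ | ⟨h2, _⟩
        · exact .inl ⟨h2, h4.symm⟩
        · exact absurd h1 h2
      · exact absurd h1 hk

theorem list_eq_singleton {α : Type*} {l : List α} {a : α} (hn : l.Nodup) (h : ∀ e, e ∈ l ↔ e = a) :
    l = [a] := by
  match l, hn, h with
  | [], _, h => exact absurd ((h a).2 rfl) (by simp)
  | [b], _, h => rw [(h b).1 (by simp)]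
  | b :: c :: l, hn, h =>
    have hb := (h b).1 (by simp)
    have hc := (h c).1 (by simp)
    subst hb
    subst hc
    simp at hn

/-- The effect of a reduction on types and potential. -/
def Effect (g : Prop) (b : Bool) (P P' : Proc) (H H' : Conf) (L' : LCtx) : Prop :=
  (H' = H ∧ (g → ∀ k e, (∀ X, Monotone (e X)) → P'.potential k e < P.potential k e)) ∨
  ∃ α, Move H α H' ∧ (∀ p, α = .crash p → b = true ∧ L' (.role p) = some .crashed) ∧
    ∀ k e, (∀ X, Monotone (e X)) → P'.potential k e ≤ P.potential (k + 1) e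

theorem J_red_sync {a b s P P' w D Θ L H} {b' : Bool} (hc : LAct.Compat a b) (h : Sync s a b P P')
    (hL : L.Closed) (hJ : J g w s D Θ VSet.empty L P) (hH : Agree H L) (hs : SafeNow H)
    (hpot : ∀ k e, (∀ X, Monotone (e X)) → P'.potential k e ≤ P.potential (k + 1) e) :
    ∃ H' L', L'.Closed ∧ J g w s D Θ VSet.empty L' P' ∧ Conf.Local H L H' L' ∧
      Effect g b' P P' H H' L' := by
  obtain ⟨H', L', hm, hL', hJ', hloc⟩ := J_sync hc h hL hJ hH hs
  refine ⟨H', L', hL', hJ', hloc, .inr ⟨_, hm, fun p hp => ?_, hpot⟩⟩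
  cases hc <;> cases hp

/-- A thread of a single role has no free endpoint besides its own. Its crash therefore leaves one
crashed endpoint and affects one entry of the context. -/
theorem J_crash {w s D Θ L H P} {p : Role} {F : List (ℕ × Role)}
    (hJ' : J g w s VSet.empty Θ VSet.empty L P) (hp : (s, p) ∈ P.fc)
    (hL : ∀ k, L k ≠ none → k = .role p) {U} (hU : L (.role p) = some U) (hw : U.IsSession)
    (hd : ¬ U.Sub .done) (hH : Agree H L) (hF : F.Nodup) (hF' : ∀ e, e ∈ F ↔ e ∈ P.fc) :
    ∃ H' L', L'.Closed ∧
      J g w s D Θ VSet.empty L' (Proc.bigPar (F.map fun e => .crashed e.1 e.2)) ∧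
      Conf.Local H L H' L' ∧
      Effect g true P (Proc.bigPar (F.map fun e => .crashed e.1 e.2)) H H' L' := by
  have hF'' : F = [(s, p)] := by
    refine list_eq_singleton hF fun e => (hF' e).trans ⟨fun he => ?_, fun he => he ▸ hp⟩
    rcases J_fc P hJ' (s' := e.1) (p := e.2) he with h | h
    · have := hL _ h.2
      cases this
      exact Prod.ext h.1 rfl
    · exact h.2.elim
  subst hF''
  obtain ⟨U', hU', hs⟩ := hH p U hU
  refine ⟨_, LCtx.nil.upd (.role p) (some .crashed), fun x => by rw [LCtx.upd_ne _ _ (by simp)]; rfl,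
    ⟨_, LCtx.nil, .inl ⟨rfl, rfl⟩, rfl, LCtx.Split.symm (LCtx.Split.nil_left.2 rfl)⟩, fun r => ?_,
    .inr ⟨_, .crash hU' (hs.isSession_left hw) (fun h => hd ?_), fun q hq => ?_, ?_⟩⟩
  · by_cases hr : r = p
    · subst hr
      refine .inr ⟨by simp [hU], ?_⟩
      rw [Function.update_self, LCtx.upd_same]
      refine ⟨fun V hV => ?_, fun h => by cases h⟩
      cases hV
      exact ⟨_, rfl, Ty.Sub.refl (.inr rfl)⟩
    · have hne : Key.role r ≠ .role p := fun h => hr (by cases h; rfl)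
      rw [Function.update_of_ne hr, LCtx.upd_ne _ _ hne]
      refine .inl ⟨rfl, ?_⟩
      by_contra h
      exact hne (hL _ (Ne.symm h))
  · have := h.unf_done
    exact hs.done_up h
  · cases hq
    exact ⟨rfl, LCtx.upd_same _ _ _⟩
  · intro k e _
    exact (Nat.zero_le _)

/-- Subject reduction. -/
theorem J_red {b P P'} (h : Proc.Red b P P') : ∀ {w s D Θ L H}, L.Closed →
    J g w s D Θ VSet.empty L P → Agree H L → SafeNow H →
    ∃ H' L', L'.Closed ∧ J g w s D Θ VSet.empty L' P' ∧ Conf.Local H L H' L' ∧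
      Effect g b P P' H H' L' := by
  induction h with
  | @comm b s' p q n lab P l d Q k hk hd =>
    intro w s D Θ L H hL hJ hH hs
    have hJ' := hJ
    obtain ⟨L₁, L₂, h1, h2, hsp⟩ := hJ'
    obtain ⟨p', U, S, T, hc, _⟩ := J_brn_closed (hL.left hsp) h1
    obtain ⟨q', V, S', T', v, hc', rfl, _⟩ := J_sel_closed (hL.right hsp) h2
    cases hc
    cases hc'
    refine J_red_sync (.comm q p l v) (.rl (.leaf (hk ▸ .brn k v)) (.leaf .sel)) hL hJ hH hs fun m e he => ?_
    -- The larger budget pays for the prefixes consumed on both sides, and the chosen branch is one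
    -- summand of the potential of the branching.
    refine Nat.add_le_add ((Proc.potential_sub_le _ _ _ _).trans ?_) le_rfl
    exact Finset.single_le_sum (f := fun i => (P i).potential m e) (fun _ _ => Nat.zero_le _)
      (Finset.mem_univ k)
  | @errLabel b s' p q n lab P l d Q hk hd =>
    intro w s D Θ L H hL hJ hH hs
    obtain ⟨L₁, L₂, h1, h2, hsp⟩ := hJ
    obtain ⟨p', U, S, T, hc, _, hU, hsub, _⟩ := J_brn_closed (hL.left hsp) h1
    obtain ⟨q', V, S', T', v, hc', _, _, hV, hsub', _⟩ := J_sel_closed (hL.right hsp) h2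
    cases hc
    cases hc'
    obtain ⟨S₁, T₁, hout, _, _⟩ := (hH.right hsp).out hV hsub'
    obtain ⟨l₀, S₀, T₀, hinp⟩ := (hH.left hsp).exists_inp hU hsub
    -- Safety would let the context receive the label, and all labels that the context receives are
    -- among those of the process.
    obtain ⟨H', hm⟩ := hs.comm hout hinp
    cases hm with
    | lost _ hcr => exact absurd hcr hinp.not_crashed
    | comm _ hi _ =>
      obtain ⟨j, hj, _⟩ := (hH.left hsp).inp hU hsub hi
      exact absurd hj (hk j)
  | @call b Ss B ws Q hlen hgr =>
    intro w s D Θ L H hL hJ hH hs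
    obtain ⟨_, _, hB, _, L', hco, hJ'⟩ := J_unfold_call hL hJ
    refine ⟨H, L', hco.closed hL, hJ', hco.local hH, .inl ⟨rfl, fun hg k e he => ?_⟩⟩
    · refine Nat.add_lt_add_right (lt_of_le_of_lt (Proc.potential_sub_le _ _ _ _) ?_) _
      change _ < Proc.callCost (Proc.potential B) e k
      -- A call costs one more than its body, which gives the strict decrease.
      rw [(hB hg).callCost_eq]
      omega
  | @ctxPar b P P' Q _ ih =>
    rintro w s D Θ L H hL ⟨L₁, L₂, h1, h2, hsp⟩ hH hs
    obtain ⟨H', L₁', hL', hJ', hloc, heff⟩ := ih (hL.left hsp) h1 (hH.left hsp) hs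
    obtain ⟨L', hsp', hcl, hloc'⟩ := hloc.split hsp hL hL'
    refine ⟨H', L', hcl, ⟨L₁', L₂, hJ', h2, hsp'⟩, hloc', ?_⟩
    rcases heff with ⟨rfl, h⟩ | ⟨α, hm, hcr, hp⟩
    · exact .inl ⟨rfl, fun hg k e he => Nat.add_lt_add_right (h hg k e he) _⟩
    · refine .inr ⟨α, hm, fun p hp => ⟨(hcr p hp).1, (hsp'.some_left (hcr p hp).2).1⟩, fun k e he => ?_⟩
      exact Nat.add_le_add (hp k e he) (Proc.potential_mono_budget Q e he _ _ (Nat.le_succ k))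
  | ctxRes _ ih =>
    intro w s D Θ L H hL hJ hH hs
    exact ih hL hJ hH hs
  | @ctxDefn b Ss B P P' _ ih =>
    intro w s D Θ L H hL hJ hH hs
    have heff : ∀ {H' L'}, Effect g b P P' H H' L' →
        Effect g b (.defn Ss B P) (.defn Ss B P') H H' L' := by
      -- Below a declaration the environment gains the cost of its calls. The restriction to
      -- monotone environments is preserved.
      have hm : ∀ {e : ℕ → ℕ → ℕ}, (∀ X, Monotone (e X)) →
          ∀ X, Monotone (scons (Proc.callCost (Proc.potential B) e) e X) := by
        intro e he X
        cases X with
        | zero => exact Proc.callCost_monotone B he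
        | succ X => exact he X
      rintro H' L' (⟨rfl, h⟩ | ⟨α, hm', hcr, hp⟩)
      · exact .inl ⟨rfl, fun hg k e he => h hg k _ (hm he)⟩
      · exact .inr ⟨α, hm', hcr, fun k e he => hp k _ (hm he)⟩
    rcases hJ with ⟨r, h1, h2, h3, hJ⟩ | ⟨h1, h2, hJ⟩
    · obtain ⟨H', L', hL', hJ', hloc, h⟩ := ih hL hJ hH hs
      exact ⟨H', L', hL', .inl ⟨r, h1, h2, h3, hJ'⟩, hloc, heff h⟩
    · obtain ⟨H', L', hL', hJ', hloc, h⟩ := ih hL hJ hH hs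
      exact ⟨H', L', hL', .inr ⟨h1, h2, hJ'⟩, hloc, heff h⟩
  | congr hc _ hc' ih =>
    intro w s D Θ L H hL hJ hH hs
    obtain ⟨H', L', hL', hJ', hloc, h⟩ := ih hL ((J_cong hc _ _ _ _ _ _).1 hJ) hH hs
    refine ⟨H', L', hL', (J_cong hc' _ _ _ _ _ _).1 hJ', hloc, ?_⟩
    unfold Effect at h ⊢
    rwa [hc.potential_eq, ← hc'.potential_eq]
  | @crashSel s' p q l d P F hd hF hF' =>
    intro w s D Θ L H hL hJ hH hs
    obtain ⟨p', U, S, T, v, hc, rfl, h1, hU, hsub, _⟩ := J_sel_closed hL hJ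
    cases hc
    -- At a prefix the judgement does not depend on the set of dead sessions, which may thus be
    -- taken to be empty.
    exact J_crash hJ (.inl (.inl rfl)) h1 hU (hsub.isSession_left hsub.2.1.sess_sel)
      hsub.not_done_sel hH hF hF'
  | @crashBrn s' p q n lab P F hF hF' =>
    intro w s D Θ L H hL hJ hH hs
    obtain ⟨p', U, S, T, hc, h1, hU, hsub, _⟩ := J_brn_closed hL hJ
    cases hc
    exact J_crash hJ (.inl rfl) h1 hU (hsub.isSession_left hsub.2.1.sess_brn)
      hsub.not_done_brn hH hF hF'
  | @lostVal b s' p q l v Q =>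
    intro w s D Θ L H hL hJ hH hs
    have hJ' := hJ
    obtain ⟨L₁, L₂, h1, h2, hsp⟩ := hJ'
    obtain ⟨q', V, S', T', v, hc', hv, _⟩ := J_sel_closed (hL.right hsp) h2
    cases hc'
    refine J_red_sync (.lost q p l _) (.rl (.leaf .dead) (.leaf .sel)) hL hJ hH hs fun m e he => ?_
    exact le_rfl
  | lostChan =>
    intro w s D Θ L H hL hJ hH hs
    obtain ⟨L₁, L₂, h1, h2, hsp⟩ := hJ
    obtain ⟨q', V, S', T', v, hc', hv, _⟩ := J_sel_closed (hL.right hsp) h2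
    cases hv
  | @detect b s' p q n lab P k hk =>
    intro w s D Θ L H hL hJ hH hs
    have hJ' := hJ
    obtain ⟨L₁, L₂, h1, h2, hsp⟩ := hJ'
    obtain ⟨p', U, S, T, hc, _⟩ := J_brn_closed (hL.left hsp) h1
    cases hc
    refine J_red_sync (.detect q p) (.lr (.leaf (hk ▸ .brn k .unit)) (.leaf .dead)) hL hJ hH hs
      fun m e he => ?_
    refine Nat.add_le_add ((Proc.potential_sub_le _ _ _ _).trans ?_) le_rfl
    exact Finset.single_le_sum (f := fun i => (P i).potential m e) (fun _ _ => Nat.zero_le _)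
      (Finset.mem_univ k)

end Typing

/-! ### Transitions of typing contexts as moves of one session -/

namespace Ctx

/-- The types of the endpoints of session `s`. -/
def conf (s : ℕ) (Γ : Ctx) : Conf := fun p => Γ (.ep s p)

/-- Replace the types of the endpoints of session `s`. -/
def withConf (s : ℕ) (Γ : Ctx) (H : Conf) : Ctx
  | .var x => Γ (.var x)
  | .ep s' p => if s' = s then H p else Γ (.ep s' p)

/-- Contexts with finite domain and well-formed types. -/
structure WF (Γ : Ctx) : Prop where
  fin : {c | Γ c ≠ none}.Finite
  ty : ∀ c U, Γ c = some U → U.TyWF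

@[simp] theorem conf_withConf (s : ℕ) (Γ : Ctx) (H : Conf) : (Γ.withConf s H).conf s = H := by
  funext p
  simp [conf, withConf]

theorem withConf_conf (s : ℕ) (Γ : Ctx) : Γ.withConf s (Γ.conf s) = Γ := by
  funext c
  rcases c with x | ⟨s', p⟩
  · rfl
  · by_cases h : s' = s
    · subst h; simp [conf, withConf]
    · simp [withConf, h]

theorem withConf_update (s : ℕ) (Γ : Ctx) (H : Conf) (p : Role) (u : Option Ty) :
    Γ.withConf s (Function.update H p u) = Function.update (Γ.withConf s H) (.ep s p) u := by
  funext c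
  rcases c with x | ⟨s', q⟩
  · simp [withConf]
  · by_cases h : s' = s
    · subst h
      by_cases hq : q = p
      · subst hq; simp [withConf]
      · simp [withConf, hq]
    · simp [withConf, h]

/-! ### Inversion of transitions -/

theorem set_ep {Γ : Ctx} {c : Chan} {U V : Ty} {c' : Chan} (hc : Γ c = none) (h : Γ c' = some V) :
    Γ.set c U c' = some V := by
  unfold set
  split
  · subst_vars; rw [hc] at h; cases h
  · exact h

theorem update_set {Γ : Ctx} {c c' : Chan} {U : Ty} {u : Option Ty} (h : c ≠ c') :
    set (Function.update Γ c' u) c U = Function.update (Γ.set c U) c' u := by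
  funext d
  unfold set
  by_cases hd : d = c
  · subst hd; simp [Function.update_of_ne h]
  · by_cases hd' : d = c'
    · subst hd'; simp [hd]
    · simp [hd, Function.update_of_ne hd']

theorem update_single (c : Chan) (U V : Ty) :
    Function.update (single c U) c (some V) = single c V := by
  funext d
  by_cases hd : d = c
  · subst hd; simp [single]
  · simp [single, hd]

theorem single_eq {c c' : Chan} {U V : Ty} (h : single c U c' = some V) : c' = c ∧ V = U := by
  unfold single at h
  split at h
  · exact ⟨‹_›, (Option.some.inj h).symm⟩
  · cases h

theorem step_out {Γ Γ' : Ctx} {α : Act} (h : Step Γ α Γ') : ∀ {s p q l S}, α = .out s p q l S →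
    ∃ T, Out (Γ.conf s) p q l S T ∧ Γ' = Function.update Γ (.ep s p) (some T) := by
  induction h with
  | @out s p q n lab S T k =>
    rintro _ _ _ _ _ ⟨⟩
    exact ⟨T k, ⟨_, n, lab, S, T, k, by simp [conf, single], .refl id, rfl, rfl, rfl⟩,
      (update_single _ _ _).symm⟩
  | @recur s p T α Γ' _ ih =>
    rintro _ _ _ _ _ rfl
    obtain ⟨T', ⟨U, n, lab, Ss, Ts, k, hU, hu, h1, h2, h3⟩, rfl⟩ := ih rfl
    obtain ⟨hc, rfl⟩ := single_eq hU
    cases hc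
    exact ⟨T', ⟨_, n, lab, Ss, Ts, k, by simp [conf, single], .step hu, h1, h2, h3⟩,
      by rw [update_single, update_single]⟩
  | @frame Γ α Γ' c U _ h h' ih =>
    rintro s p _ _ _ rfl
    obtain ⟨T', ⟨U', n, lab, Ss, Ts, k, hU, hu⟩, rfl⟩ := ih rfl
    have hc : c ≠ .ep s p := by rintro rfl; simp at h'
    exact ⟨T', ⟨U', n, lab, Ss, Ts, k, set_ep h hU, hu⟩, update_set hc⟩
  | _ => rintro _ _ _ _ _ ⟨⟩

theorem step_inp {Γ Γ' : Ctx} {α : Act} (h : Step Γ α Γ') : ∀ {s p q l S}, α = .inp s p q l S →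
    ∃ T, Inp (Γ.conf s) p q l S T ∧ Γ' = Function.update Γ (.ep s p) (some T) := by
  induction h with
  | @inp s p q n lab S T k =>
    rintro _ _ _ _ _ ⟨⟩
    exact ⟨T k, ⟨_, n, lab, S, T, k, by simp [conf, single], .refl id, rfl, rfl, rfl⟩,
      (update_single _ _ _).symm⟩
  | @recur s p T α Γ' _ ih =>
    rintro _ _ _ _ _ rfl
    obtain ⟨T', ⟨U, n, lab, Ss, Ts, k, hU, hu, h1, h2, h3⟩, rfl⟩ := ih rfl
    obtain ⟨hc, rfl⟩ := single_eq hU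
    cases hc
    exact ⟨T', ⟨_, n, lab, Ss, Ts, k, by simp [conf, single], .step hu, h1, h2, h3⟩,
      by rw [update_single, update_single]⟩
  | @frame Γ α Γ' c U _ h h' ih =>
    rintro s p _ _ _ rfl
    obtain ⟨T', ⟨U', n, lab, Ss, Ts, k, hU, hu⟩, rfl⟩ := ih rfl
    have hc : c ≠ .ep s p := by rintro rfl; simp at h'
    exact ⟨T', ⟨U', n, lab, Ss, Ts, k, set_ep h hU, hu⟩, update_set hc⟩
  | _ => rintro _ _ _ _ _ ⟨⟩

theorem ty_single {c : Chan} {T : Ty} (h : ∀ d U, single c (.mu T) d = some U → U.TyWF) :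
    ∀ d U, single c T.unfold d = some U → U.TyWF := by
  intro d U hd
  obtain ⟨rfl, rfl⟩ := single_eq hd
  exact Ty.TyWF.unfold (h d _ (by simp [single]))

/-- Well-formedness is essential: the rule for recursion would otherwise allow a recursive type that
unfolds to the crash type to signal that it has stopped. -/
theorem step_stopped {Γ Γ' : Ctx} {α : Act} (h : Step Γ α Γ') : ∀ {s p}, α = .stopped s p →
    (∀ c U, Γ c = some U → U.TyWF) → Γ.conf s p = some .crashed ∧ Γ' = Γ := by
  induction h with
  | stopped => rintro _ _ ⟨⟩ _; exact ⟨by simp [conf, single], rfl⟩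
  | @recur s p T α Γ' _ ih =>
    rintro _ _ rfl hw
    obtain ⟨hU, rfl⟩ := ih rfl (ty_single hw)
    obtain ⟨hc, hU⟩ := single_eq hU
    have := hw (.ep s p) (.mu T) (by simp [single])
    rcases this with (h | h) | h
    · exact h.elim
    · have := Ty.IsSession.unfold h
      rw [← hU] at this
      exact this.elim
    · cases h
  | @frame Γ α Γ' c U _ h h' ih =>
    rintro s p rfl hw
    obtain ⟨hU, rfl⟩ := ih rfl fun d V hd => hw d V (set_ep h hd)
    exact ⟨set_ep h hU, rfl⟩
  | _ => rintro _ _ ⟨⟩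

theorem Comp.left {Γ₁ Γ₂ Γ : Ctx} (h : Comp Γ₁ Γ₂ Γ) {c U} (hc : Γ₁ c = some U) :
    Γ c = some U ∧ Γ₂ c = none := by
  rcases h c with ⟨h1, h2⟩ | ⟨h1, h2⟩
  · rw [hc] at h1; cases h1
  · exact ⟨h2.trans hc, h1⟩

theorem Comp.symm {Γ₁ Γ₂ Γ : Ctx} (h : Comp Γ₁ Γ₂ Γ) : Comp Γ₂ Γ₁ Γ := fun c => (h c).symm

theorem Comp.right {Γ₁ Γ₂ Γ : Ctx} (h : Comp Γ₁ Γ₂ Γ) {c U} (hc : Γ₂ c = some U) :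
    Γ c = some U ∧ Γ₁ c = none := h.symm.left hc

theorem Comp.det {Γ₁ Γ₂ Γ Γ' : Ctx} (h : Comp Γ₁ Γ₂ Γ) (h' : Comp Γ₁ Γ₂ Γ') : Γ = Γ' := by
  funext c
  rcases h c with ⟨h1, h2⟩ | ⟨h1, h2⟩ <;> rcases h' c with ⟨h3, h4⟩ | ⟨h3, h4⟩ <;> simp_all

theorem Comp.update {Γ₁ Γ₂ Γ : Ctx} (h : Comp Γ₁ Γ₂ Γ) {c U} (hc : Γ₁ c = some U) (u : Option Ty) :
    Comp (Function.update Γ₁ c u) Γ₂ (Function.update Γ c u) := by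
  intro d
  by_cases hd : d = c
  · subst hd
    exact .inr ⟨(h.left hc).2, by simp⟩
  · rw [Function.update_of_ne hd, Function.update_of_ne hd]
    exact h d

/-- The action of a transition of `s` as a move, if it is a reduction or crash. -/
def _root_.MPST.Act.IsMove (s : ℕ) : Act → MAct → Prop
  | .comm s' p q l, α => s' = s ∧ α = .comm p q l
  | .crash s' p, α => s' = s ∧ α = .crash p
  | .detect s' q p, α => s' = s ∧ α = .detect q p
  | _, _ => False

theorem _root_.MPST.Conf.Out.comp {Γ₁ Γ₂ Γ : Ctx} (h : Comp Γ₁ Γ₂ Γ) {s p q l S T}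
    (ho : Out (Γ₁.conf s) p q l S T) : Out (Γ.conf s) p q l S T := by
  obtain ⟨U, n, lab, Ss, Ts, k, hU, h'⟩ := ho
  exact ⟨U, n, lab, Ss, Ts, k, (h.left hU).1, h'⟩

theorem _root_.MPST.Conf.Inp.comp {Γ₁ Γ₂ Γ : Ctx} (h : Comp Γ₁ Γ₂ Γ) {s p q l S T}
    (ho : Inp (Γ₁.conf s) p q l S T) : Inp (Γ.conf s) p q l S T := by
  obtain ⟨U, n, lab, Ss, Ts, k, hU, h'⟩ := ho
  exact ⟨U, n, lab, Ss, Ts, k, (h.left hU).1, h'⟩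

theorem Out.mem {H : Conf} {p q l S T} (h : Out H p q l S T) : ∃ U, H p = some U := by
  obtain ⟨U, n, lab, Ss, Ts, k, hU, h'⟩ := h
  exact ⟨U, hU⟩

theorem Inp.mem {H : Conf} {p q l S T} (h : Inp H p q l S T) : ∃ U, H p = some U := by
  obtain ⟨U, n, lab, Ss, Ts, k, hU, h'⟩ := h
  exact ⟨U, hU⟩

/-- The rules take a context apart and frame it. On partial maps this amounts to updating the
entries of the participants in place. -/
theorem step_move {Γ Γ' : Ctx} {α : Act} (h : Step Γ α Γ') : ∀ {s β}, α.IsMove s β →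
    (∀ c U, Γ c = some U → U.TyWF) → ∃ H', Move (Γ.conf s) β H' ∧ Γ' = Γ.withConf s H' := by
  have ty1 : ∀ {Γ₁ Γ₂ Γ : Ctx}, Comp Γ₁ Γ₂ Γ → (∀ c U, Γ c = some U → U.TyWF) →
      ∀ c U, Γ₁ c = some U → U.TyWF := fun hc h c U hU => h c U (hc.left hU).1
  induction h with
  | @comm Γ₁ Γ₁' Γ₂ Γ₂' Γ Γ' s p q l S S' h1 h2 hS hc hc' _ _ =>
    rintro _ _ ⟨rfl, rfl⟩ hw
    obtain ⟨T, ho, rfl⟩ := step_out h1 rfl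
    obtain ⟨T', hi, rfl⟩ := step_inp h2 rfl
    refine ⟨_, .comm (ho.comp hc) (hi.comp hc.symm) hS, ?_⟩
    rw [withConf_update, withConf_update, withConf_conf]
    obtain ⟨U, hU⟩ := Out.mem ho
    obtain ⟨V, hV⟩ := Inp.mem hi
    have h3 := (hc.update hU (some T)).symm.update hV (some T')
    exact hc'.symm.det h3
  | @lost Γ₁ Γ₁' Γ₂ Γ₂' Γ Γ' s p q l S h1 h2 hc hc' _ _ =>
    rintro _ _ ⟨rfl, rfl⟩ hw
    obtain ⟨T, ho, rfl⟩ := step_out h1 rfl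
    obtain ⟨hq, rfl⟩ := step_stopped h2 rfl (ty1 hc.symm hw)
    refine ⟨_, .lost (ho.comp hc) (hc.right hq).1, ?_⟩
    rw [withConf_update, withConf_conf]
    obtain ⟨U, hU⟩ := Out.mem ho
    exact hc'.det (hc.update hU _)
  | @detect Γ₁ Γ₁' Γ₂ Γ₂' Γ Γ' s p q h1 h2 hc hc' _ _ =>
    rintro _ _ ⟨rfl, rfl⟩ hw
    obtain ⟨T, hi, rfl⟩ := step_inp h1 rfl
    obtain ⟨hq, rfl⟩ := step_stopped h2 rfl (ty1 hc.symm hw)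
    refine ⟨_, .detect (hi.comp hc) (hc.right hq).1, ?_⟩
    rw [withConf_update, withConf_conf]
    obtain ⟨U, hU⟩ := Inp.mem hi
    exact hc'.det (hc.update hU _)
  | @crash s p T hT hd =>
    rintro _ _ ⟨rfl, rfl⟩ hw
    refine ⟨_, .crash (T := T) (by simp [conf, single]) hT hd, ?_⟩
    rw [withConf_update, withConf_conf, update_single]
  | @recur s p T α Γ' _ ih =>
    intro s' β hm hw
    obtain ⟨H', hm', rfl⟩ := ih hm (ty_single hw)
    have hs : ∀ {r U}, (single (.ep s p) T.unfold).conf s' r = some U → s' = s ∧ r = p ∧ U = T.unfold := by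
      intro r U h
      obtain ⟨h1, h2⟩ := single_eq h
      cases h1
      exact ⟨rfl, rfl, h2⟩
    -- The rule for recursion acts on a single endpoint, which cannot be both partners of an
    -- interaction. Only a crash is possible.
    cases hm' with
    | comm ho hi _ =>
      obtain ⟨U, hU⟩ := Out.mem ho
      obtain ⟨V, hV⟩ := Inp.mem hi
      obtain ⟨rfl, rfl, _⟩ := hs hU
      obtain ⟨_, rfl, _⟩ := hs hV
      exact (ho.not_inp hi).elim
    | lost ho hi =>
      obtain ⟨U, hU⟩ := Out.mem ho
      obtain ⟨rfl, rfl, _⟩ := hs hU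
      obtain ⟨_, rfl, _⟩ := hs hi
      exact (ho.not_crashed hi).elim
    | detect ho hi =>
      obtain ⟨U, hU⟩ := Inp.mem ho
      obtain ⟨rfl, rfl, _⟩ := hs hU
      obtain ⟨_, rfl, _⟩ := hs hi
      exact (ho.not_crashed hi).elim
    | @crash p' T' hU hT hd =>
      obtain ⟨rfl, rfl, rfl⟩ := hs hU
      have hw' := hw (.ep s' p') (.mu T) (by simp [single])
      refine ⟨_, .crash (p := p') (T := .mu T) (by simp [conf, single]) ?_ fun h => hd ?_, ?_⟩
      · rcases hw' with (h | h) | h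
        · exact h.elim
        · exact h
        · cases h
      · have := h.unf_done
        cases this with
        | step h => exact Ty.Sub.of_unf_done (.inl (.inr hT)) h
      · rw [withConf_update, withConf_update, withConf_conf, withConf_conf, update_single, update_single]
  | @frame Γ α Γ' c U _ h h' ih =>
    intro s β hm hw
    obtain ⟨H', hm', rfl⟩ := ih hm fun d V hd => hw d V (set_ep h hd)
    have hs : ∀ {p V}, Γ.conf s p = some V → (Γ.set c U).conf s p = some V := fun hV => set_ep h hV
    have hne : ∀ {p V}, Γ.conf s p = some V → c ≠ .ep s p := by
      rintro p V hV rfl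
      rw [conf, h] at hV
      cases hV
    have hout : ∀ {p q l S T}, Out (Γ.conf s) p q l S T → Out ((Γ.set c U).conf s) p q l S T := by
      rintro p q l S T ⟨V, n, lab, Ss, Ts, k, hV, h⟩
      exact ⟨V, n, lab, Ss, Ts, k, hs hV, h⟩
    have hinp : ∀ {p q l S T}, Inp (Γ.conf s) p q l S T → Inp ((Γ.set c U).conf s) p q l S T := by
      rintro p q l S T ⟨V, n, lab, Ss, Ts, k, hV, h⟩
      exact ⟨V, n, lab, Ss, Ts, k, hs hV, h⟩
    cases hm' with
    | comm ho hi hS =>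
      obtain ⟨_, hU⟩ := Out.mem ho
      obtain ⟨_, hV⟩ := Inp.mem hi
      refine ⟨_, .comm (hout ho) (hinp hi) hS, ?_⟩
      simp only [withConf_update, withConf_conf, update_set (hne hU), update_set (hne hV)]
    | lost ho hi =>
      obtain ⟨_, hU⟩ := Out.mem ho
      refine ⟨_, .lost (hout ho) (hs hi), ?_⟩
      simp only [withConf_update, withConf_conf, update_set (hne hU)]
    | detect ho hi =>
      obtain ⟨_, hU⟩ := Inp.mem ho
      refine ⟨_, .detect (hinp ho) (hs hi), ?_⟩
      simp only [withConf_update, withConf_conf, update_set (hne hU)]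
    | crash hU hT hd =>
      refine ⟨_, .crash (hs hU) hT hd, ?_⟩
      simp only [withConf_update, withConf_conf, update_set (hne hU)]
  | _ => rintro _ _ ⟨⟩

/-! ### Construction of transitions -/

theorem step_unf {U H : Ty} (h : Ty.Unf U H) {s p α Γ'} (h' : Step (single (.ep s p) H) α Γ') :
    Step (single (.ep s p) U) α Γ' := by
  induction h with
  | refl => exact h'
  | step _ ih => exact .recur (ih h')

/-- The framing rule adds one entry at a time, so a context can be framed only if its domain is
finite. This is the purpose of the finiteness condition in `Ctx.WF`. -/
theorem step_frame {Γ₁ Γ₁' : Ctx} {α : Act} (h : Step Γ₁ α Γ₁') (F : Finset Chan) :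
    ∀ {Γ₀ Γ Γ' : Ctx}, (∀ c, Γ₀ c ≠ none → c ∈ F) → Comp Γ₁ Γ₀ Γ → Comp Γ₁' Γ₀ Γ' →
      Step Γ α Γ' := by
  induction F using Finset.induction_on with
  | empty =>
    intro Γ₀ Γ Γ' hF hc hc'
    have h0 : ∀ c, Γ₀ c = none := fun c => by
      by_contra hc
      exact absurd (hF c hc) (by simp)
    have e1 : Γ = Γ₁ := by
      funext c
      rcases hc c with ⟨h1, h2⟩ | ⟨_, h2⟩
      · rw [h2, h1, h0]
      · exact h2
    have e2 : Γ' = Γ₁' := by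
      funext c
      rcases hc' c with ⟨h1, h2⟩ | ⟨_, h2⟩
      · rw [h2, h1, h0]
      · exact h2
    rw [e1, e2]
    exact h
  | insert c F _ ih =>
    intro Γ₀ Γ Γ' hF hc hc'
    by_cases h0 : Γ₀ c = none
    · refine ih (fun d hd => ?_) hc hc'
      rcases Finset.mem_insert.1 (hF d hd) with rfl | h
      · exact absurd h0 hd
      · exact h
    · obtain ⟨U, hU⟩ := Option.ne_none_iff_exists'.1 h0
      have key : ∀ {Γ₁ Γ : Ctx}, Comp Γ₁ Γ₀ Γ →
          Comp Γ₁ (Function.update Γ₀ c none) (Function.update Γ c none) ∧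
            set (Function.update Γ c none) c U = Γ := by
        intro Γ₁ Γ hc
        constructor
        · intro d
          by_cases hd : d = c
          · subst hd
            exact .inl ⟨(hc.right hU).2, by simp⟩
          · rw [Function.update_of_ne hd, Function.update_of_ne hd]
            exact hc d
        · funext d
          by_cases hd : d = c
          · subst hd; simp [set, (hc.right hU).1]
          · simp [set, hd]
      have h3 := ih (Γ₀ := Function.update Γ₀ c none) (fun d hd => ?_) (key hc).1 (key hc').1
      · have := h3.frame (c := c) (U := U) (by simp) (by simp)
        rwa [(key hc).2, (key hc').2] at this
      · by_cases hdc : d = c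
        · subst hdc; simp at hd
        · rw [Function.update_of_ne hdc] at hd
          exact (Finset.mem_insert.1 (hF d hd)).resolve_left hdc

theorem comp_single (Γ : Ctx) (c : Chan) (V : Ty) :
    Comp (single c V) (Function.update Γ c none) (Function.update Γ c (some V)) := by
  intro d
  by_cases hd : d = c
  · subst hd; exact .inr ⟨by simp, by simp [single]⟩
  · exact .inl ⟨by simp [single, hd], by simp [hd]⟩

theorem comp_single_self {Γ : Ctx} {c : Chan} {V : Ty} (h : Γ c = some V) :
    Comp (single c V) (Function.update Γ c none) Γ := by
  have := comp_single Γ c V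
  rwa [← h, Function.update_eq_self] at this

theorem fin_update {Γ : Ctx} (h : {c | Γ c ≠ none}.Finite) (c : Chan) (u : Option Ty) :
    {d | Function.update Γ c u d ≠ none}.Finite := by
  refine (h.insert c).subset fun d hd => ?_
  by_cases hdc : d = c
  · exact .inl hdc
  · refine .inr ?_
    simpa [hdc] using hd

theorem step_local {Γ : Ctx} (hf : {c | Γ c ≠ none}.Finite) {s p} {U T : Ty} {α : Act}
    (hU : Γ (.ep s p) = some U) (h : Step (single (.ep s p) U) α (single (.ep s p) T)) :
    Step Γ α (Function.update Γ (.ep s p) (some T)) :=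
  step_frame h (fin_update hf (.ep s p) none).toFinset (fun c hc => by simpa using hc)
    (comp_single_self hU) (comp_single _ _ _)

theorem step_of_out {Γ : Ctx} (hf : {c | Γ c ≠ none}.Finite) {s p q l S T}
    (h : Out (Γ.conf s) p q l S T) :
    Step Γ (.out s p q l S) (Function.update Γ (.ep s p) (some T)) := by
  obtain ⟨U, n, lab, Ss, Ts, k, hU, hu, rfl, rfl, rfl⟩ := h
  exact step_local hf hU (step_unf hu (.out k))

theorem step_of_inp {Γ : Ctx} (hf : {c | Γ c ≠ none}.Finite) {s p q l S T}
    (h : Inp (Γ.conf s) p q l S T) :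
    Step Γ (.inp s p q l S) (Function.update Γ (.ep s p) (some T)) := by
  obtain ⟨U, n, lab, Ss, Ts, k, hU, hu, rfl, rfl, rfl⟩ := h
  exact step_local hf hU (step_unf hu (.inp k))

theorem step_of_crashed {Γ : Ctx} (hf : {c | Γ c ≠ none}.Finite) {s p}
    (h : Γ.conf s p = some .crashed) : Step Γ (.stopped s p) Γ := by
  have := step_local hf h .stopped
  rwa [show some Ty.crashed = Γ (.ep s p) from h.symm, Function.update_eq_self] at this

/-- The action of session `s` that corresponds to a move. -/
def _root_.MPST.MAct.act (s : ℕ) : MAct → Act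
  | .comm p q l => .comm s p q l
  | .detect q p => .detect s q p
  | .crash p => .crash s p

/-- In an interaction one participant is isolated as a singleton and the partner acts in the
remaining context, where its entry is still present because the two roles differ. -/
theorem step_of_move {Γ : Ctx} (hf : {c | Γ c ≠ none}.Finite) {s β H'}
    (h : Move (Γ.conf s) β H') : Step Γ (β.act s) (Γ.withConf s H') := by
  cases h with
  | @comm p q l S S' T T' ho hi hS =>
    have hne : q ≠ p := by rintro rfl; exact ho.not_inp hi
    obtain ⟨U, n, lab, Ss, Ts, k, hU, hu, rfl, rfl, rfl⟩ := ho
    obtain ⟨V, n', lab', Ss', Ts', k', hV, hu', h1, rfl, rfl⟩ := hi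
    have hV' : (Function.update Γ (.ep s p) none : Ctx) (.ep s q) = some V := by
      rw [Function.update_of_ne (by simpa using hne)]; exact hV
    refine Step.comm (step_unf hu (.out k))
      (step_of_inp (fin_update hf _ none) (Γ := Function.update Γ (.ep s p) none)
        ⟨V, n', lab', Ss', Ts', k', hV', hu', h1, rfl, rfl⟩) hS (comp_single_self hU) ?_
    rw [withConf_update, withConf_update, withConf_conf]
    exact ((comp_single Γ (.ep s p) (Ts k)).symm.update hV' _).symm
  | @lost p q l S T ho hi =>
    have hne : q ≠ p := by rintro rfl; exact ho.not_crashed hi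
    obtain ⟨U, n, lab, Ss, Ts, k, hU, hu, rfl, rfl, rfl⟩ := ho
    have hV' : (Function.update Γ (.ep s p) none : Ctx) (.ep s q) = some .crashed := by
      rw [Function.update_of_ne (by simpa using hne)]; exact hi
    refine Step.lost (step_unf hu (.out k))
      (step_of_crashed (fin_update hf _ none) (Γ := Function.update Γ (.ep s p) none) hV')
      (comp_single_self hU) ?_
    rw [withConf_update, withConf_conf]
    exact comp_single _ _ _
  | @detect p q T ho hi =>
    have hne : p ≠ q := by rintro rfl; exact ho.not_crashed hi
    obtain ⟨U, n, lab, Ss, Ts, k, hU, hu, h1, h2, rfl⟩ := ho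
    have hV' : (Function.update Γ (.ep s q) none : Ctx) (.ep s p) = some .crashed := by
      rw [Function.update_of_ne (by simpa using hne)]; exact hi
    have h3 := Step.inp (s := s) (p := q) (q := p) (lab := lab) (S := Ss) (T := Ts) k
    rw [h1, h2] at h3
    refine Step.detect (step_unf hu h3)
      (step_of_crashed (fin_update hf _ none) (Γ := Function.update Γ (.ep s q) none) hV')
      (comp_single_self hU) ?_
    rw [withConf_update, withConf_conf]
    exact comp_single _ _ _
  | crash hU hT hd =>
    rw [withConf_update, withConf_conf]
    exact step_local hf hU (.crash hT hd)

theorem _root_.MPST.MAct.act_isMove (s : ℕ) (β : MAct) : (β.act s).IsMove s β := by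
  cases β <;> exact ⟨rfl, rfl⟩

/-! ### Capabilities, reductions and safety in terms of moves -/

theorem can_out {Γ : Ctx} (hw : Γ.WF) {s p q l S} :
    Γ.Can (.out s p q l S) ↔ ∃ T, Out (Γ.conf s) p q l S T :=
  ⟨fun ⟨_, h⟩ => (step_out h rfl).imp fun _ h => h.1, fun ⟨_, h⟩ => ⟨_, step_of_out hw.fin h⟩⟩

theorem can_inp {Γ : Ctx} (hw : Γ.WF) {s p q l S} :
    Γ.Can (.inp s p q l S) ↔ ∃ T, Inp (Γ.conf s) p q l S T :=
  ⟨fun ⟨_, h⟩ => (step_inp h rfl).imp fun _ h => h.1, fun ⟨_, h⟩ => ⟨_, step_of_inp hw.fin h⟩⟩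

theorem can_stopped {Γ : Ctx} (hw : Γ.WF) {s p} :
    Γ.Can (.stopped s p) ↔ Γ.conf s p = some .crashed :=
  ⟨fun ⟨_, h⟩ => (step_stopped h rfl hw.ty).1, fun h => ⟨_, step_of_crashed hw.fin h⟩⟩

theorem can_move {Γ : Ctx} (hw : Γ.WF) {s β} :
    Γ.Can (β.act s) ↔ ∃ H', Move (Γ.conf s) β H' :=
  ⟨fun ⟨_, h⟩ => (step_move h (β.act_isMove s) hw.ty).imp fun _ h => h.1,
    fun ⟨_, h⟩ => ⟨_, step_of_move hw.fin h⟩⟩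

theorem step_iff {Γ Γ' : Ctx} (hw : Γ.WF) {s β} :
    Step Γ (β.act s) Γ' ↔ ∃ H', Move (Γ.conf s) β H' ∧ Γ' = Γ.withConf s H' :=
  ⟨fun h => step_move h (β.act_isMove s) hw.ty,
    fun ⟨_, h, h'⟩ => h' ▸ step_of_move hw.fin h⟩

/-- Moves preserve well-formedness of contexts. -/
theorem WF.move {Γ : Ctx} (hw : Γ.WF) {s β H'} (h : Move (Γ.conf s) β H') : (Γ.withConf s H').WF := by
  have hout : ∀ {p q l S T}, Out (Γ.conf s) p q l S T → T.TyWF := by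
    rintro p q l S T ⟨U, n, lab, Ss, Ts, k, hU, hu, rfl, rfl, rfl⟩
    exact .inl (.inr (((hw.ty _ _ hU).unf hu).sess_sel.2.2.2 k))
  have hinp : ∀ {p q l S T}, Inp (Γ.conf s) p q l S T → T.TyWF := by
    rintro p q l S T ⟨U, n, lab, Ss, Ts, k, hU, hu, rfl, rfl, rfl⟩
    exact .inl (.inr (((hw.ty _ _ hU).unf hu).sess_brn.2.2.2 k))
  have hupd : ∀ {Δ : Ctx}, Δ.WF → ∀ c {T}, T.TyWF → WF (Function.update Δ c (some T)) := by
    intro Δ hΔ c T hT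
    refine ⟨fin_update hΔ.fin _ _, fun d U hd => ?_⟩
    by_cases hdc : d = c
    · subst hdc
      simp only [Function.update_self, Option.some.injEq] at hd
      exact hd ▸ hT
    · rw [Function.update_of_ne hdc] at hd
      exact hΔ.ty _ _ hd
  cases h with
  | comm ho hi _ =>
    simp only [withConf_update, withConf_conf]
    exact hupd (hupd hw _ (hout ho)) _ (hinp hi)
  | lost ho _ =>
    simp only [withConf_update, withConf_conf]
    exact hupd hw _ (hout ho)
  | detect ho _ =>
    simp only [withConf_update, withConf_conf]
    exact hupd hw _ (hinp ho)
  | crash _ _ _ =>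
    simp only [withConf_update, withConf_conf]
    exact hupd hw _ (.inr rfl)

theorem redOn_iff {Γ Γ' : Ctx} (hw : Γ.WF) {s R} : RedOn s R Γ Γ' ↔
    ∃ β H', Move (Γ.conf s) β H' ∧ Γ' = Γ.withConf s H' ∧ ∀ p, β = .crash p → p ∉ R := by
  constructor
  · rintro (⟨q, r, l, h⟩ | ⟨q, r, h⟩ | ⟨p, hp, h⟩)
    · obtain ⟨H', h⟩ := (step_iff hw (β := .comm q r l)).1 h
      exact ⟨_, H', h.1, h.2, fun _ h => by cases h⟩
    · obtain ⟨H', h⟩ := (step_iff hw (β := .detect q r)).1 h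
      exact ⟨_, H', h.1, h.2, fun _ h => by cases h⟩
    · obtain ⟨H', h⟩ := (step_iff hw (β := .crash p)).1 h
      exact ⟨_, H', h.1, h.2, fun _ h => by cases h; exact hp⟩
  · rintro ⟨β, H', h, rfl, h'⟩
    have := step_of_move hw.fin h
    cases β with
    | comm p q l => exact .inl ⟨p, q, l, this⟩
    | detect p q => exact .inr (.inl ⟨p, q, this⟩)
    | crash p => exact .inr (.inr ⟨p, h' p rfl, this⟩)

theorem WF.redOn {Γ Γ' : Ctx} (hw : Γ.WF) {s R} (h : RedOn s R Γ Γ') : Γ'.WF := by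
  obtain ⟨β, H', hm, rfl, _⟩ := (redOn_iff hw).1 h
  exact hw.move hm

theorem Safe.redOn {Γ Γ' : Ctx} {s R} (h : Γ.Safe s R) (h' : RedOn s R Γ Γ') : Γ'.Safe s R := by
  obtain ⟨φ, hφ, hΓ⟩ := h
  exact ⟨φ, hφ, hφ.move _ hΓ _ h'⟩

theorem Safe.now {Γ : Ctx} (hw : Γ.WF) {s R} (h : Γ.Safe s R) : SafeNow (Γ.conf s) := by
  obtain ⟨φ, hφ, hΓ⟩ := h
  refine ⟨fun ho hi => ?_, fun hc hi => ?_⟩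
  · exact (can_move hw (β := .comm _ _ _)).1
      (hφ.comm Γ hΓ _ _ _ _ _ _ ((can_out hw).2 ⟨_, ho⟩) ((can_inp hw).2 ⟨_, hi⟩))
  · exact (can_move hw (β := .detect _ _)).1
      (hφ.crash Γ hΓ _ _ _ _ ((can_stopped hw).2 hc) ((can_inp hw).2 ⟨_, hi⟩))

end Ctx

/-! ## From the typing judgement to the linear judgement -/

/-- The channel that denotes a resource. -/
def Key.chan (s : ℕ) : Key → Chan
  | .role p => .ep s p
  | .var x => .var x

theorem Key.chan_inj {s : ℕ} {k k' : Key} (h : k.chan s = k'.chan s) : k = k' := by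
  rcases k with p | x <;> rcases k' with q | y <;> cases h <;> rfl

/-- The linear resources of a typing context. -/
noncomputable def Ctx.lin (s : ℕ) (Γ : Ctx) : LCtx := fun k => (Γ (k.chan s)).bind Ty.lin

/-- An entry that is allowed by `end(·)`. -/
def EndEntry (c : Chan) (U : Ty) : Prop := ((∃ x, c = .var x) ∧ U.IsBasic) ∨ U.Sub .done

theorem EndEntry.lin {c U} (h : EndEntry c U) : U.lin = none :=
  Ty.lin_eq_none.2 (h.imp And.right id)

/-- All entries for sessions other than `s` are allowed by `end(·)`. -/
def Ctx.Only (s : ℕ) (Γ : Ctx) : Prop := ∀ s' q U, s' ≠ s → Γ (.ep s' q) = some U → U.Sub .done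

namespace Ctx

theorem lin_nil {s : ℕ} {Γ : Ctx} (h : ∀ c U, Γ c = some U → EndEntry c U) : Γ.lin s = LCtx.nil := by
  funext k
  cases hk : Γ (k.chan s) with
  | none => simp [lin, hk, LCtx.nil]
  | some U => simp [lin, hk, LCtx.nil, (h _ _ hk).lin]

theorem Comp.split {Γ₁ Γ₂ Γ : Ctx} (h : Comp Γ₁ Γ₂ Γ) (s : ℕ) :
    LCtx.Split (Γ₁.lin s) (Γ₂.lin s) (Γ.lin s) := by
  intro k
  rcases h (k.chan s) with ⟨h1, h2⟩ | ⟨h1, h2⟩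
  · exact .inl (by simp [lin, h1, h2])
  · exact .inr (by simp [lin, h1, h2])

theorem lin_set (s : ℕ) (Γ : Ctx) (k : Key) (U : Ty) :
    (Γ.set (k.chan s) U).lin s = (Γ.lin s).upd k U.lin := by
  funext k'
  by_cases hk : k' = k
  · subst hk; simp [lin, set]
  · rw [LCtx.upd_ne _ _ hk]
    have : k'.chan s ≠ k.chan s := fun h => hk (Key.chan_inj h)
    simp [lin, set, this]

theorem lin_single (s : ℕ) (k : Key) (U : Ty) :
    (single (k.chan s) U).lin s = LCtx.nil.upd k U.lin := lin_set s empty k U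

theorem Comp.right_eq {Γ₁ Γ₂ Γ : Ctx} (h : Comp Γ₁ Γ₂ Γ) {c U} (hc : Γ c = some U) :
    Γ₁ c = some U ∨ Γ₂ c = some U := by
  rcases h c with ⟨_, h2⟩ | ⟨_, h2⟩
  · exact .inr (h2 ▸ hc)
  · exact .inl (h2 ▸ hc)

end Ctx

/-- The conditions under which `Γ` describes the resources of a single role `p` in session `s`. -/
structure Ctx.SingleRole (s : ℕ) (p : Role) (Δ : VSet) (Γ : Ctx) : Prop where
  only : Γ.Only s
  own : ∀ q, Γ.lin s (.role q) ≠ none → q = p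
  basic : ∀ x S, Γ (.var x) = some S → S.IsBasic → Δ x

theorem Ctx.SingleRole.sub {s p Δ} {Γ Γ' : Ctx} (h : Γ.SingleRole s p Δ)
    (hs : ∀ c U, Γ' c = some U → Γ c = some U) : Γ'.SingleRole s p Δ := by
  refine ⟨fun s' q U hne hU => h.only s' q U hne (hs _ _ hU), fun q hq => h.own q ?_,
    fun x S hx => h.basic x S (hs _ _ hx)⟩
  simp only [Ctx.lin] at hq ⊢
  cases hU : Γ' (Key.chan s (.role q)) with
  | none => simp [hU] at hq
  | some U => rw [hs _ _ hU]; rwa [hU] at hq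

theorem Ctx.SingleRole.left {s p Δ} {Γ₁ Γ₂ Γ : Ctx} (h : Γ.SingleRole s p Δ) (hs : Ctx.Comp Γ₁ Γ₂ Γ) :
    Γ₁.SingleRole s p Δ := h.sub fun _ _ hc => (hs.left hc).1

theorem Ctx.SingleRole.right {s p Δ} {Γ₁ Γ₂ Γ : Ctx} (h : Γ.SingleRole s p Δ) (hs : Ctx.Comp Γ₁ Γ₂ Γ) :
    Γ₂.SingleRole s p Δ := h.sub fun _ _ hc => (hs.right hc).1

theorem Ctx.SingleRole.chan {s p Δ} {Γ : Ctx} (h : Γ.SingleRole s p Δ) {c U} (hc : Γ c = some U)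
    (hd : ¬ U.Sub .done) : ∃ k, c.key s = some k ∧ k.chan s = c := by
  rcases c with x | ⟨s', q⟩
  · exact ⟨_, rfl, rfl⟩
  · by_cases hs : s' = s
    · exact ⟨.role q, by simp [Chan.key, hs], by simp [Key.chan, hs]⟩
    · exact absurd (h.only _ _ _ hs hc) hd

theorem PayTyped.sub_chan {Γ : Ctx} {c : Chan} {S : Ty} (h : PayTyped Γ (.chan c) S) :
    ∃ S₀, c.PaySort S₀ ∧ S₀.Sub S ∧ Γ = Ctx.single c S₀ := by
  cases h with
  | chan h1 h2 => exact ⟨_, h1, h2, rfl⟩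

theorem Chan.PaySort.tyWF {c : Chan} {S : Ty} (h : c.PaySort S) : S.TyWF := by
  cases c with
  | var x => exact .inl h
  | ep s p => exact .inl (.inr h)

theorem Chan.PaySort.not_crashed {c : Chan} {S : Ty} (h : c.PaySort S) : S ≠ .crashed := by
  rintro rfl
  cases c with
  | var x => exact h.elim id id
  | ep s p => exact h

/-- A payload whose type is not ended has an unended type in the context as well. If it is an
endpoint, it belongs to the live session, since all other sessions are ended. -/
theorem PayTyped.payJ {s p Δ} {Γ : Ctx} {d S} (h : PayTyped Γ d S) (hd : ¬ S.Sub .done)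
    (hΓ : Γ.SingleRole s p Δ) : PayJ s Δ (Γ.lin s) d S := by
  cases h with
  | val h => exact .inl ⟨trivial, Ctx.lin_nil (fun _ _ h => (nomatch h)), .inl ⟨_, rfl⟩⟩
  | @chan c S₀ _ h1 h2 =>
    have hc : Ctx.single c S₀ c = some S₀ := by simp [Ctx.single]
    have hd₀ : ¬ S₀.Sub .done := fun h => hd (h2.done_up h)
    obtain ⟨k, hk, rfl⟩ := hΓ.chan hc hd₀
    rw [Ctx.lin_single]
    by_cases hb : S.IsBasic
    · have hb₀ := h2.isBasic_left hb
      refine .inl ⟨hb, ?_, .inr ?_⟩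
      · rw [Ty.lin_eq_none.2 (.inl hb₀)]
        funext k'
        by_cases hk : k' = k
        · subst hk; simp [LCtx.nil]
        · rw [LCtx.upd_ne _ _ hk]
      · rcases k with q | x
        · exact absurd h1 hb₀.not_session
        · exact ⟨x, rfl, hΓ.basic x S₀ hc hb₀⟩
    · have hb₀ : ¬ S₀.IsBasic := fun h => hb (h2.isBasic h)
      rw [Ty.lin_eq_some.2 ⟨rfl, hb₀, hd₀⟩]
      refine .inr ⟨_, k, S₀, rfl, hk, ?_, hd, h2, rfl⟩
      rcases h2.2.1 with (h | h) | h
      · exact absurd h hb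
      · exact h
      · exact absurd (Ty.Sub.eq_crashed (h ▸ h2)) h1.not_crashed

theorem ArgsTyped.argsJ {s p Δ} {Γ : Ctx} {ds Ss} (h : ArgsTyped Γ ds Ss) :
    Γ.SingleRole s p Δ → ArgsJ s Δ (Γ.lin s) ds Ss := by
  induction h with
  | nil h => intro _; exact Ctx.lin_nil h.2
  | cons h1 h2 _ hc ih =>
    intro hΓ
    exact ⟨_, _, h1.payJ h2 (hΓ.left hc), ih (hΓ.right hc), hc.split s⟩

theorem Ctx.lin_ofParams (s : ℕ) (Ss : List Ty) : (Ctx.ofParams Ss).lin s = LCtx.params Ss := by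
  funext k
  cases k <;> rfl

theorem Ctx.lin_consSession (s : ℕ) (A : Role → Option Ty) (Γ : Ctx) :
    (Ctx.consSession A Γ).lin (s + 1) = Γ.lin s := by
  funext k
  cases k <;> rfl

theorem Ctx.lin_consVar (s : ℕ) (S : Ty) (Γ : Ctx) :
    (Ctx.consVar S Γ).lin s = LCtx.cons S (Γ.lin s) := by
  funext k
  rcases k with p | _ | x <;> rfl

theorem Ctx.SingleRole.set {s p Δ} {Γ₀ Γ₁ Γ : Ctx} (h : Γ.SingleRole s p Δ) {k : Key} {S₀ T : Ty}
    (hΓ : Ctx.Comp Γ₀ Γ₁ Γ) (h1 : Γ₁ = Ctx.single (k.chan s) S₀) (hb : ¬ S₀.IsBasic)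
    (hd : ¬ S₀.Sub .done) (hT : T.IsSession) : (Γ₀.set (k.chan s) T).SingleRole s p Δ := by
  have hk : Γ (k.chan s) = some S₀ := (hΓ.right (h1 ▸ by simp [Ctx.single])).1
  refine ⟨fun s' q U hne hU => ?_, fun q hq => ?_, fun x S hx hS => ?_⟩
  · have : Chan.ep s' q ≠ k.chan s := by rintro h'; cases k <;> cases h'; exact hne rfl
    simp only [Ctx.set, this, if_false] at hU
    exact h.only s' q U hne (hΓ.left hU).1
  · rw [Ctx.lin_set] at hq
    by_cases hqk : Key.role q = k
    · subst hqk
      refine h.own q ?_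
      simp only [Ctx.lin, hk, Option.bind_some]
      rw [Ty.lin_eq_some.2 ⟨rfl, hb, hd⟩]
      simp
    · rw [LCtx.upd_ne _ _ hqk] at hq
      exact (h.left hΓ).own q hq
  · by_cases hxk : Chan.var x = k.chan s
    · simp only [Ctx.set, hxk, if_true, Option.some.injEq] at hx
      exact absurd (hx ▸ hT) hS.not_session
    · simp only [Ctx.set, hxk, if_false] at hx
      exact (h.left hΓ).basic x S hx hS

/-- Processes that play a single role satisfy the linear judgement. -/
theorem Typed.toJ {g : Prop} {p : Role} {Θ Γ P} (h : Typed Θ Γ P) :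
    ∀ {s : ℕ} {D : VSet} {Θ' : TEnv} {Δ : VSet}, P.GuardedDefs → P.EndRestrictions →
      (g → P.GuardedRec) → Γ.SingleRole s p Δ → (∀ X Ss, Θ[X]? = some Ss → Θ' X p Ss) →
      J g p s D Θ' Δ (Γ.lin s) P := by
  have own : ∀ {s Δ} {Γ : Ctx}, Γ.SingleRole s p Δ → (Γ.lin s).Own p p := fun h =>
    ⟨h.own, fun _ _ => rfl⟩
  have only : ∀ {Θ : List (List Ty)} {Θ' : TEnv}, (∀ X Ss, Θ[X]? = some Ss → Θ' X p Ss) →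
      ∀ X Ss, Θ[X]? = some Ss → TEnv.only p Θ' X p Ss := fun h X Ss hX => ⟨h X Ss hX, rfl⟩
  have ext : ∀ {Θ : List (List Ty)} {Θ' : TEnv} {Ss : List Ty}, (∀ X Ss, Θ[X]? = some Ss → Θ' X p Ss) →
      ∀ X Ss', (Ss :: Θ)[X]? = some Ss' → (scons (entry p Ss) Θ' : TEnv) X p Ss' := by
    intro Θ Θ' Ss h X Ss' hX
    cases X with
    | zero => cases hX; exact ⟨rfl, rfl⟩
    | succ X => exact h X Ss' hX
  induction h with
  | nil h => intro s D Θ' Δ _ _ _ hΓ _; exact Ctx.lin_nil h.2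
  | call hX h =>
    intro s D Θ' Δ _ _ _ hΓ hΘ
    exact ⟨p, _, hΘ _ _ hX, own hΓ, h.argsJ hΓ⟩
  | @defn Θ Γ Ss Q P _ _ ihQ ihP =>
    rintro s D Θ' Δ ⟨h1, h2, h3⟩ ⟨h4, h5⟩ h6 hΓ hΘ
    refine .inl ⟨p, h1, fun hg => Proc.guardedBody_of_not_hasEarlyCall (h6 hg).1, ?_,
      ihP h3 h5 (fun hg => (h6 hg).2.2) hΓ (ext hΘ)⟩
    rw [← Ctx.lin_ofParams s]
    exact ihQ h2 h4 (fun hg => (h6 hg).2.1) ⟨fun _ _ _ _ h => (nomatch h), fun q hq => absurd rfl hq,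
      fun x S hx hS => ⟨S, hx, hS⟩⟩ (ext (only hΘ))
  | @brn Θ Γ₀ Γ₁ Γ c q n lab S T P hc _ hΓ' ih =>
    intro s D Θ' Δ h1 h2 h3 hΓ hΘ
    obtain ⟨S₀, hS₀, hsub, hΓ₁⟩ := hc.sub_chan
    have hwf := hsub.2.1.sess_brn
    have hd := hsub.not_done_brn
    have hb : ¬ S₀.IsBasic := fun h => (hsub.isBasic h).elim
    have hcS : Γ c = some S₀ := (hΓ'.right (hΓ₁ ▸ by simp [Ctx.single])).1
    obtain ⟨k, hk, rfl⟩ := hΓ.chan hcS hd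
    refine ⟨p, k, S₀, S, T, hk, own hΓ, ?_, hsub, fun i => ?_⟩
    · simp only [Ctx.lin, hcS, Option.bind_some]
      exact Ty.lin_eq_some.2 ⟨rfl, hb, hd⟩
    have hset := hΓ.set hΓ' hΓ₁ hb hd (hwf.2.2.2 i)
    have hlin : (Γ₀.set (k.chan s) (T i)).lin s = (Γ.lin s).upd k (T i).lin := by
      rw [Ctx.lin_set]
      funext k'
      by_cases hk' : k' = k
      · subst hk'; simp
      · rw [LCtx.upd_ne _ _ hk', LCtx.upd_ne _ _ hk']
        rcases hΓ' (k'.chan s) with ⟨h4, h5⟩ | ⟨_, h5⟩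
        · have : k'.chan s ≠ k.chan s := fun h => hk' (Key.chan_inj h)
          simp [Ctx.lin, h5, h4, hΓ₁, Ctx.single, this]
        · simp [Ctx.lin, h5]
    have := ih i (s := s) (D := fun _ => False) (Δ := scons (S i).IsBasic Δ) (h1 i) (h2 i)
      (fun hg => h3 hg i) ⟨fun s' r U hne hU => hset.only s' r U hne hU, fun r hr => hset.own r hr,
        fun x S' hx hS' => ?_⟩ (only hΘ)
    · rwa [Ctx.lin_consVar, hlin] at this
    · cases x with
      | zero => cases hx; exact hS'
      | succ x => exact hset.basic x S' hx hS'
  | @sel Θ Γ₀ Γ₁ Γ₂ Γ' Γ c q l d S T P hc hd' hS _ hΓ' hΓ'' ih =>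
    intro s D Θ' Δ h1 h2 h3 hΓ hΘ
    obtain ⟨S₀, hS₀, hsub, hΓ₁⟩ := hc.sub_chan
    have hwf := hsub.2.1.sess_sel
    have hd := hsub.not_done_sel
    have hb : ¬ S₀.IsBasic := fun h => (hsub.isBasic h).elim
    have hc1 : Γ₁ c = some S₀ := hΓ₁ ▸ by simp [Ctx.single]
    have hc' : Γ' c = some S₀ := (hΓ'.left hc1).1
    have hcS : Γ c = some S₀ := (hΓ''.right hc').1
    obtain ⟨k, hk, rfl⟩ := hΓ.chan hcS hd
    -- The linear rule keeps the subject together with the resources of the continuation, while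
    -- `Typed` separates them. The context is regrouped as `Γ₀, Γ₁` against the payload context
    -- `Γ₂`.
    have hcomp : Ctx.Comp Γ₀ Γ₁ (Γ₀.set (k.chan s) S₀) := by
      intro e
      by_cases he : e = k.chan s
      · subst he
        exact .inl ⟨(hΓ''.right hc').2, by simp [Ctx.set, hc1]⟩
      · exact .inr ⟨by simp [hΓ₁, Ctx.single, he], by simp [Ctx.set, he]⟩
    have hsub' : ∀ e U, Γ₀.set (k.chan s) S₀ e = some U → Γ e = some U := by
      intro e U he
      rcases hcomp.right_eq he with h | h
      · exact (hΓ''.left h).1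
      · exact (hΓ''.right (hΓ'.left h).1).1
    have hsp : Ctx.Comp (Γ₀.set (k.chan s) S₀) Γ₂ Γ := by
      intro e
      by_cases he : e = k.chan s
      · subst he
        exact .inr ⟨(hΓ'.left hc1).2, by simp [Ctx.set, hcS]⟩
      · have h1e : Γ₁ e = none := by simp [hΓ₁, Ctx.single, he]
        have h2e : Γ' e = Γ₂ e := by
          rcases hΓ' e with ⟨_, h⟩ | ⟨h, h'⟩
          · exact h
          · rw [h', h, h1e]
        simp only [Ctx.set, he, if_false]
        rw [← h2e]
        exact hΓ'' e
    have hset := (hΓ.sub hsub').set hcomp hΓ₁ hb hd (hwf.2.2.2 0)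
    refine ⟨p, k, S₀, S, T, (Γ₀.set (k.chan s) S₀).lin s, Γ₂.lin s, hk, own hΓ, hsp.split s, ?_, hsub,
      hd'.payJ hS (hΓ.right hsp), ?_⟩
    · rw [Ctx.lin_set, LCtx.upd_same]
      exact Ty.lin_eq_some.2 ⟨rfl, hb, hd⟩
    · have hlin : ((Γ₀.set (k.chan s) S₀).lin s).upd k T.lin = (Γ₀.set (k.chan s) T).lin s := by
        rw [Ctx.lin_set, Ctx.lin_set]
        funext k'
        by_cases hk' : k' = k
        · subst hk'; simp
        · rw [LCtx.upd_ne _ _ hk', LCtx.upd_ne _ _ hk', LCtx.upd_ne _ _ hk']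
      rw [hlin]
      exact ih h1 h2 h3 hset (only hΘ)
  | par _ _ hΓ' ihP ihQ =>
    rintro s D Θ' Δ ⟨h1, h2⟩ ⟨h3, h4⟩ h5 hΓ hΘ
    exact ⟨_, _, ihP h1 h3 (fun hg => (h5 hg).1) (hΓ.left hΓ') hΘ,
      ihQ h2 h4 (fun hg => (h5 hg).2) (hΓ.right hΓ') hΘ, hΓ'.split s⟩
  | @crashed Θ Γ₀ Γ s' q h hΓ' =>
    intro s D Θ' Δ _ _ _ hΓ hΘ
    have h1 : Γ (.ep s' q) = some .crashed := (hΓ'.right (by simp [Ctx.single])).1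
    obtain ⟨k, hk, hk'⟩ := hΓ.chan h1 Ty.crashed_not_sub_done
    obtain ⟨rfl, rfl⟩ := key_ep hk
    refine .inl ⟨rfl, ?_⟩
    have h2 := hΓ'.split s'
    rw [Ctx.lin_nil h.2, LCtx.Split.nil_left] at h2
    rw [h2, ← hk', Ctx.lin_single, Ty.lin_eq_some.2 ⟨rfl, id, Ty.crashed_not_sub_done⟩]
  | @res Θ Γ A P R _ _ ih =>
    rintro s D Θ' Δ h1 ⟨h2, h3⟩ h4 hΓ hΘ
    -- The condition on restrictions makes all types of the new session ended, so the session may be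
    -- treated as dead.
    have := ih (s := s + 1) (D := scons True D) (Δ := Δ) h1 h3 h4 ⟨fun s' q U hne hU => ?_,
      fun q hq => hΓ.own q hq, hΓ.basic⟩ hΘ
    · rwa [Ctx.lin_consSession] at this
    · cases s' with
      | zero =>
        rcases h2.2 (.ep 0 q) U hU with ⟨⟨x, hx⟩, _⟩ | h
        · cases hx
        · exact h
      | succ s' => exact hΓ.only s' q U (fun h => hne (by rw [h])) hU

/-! ### Contexts of typed processes are well-formed -/

theorem Ctx.WF.comp {Γ₁ Γ₂ Γ : Ctx} (h1 : Γ₁.WF) (h2 : Γ₂.WF) (h : Ctx.Comp Γ₁ Γ₂ Γ) : Γ.WF := by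
  refine ⟨(h1.fin.union h2.fin).subset fun c hc => ?_, fun c U hc => ?_⟩
  · obtain ⟨U, hU⟩ := Option.ne_none_iff_exists'.1 hc
    rcases h.right_eq hU with h | h
    · exact .inl (by simp [h])
    · exact .inr (by simp [h])
  · rcases h.right_eq hc with h | h
    · exact h1.ty c U h
    · exact h2.ty c U h

theorem Ctx.wf_single {c : Chan} {U : Ty} (h : U.TyWF) : (Ctx.single c U).WF := by
  refine ⟨(Set.finite_singleton c).subset fun d hd => ?_, fun d V hd => ?_⟩
  · by_contra hne
    exact hd (if_neg hne)
  · obtain ⟨rfl, rfl⟩ := Ctx.single_eq hd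
    exact h

theorem Ctx.End.wf {Γ : Ctx} (h : Γ.End) : Γ.WF :=
  ⟨h.1, fun c U hc => (h.2 c U hc).elim (fun h => .inl (.inl h.2)) fun h => h.1⟩

theorem PayTyped.wf {Γ d S} (h : PayTyped Γ d S) : Γ.WF := by
  cases h with
  | val _ => exact ⟨by simp [Ctx.empty], fun _ _ h => by cases h⟩
  | chan h _ => exact Ctx.wf_single h.tyWF

theorem Ctx.WF.of_inj {Γ Γ' : Ctx} (h : Γ'.WF) (f : Chan → Chan) (hf : Function.Injective f)
    (hΓ : ∀ c, Γ c ≠ none → Γ' (f c) = Γ c) : Γ.WF := by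
  refine ⟨(h.fin.preimage hf.injOn).subset fun c hc => ?_, fun c U hc => ?_⟩
  · change Γ' (f c) ≠ none
    rwa [hΓ c hc]
  · exact h.ty (f c) U ((hΓ c (by simp [hc])).trans hc)

theorem Ctx.WF.of_set {Γ : Ctx} {c : Chan} {U : Ty} (h : (Γ.set c U).WF) (hc : Γ c = none) : Γ.WF :=
  h.of_inj id Function.injective_id fun d hd => by
    have : d ≠ c := by rintro rfl; exact hd hc
    simp [Ctx.set, this]

theorem Typed.wf {Θ Γ P} (h : Typed Θ Γ P) : Γ.WF := by
  induction h with
  | nil h => exact h.wf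
  | call hX h =>
    clear hX
    induction h with
    | nil h => exact h.wf
    | cons h _ _ hc ih => exact h.wf.comp ih hc
  | defn _ _ _ ih => exact ih
  | @brn Θ Γ₀ Γ₁ Γ c q n lab S T P hc _ hΓ ih =>
    obtain ⟨S₀, _, hsub, rfl⟩ := hc.sub_chan
    -- The context `Γ₀` is known only through the branches, so that a branch must exist.
    have h0 : 0 < n := Nat.pos_of_ne_zero hsub.2.1.sess_brn.1
    refine Ctx.WF.comp (Ctx.WF.of_set (Γ := Γ₀) (U := T ⟨0, h0⟩) ?_ (hΓ.right (by simp [Ctx.single] : Ctx.single c S₀ c = some S₀)).2)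
      hc.wf hΓ
    refine (ih ⟨0, h0⟩).of_inj (fun c => match c with
      | .var x => .var (x + 1)
      | .ep s p => .ep s p) ?_ fun c _ => by cases c <;> rfl
    rintro (x | ⟨s, p⟩) (y | ⟨s', p'⟩) h <;> simp_all
  | @sel Θ Γ₀ Γ₁ Γ₂ Γ' Γ c q l d S T P hc hd' hS _ hΓ' hΓ'' ih =>
    obtain ⟨S₀, _, hsub, rfl⟩ := hc.sub_chan
    have h0 := (hΓ'.left (by simp [Ctx.single] : Ctx.single c S₀ c = some S₀)).1
    exact (Ctx.WF.of_set (Γ := Γ₀) ih (hΓ''.right h0).2).comp (hc.wf.comp hd'.wf hΓ') hΓ''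
  | par _ _ hc ih1 ih2 => exact ih1.comp ih2 hc
  | crashed h hc => exact h.wf.comp (Ctx.wf_single (.inr rfl)) hc
  | res R _ _ ih =>
    refine ih.of_inj (fun c => match c with
      | .var x => .var x
      | .ep s p => .ep (s + 1) p) ?_ fun c _ => by cases c <;> rfl
    rintro (x | ⟨s, p⟩) (y | ⟨s', p'⟩) h <;> simp_all

/-! ### Processes congruent to the inactive process -/

/-- No threads other than crashed endpoints of the sessions in `D`. -/
def Inert : VSet → Proc → Prop
  | _, .nil => True
  | D, .res _ P => Inert (scons True D) P
  | D, .par P Q => Inert D P ∧ Inert D Q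
  | D, .defn _ _ P => Inert D P
  | D, .crashed s _ => D s
  | _, _ => False

theorem inert_renS (P : Proc) : ∀ {ρ : ℕ → ℕ} {D D' : VSet}, (∀ x, D' (ρ x) ↔ D x) →
    (Inert D' (P.renS ρ) ↔ Inert D P) := by
  induction P with
  | res A P ih =>
    intro ρ D D' h
    refine ih fun x => ?_
    cases x with
    | zero => rfl
    | succ x => exact h x
  | par P Q ihP ihQ => intro ρ D D' h; exact and_congr (ihP h) (ihQ h)
  | defn Ss Q P _ ih => intro ρ D D' h; exact ih h
  | crashed s p => intro ρ D D' h; exact h s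
  | _ => intros; rfl

theorem inert_renX (P : Proc) : ∀ {ρ : ℕ → ℕ} {D : VSet}, Inert D (P.renX ρ) ↔ Inert D P := by
  induction P with
  | res A P ih => intro ρ D; exact ih
  | par P Q ihP ihQ => intro ρ D; exact and_congr ihP ihQ
  | defn Ss Q P _ ih => intro ρ D; exact ih
  | _ => intros; rfl

/-- Typing cannot be transported along a congruence with the inactive process. This syntactic
invariant can, and it determines the typing context well enough. -/
theorem Proc.Cong.inert {P Q : Proc} (h : Proc.Cong P Q) : ∀ D, Inert D P ↔ Inert D Q := by
  induction h with
  | refl => intro D; rfl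
  | symm _ ih => intro D; exact (ih D).symm
  | trans _ _ ih1 ih2 => intro D; exact (ih1 D).trans (ih2 D)
  | congRes _ ih => intro D; exact ih _
  | congPar _ _ ih1 ih2 => intro D; exact and_congr (ih1 D) (ih2 D)
  | congDefn _ _ _ ih => intro D; exact ih D
  | parComm => intro D; exact and_comm
  | parAssoc => intro D; exact and_assoc
  | parNil => intro D; exact ⟨And.left, fun h => ⟨h, trivial⟩⟩
  | resSwap A B P =>
    intro D
    refine (inert_renS P fun x => ?_).symm
    rcases x with _ | _ | x <;> rfl
  | resLift A P Q => intro D; exact and_congr (inert_renS P fun x => Iff.rfl) Iff.rfl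
  | stopElim A ps =>
    intro D
    refine iff_of_true ?_ trivial
    change Inert (scons True D) _
    induction ps with
    | nil => trivial
    | cons p ps ih => exact ⟨trivial, ih⟩
  | defPar Ss Q P R => intro D; exact and_congr Iff.rfl (inert_renX R)
  | defSwap Ss Q Ss' Q' P => intro D; exact (inert_renX P).symm
  | _ => intro D; rfl

/-- Only crashed endpoints contribute entries that are not allowed by `end(·)`, and in an inert
process they belong to sessions in `D`. At the outermost level `D` is empty. -/
theorem Typed.inert_end {Θ Γ P} (h : Typed Θ Γ P) : ∀ {D}, Inert D P → ∀ c U, Γ c = some U →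
    EndEntry c U ∨ ∃ s p, c = .ep s p ∧ D s := by
  induction h with
  | nil h => intro D _ c U hc; exact .inl (h.2 c U hc)
  | defn _ _ _ ih => intro D h; exact ih h
  | par _ _ hΓ ih1 ih2 =>
    rintro D ⟨h1, h2⟩ c U hc
    exact (hΓ.right_eq hc).elim (ih1 h1 c U) (ih2 h2 c U)
  | crashed h hΓ =>
    intro D hD c U hc
    rcases hΓ.right_eq hc with h' | h'
    · exact .inl (h.2 c U h')
    · obtain ⟨rfl, _⟩ := Ctx.single_eq h'
      exact .inr ⟨_, _, rfl, hD⟩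
  | res R _ _ ih =>
    intro D h c U hc
    rcases c with x | ⟨s, p⟩
    · rcases ih h (.var x) U hc with h | ⟨_, _, h, _⟩
      · exact .inl h
      · cases h
    · rcases ih h (.ep (s + 1) p) U hc with (⟨⟨x, hx⟩, _⟩ | h) | ⟨s', p', h, hD⟩
      · cases hx
      · exact .inl (.inr h)
      · cases h
        exact .inr ⟨s, p, rfl, hD⟩
  | _ => intro D h; exact h.elim

/-- A typing context of a process congruent to the inactive process satisfies `end(·)`. -/
theorem Typed.end_of_cong_nil {Θ Γ P} (h : Typed Θ Γ P) (hc : Proc.Cong P .nil) :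
    ∀ c U, Γ c = some U → EndEntry c U := by
  intro c U hU
  rcases h.inert_end ((hc.inert (fun _ => False)).2 trivial) c U hU with h | ⟨_, _, _, h⟩
  · exact h
  · exact h.elim

/-! ### Crashed endpoints in typed processes -/

section Typing

variable {g : Prop}

/-- Subtyping relates the crash type to itself only, hence a prefix or a call cannot hold a resource
of this type. -/
theorem J_lts_of_crashed {P} : ∀ {w s D Θ L p}, L.Closed → J g w s D Θ VSet.empty L P →
    L (.role p) = some .crashed → ∃ P', Lts s (.dead p) P P' := by
  induction P with
  | nil => rintro w s D Θ L p hL rfl hU; cases hU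
  | err => intro w s D Θ L p hL h; exact h.elim
  | res A P ih => intro w s D Θ L p hL h hU; exact (ih hL h hU).imp' _ fun _ => .res
  | par P Q ihP ihQ =>
    rintro w s D Θ L p hL ⟨L₁, L₂, h1, h2, hs⟩ hU
    rcases hs (.role p) with ⟨_, h⟩ | ⟨_, h⟩
    · exact (ihQ (hL.right hs) h2 (h ▸ hU)).imp' _ fun _ => .parR
    · exact (ihP (hL.left hs) h1 (h ▸ hU)).imp' _ fun _ => .parL
  | defn Ss B P _ ih =>
    rintro w s D Θ L p hL (⟨_, _, _, _, h⟩ | ⟨_, _, h⟩) hU <;>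
    exact (ih hL h hU).imp' _ fun _ => .defn
  | sel c q l d P _ =>
    intro w s D Θ L p hL h hU
    obtain ⟨p', U', S, T, v, rfl, rfl, h1, h2, h3, _⟩ := J_sel_closed hL h
    cases h1 (.role p) (by simp [hU])
    cases hU.symm.trans h2
    cases h3.crashed_eq
  | brn c q n lab P _ =>
    intro w s D Θ L p hL h hU
    obtain ⟨p', U', S, T, rfl, h1, h2, h3, _⟩ := J_brn_closed hL h
    cases h1 (.role p) (by simp [hU])
    cases hU.symm.trans h2
    cases h3.crashed_eq
  | call X ds =>
    rintro w s D Θ L p hL ⟨r, Ss, _, _, h⟩ hU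
    obtain ⟨i, S, ⟨_, hS, _⟩, h⟩ := h.exists_argAt hU
    rw [h.crashed_eq] at hS
    exact hS.elim
  | crashed s' q =>
    rintro w s D Θ L p hL (⟨rfl, rfl⟩ | ⟨_, _, rfl⟩) hU
    · by_cases hq : p = q
      · subst hq
        exact ⟨_, .leaf .dead⟩
      · rw [LCtx.upd_ne _ _ (by simpa using hq)] at hU
        cases hU
    · cases hU

theorem Lts.dead_cong {s p P P'} (h : Lts s (.dead p) P P') :
    ∃ Q, Proc.Cong P (.par Q (.crashed s p)) := by
  generalize ha : LAct.dead p = a at h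
  induction h with
  | leaf h =>
    subst ha
    cases h
    exact ⟨.nil, (Proc.Cong.parNil _).symm.trans (Proc.Cong.parComm _ _)⟩
  | parL _ ih =>
    obtain ⟨Q, h⟩ := ih ha
    exact ⟨_, (h.congPar (.refl _)).trans (cong_par_assoc_swap _ _ _)⟩
  | parR _ ih =>
    obtain ⟨Q, h⟩ := ih ha
    exact ⟨_, ((Proc.Cong.refl _).congPar h).trans (Proc.Cong.parAssoc _ _ _).symm⟩
  | res _ ih =>
    obtain ⟨Q, h⟩ := ih ha
    exact ⟨_, (Proc.Cong.congRes h).trans (cong_par_res _ _ (.crashed _ p)).symm⟩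
  | defn _ ih =>
    obtain ⟨Q, h⟩ := ih ha
    exact ⟨_, (Proc.Cong.congDefn (.refl _) h).trans (cong_par_defn _ _ _ (.crashed _ p)).symm⟩

end Typing

/-! ## The simulation of processes by typing contexts -/

/-- The environment without process variables. -/
abbrev TEnv.empty : TEnv := fun _ _ _ => False

/-- The process `P` conforms to the context `Γ`, in which only session `s` is live. -/
structure Conforms (g : Prop) (s : ℕ) (Ses : Set ℕ) (Γ : Ctx) (L : LCtx) (P : Proc) : Prop where
  wf : Γ.WF
  only : Γ.Only s
  ses : ∀ p, Γ (.ep s p) ≠ none → s ∈ Ses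
  closed : L.Closed
  typed : J g 0 s VSet.empty TEnv.empty VSet.empty L P
  ok : ∀ p, Ok (Γ.conf s p) (L (.role p))

namespace Conforms

variable {g : Prop} {s : ℕ} {Ses : Set ℕ} {Γ : Ctx} {L : LCtx} {P : Proc}

theorem agree (h : Conforms g s Ses Γ L P) : Agree (Γ.conf s) L := fun p U hU => (h.ok p).1 U hU

theorem some_of_not_done (h : Conforms g s Ses Γ L P) {p U} (hU : Γ.conf s p = some U)
    (hd : ¬ U.Sub .done) : ∃ V, L (.role p) = some V ∧ U.Sub V := by
  cases hL : L (.role p) with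
  | none => exact absurd ((h.ok p).2 hL U hU) hd
  | some V =>
    obtain ⟨U', hU', hs⟩ := h.agree p V hL
    cases hU.symm.trans hU'
    exact ⟨V, rfl, hs⟩

theorem _root_.MPST.Conf.Out.not_done {H : Conf} {p q l S T} (h : Out H p q l S T) :
    ∃ U, H p = some U ∧ ¬ U.Sub .done ∧ ∃ n lab Ss Ts, Ty.Unf U (.sel q n lab Ss Ts) := by
  obtain ⟨U, n, lab, Ss, Ts, k, hU, hu, _⟩ := h
  exact ⟨U, hU, fun h => (by cases hu.det h.unf_done), n, lab, Ss, Ts, hu⟩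

theorem _root_.MPST.Conf.Inp.not_done {H : Conf} {p q l S T} (h : Inp H p q l S T) :
    ∃ U, H p = some U ∧ ¬ U.Sub .done ∧ ∃ n lab Ss Ts, Ty.Unf U (.brn q n lab Ss Ts) := by
  obtain ⟨U, n, lab, Ss, Ts, k, hU, hu, _⟩ := h
  exact ⟨U, hU, fun h => (by cases hu.det h.unf_done), n, lab, Ss, Ts, hu⟩

theorem exists_dead (h : Conforms g s Ses Γ L P) {p} (hp : Γ.conf s p = some .crashed) :
    ∃ P', Lts s (.dead p) P P' := by
  obtain ⟨V, hV, hs⟩ := h.some_of_not_done hp Ty.crashed_not_sub_done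
  rw [hs.crashed_eq] at hV
  exact J_lts_of_crashed h.closed h.typed hV

/-- The thread that holds the endpoint is found by `J_holder`, and comparing heads of types excludes
the wrong kinds. The label may differ from `l`, since a process may use any of the labels that its
type allows. -/
theorem exists_out (h : Conforms g s Ses Γ L P) {p q l S T} (ho : Out (Γ.conf s) p q l S T) :
    ActCall (Passes p) s P ∨ ∃ l' v P', Lts s (.out p q l' v) P P' := by
  obtain ⟨U, hU, hd, n, lab, Ss, Ts, hu⟩ := ho.not_done
  obtain ⟨V, hV, hs⟩ := h.some_of_not_done hU hd
  rcases J_holder h.closed h.typed hV with ⟨rfl, _⟩ | ⟨q', l', v, P', h'⟩ |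
    ⟨q', n', lab', S', T', hV', _⟩ | h'
  · exact absurd (hs.eq_crashed ▸ hU) ho.not_crashed
  · obtain ⟨V', S', T', hV', hs', _⟩ := J_lts_out h' h.closed h.typed
    cases hV.symm.trans hV'
    obtain ⟨n', lab', Ss', Ts', hu', _⟩ := (hs.trans hs').sel_inv
    cases hu.det hu'
    exact .inr ⟨l', v, P', h'⟩
  · obtain ⟨n', lab', Ss', Ts', hu', _⟩ := (hs.trans hV').brn_inv
    cases hu.det hu'
  · exact .inl h'

/-- As for outputs, but the whole branching is returned, because the label is decided by the
partner. -/
theorem exists_inp (h : Conforms g s Ses Γ L P) {p q l S T} (ho : Inp (Γ.conf s) p q l S T) :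
    ActCall (Passes p) s P ∨ ∃ V n lab S' T', L (.role p) = some V ∧ V.Sub (.brn q n lab S' T') ∧
      ∀ i v, ∃ P', Lts s (.inp p q (lab i) v) P P' := by
  obtain ⟨U, hU, hd, n, lab, Ss, Ts, hu⟩ := ho.not_done
  obtain ⟨V, hV, hs⟩ := h.some_of_not_done hU hd
  rcases J_holder h.closed h.typed hV with ⟨rfl, _⟩ | ⟨q', l', v, P', h'⟩ |
    ⟨q', n', lab', S', T', hV', hl⟩ | h'
  · exact absurd (hs.eq_crashed ▸ hU) ho.not_crashed
  · obtain ⟨V', S', T', hV', hs', _⟩ := J_lts_out h' h.closed h.typed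
    cases hV.symm.trans hV'
    obtain ⟨n', lab', Ss', Ts', hu', _⟩ := (hs.trans hs').sel_inv
    cases hu.det hu'
  · obtain ⟨n'', lab'', Ss', Ts', hu', _⟩ := (hs.trans hV').brn_inv
    cases hu.det hu'
    exact .inr ⟨V, n', lab', S', T', hV, hV', hl⟩
  · exact .inl h'

/-- A transition of the context can be followed by the process, after unfolding calls. -/
theorem exists_sync (h : Conforms g s Ses Γ L P) (hs : SafeNow (Γ.conf s)) {β H'}
    (hm : Move (Γ.conf s) β H') :
    (∃ p, β = .crash p) ∨
    (∃ p, ActCall (Passes p) s P ∧ ((∃ q l, β = .comm p q l) ∨ (∃ q l, β = .comm q p l) ∨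
      ∃ q, β = .detect p q)) ∨
    ∃ a b R, LAct.Compat a b ∧ Sync s a b P R ∧
      (a.move = β ∨ ∃ p q l l', β = .comm p q l ∧ a.move = .comm p q l') := by
  cases hm with
  | crash => exact .inl ⟨_, rfl⟩
  | @comm p q l S S' T T' ho hi hS =>
    have hne : p ≠ q := by rintro rfl; exact ho.not_inp hi
    refine .inr ?_
    rcases h.exists_out ho with hc | ⟨l', v, P', hl⟩
    · exact .inl ⟨p, hc, .inl ⟨q, l, rfl⟩⟩
    rcases h.exists_inp hi with hc | ⟨V, n, lab, Sb, Tb, hV, hsub, hl'⟩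
    · exact .inl ⟨q, hc, .inr (.inl ⟨p, l, rfl⟩)⟩
    obtain ⟨U, S₁, T₁, hU, hsub', _⟩ := J_lts_out hl h.closed h.typed
    obtain ⟨S₂, T₂, ho', _⟩ := h.agree.out hU hsub'
    -- The sender may have picked a label other than that of the given move. Safety guarantees that
    -- the receiver accepts this one too.
    obtain ⟨H'', hm⟩ := hs.comm ho' hi
    cases hm with
    | lost _ hcr => exact absurd hcr hi.not_crashed
    | comm _ hi' _ =>
      obtain ⟨j, hj, _⟩ := h.agree.inp hV hsub hi'
      obtain ⟨P'', hl''⟩ := hl' j v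
      rw [hj] at hl''
      obtain ⟨R, hR⟩ := Sync.exists hl hl'' hne
      exact .inr ⟨_, _, R, .comm p q l' v, hR, .inr ⟨p, q, l, l', rfl, rfl⟩⟩
  | @lost p q l S T ho hcr =>
    have hne : p ≠ q := by rintro rfl; exact ho.not_crashed hcr
    refine .inr ?_
    rcases h.exists_out ho with hc | ⟨l', v, P', hl⟩
    · exact .inl ⟨p, hc, .inl ⟨q, l, rfl⟩⟩
    obtain ⟨P'', hl''⟩ := h.exists_dead hcr
    obtain ⟨R, hR⟩ := Sync.exists hl hl'' hne
    exact .inr ⟨_, _, R, .lost p q l' v, hR, .inr ⟨p, q, l, l', rfl, rfl⟩⟩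
  | @detect p q T hi hcr =>
    have hne : q ≠ p := by rintro rfl; exact hi.not_crashed hcr
    refine .inr ?_
    rcases h.exists_inp hi with hc | ⟨V, n, lab, Sb, Tb, hV, hsub, hl'⟩
    · exact .inl ⟨q, hc, .inr (.inr ⟨p, rfl⟩)⟩
    obtain ⟨P'', hl''⟩ := h.exists_dead hcr
    obtain ⟨j, hj, _⟩ := h.agree.inp hV hsub hi
    obtain ⟨P', hl⟩ := hl' j .unit
    rw [hj] at hl
    obtain ⟨R, hR⟩ := Sync.exists hl hl'' hne
    exact .inr ⟨_, _, R, .detect p q, hR, .inl rfl⟩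

theorem exists_unfold (h : Conforms g s Ses Γ L P) {φ : ℕ → List Pay → Prop}
    (hφ : ∀ s ws, φ (s + 1) (ws.map (Pay.renS Nat.succ)) → φ s ws) (ha : ActCall φ s P) :
    ∃ P', Unfold φ s P P' := by
  rcases J_exists_unfold hφ h.closed h.typed ha with h | ⟨_, _, _, _, _, ⟨_, _, h⟩, _⟩
  · exact h
  · exact h.elim

theorem _root_.MPST.Passes.of_renS {p : Role} (s : ℕ) (ws : List Pay)
    (h : Passes p (s + 1) (ws.map (Pay.renS Nat.succ))) : Passes p s ws := by
  obtain ⟨d, hd, h⟩ := List.mem_map.1 h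
  rcases d with v | (x | ⟨s', q⟩) <;> cases h
  exact hd

/-- If the context can reduce then so can the process. -/
theorem exists_red (h : Conforms g s Ses Γ L P) (hs : SafeNow (Γ.conf s)) {β H'}
    (hm : Move (Γ.conf s) β H') (hβ : ∀ p, β ≠ .crash p) : ∃ P', Proc.Red false P P' := by
  rcases h.exists_sync hs hm with ⟨p, hp⟩ | ⟨p, ha, _⟩ | ⟨a, b, R, hc, hR, _⟩
  · exact absurd hp (hβ p)
  · obtain ⟨P', hP'⟩ := h.exists_unfold Passes.of_renS ha
    exact ⟨P', (J_unfold hP' h.closed h.typed).1⟩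
  · exact ⟨R, hR.red hc⟩

/-- Reductions of the context take place on the live session. -/
theorem _root_.MPST.Ctx.Red.move {Γ Γ' : Ctx} (hw : Γ.WF) (ho : Γ.Only s) (h : Ctx.Red Γ Γ') :
    ∃ β H', Move (Γ.conf s) β H' ∧ (∀ p, β ≠ .crash p) ∧ Γ' = Γ.withConf s H' ∧
      Ctx.Step Γ (β.act s) Γ' := by
  obtain ⟨s', p, q, h⟩ := h
  have hs' : s' = s := by
    by_contra hne
    have hout : ∀ {p q l S T}, ¬ Out (Γ.conf s') p q l S T := fun h => by
      obtain ⟨U, hU, hd, _⟩ := h.not_done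
      exact hd (ho _ _ _ hne hU)
    have hinp : ∀ {p q l S T}, ¬ Inp (Γ.conf s') p q l S T := fun h => by
      obtain ⟨U, hU, hd, _⟩ := h.not_done
      exact hd (ho _ _ _ hne hU)
    rcases h with ⟨l, h⟩ | h
    · obtain ⟨H', h, _⟩ := (Ctx.step_iff hw (β := .comm p q l)).1 h
      cases h with
      | comm h _ _ => exact hout h
      | lost h _ => exact hout h
    · obtain ⟨H', h, _⟩ := (Ctx.step_iff hw (β := .detect q p)).1 h
      cases h with
      | detect h _ => exact hinp h
  subst hs'
  rcases h with ⟨l, h⟩ | h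
  · obtain ⟨H', h1, h2⟩ := (Ctx.step_iff hw (β := .comm p q l)).1 h
    exact ⟨_, H', h1, fun _ h => (nomatch h), h2, h⟩
  · obtain ⟨H', h1, h2⟩ := (Ctx.step_iff hw (β := .detect q p)).1 h
    exact ⟨_, H', h1, fun _ h => (nomatch h), h2, h⟩

theorem _root_.MPST.Ctx.red_of_move {Γ : Ctx} (hw : Γ.WF) {β H'} (h : Move (Γ.conf s) β H')
    (hβ : ∀ p, β ≠ .crash p) : Ctx.Red Γ (Γ.withConf s H') := by
  have := Ctx.step_of_move hw.fin h
  cases β with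
  | comm p q l => exact ⟨s, p, q, .inl ⟨l, this⟩⟩
  | detect q p => exact ⟨s, p, q, .inr this⟩
  | crash p => exact absurd rfl (hβ p)

/-- Moves only concern endpoints in the domain. -/
theorem _root_.MPST.Conf.Move.dom {H H' : Conf} {β} (h : Move H β H') {p} (hp : H' p ≠ none) : H p ≠ none := by
  have key : ∀ {H : Conf} {q p : Role} {u : Option Ty}, H q ≠ none → Function.update H q u p ≠ none →
      H p ≠ none := by
    intro H q p u hq hp
    by_cases h : p = q
    · exact h ▸ hq
    · rwa [Function.update_of_ne h] at hp
  have hout : ∀ {p q l S T}, Out H p q l S T → H p ≠ none := fun h => by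
    obtain ⟨U, hU, _⟩ := h.not_done
    simp [hU]
  have hinp : ∀ {p q l S T}, Inp H p q l S T → H p ≠ none := fun h => by
    obtain ⟨U, hU, _⟩ := h.not_done
    simp [hU]
  cases h with
  | @comm p' q' _ _ _ _ _ ho hi _ =>
    refine key (hout ho) (key ?_ hp)
    by_cases h : q' = p'
    · subst h; simp
    · rw [Function.update_of_ne h]; exact hinp hi
  | lost ho _ => exact key (hout ho) hp
  | detect ho _ => exact key (hinp ho) hp
  | crash hU _ _ => exact key (by simp [hU]) hp

/-- Conformance is preserved by local transitions. -/
theorem of_local (h : Conforms g s Ses Γ L P) {H' L' P'}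
    (hm : H' = Γ.conf s ∨ ∃ β, Move (Γ.conf s) β H') (hL : L'.Closed)
    (hJ : J g 0 s VSet.empty TEnv.empty VSet.empty L' P') (hloc : Conf.Local (Γ.conf s) L H' L') :
    Conforms g s Ses (Γ.withConf s H') L' P' := by
  have hwf : (Γ.withConf s H').WF ∧ ∀ p, H' p ≠ none → Γ (.ep s p) ≠ none := by
    rcases hm with rfl | ⟨β, hm⟩
    · rw [Ctx.withConf_conf]
      exact ⟨h.wf, fun p hp => hp⟩
    · exact ⟨h.wf.move hm, fun p hp => hm.dom hp⟩
  refine ⟨hwf.1, fun s' q U hne hU => ?_, fun p hp => h.ses p (hwf.2 p ?_), hL, hJ, fun p => ?_⟩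
  · simp only [Ctx.withConf, hne, if_false] at hU
    exact h.only s' q U hne hU
  · simpa [Ctx.withConf] using hp
  · rw [Ctx.conf_withConf]
    rcases hloc p with ⟨h1, h2⟩ | ⟨_, h2⟩
    · rw [h1, h2]; exact h.ok p
    · exact h2

/-- One reduction of a conforming process. -/
theorem red (h : Conforms g s Ses Γ L P) (hs : SafeNow (Γ.conf s)) {b P'} (hr : Proc.Red b P P') :
    ∃ H' L', Conforms g s Ses (Γ.withConf s H') L' P' ∧ Effect g b P P' (Γ.conf s) H' L' := by
  obtain ⟨H', L', hL', hJ', hloc, heff⟩ := J_red hr h.closed h.typed h.agree hs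
  exact ⟨H', L', h.of_local (heff.imp (fun h => h.1) fun ⟨β, hm, _⟩ => ⟨β, hm⟩) hL' hJ' hloc, heff⟩

/-- Reductions of contexts, with the effect on potentials. -/
def Tracks (g : Prop) (s : ℕ) (R : Set Role) (Γ Γ' : Ctx) (P P' : Proc) : Prop :=
  (Γ' = Γ ∧ (g → ∀ k e, (∀ X, Monotone (e X)) → P'.potential k e < P.potential k e)) ∨
  (Ctx.RedOn s R Γ Γ' ∧ ∀ k e, (∀ X, Monotone (e X)) → P'.potential k e ≤ P.potential (k + 1) e)

theorem red_false (h : Conforms g s Ses Γ L P) {R} (hs : Γ.Safe s R) {P'} (hr : Proc.Red false P P') :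
    ∃ Γ' L', Conforms g s Ses Γ' L' P' ∧ Tracks g s R Γ Γ' P P' := by
  obtain ⟨H', L', h', heff⟩ := h.red (hs.now h.wf) hr
  refine ⟨_, L', h', ?_⟩
  rcases heff with ⟨rfl, hp⟩ | ⟨β, hm, hc, hp⟩
  · exact .inl ⟨Ctx.withConf_conf _ _, hp⟩
  · exact .inr ⟨(Ctx.redOn_iff h.wf).2 ⟨β, H', hm, rfl, fun p hp => by cases (hc p hp).1⟩, hp⟩

theorem redChecked (h : Conforms g s Ses Γ L P) {Rel : ℕ → Set Role} (hs : Γ.Safe s (Rel s)) {P'}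
    (hr : Proc.RedChecked Ses Rel P P') :
    ∃ Γ' L', Conforms g s Ses Γ' L' P' ∧ Tracks g s (Rel s) Γ Γ' P P' := by
  obtain ⟨H', L', h', heff⟩ := h.red (hs.now h.wf) hr.1
  refine ⟨_, L', h', ?_⟩
  rcases heff with ⟨rfl, hp⟩ | ⟨β, hm, hc, hp⟩
  · exact .inl ⟨Ctx.withConf_conf _ _, hp⟩
  · refine .inr ⟨(Ctx.redOn_iff h.wf).2 ⟨β, H', hm, rfl, fun p hp hR => ?_⟩, hp⟩
    subst hp
    -- The assumption on reliable roles is available only for sessions of the initial context, to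
    -- which `s` belongs as soon as one of its endpoints crashes.
    have hs : s ∈ Ses := by
      cases hm with
      | crash hU _ _ => exact h.ses p (fun h => by cases hU.symm.trans h)
    -- A crash of a reliable role would expose its crashed endpoint at the top level of the result,
    -- which assumption-abiding reduction forbids.
    obtain ⟨P'', hl⟩ := J_lts_of_crashed h'.closed h'.typed (hc p rfl).2
    exact (hr.2.1 s hs).2 p hR hl.dead_cong

/-- All properties of processes quantify over reachable processes. This yields a reachable context
to which the corresponding property of `Γ` applies. -/
theorem steps {Rel : ℕ → Set Role} (h : Conforms g s Ses Γ L P) (hs : Γ.Safe s (Rel s)) {P'}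
    (hr : Relation.ReflTransGen (Proc.RedChecked Ses Rel) P P') :
    ∃ Γ' L', Conforms g s Ses Γ' L' P' ∧ Γ'.Safe s (Rel s) ∧
      Relation.ReflTransGen (Ctx.RedOn s (Rel s)) Γ Γ' := by
  induction hr with
  | refl => exact ⟨Γ, L, h, hs, .refl⟩
  | tail _ hr ih =>
    obtain ⟨Γ', L', h', hs', hΓ⟩ := ih
    obtain ⟨Γ'', L'', h'', ⟨rfl, _⟩ | ⟨hred, _⟩⟩ := h'.redChecked hs' hr
    · exact ⟨_, L'', h'', hs', hΓ⟩
    · exact ⟨_, L'', h'', hs'.redOn hred, hΓ.tail hred⟩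

theorem neverTerminating {Rel : ℕ → Set Role} (h : Conforms g s Ses Γ L P) (hs : Γ.Safe s (Rel s))
    (hn : Γ.NeverTerminating s (Rel s)) : P.NeverTerminating Ses Rel := by
  intro P' hr
  obtain ⟨Γ', L', h', hs', hΓ⟩ := h.steps hs hr
  obtain ⟨Γ'', hred⟩ := hn Γ' hΓ
  obtain ⟨β, H', hm, hβ, _⟩ := hred.move h'.wf h'.only
  exact h'.exists_red (hs'.now h'.wf) hm hβ

end Conforms

/-! ## Initial conformance -/

section Typing

variable {g : Prop}

theorem PayJ.congr_vset {s : ℕ} {Δ Δ' : VSet} {L d S} (h : PayJ s Δ L d S)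
    (hΔ : ∀ x ∈ d.fv, Δ x → Δ' x) : PayJ s Δ' L d S := by
  rcases h with ⟨h1, h2, h3 | ⟨x, rfl, hx⟩⟩ | h
  · exact .inl ⟨h1, h2, .inl h3⟩
  · exact .inl ⟨h1, h2, .inr ⟨x, rfl, hΔ x rfl hx⟩⟩
  · exact .inr h

theorem ArgsJ.congr_vset {s : ℕ} {Δ Δ' : VSet} {ds : List Pay} : ∀ {L Ss}, ArgsJ s Δ L ds Ss →
    (∀ d ∈ ds, ∀ x ∈ d.fv, Δ x → Δ' x) → ArgsJ s Δ' L ds Ss := by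
  induction ds with
  | nil => rintro L (_ | ⟨S, Ss⟩) h _ <;> exact h
  | cons d ds ih =>
    rintro L (_ | ⟨S, Ss⟩) h hΔ
    · exact h
    · obtain ⟨L₁, L₂, h1, h2, hs⟩ := h
      exact ⟨L₁, L₂, h1.congr_vset (hΔ d (by simp)), ih h2 fun d hd => hΔ d (by simp [hd]), hs⟩

/-- Only the free variables of a process matter. -/
theorem J_congr_vset (P : Proc) : ∀ {w s D Θ Δ Δ' L}, J g w s D Θ Δ L P →
    (∀ x ∈ P.fv, Δ x → Δ' x) → J g w s D Θ Δ' L P := by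
  induction P with
  | nil => intro w s D Θ Δ Δ' L h _; exact h
  | err => intro w s D Θ Δ Δ' L h _; exact h
  | crashed s p => intro w s D Θ Δ Δ' L h _; exact h
  | res A P ih => intro w s D Θ Δ Δ' L h hΔ; exact ih (s := s + 1) h hΔ
  | par P Q ihP ihQ =>
    rintro w s D Θ Δ Δ' L ⟨L₁, L₂, h1, h2, hs⟩ hΔ
    exact ⟨L₁, L₂, ihP h1 fun x hx => hΔ x (.inl hx), ihQ h2 fun x hx => hΔ x (.inr hx), hs⟩
  | sel c q l d P ih =>
    rintro w s D Θ Δ Δ' L ⟨r, k, U, S, T, L₀, L₂, h1, h2, h3, h4, h5, h6, h7⟩ hΔ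
    exact ⟨r, k, U, S, T, L₀, L₂, h1, h2, h3, h4, h5,
      h6.congr_vset fun x hx => hΔ x (.inl (.inr hx)), ih h7 fun x hx => hΔ x (.inr hx)⟩
  | brn c q n lab P ih =>
    rintro w s D Θ Δ Δ' L ⟨r, k, U, S, T, h1, h2, h3, h4, h5⟩ hΔ
    refine ⟨r, k, U, S, T, h1, h2, h3, h4, fun i => ih i (h5 i) fun x hx hx' => ?_⟩
    cases x with
    | zero => exact hx'
    | succ x => exact hΔ x (.inr ⟨i, hx⟩) hx'
  | defn Ss Q P _ ih =>
    rintro w s D Θ Δ Δ' L (⟨r, h1, h2, h3, h⟩ | ⟨h1, h2, h⟩) hΔ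
    · exact .inl ⟨r, h1, h2, h3, ih h fun x hx => hΔ x (.inr hx)⟩
    · exact .inr ⟨h1, h2, ih h fun x hx => hΔ x (.inr hx)⟩
  | call X ds =>
    rintro w s D Θ Δ Δ' L ⟨r, Ss, h1, h2, h3⟩ hΔ
    exact ⟨r, Ss, h1, h2, h3.congr_vset fun d hd x hx => hΔ x ⟨d, hd, hx⟩⟩

/-- The linear judgement for a parallel composition of processes that play different roles. -/
theorem J_bigPar {w s D Θ Δ} (Lr : Role → LCtx) (Pr : Role → Proc) (l : List Role) (hl : l.Nodup)
    (h : ∀ p ∈ l, J g w s D Θ Δ (Lr p) (Pr p) ∧ ∀ k, Lr p k ≠ none → k = .role p) :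
    J g w s D Θ Δ (fun k => match k with
      | .role p => if p ∈ l then Lr p (.role p) else none
      | .var _ => none) (Proc.bigPar (l.map Pr)) := by
  induction l with
  | nil => funext k; cases k <;> simp [LCtx.nil]
  | cons p l ih =>
    obtain ⟨h1, h2⟩ := h p (by simp)
    have hp := (List.nodup_cons.1 hl).1
    refine ⟨_, _, h1, ih (List.nodup_cons.1 hl).2 fun q hq => h q (by simp [hq]), fun k => ?_⟩
    rcases k with q | x
    · by_cases hq : q = p
      · subst hq
        exact .inr ⟨by simp [hp], by simp⟩
      · refine .inl ⟨?_, by simp [hq]⟩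
        by_contra hn
        have := h2 _ hn
        cases this
        exact hq rfl
    · refine .inl ⟨?_, rfl⟩
      by_contra hn
      have := h2 _ hn
      cases this

end Typing

/-- Endpoints do not have basic types. -/
theorem Typed.ep_not_basic {Θ Γ P} (h : Typed Θ Γ P) : ∀ {s p U}, Γ (.ep s p) = some U → ¬ U.IsBasic := by
  have hend : ∀ {Γ : Ctx}, Γ.End → ∀ {s p U}, Γ (.ep s p) = some U → ¬ U.IsBasic := by
    intro Γ h s p U hU hb
    rcases h.2 _ _ hU with ⟨⟨x, hx⟩, _⟩ | h
    · cases hx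
    · exact Ty.basic_not_sub_done hb h
  have hpay : ∀ {Γ : Ctx} {d S}, PayTyped Γ d S → ∀ {s p U}, Γ (.ep s p) = some U → ¬ U.IsBasic := by
    intro Γ d S h s p U hU hb
    cases h with
    | val _ => cases hU
    | chan h _ =>
      obtain ⟨rfl, rfl⟩ := Ctx.single_eq hU
      exact hb.not_session h
  induction h with
  | nil h => exact hend h
  | call hX h =>
    clear hX
    induction h with
    | nil h => exact hend h
    | cons h _ _ hc ih =>
      intro s p U hU
      rcases hc.right_eq hU with h' | h'
      · exact hpay h h'
      · exact ih h'
  | defn _ _ _ ih => exact ih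
  | @brn Θ Γ₀ Γ₁ Γ c q n lab S T P hc _ hΓ ih =>
    intro s p U hU
    rcases hΓ.right_eq hU with h | h
    · obtain ⟨S₀, _, hsub, rfl⟩ := hc.sub_chan
      have hne : Chan.ep s p ≠ c := by
        rintro rfl
        have := (hΓ.right (by simp [Ctx.single] : Ctx.single (.ep s p) S₀ (.ep s p) = some S₀)).2
        rw [h] at this
        cases this
      refine ih ⟨0, Nat.pos_of_ne_zero hsub.2.1.sess_brn.1⟩ (s := s) (p := p) ?_
      simpa [Ctx.consVar, Ctx.set, hne] using h
    · exact hpay hc h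
  | @sel Θ Γ₀ Γ₁ Γ₂ Γ' Γ c q l d S T P hc hd' hS _ hΓ' hΓ'' ih =>
    intro s p U hU
    rcases hΓ''.right_eq hU with h | h
    · obtain ⟨S₀, _, hsub, rfl⟩ := hc.sub_chan
      have hne : Chan.ep s p ≠ c := by
        rintro rfl
        have := (hΓ''.right (hΓ'.left (by simp [Ctx.single] :
          Ctx.single (.ep s p) S₀ (.ep s p) = some S₀)).1).2
        rw [h] at this
        cases this
      refine ih (s := s) (p := p) ?_
      simpa [Ctx.set, hne] using h
    · rcases hΓ'.right_eq h with h | h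
      · exact hpay hc h
      · exact hpay hd' h
  | par _ _ hc ih1 ih2 =>
    intro s p U hU
    exact (hc.right_eq hU).elim ih1 ih2
  | crashed h hc =>
    intro s p U hU
    rcases hc.right_eq hU with h' | h'
    · exact hend h h'
    · obtain ⟨_, rfl⟩ := Ctx.single_eq h'
      exact id
  | res R _ _ ih =>
    intro s p U hU
    exact ih (s := s + 1) hU

/-- Each component contributes at most the endpoint of its own role, so the linear contexts of the
components are disjoint and unite to one for their parallel composition. A component congruent to
the inactive process contributes nothing, and its context has only entries allowed by `end(·)`. -/
theorem conforms_init {g : Prop} {s : ℕ} {Γ : Ctx} {P : Proc} {I : Finset Role} {Γr : Role → Ctx}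
    {Pr : Role → Proc} (hP : Typed [] Γ P) (hcong : Proc.Cong P (Proc.bigPar (I.toList.map Pr)))
    (hΓ : ∀ c U, Γ c = some U ↔ ∃ p ∈ I, Γr p c = some U) (htyped : ∀ p ∈ I, Typed [] (Γr p) (Pr p))
    (hplays : ∀ p ∈ I, Proc.Cong (Pr p) .nil ∨ (Pr p).OnlyPlays s p (Γr p))
    (hg : g → ∀ p ∈ I, Proc.Cong (Pr p) .nil ∨ (Pr p).GuardedRec) :
    ∃ L, Conforms g s Γ.sessions Γ L P := by
  classical
  have key : ∀ p ∈ I, ∃ Lp : LCtx, J g 0 s VSet.empty TEnv.empty VSet.empty Lp (Pr p) ∧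
      (∀ k, Lp k ≠ none → k = .role p) ∧
      (∀ U, Lp (.role p) = some U → Γr p (.ep s p) = some U) ∧
      ∀ c U, Γr p c = some U → EndEntry c U ∨ (c = .ep s p ∧ Lp (.role p) = some U) := by
    intro p hp
    by_cases hn : Proc.Cong (Pr p) .nil
    · exact ⟨LCtx.nil, (J_cong hn _ _ _ _ _ _).2 rfl, fun k hk => absurd rfl hk, fun U hU => (nomatch hU),
        fun c U hc => .inl ((htyped p hp).end_of_cong_nil hn c U hc)⟩
    · obtain ⟨htyp, hgd, hcl, ⟨Γ₀, S, hE, hC, hS⟩, hR⟩ := (hplays p hp).resolve_left hn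
      have hent : ∀ c U, Γr p c = some U → EndEntry c U ∨ (c = .ep s p ∧ U = S) := by
        intro c U hc
        rcases hC.right_eq hc with h | h
        · exact .inl (hE.2 c U h)
        · exact .inr (Ctx.single_eq h)
      have hlin : ∀ k, (Γr p).lin s k ≠ none → k = .role p := by
        intro k hk
        cases hU : Γr p (k.chan s) with
        | none => simp [Ctx.lin, hU] at hk
        | some U =>
          rcases hent _ _ hU with h | ⟨h, _⟩
          · simp [Ctx.lin, hU, h.lin] at hk
          · exact Key.chan_inj (k' := .role p) h
      -- All variables are provisionally admitted as basic, because the context may contain some.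
      -- The process has no free variables, so this set is emptied afterwards.
      have hsr : (Γr p).SingleRole s p (fun _ => True) := by
        refine ⟨fun s' q U hne hU => ?_, fun q hq => ?_, fun _ _ _ _ => trivial⟩
        · rcases hent _ _ hU with (⟨⟨x, hx⟩, _⟩ | h) | ⟨h, _⟩
          · cases hx
          · exact h
          · cases h; exact absurd rfl hne
        · have := hlin _ hq
          cases this
          rfl
      have hJ := htyp.toJ (g := g) (D := VSet.empty) (Θ' := TEnv.empty) hgd hR
        (fun h => (hg h p hp).resolve_left hn) hsr (fun X Ss hX => by simp at hX)
      refine ⟨_, J_mono _ (fun _ h => h) (fun _ _ _ h => h) (fun x hx => ?_)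
        (J_congr_vset _ hJ fun x hx => by rw [hcl] at hx; exact hx.elim), hlin, fun U hU => ?_, fun c U hc => ?_⟩
      · have := hlin _ hx
        cases this
      · change (Γr p (.ep s p)).bind Ty.lin = _ at hU
        obtain ⟨V, hV, hU⟩ := Option.bind_eq_some_iff.1 hU
        rw [hV, (Ty.lin_eq_some.1 hU).1]
      · rcases hent c U hc with h | ⟨rfl, rfl⟩
        · exact .inl h
        · refine .inr ⟨rfl, ?_⟩
          change (Γr p (.ep s p)).bind Ty.lin = _
          rw [hc, Option.bind_some, Ty.lin_eq_some]
          exact ⟨rfl, htyp.ep_not_basic hc, hS⟩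
  choose! Lr hLr using key
  have hwf := hP.wf
  have hent : ∀ c U, Γ c = some U → EndEntry c U ∨
      ∃ p ∈ I, c = .ep s p ∧ Lr p (.role p) = some U := by
    intro c U hc
    obtain ⟨p, hp, hc⟩ := (hΓ c U).1 hc
    exact ((hLr p hp).2.2.2 c U hc).imp id fun h => ⟨p, hp, h⟩
  refine ⟨_, hwf, fun s' q U hne hU => ?_, fun p hp => ⟨p, hp⟩, fun x => rfl,
    (J_cong hcong _ _ _ _ _ _).2 (J_bigPar Lr Pr I.toList I.nodup_toList fun p hp =>
      ⟨(hLr p (by simpa using hp)).1, (hLr p (by simpa using hp)).2.1⟩), fun p => ?_⟩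
  · rcases hent _ _ hU with (⟨⟨x, hx⟩, _⟩ | h) | ⟨p, _, h, _⟩
    · cases hx
    · exact h
    · cases h; exact absurd rfl hne
  · simp only [Finset.mem_toList]
    constructor
    · intro U hU
      split at hU
      · rename_i hp
        have := (hΓ _ _).2 ⟨p, hp, (hLr p hp).2.2.1 U hU⟩
        exact ⟨U, this, Ty.Sub.refl (hwf.ty _ _ this)⟩
      · cases hU
    · intro hn U hU
      rcases hent _ _ hU with (⟨⟨x, hx⟩, _⟩ | h) | ⟨q, hq, h, hq'⟩
      · cases hx
      · exact h
      · cases h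
        rw [if_pos hq, hq'] at hn
        cases hn

/-! ## Termination -/

/-- There are at most `k` consecutive reductions of `Γ`. -/
def Ctx.Bounded (s : ℕ) (R : Set Role) (k : ℕ) (Γ : Ctx) : Prop :=
  ∀ m Γ', Path (Ctx.RedOn s R) m Γ Γ' → m ≤ k

theorem Path.cons {α : Type} {r : α → α → Prop} {n : ℕ} {a b c : α} (h : r a b) (h' : Path r n b c) :
    Path r (n + 1) a c := by
  obtain ⟨f, rfl, rfl, hf⟩ := h'
  refine ⟨fun i => match i with
    | 0 => a
    | i + 1 => f i, rfl, rfl, fun i hi => ?_⟩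
  cases i with
  | zero => exact h
  | succ i => exact hf i (by omega)

theorem Path.uncons {α : Type} {r : α → α → Prop} {n : ℕ} {a c : α} (h : Path r (n + 1) a c) :
    ∃ b, r a b ∧ Path r n b c := by
  obtain ⟨f, rfl, rfl, hf⟩ := h
  exact ⟨f 1, hf 0 (by omega), fun i => f (i + 1), rfl, rfl, fun i hi => hf (i + 1) (by omega)⟩

theorem Ctx.Bounded.step {s R k Γ Γ'} (h : Ctx.Bounded s R k Γ) (h' : Ctx.RedOn s R Γ Γ') :
    ∃ k', k = k' + 1 ∧ Ctx.Bounded s R k' Γ' := by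
  have h1 := h 1 Γ' (Path.cons h' ⟨fun _ => Γ', rfl, rfl, fun i hi => absurd hi (by omega)⟩)
  obtain ⟨k, rfl⟩ : ∃ k', k = k' + 1 := ⟨k - 1, by omega⟩
  exact ⟨k, rfl, fun m Γ'' hm => by have := h _ _ (Path.cons h' hm); omega⟩

/-- The measure is the number `k` of context transitions still possible plus the potential at budget
`k`. An unfolding lowers the potential. A context transition lowers `k`, and the potential at the
smaller budget does not exceed the former one. The additional reduction at the end makes the
inequality strict. -/
theorem Conforms.path_bound {s Ses Rel} (n : ℕ) : ∀ {k Γ L P P' P''}, Conforms True s Ses Γ L P →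
    Γ.Safe s (Rel s) → Ctx.Bounded s (Rel s) k Γ → Path (Proc.RedChecked Ses Rel) n P P' →
    Proc.Red false P' P'' → n < k + P.potential k (fun _ _ => 0) := by
  have hmono : ∀ X : ℕ, Monotone ((fun _ _ => 0 : ℕ → ℕ → ℕ) X) := fun _ _ _ _ => le_rfl
  have key : ∀ {k Γ Γ' P P'}, Ctx.Bounded s (Rel s) k Γ → Conforms.Tracks True s (Rel s) Γ Γ' P P' →
      ∃ k', Ctx.Bounded s (Rel s) k' Γ' ∧
        k' + Proc.potential P' k' (fun _ _ => 0) < k + Proc.potential P k (fun _ _ => 0) := by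
    rintro k Γ Γ' P P' hb (⟨rfl, h⟩ | ⟨h, h'⟩)
    · exact ⟨k, hb, Nat.add_lt_add_left (h trivial k _ hmono) _⟩
    · obtain ⟨k, rfl, hb'⟩ := hb.step h
      exact ⟨k, hb', by have := h' k _ hmono; omega⟩
  induction n with
  | zero =>
    rintro k Γ L P P' P'' h hs hb ⟨f, rfl, rfl, _⟩ hr
    obtain ⟨Γ', L', _, ht⟩ := h.red_false hs hr
    obtain ⟨k', _, hlt⟩ := key hb ht
    omega
  | succ n ih =>
    intro k Γ L P P' P'' h hs hb hp hr
    obtain ⟨P₁, h1, hp⟩ := hp.uncons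
    obtain ⟨Γ', L', h', ht⟩ := h.redChecked hs h1
    obtain ⟨k', hb', hlt⟩ := key hb ht
    have hs' : Γ'.Safe s (Rel s) := by
      rcases ht with ⟨rfl, _⟩ | ⟨hr, _⟩
      · exact hs
      · exact hs.redOn hr
    have := ih h' hs' hb' hp hr
    omega

-- The hypothesis forbids only crash-free reductions after `j` steps. From then on every step is a
-- crash, and each crash uses up an endpoint of the finite domain. This gives the bound `j` plus the
-- size of the domain.
open Classical in
theorem Ctx.Terminating.bounded {s R} {Γ : Ctx} (hw : Γ.WF) (h : Γ.Terminating s R) :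
    ∃ k, Ctx.Bounded s R k Γ := by
  obtain ⟨_, j, hj⟩ := h
  let F := hw.fin.toFinset
  let μ : Ctx → ℕ := fun Γ' => (F.filter fun c => Γ' c ≠ some .crashed).card
  refine ⟨j + F.card, ?_⟩
  rintro m Γ' ⟨f, hf0, rfl, hf⟩
  have hwf : ∀ i ≤ m, (f i).WF ∧ ∀ c, f i c ≠ none → c ∈ F := by
    intro i
    induction i with
    | zero => intro _; rw [hf0]; exact ⟨hw, fun c hc => by simpa [F] using hc⟩
    | succ i ih =>
      intro hi
      obtain ⟨h1, h2⟩ := ih (by omega)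
      refine ⟨h1.redOn (hf i hi), fun c hc => h2 c ?_⟩
      obtain ⟨β, H', hm, he, _⟩ := (Ctx.redOn_iff h1).1 (hf i hi)
      rw [he] at hc
      rcases c with x | ⟨s', p⟩
      · exact hc
      · by_cases hs : s' = s
        · subst hs
          simp only [Ctx.withConf, if_true] at hc
          exact hm.dom hc
        · simpa [Ctx.withConf, hs] using hc
  -- Every step after the first `j` removes one entry from the set of those not yet crashed.
  have hμ : ∀ i, i + j ≤ m → μ (f (i + j)) + i ≤ F.card := by
    intro i
    induction i with
    | zero => intro _; exact Finset.card_filter_le _ _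
    | succ i ih =>
      intro hi
      have h1 := ih (by omega)
      obtain ⟨hw', hF⟩ := hwf (i + j) (by omega)
      have hstep := hf (i + j) (by omega)
      have hstuck := hj (i + j) (by omega) (f (i + j)) ⟨f, hf0, rfl, fun k hk => hf k (by omega)⟩
      obtain ⟨β, H', hm, he, _⟩ := (Ctx.redOn_iff hw').1 hstep
      cases β with
      | comm p q l => exact absurd ⟨_, Ctx.red_of_move hw' hm fun _ h => nomatch h⟩ hstuck
      | detect q p => exact absurd ⟨_, Ctx.red_of_move hw' hm fun _ h => nomatch h⟩ hstuck
      | crash p =>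
        cases hm with
        | @crash _ T hU hT _ =>
          have he' : f (i + j + 1) = Function.update (f (i + j)) (.ep s p) (some .crashed) := by
            rw [he, Ctx.withConf_update, Ctx.withConf_conf]
          have hlt : μ (f (i + j + 1)) < μ (f (i + j)) := by
            refine Finset.card_lt_card ((Finset.ssubset_iff_of_subset fun c hc => ?_).2
              ⟨.ep s p, ?_, ?_⟩)
            · simp only [Finset.mem_filter] at hc ⊢
              refine ⟨hc.1, fun h => hc.2 ?_⟩
              rw [he']
              by_cases hcs : c = .ep s p
              · subst hcs; simp
              · rw [Function.update_of_ne hcs]; exact h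
            · simp only [Finset.mem_filter]
              refine ⟨hF _ (fun h => by cases h.symm.trans hU), fun h => ?_⟩
              cases hU.symm.trans h
              exact hT
            · simp [he']
          rw [show i + 1 + j = i + j + 1 by omega]
          omega
  by_contra hlt
  have := hμ (m - j) (by omega)
  have h2 : m - j + j = m := by omega
  omega

theorem Conforms.terminating {s Ses Γ L P} {Rel : ℕ → Set Role} (h : Conforms True s Ses Γ L P)
    (hs : Γ.Safe s (Rel s)) (ht : Γ.Terminating s (Rel s)) (hd : P.DeadlockFree Ses Rel) :
    P.Terminating Ses Rel := by
  obtain ⟨k, hk⟩ := ht.bounded h.wf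
  refine ⟨hd, k + P.potential k (fun _ _ => 0), fun n hn P' hp hr => ?_⟩
  obtain ⟨P'', hr⟩ := hr
  have := h.path_bound n hs hk hp hr
  omega

/-! ## Strengthening -/

namespace Proc

/-- Free process variables. -/
def fpv : Proc → Set ℕ
  | nil => ∅
  | res _ P => fpv P
  | par P Q => fpv P ∪ fpv Q
  | sel _ _ _ _ P => fpv P
  | brn _ _ _ _ P => {X | ∃ i, X ∈ fpv (P i)}
  | defn _ Q P => {X | X + 1 ∈ fpv Q ∨ X + 1 ∈ fpv P}
  | call X _ => {X}
  | err => ∅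
  | crashed _ _ => ∅

theorem renX_eq_self (P : Proc) : ∀ {ρ : ℕ → ℕ}, (∀ X ∈ P.fpv, ρ X = X) → P.renX ρ = P := by
  have hup : ∀ {ρ : ℕ → ℕ} {X}, (∀ Y, X = Y + 1 → ρ Y = Y) → upRen ρ X = X := by
    intro ρ X h
    cases X with
    | zero => rfl
    | succ X => exact congrArg _ (h X rfl)
  induction P with
  | res A P ih => intro ρ h; exact congrArg _ (ih h)
  | par P Q ihP ihQ =>
    intro ρ h
    exact congrArg₂ _ (ihP fun X hX => h X (.inl hX)) (ihQ fun X hX => h X (.inr hX))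
  | sel c q l d P ih => intro ρ h; exact congrArg _ (ih h)
  | brn c q n lab P ih =>
    intro ρ h
    exact congrArg _ (funext fun i => ih i fun X hX => h X ⟨i, hX⟩)
  | defn Ss Q P ihQ ihP =>
    intro ρ h
    exact congrArg₂ _ (ihQ fun X hX => hup fun Y hY => h Y (.inl (hY ▸ hX)))
      (ihP fun X hX => hup fun Y hY => h Y (.inr (hY ▸ hX)))
  | call X ds => intro ρ h; exact congrArg (call · ds) (h X rfl)
  | _ => intros; rfl

theorem renS_eq_self (P : Proc) : ∀ {ρ : ℕ → ℕ}, (∀ e ∈ P.fc, ρ e.1 = e.1) → P.renS ρ = P := by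
  have hc : ∀ {ρ : ℕ → ℕ} {c : Chan}, (∀ e ∈ (Pay.chan c).fc, ρ e.1 = e.1) → c.renS ρ = c := by
    intro ρ c h
    rcases c with x | ⟨s, p⟩
    · rfl
    · exact congrArg (Chan.ep · p) (h (s, p) rfl)
  have hd : ∀ {ρ : ℕ → ℕ} {d : Pay}, (∀ e ∈ d.fc, ρ e.1 = e.1) → d.renS ρ = d := by
    intro ρ d h
    rcases d with v | c
    · rfl
    · exact congrArg Pay.chan (hc h)
  induction P with
  | res A P ih =>
    intro ρ h
    refine congrArg _ (ih fun e he => ?_)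
    obtain ⟨s, p⟩ := e
    cases s with
    | zero => rfl
    | succ s => exact congrArg Nat.succ (h (s, p) he)
  | par P Q ihP ihQ =>
    intro ρ h
    exact congrArg₂ _ (ihP fun X hX => h X (.inl hX)) (ihQ fun X hX => h X (.inr hX))
  | sel c q l d P ih =>
    intro ρ h
    simp only [renS, hc fun e he => h e (.inl (.inl he)), hd fun e he => h e (.inl (.inr he)),
      ih fun e he => h e (.inr he)]
  | brn c q n lab P ih =>
    intro ρ h
    simp only [renS, hc fun e he => h e (.inl he), fun i => ih i fun e he => h e (.inr ⟨i, he⟩)]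
  | defn Ss Q P ihQ ihP =>
    intro ρ h
    exact congrArg₂ _ (ihQ fun X hX => h X (.inl hX)) (ihP fun X hX => h X (.inr hX))
  | call X ds =>
    intro ρ h
    refine congrArg (call X) ((List.map_congr_left fun d hd' => ?_).trans (List.map_id ds))
    exact hd fun e he => h e ⟨d, hd', he⟩
  | crashed s p => intro ρ h; exact congrArg (crashed · p) (h (s, p) rfl)
  | _ => intros; rfl

theorem mem_fpv_renX (P : Proc) : ∀ {ρ : ℕ → ℕ} {X}, X ∈ (P.renX ρ).fpv → ∃ Y ∈ P.fpv, X = ρ Y := by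
  have hup : ∀ {ρ : ℕ → ℕ} {X} {S : Set ℕ}, (∃ Y ∈ S, X + 1 = upRen ρ Y) → ∃ Y, Y + 1 ∈ S ∧ X = ρ Y := by
    rintro ρ X S ⟨_ | Y, hY, h⟩
    · cases h
    · exact ⟨Y, hY, Nat.succ_injective h⟩
  induction P with
  | res A P ih => intro ρ X h; exact ih h
  | par P Q ihP ihQ =>
    rintro ρ X (h | h)
    · exact (ihP h).imp fun Y h => ⟨.inl h.1, h.2⟩
    · exact (ihQ h).imp fun Y h => ⟨.inr h.1, h.2⟩
  | sel c q l d P ih => intro ρ X h; exact ih h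
  | brn c q n lab P ih =>
    rintro ρ X ⟨i, h⟩
    exact (ih i h).imp fun Y h => ⟨⟨i, h.1⟩, h.2⟩
  | defn Ss Q P ihQ ihP =>
    rintro ρ X (h | h)
    · exact (hup (ihQ h)).imp fun Y h => ⟨.inl h.1, h.2⟩
    · exact (hup (ihP h)).imp fun Y h => ⟨.inr h.1, h.2⟩
  | call Y ds => rintro ρ X rfl; exact ⟨Y, rfl, rfl⟩
  | _ => intro ρ X h; exact h.elim

theorem renS_renS (P : Proc) : ∀ (ρ ρ' : ℕ → ℕ), (P.renS ρ').renS ρ = P.renS fun i => ρ (ρ' i) := by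
  have hup : ∀ (ρ ρ' : ℕ → ℕ), (fun i => upRen ρ (upRen ρ' i)) = upRen fun i => ρ (ρ' i) := by
    intro ρ ρ'; funext i; cases i <;> rfl
  have hc : ∀ (ρ ρ' : ℕ → ℕ) (c : Chan), (c.renS ρ').renS ρ = c.renS fun i => ρ (ρ' i) := by
    intro ρ ρ' c; cases c <;> rfl
  induction P with
  | call X ds => intro ρ ρ'; simp [renS, Pay.renS_renS]
  | _ => intro ρ ρ'; simp_all [renS, Pay.renS_renS]

theorem IsRecovery.renX {P : Proc} (h : IsRecovery P) : ∀ (ρ : ℕ → ℕ), IsRecovery (P.renX ρ) := by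
  induction h with
  | brn s p q P => intro ρ; exact .brn s p q _
  | defn Ss B _ ih => intro ρ; exact .defn _ _ (ih _)

theorem IsRecovery.renS {P : Proc} (h : IsRecovery P) : ∀ (ρ : ℕ → ℕ), IsRecovery (P.renS ρ) := by
  induction h with
  | brn s p q P => intro ρ; exact .brn _ p q _
  | defn Ss B _ ih => intro ρ; exact .defn _ _ (ih _)

/-- An unused declaration is made to scope over an inserted inactive process alone, where `defNil`
removes it. -/
theorem cong_defn_drop {Ss Q P} (hc : fc Q = ∅) (hv : ∀ x ∈ fv Q, x < Ss.length) :
    Cong (defn Ss Q (renX Nat.succ P)) P :=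
  (Cong.congDefn (.refl _) ((Cong.parNil _).symm.trans (.parComm _ _))).trans
    ((Cong.defPar Ss Q nil P).trans ((Cong.congPar (.defNil Ss Q hc hv) (.refl _)).trans
      ((Cong.parComm _ _).trans (.parNil _))))

theorem cong_bigPar_append (l l' : List Proc) :
    Cong (bigPar (l ++ l')) (par (bigPar l) (bigPar l')) := by
  induction l with
  | nil => exact (Cong.parNil _).symm.trans (.parComm _ _)
  | cons P l ih => exact (Cong.congPar (.refl _) ih).trans (Cong.parAssoc _ _ _).symm

end Proc

/-! ### The form of stuck processes -/

section Final

variable {g : Prop}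

/-- Declarations that are not owned by a role can be removed. -/
theorem J_clean (P : Proc) : ∀ {w s D Θ Δ L}, J g w s D Θ Δ L P →
    ∃ P', Proc.Cong P P' ∧ (∀ X ∈ P'.fpv, ∃ o Ss, Θ X o Ss) ∧
      (P.IsRecovery → P'.IsRecovery) := by
  induction P with
  | res A P ih =>
    intro w s D Θ Δ L h
    obtain ⟨P', h1, h2, _⟩ := ih (s := s + 1) h
    exact ⟨_, .congRes h1, h2, fun h => nomatch h⟩
  | par P Q ihP ihQ =>
    rintro w s D Θ Δ L ⟨L₁, L₂, h1, h2, hs⟩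
    obtain ⟨P', h3, h4, _⟩ := ihP h1
    obtain ⟨Q', h5, h6, _⟩ := ihQ h2
    exact ⟨_, .congPar h3 h5, fun X hX => hX.elim (h4 X) (h6 X), fun h => nomatch h⟩
  | sel c q l d P ih =>
    rintro w s D Θ Δ L ⟨r, k, U, S, T, L₀, L₂, h1, h2, h3, h4, h5, h6, h7⟩
    obtain ⟨P', h8, h9, _⟩ := ih h7
    refine ⟨_, .congSel h8, fun X hX => ?_, fun h => nomatch h⟩
    obtain ⟨o, Ss, h, _⟩ := h9 X hX
    exact ⟨o, Ss, h⟩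
  | brn c q n lab P ih =>
    rintro w s D Θ Δ L ⟨r, k, U, S, T, h1, h2, h3, h4, h5⟩
    choose P' h6 h7 _ using fun i => ih i (h5 i)
    refine ⟨_, .congBrn h6, fun X hX => ?_, fun h => ?_⟩
    · obtain ⟨i, hi⟩ := hX
      obtain ⟨o, Ss, h, _⟩ := h7 i X hi
      exact ⟨o, Ss, h⟩
    · cases h
      exact .brn _ _ _ _
  | defn Ss Q P ihQ ihP =>
    rintro w s D Θ Δ L (⟨r, h1, h2, h3, h⟩ | ⟨h1, h2, h⟩)
    · obtain ⟨Q', h4, h5, _⟩ := ihQ h3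
      obtain ⟨P', h6, h7, h8⟩ := ihP h
      refine ⟨_, .congDefn h4 h6, fun X hX => ?_, fun h => ?_⟩
      · rcases hX with hX | hX
        · obtain ⟨o, Ss', h, _⟩ := h5 _ hX
          exact ⟨o, Ss', h⟩
        · exact h7 _ hX
      · cases h with
        | defn _ _ h => exact .defn _ _ (h8 h)
    · obtain ⟨P', h6, h7, h8⟩ := ihP h
      -- After cleaning, variable `0` is no longer called, so lowering the indices loses nothing and
      -- the process is a weakening.
      have h0 : (P'.renX Nat.pred).renX Nat.succ = P' := by
        rw [renX_renX]
        refine Proc.renX_eq_self _ fun X hX => ?_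
        cases X with
        | zero => exact (h7 _ hX).elim fun _ h => h.elim fun _ h => h.elim
        | succ X => rfl
      have hc : Proc.Cong (.defn Ss Q P) (P'.renX Nat.pred) :=
        (Proc.Cong.congDefn (.refl _) h6).trans (by
          conv_lhs => rw [← h0]
          exact Proc.cong_defn_drop h1 h2)
      refine ⟨_, hc, fun X hX => ?_, fun h => ?_⟩
      · obtain ⟨Y, hY, rfl⟩ := Proc.mem_fpv_renX P' hX
        have := h7 Y hY
        cases Y with
        | zero => exact this.elim fun _ h => h.elim fun _ h => h.elim
        | succ Y => exact this
      · cases h with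
        | defn _ _ h => exact (h8 h).renX _
  | call X ds =>
    rintro w s D Θ Δ L ⟨r, Ss, h, _⟩
    exact ⟨_, .refl _, fun Y hY => ⟨r, Ss, by cases hY; exact h⟩, id⟩
  | _ => intro w s D Θ Δ L _; exact ⟨_, .refl _, fun X hX => hX.elim, id⟩

/-- A typed crash-recovery thread of role `p`. -/
def RecoveryAt (g : Prop) (s : ℕ) (Θ : TEnv) (x : Role × Proc) : Prop :=
  x.2.IsRecovery ∧ ∃ L : LCtx, L.Closed ∧ J g x.1 s VSet.empty (TEnv.only x.1 Θ) VSet.empty L x.2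

/-- The parallel composition of a list of threads. -/
def threads (l : List (Role × Proc)) : Proc := Proc.bigPar (l.map Prod.snd)

/-- A thread may call only variables of its owner. If the outermost declaration has no entry for
that role, it is unused once untyped declarations have been removed, so the thread can leave its
scope. -/
theorem RecoveryAt.strip {s : ℕ} {Θ : TEnv} {θ : Role → List Ty → Prop} {x : Role × Proc}
    (h : RecoveryAt g s (scons θ Θ) x) (hθ : ∀ Ss, ¬ θ x.1 Ss) :
    ∃ P, Proc.Cong x.2 (P.renX Nat.succ) ∧ RecoveryAt g s Θ (x.1, P) := by
  obtain ⟨hr, L, hL, hJ⟩ := h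
  obtain ⟨P', h1, h2, h3⟩ := J_clean _ hJ
  have h0 : (P'.renX Nat.pred).renX Nat.succ = P' := by
    rw [renX_renX]
    refine Proc.renX_eq_self _ fun X hX => ?_
    cases X with
    | zero =>
      obtain ⟨o, Ss, h, rfl⟩ := h2 _ hX
      exact absurd h (hθ Ss)
    | succ X => rfl
  refine ⟨P'.renX Nat.pred, h0.symm ▸ h1, (h3 hr).renX _, L, hL, ?_⟩
  have := (J_cong h1 _ _ _ _ _ _).1 hJ
  rw [← h0] at this
  exact (J_renX _ (Θ := TEnv.only x.1 Θ) Nat.succ_injective fun X => rfl).1 this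

theorem exists_strip {s : ℕ} {Θ : TEnv} {θ : Role → List Ty → Prop} (l : List (Role × Proc))
    (h : ∀ x ∈ l, RecoveryAt g s (scons θ Θ) x ∧ ∀ Ss, ¬ θ x.1 Ss) :
    ∃ l' : List (Role × Proc), l'.map Prod.fst = l.map Prod.fst ∧
      Proc.Cong (threads l) ((threads l').renX Nat.succ) ∧ ∀ x ∈ l', RecoveryAt g s Θ x := by
  induction l with
  | nil => exact ⟨[], rfl, .refl _, by simp⟩
  | cons x l ih =>
    obtain ⟨l', h1, h2, h3⟩ := ih fun y hy => h y (by simp [hy])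
    obtain ⟨P, h4, h5⟩ := (h x (by simp)).1.strip (h x (by simp)).2
    exact ⟨(x.1, P) :: l', by simp [h1], .congPar h4 h2, by
      rintro y (_ | ⟨_, hy⟩)
      · exact h5
      · exact h3 y hy⟩

theorem defn_noFree {s r Θ Ss Q} (h : J g r s VSet.empty Θ (basicParams Ss) (LCtx.params Ss) Q) :
    Proc.fc Q = ∅ ∧ ∀ x ∈ Proc.fv Q, x < Ss.length := by
  constructor
  · refine Set.eq_empty_of_forall_notMem fun e he => ?_
    rcases J_fc Q h (s' := e.1) (p := e.2) he with h | h
    · exact h.2 rfl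
    · exact h.2
  · intro x hx
    rcases J_fv Q h hx with h | h
    · exact basicParams_lt h
    · exact params_ne_none h

/-- A declaration owned by a role is moved to the thread of its owner. -/
theorem exists_attach {s r : ℕ} {Θ : TEnv} {Ss : List Ty} {Q : Proc}
    (h1 : ∀ i S, Ss[i]? = some S → S.IsSession → ¬ Proc.HasEarlyPass i Q) (h2 : g → Proc.GuardedBody Q)
    (h3 : J g r s VSet.empty (scons (entry r Ss) (TEnv.only r Θ)) (basicParams Ss) (LCtx.params Ss) Q)
    (l : List (Role × Proc)) (hn : (l.map Prod.fst).Nodup)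
    (h : ∀ x ∈ l, RecoveryAt g s (scons (entry r Ss) Θ) x) :
    ∃ l' : List (Role × Proc), l'.map Prod.fst = l.map Prod.fst ∧
      Proc.Cong (.defn Ss Q (threads l)) (threads l') ∧ ∀ x ∈ l', RecoveryAt g s Θ x := by
  obtain ⟨hfc, hfv⟩ := defn_noFree h3
  induction l with
  | nil => exact ⟨[], rfl, .defNil Ss Q hfc hfv, by simp⟩
  | cons x l ih =>
    obtain ⟨hx, hn⟩ := List.nodup_cons.1 hn
    by_cases hr : x.1 = r
    -- The roles of the threads are distinct, so all remaining threads can leave the scope of the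
    -- declaration.
    · obtain ⟨l', h4, h5, h6⟩ := exists_strip l fun y hy => ⟨h y (by simp [hy]), fun Ss' hy' => by
        refine hx ?_
        rw [hr, ← hy'.1]
        exact List.mem_map_of_mem hy⟩
      refine ⟨(x.1, .defn Ss Q x.2) :: l', by simp [h4],
        (Proc.Cong.congDefn (.refl _) (.congPar (.refl _) h5)).trans (.defPar _ _ _ _), ?_⟩
      rintro y (_ | ⟨_, hy⟩)
      · obtain ⟨hrec, L, hL, hJ⟩ := h x (by simp)
        refine ⟨.defn _ _ hrec, L, hL, .inl ⟨r, h1, h2, ?_, ?_⟩⟩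
        · refine J_mono Q (fun _ h => h) (fun X o Ss' hX => ?_) (fun _ _ => rfl) h3
          cases X with
          | zero => exact hX
          | succ X => exact ⟨⟨hX.1, hX.2.trans hr.symm⟩, hX.2⟩
        · refine J_mono x.2 (fun _ h => h) (fun X o Ss' hX => ?_) (fun _ _ => rfl) hJ
          cases X with
          | zero => exact hX.1
          | succ X => exact hX
      · exact h6 y hy
    · obtain ⟨l', h4, h5, h6⟩ := ih hn fun y hy => h y (by simp [hy])
      obtain ⟨P, h7, h8⟩ := (h x (by simp)).strip fun Ss' hx' => hr hx'.1
      refine ⟨(x.1, P) :: l', by simp [h4], ?_, ?_⟩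
      · refine (Proc.Cong.congDefn (.refl _)
          ((Proc.Cong.congPar h7 (.refl _)).trans (.parComm _ _))).trans ?_
        exact (Proc.Cong.defPar _ _ _ _).trans ((Proc.Cong.congPar h5 (.refl _)).trans (.parComm _ _))
      · rintro y (_ | ⟨_, hy⟩)
        · exact h8
        · exact h6 y hy

/-- The parallel composition of crashed endpoints. -/
def ruins (E : List (ℕ × Role)) : Proc := Proc.bigPar (E.map fun e => .crashed e.1 e.2)

theorem ruins_renX (ρ : ℕ → ℕ) (E : List (ℕ × Role)) : (ruins E).renX ρ = ruins E := by
  induction E with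
  | nil => rfl
  | cons e E ih => exact congrArg (Proc.par _) ih

/-- The crashed endpoints of the innermost restricted session, and the others. -/
theorem exists_ruins (E : List (ℕ × Role)) : ∃ (ps : List Role) (E' : List (ℕ × Role)),
    Proc.Cong (ruins E) (.par ((ruins E').renS Nat.succ) (Proc.bigPar (ps.map (.crashed 0)))) := by
  induction E with
  | nil => exact ⟨[], [], (Proc.Cong.parNil _).symm⟩
  | cons e E ih =>
    obtain ⟨ps, E', h⟩ := ih
    obtain ⟨s, p⟩ := e
    cases s with
    | zero =>
      refine ⟨p :: ps, E', (Proc.Cong.congPar (.refl _) h).trans ?_⟩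
      exact (Proc.Cong.parAssoc _ _ _).symm.trans
        ((Proc.Cong.congPar (.parComm _ _) (.refl _)).trans (.parAssoc _ _ _))
    | succ s =>
      exact ⟨ps, (s, p) :: E', (Proc.Cong.congPar (.refl _) h).trans (Proc.Cong.parAssoc _ _ _).symm⟩

/-- Recovery threads do not mention dead sessions, in particular not the innermost restricted one.
They can therefore be moved out of the restriction. -/
theorem exists_lower {s : ℕ} {Θ : TEnv} (l : List (Role × Proc))
    (h : ∀ x ∈ l, RecoveryAt g (s + 1) Θ x) :
    ∃ l' : List (Role × Proc), l'.map Prod.fst = l.map Prod.fst ∧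
      threads l = (threads l').renS Nat.succ ∧ ∀ x ∈ l', RecoveryAt g s Θ x := by
  induction l with
  | nil => exact ⟨[], rfl, rfl, by simp⟩
  | cons x l ih =>
    obtain ⟨l', h1, h2, h3⟩ := ih fun y hy => h y (by simp [hy])
    obtain ⟨hr, L, hL, hJ⟩ := h x (by simp)
    have h0 : (x.2.renS Nat.pred).renS Nat.succ = x.2 := by
      rw [Proc.renS_renS]
      refine Proc.renS_eq_self _ fun e he => ?_
      rcases J_fc _ hJ (s' := e.1) (p := e.2) he with h | h
      · rw [h.1]; rfl
      · exact h.2.elim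
    refine ⟨(x.1, x.2.renS Nat.pred) :: l', by simp [h1], ?_, ?_⟩
    · change Proc.par x.2 (threads l) = .par _ _
      rw [h0, h2]
      rfl
    · rintro y (_ | ⟨_, hy⟩)
      · refine ⟨hr.renS _, L, hL, ?_⟩
        have hJ' := hJ
        rw [← h0] at hJ'
        exact (J_renS _ (ρ := Nat.succ) (s := s) (fun x => Nat.succ_inj) fun x => Iff.rfl).1 hJ'
      · exact h3 y hy

/-- The form of processes without calls in which all types are those of crash recoveries. -/
theorem J_finalForm (P : Proc) : ∀ {w s D Θ L}, L.Closed → J g w s D Θ VSet.empty L P →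
    ¬ ActCall (fun _ _ => True) s P →
    (∀ p U, L (.role p) = some U →
      (∀ q l S T, ¬ U.Sub (.sel q 1 (fun _ => l) (fun _ => S) (fun _ => T))) ∧
      ∀ q n lab S T, U.Sub (.brn q n lab S T) → n = 1 ∧ ∀ i, lab i = .crash) →
    ∃ (E : List (ℕ × Role)) (l : List (Role × Proc)), Proc.Cong P (.par (ruins E) (threads l)) ∧
      (l.map Prod.fst).Nodup ∧ (∀ p ∈ l.map Prod.fst, L (.role p) ≠ none) ∧
      ∀ x ∈ l, RecoveryAt g s Θ x := by
  induction P with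
  | nil =>
    intro w s D Θ L _ _ _ _
    exact ⟨[], [], (Proc.Cong.parNil _).symm, by simp, by simp, by simp⟩
  | err => intro w s D Θ L _ h; exact h.elim
  | call X ds => intro w s D Θ L _ _ h; exact absurd trivial h
  | crashed s' p =>
    intro w s D Θ L _ _ _ _
    exact ⟨[(s', p)], [], (Proc.Cong.parNil _).symm.trans (Proc.Cong.parNil _).symm, by simp, by simp,
      by simp⟩
  | sel c q l d P _ =>
    intro w s D Θ L hL h _ hA
    obtain ⟨p', U, S, T, v, rfl, rfl, h1, h2, h3, _⟩ := J_sel_closed hL h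
    exact absurd h3 ((hA p' U h2).1 _ _ _ _)
  | brn c q n lab P _ =>
    intro w s D Θ L hL h _ hA
    have h' := h
    obtain ⟨p, U, S, T, rfl, h1, h2, h3, h4⟩ := J_brn_closed hL h'
    obtain ⟨rfl, hlab⟩ := (hA p U h2).2 _ _ _ _ _ h3
    obtain rfl : lab = fun _ => .crash := funext hlab
    refine ⟨[], [(p, _)], (Proc.Cong.parNil _).symm.trans ((Proc.Cong.parNil _).symm.trans
      ((Proc.Cong.parComm _ _).trans (.congPar (.refl _) (.refl _)))), by simp, by simp [h2], ?_⟩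
    intro x hx
    obtain rfl := List.mem_singleton.1 hx
    refine ⟨.brn _ _ _ _, L, hL, ?_⟩
    obtain ⟨r, k, U', S', T', h5, h6, h7, h8, h9⟩ := h
    have hr : p = r := h6.1 p (by simp [h2])
    subst hr
    exact ⟨p, k, U', S', T', h5, ⟨h6.1, fun x hx => absurd (hL x) hx⟩, h7, h8, fun i =>
      J_mono _ (fun _ h => h) (fun X o Ss h => ⟨h, h.2⟩) (fun _ _ => rfl) (h9 i)⟩
  | par P Q ihP ihQ =>
    rintro w s D Θ L hL ⟨L₁, L₂, h1, h2, hs⟩ hc hA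
    obtain ⟨E, l, h3, h4, h5, h6⟩ := ihP (hL.left hs) h1 (fun h => hc (.inl h))
      fun p U hU => hA p U (hs.some_left hU).1
    obtain ⟨E', l', h3', h4', h5', h6'⟩ := ihQ (hL.right hs) h2 (fun h => hc (.inr h))
      fun p U hU => hA p U (hs.some_right hU).1
    refine ⟨E ++ E', l ++ l', ?_, ?_, ?_, ?_⟩
    · have hE : Proc.Cong (ruins (E ++ E')) (.par (ruins E) (ruins E')) := by
        simp only [ruins, List.map_append]
        exact Proc.cong_bigPar_append _ _
      have hl : Proc.Cong (threads (l ++ l')) (.par (threads l) (threads l')) := by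
        simp only [threads, List.map_append]
        exact Proc.cong_bigPar_append _ _
      refine (Proc.Cong.congPar h3 h3').trans (.trans ?_ (Proc.Cong.congPar hE hl).symm)
      refine (cong_par_assoc_swap _ _ _).trans ?_
      refine (Proc.Cong.congPar (Proc.Cong.parAssoc _ _ _).symm (.refl _)).trans ?_
      exact (Proc.Cong.parAssoc _ _ _).trans (.congPar (.refl _) (.parComm _ _))
    · rw [List.map_append, List.nodup_append]
      refine ⟨h4, h4', fun a ha b hb hab => ?_⟩
      subst hab
      exact (hs (.role a)).elim (fun h => h5 a ha h.1) (fun h => h5' a hb h.1)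
    · intro p hp
      rw [List.map_append, List.mem_append] at hp
      exact hs.ne_none.2 (hp.imp (h5 p) (h5' p))
    · intro x hx
      exact (List.mem_append.1 hx).elim (h6 x) (h6' x)
  | res A P ih =>
    intro w s D Θ L hL h hc hA
    obtain ⟨E, l, h1, h2, h3, h4⟩ := ih (s := s + 1) hL h hc hA
    -- Once the threads and the other crashed endpoints have left the restriction, it contains only
    -- crashed endpoints of its own session and is removed by `stopElim`.
    obtain ⟨ps, E', h5⟩ := exists_ruins E
    obtain ⟨l', h6, h7, h8⟩ := exists_lower l h4
    rw [← h6] at h2 h3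
    refine ⟨E', l', (Proc.Cong.congRes (h1.trans ?_)).trans ((Proc.Cong.resLift A
      (.par (ruins E') (threads l')) (Proc.bigPar (ps.map (.crashed 0)))).trans ?_), h2, h3, h8⟩
    · rw [h7]
      exact (Proc.Cong.congPar h5 (.refl _)).trans (cong_par_assoc_swap _ _ _)
    · exact (Proc.Cong.congPar (.refl _) (.stopElim A ps)).trans (.parNil _)
  | defn Ss Q P _ ih =>
    rintro w s D Θ L hL (⟨r, h1, h2, h3, h⟩ | ⟨h1, h2, h⟩) hc hA
    · obtain ⟨E, l, h4, h5, h6, h7⟩ := ih hL h hc hA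
      obtain ⟨l', h8, h9, h10⟩ := exists_attach h1 h2 h3 l h5 h7
      rw [← h8] at h5 h6
      refine ⟨E, l', (Proc.Cong.congDefn (.refl _) (h4.trans (.parComm _ _))).trans ?_, h5, h6, h10⟩
      have := Proc.Cong.defPar Ss Q (threads l) (ruins E)
      rw [ruins_renX] at this
      exact this.trans ((Proc.Cong.congPar h9 (.refl _)).trans (.parComm _ _))
    · obtain ⟨E, l, h4, h5, h6, h7⟩ := ih hL h hc hA
      obtain ⟨l', h8, h9, h10⟩ := exists_strip l fun x hx => ⟨h7 x hx, fun _ h => h⟩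
      rw [← h8] at h5 h6
      refine ⟨E, l', (Proc.Cong.congDefn (.refl _) (h4.trans (.congPar (.refl _) h9))).trans ?_,
        h5, h6, h10⟩
      have := Proc.cong_defn_drop (P := .par (ruins E) (threads l')) h1 h2
      rwa [Proc.renX, ruins_renX] at this

end Final

/-- A stuck process has no active calls, and its context is stuck, since otherwise the process could
follow it. Deadlock-freedom of the context then leaves no prefixes other than pure crash recoveries.
-/
theorem Conforms.deadlockFree {g : Prop} {s : ℕ} {Ses : Set ℕ} {Γ : Ctx} {L : LCtx} {P : Proc}
    {Rel : ℕ → Set Role} (h : Conforms g s Ses Γ L P) (hs : Γ.Safe s (Rel s))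
    (hd : Γ.DeadlockFree s (Rel s)) : P.DeadlockFree Ses Rel := by
  intro P' hr hst
  obtain ⟨Γ', L', h', hs', hΓ⟩ := h.steps hs hr
  have hstuck : Γ'.Stuck := by
    rintro ⟨Γ'', hred⟩
    obtain ⟨β, H', hm, hβ, _⟩ := hred.move h'.wf h'.only
    exact hst (h'.exists_red (hs'.now h'.wf) hm hβ)
  have hcall : ¬ ActCall (fun _ _ => True) s P' := by
    intro ha
    obtain ⟨P'', hu⟩ := h'.exists_unfold (fun _ _ _ => trivial) ha
    exact hst ⟨P'', (J_unfold hu h'.closed h'.typed).1⟩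
  obtain ⟨E, l, h1, _, _, h4⟩ := J_finalForm P' h'.closed h'.typed hcall fun p U hU => by
    obtain ⟨U', hU', hsub⟩ := h'.agree p U hU
    have hcase := hd Γ' hΓ hstuck p U' hU'
    constructor
    · intro q l S T hsel
      have hsel := hsub.trans hsel
      obtain ⟨n, lab, Ss, Ts, hu, _⟩ := hsel.sel_inv
      rcases hcase with h | rfl | ⟨q', T', h⟩
      · exact hsel.not_done_sel h
      · cases hsel.crashed_eq
      · obtain ⟨n', lab', Ss', Ts', hu', _⟩ := h.brn_inv
        cases hu.det hu'
    · intro q n lab S T hbrn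
      have hbrn := hsub.trans hbrn
      obtain ⟨n₀, lab₀, S₀, T₀, hu, hlab, hone⟩ := hbrn.brn_inv
      have hinj := (hbrn.1.unf hu).sess_brn
      rcases hcase with h | rfl | ⟨q', T', h⟩
      · exact absurd h hbrn.not_done_brn
      · cases hbrn.crashed_eq
      · obtain ⟨n', lab', Ss', Ts', hu', hlab', _⟩ := h.brn_inv
        cases hu.det hu'
        have hcr : ∀ i, lab₀ i = .crash := fun i => (hlab' i).elim fun _ h => h.1
        have h0 : 0 < n₀ := Nat.pos_of_ne_zero hinj.1
        have h1 : n₀ = 1 := by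
          by_contra hne
          have := hinj.2.1 ((hcr ⟨0, h0⟩).trans (hcr ⟨1, by omega⟩).symm)
          simp at this
        -- The subtyping rule for pure crash choices makes the branching of the process a pure crash
        -- recovery too: such a choice has no supertype with more branches.
        have hn := (hone h1).resolve_left fun h => h ⟨0, h0⟩ (hcr _)
        refine ⟨hn, fun i => ?_⟩
        obtain ⟨j, hj, _⟩ := hlab ⟨0, h0⟩
        subst hn
        rw [Subsingleton.elim i j, ← hj, hcr]
  refine ⟨E, l.map Prod.snd, fun Q hQ => ?_, h1.trans ((Proc.Cong.parNil _).symm.trans (.parComm _ _))⟩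
  obtain ⟨x, hx, rfl⟩ := List.mem_map.1 hQ
  exact (h4 x hx).1

/-! ## Fair schedules -/

/-- Pairing each code with an arbitrary second component makes every task recur beyond every
position. -/
theorem exists_schedule (T : Type) [Encodable T] [Inhabited T] :
    ∃ σ : ℕ → T, ∀ t n, ∃ m, n ≤ m ∧ σ m = t :=
  ⟨fun m => (Encodable.decode m.unpair.1).getD default, fun t n =>
    ⟨Nat.pair (Encodable.encode t) n, Nat.right_le_pair _ _, by simp⟩⟩

/-- If tasks stay enabled until they are executed, then there is a run that executes each task that
is enabled at some point. -/
theorem exists_fair_run {X T : Type} [Encodable T] [Inhabited T] (En : X → T → Prop)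
    (St : X → T → X → Prop) (hex : ∀ x t, En x t → ∃ x', St x t x')
    (hper : ∀ x t x' u, St x t x' → En x u → u ≠ t → En x' u) (x₀ : X) :
    ∃ f : ℕ → X, f 0 = x₀ ∧ (∀ n, (∃ t, En (f n) t) → ∃ t, St (f n) t (f (n + 1))) ∧
      ∀ n t, En (f n) t → ∃ k, n ≤ k ∧ St (f k) t (f (k + 1)) ∧
        ∀ i, n ≤ i → i ≤ k → En (f i) t := by
  classical
  obtain ⟨σ, hσ⟩ := exists_schedule T
  -- A state carries a pointer into the schedule. The next task is the first enabled one from the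
  -- pointer on, and the pointer moves past it. If nothing is enabled, the next state is immaterial.
  have hnext : ∀ y : X × ℕ, ∃ y' : X × ℕ, (∃ t, En y.1 t) → ∃ m, y.2 ≤ m ∧ y'.2 = m + 1 ∧
      (∀ j, y.2 ≤ j → En y.1 (σ j) → m ≤ j) ∧ St y.1 (σ m) y'.1 := by
    intro y
    by_cases h : ∃ t, En y.1 t
    · obtain ⟨t, ht⟩ := h
      have hm : ∃ m, y.2 ≤ m ∧ En y.1 (σ m) := by
        obtain ⟨m, h1, h2⟩ := hσ t y.2
        exact ⟨m, h1, h2.symm ▸ ht⟩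
      obtain ⟨x', hx'⟩ := hex _ _ (Nat.find_spec hm).2
      exact ⟨(x', Nat.find hm + 1), fun _ => ⟨Nat.find hm, (Nat.find_spec hm).1, rfl,
        fun j h1 h2 => Nat.find_min' hm ⟨h1, h2⟩, hx'⟩⟩
    · exact ⟨y, fun h' => absurd h' h⟩
  choose F hF using hnext
  let y : ℕ → X × ℕ := fun n => Nat.rec (x₀, 0) (fun _ => F) n
  refine ⟨fun n => (y n).1, rfl, fun n h => ?_, fun n t h => ?_⟩
  · obtain ⟨m, _, _, _, h⟩ := hF (y n) h
    exact ⟨σ m, h⟩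
  obtain ⟨m, hm, rfl⟩ := hσ t (y n).2
  -- The pointer cannot pass position `m` while `σ m` is enabled without performing that task. Hence
  -- the distance `d` to `m` decreases until it is performed.
  suffices key : ∀ d n, (y n).2 ≤ m → m ≤ (y n).2 + d → En (y n).1 (σ m) → ∃ k, n ≤ k ∧
      St (y k).1 (σ m) (y (k + 1)).1 ∧ ∀ i, n ≤ i → i ≤ k → En (y i).1 (σ m) from
    key m n hm (by omega) h
  intro d
  induction d with
  | zero =>
    intro n h1 h2 h
    obtain ⟨m', h3, h4, h5, h6⟩ := hF (y n) ⟨_, h⟩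
    obtain rfl : m' = m := by have := h5 m h1 h; omega
    exact ⟨n, le_rfl, h6, fun i h7 h8 => le_antisymm h7 h8 ▸ h⟩
  | succ d ih =>
    intro n h1 h2 h
    obtain ⟨m', h3, h4, h5, h6⟩ := hF (y n) ⟨_, h⟩
    have h7 := h5 m h1 h
    by_cases hm' : σ m = σ m'
    · exact ⟨n, le_rfl, hm' ▸ h6, fun i h7 h8 => le_antisymm h7 h8 ▸ h⟩
    · have hlt : m' < m := lt_of_le_of_ne h7 fun h => hm' (h ▸ rfl)
      obtain ⟨k, h8, h9, h10⟩ := ih (n + 1) (by change (F (y n)).2 ≤ m; omega)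
        (by change m ≤ (F (y n)).2 + d; omega) (hper _ _ _ _ h6 h hm')
      refine ⟨k, by omega, h9, fun i h11 h12 => ?_⟩
      rcases Nat.eq_or_lt_of_le h11 with rfl | h11
      · exact h
      · exact h10 i h11 h12

/-! ## Persistence of moves -/

/-- The communication or detection that a move performs, without the label. -/
def MAct.task : MAct → Option (Bool × Role × Role)
  | comm p q _ => some (true, p, q)
  | detect q p => some (false, q, p)
  | crash _ => none

/-- The task `t` can be performed. -/
def Conf.Enabled (H : Conf) (t : Bool × Role × Role) : Prop :=
  ∃ β H', β.task = some t ∧ Move H β H'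

namespace Conf

theorem enabled_comm {H : Conf} {p q} :
    H.Enabled (true, p, q) ↔ ∃ l H', Move H (.comm p q l) H' := by
  refine ⟨?_, fun ⟨l, H', h⟩ => ⟨_, H', rfl, h⟩⟩
  rintro ⟨β | β | β, H', hβ, hm⟩ <;> cases hβ
  exact ⟨_, H', hm⟩

theorem enabled_detect {H : Conf} {q p} :
    H.Enabled (false, q, p) ↔ ∃ H', Move H (.detect q p) H' := by
  refine ⟨?_, fun ⟨H', h⟩ => ⟨_, H', rfl, h⟩⟩
  rintro ⟨β | β | β, H', hβ, hm⟩ <;> cases hβ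
  exact ⟨H', hm⟩

theorem Inp.det {H : Conf} {p q q' l l' S T S' T'} (h : Inp H p q l S T)
    (h' : Inp H p q' l' S' T') : q = q' := by
  obtain ⟨U, n, lab, Ss, Ts, k, hU, hu, _⟩ := h
  obtain ⟨V, n', lab', Ss', Ts', k', hV, hu', _⟩ := h'
  cases hU.symm.trans hV
  cases hu.det hu'
  rfl

theorem Out.congr {H H' : Conf} {p q l S T} (h : Out H p q l S T) (hp : H' p = H p) :
    Out H' p q l S T := by
  obtain ⟨U, n, lab, Ss, Ts, k, hU, h⟩ := h
  exact ⟨U, n, lab, Ss, Ts, k, hp.trans hU, h⟩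

theorem Inp.congr {H H' : Conf} {p q l S T} (h : Inp H p q l S T) (hp : H' p = H p) :
    Inp H' p q l S T := by
  obtain ⟨U, n, lab, Ss, Ts, k, hU, h⟩ := h
  exact ⟨U, n, lab, Ss, Ts, k, hp.trans hU, h⟩

theorem Out.det_role {H : Conf} {p q q' l l' S T S' T'} (h : Out H p q l S T)
    (h' : Out H p q' l' S' T') : q = q' := by
  obtain ⟨U, n, lab, Ss, Ts, k, hU, hu, _⟩ := h
  obtain ⟨V, n', lab', Ss', Ts', k', hV, hu', _⟩ := h'
  cases hU.symm.trans hV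
  cases hu.det hu'
  rfl

/-- The roles that a move changes. -/
theorem Move.eq_or {H H' : Conf} {β t} (h : Move H β H') (hβ : β.task = some t) (r : Role) :
    H' r = H r ∨ (∃ p q, t = (true, p, q) ∧ ((r = p ∧ ∃ l S T, Out H p q l S T) ∨
        (r = q ∧ (∃ l S T, Out H p q l S T) ∧ ∃ l S T, Inp H q p l S T))) ∨
      ∃ p q, t = (false, q, p) ∧ r = q ∧ H p = some .crashed ∧ ∃ l S T, Inp H q p l S T := by
  cases h with
  | @comm p q l S S' T T' ho hi hS =>
    cases hβ
    by_cases hq : r = q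
    · exact .inr (.inl ⟨p, q, rfl, .inr ⟨hq, ⟨_, _, _, ho⟩, _, _, _, hi⟩⟩)
    by_cases hp : r = p
    · exact .inr (.inl ⟨p, q, rfl, .inl ⟨hp, _, _, _, ho⟩⟩)
    · exact .inl (by rw [Function.update_of_ne hq, Function.update_of_ne hp])
  | @lost p q l S T ho hc =>
    cases hβ
    by_cases hp : r = p
    · exact .inr (.inl ⟨p, q, rfl, .inl ⟨hp, _, _, _, ho⟩⟩)
    · exact .inl (Function.update_of_ne hp _ _)
  | @detect p q T hi hc =>
    cases hβ
    by_cases hq : r = q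
    · exact .inr (.inr ⟨p, q, rfl, hq, hc, _, _, _, hi⟩)
    · exact .inl (Function.update_of_ne hq _ _)
  | crash => cases hβ

theorem Move.crashed {H H' : Conf} {β t r} (h : Move H β H') (hβ : β.task = some t)
    (hr : H r = some .crashed) : H' r = some .crashed := by
  rcases h.eq_or hβ r with h | ⟨p, q, _, ⟨rfl, _, _, _, h⟩ | ⟨rfl, _, _, _, _, h⟩⟩ |
    ⟨p, q, _, rfl, _, _, _, _, h⟩
  · rw [h, hr]
  all_goals exact absurd hr h.not_crashed

/-- Tasks stay enabled until they are performed. -/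
theorem Enabled.move {H H' : Conf} {β t u} (hu : H.Enabled u) (h : Move H β H')
    (hβ : β.task = some t) (hne : u ≠ t) : H'.Enabled u := by
  have hout : ∀ {p q l S T}, Out H p q l S T → u = (true, p, q) → H' p = H p := by
    rintro p q l S T ho rfl
    rcases h.eq_or hβ p with h | ⟨p', q', rfl, ⟨rfl, _, _, _, h⟩ | ⟨rfl, _, _, _, _, h⟩⟩ |
      ⟨p', q', _, rfl, _, _, _, _, h⟩
    · exact h
    · exact absurd (by rw [ho.det_role h]) hne
    all_goals exact (ho.not_inp h).elim
  obtain ⟨γ, K, hγ, hm⟩ := hu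
  cases hm with
  | @comm p q l S S' T T' ho hi hS =>
    cases hγ
    have hq : H' q = H q := by
      rcases h.eq_or hβ q with h | ⟨p', q', rfl, ⟨rfl, _, _, _, h⟩ | ⟨rfl, _, _, _, _, h⟩⟩ |
        ⟨p', q', _, rfl, hc, _, _, _, h⟩
      · exact h
      · exact (h.not_inp hi).elim
      · exact absurd (by rw [hi.det h]) hne
      -- A detection by `q` would concern its only possible partner `p`, which is able to send and
      -- so has not crashed.
      · rw [← hi.det h] at hc
        exact absurd hc ho.not_crashed
    exact ⟨_, _, rfl, .comm (ho.congr (hout ho rfl)) (hi.congr hq) hS⟩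
  | @lost p q l S T ho hc =>
    cases hγ
    exact ⟨_, _, rfl, .lost (ho.congr (hout ho rfl)) (h.crashed hβ hc)⟩
  | @detect p q T hi hc =>
    cases hγ
    have hq : H' q = H q := by
      rcases h.eq_or hβ q with h | ⟨p', q', rfl, ⟨rfl, _, _, _, h⟩ | ⟨rfl, ⟨_, _, _, ho⟩, _, _, _, h⟩⟩ |
        ⟨p', q', rfl, rfl, _, _, _, _, h⟩
      · exact h
      · exact (h.not_inp hi).elim
      · rw [← hi.det h] at ho
        exact absurd hc ho.not_crashed
      · exact absurd (by rw [hi.det h]) hne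
    exact ⟨_, _, rfl, .detect (hi.congr hq) (h.crashed hβ hc)⟩
  | crash => cases hγ

end Conf

/-! ## Transitions of processes in reduction contexts -/

/-- The index of session `s` below a reduction context. -/
def RCtx.level : RCtx → ℕ → ℕ
  | hole, s => s
  | par C _, s => C.level s
  | res _ C, s => C.level (s + 1)
  | defn _ _ C, s => C.level s

/-- The subject of a selection or branching. -/
def Proc.head : Proc → Option Chan
  | sel c _ _ _ _ => some c
  | brn c _ _ _ _ => some c
  | _ => none

/-- A prefix contains no active call, so what is removed lies in the surrounding context. The prefix
keeps waiting while calls are unfolded around it. -/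
theorem Ext.fill {Q : Proc} {c} (hQ : Q.head = some c) : ∀ (C : RCtx) {X ws P'},
    Ext X ws (C.fill Q) P' → ∃ C' : RCtx, P' = C'.fill Q := by
  intro C
  induction C with
  | hole =>
    intro X ws P' h
    change Ext X ws Q P' at h
    cases h <;> cases hQ
  | par C R ih =>
    intro X ws P' h
    cases h with
    | parL h => obtain ⟨C', rfl⟩ := ih h; exact ⟨.par C' R, rfl⟩
    | parR h => exact ⟨.par C _, rfl⟩
  | res A C ih =>
    intro X ws P' h
    cases h with
    | res h => obtain ⟨C', rfl⟩ := ih h; exact ⟨.res A C', rfl⟩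
  | defn Ss B C ih =>
    intro X ws P' h
    cases h with
    | defn h => obtain ⟨C', rfl⟩ := ih h; exact ⟨.defn Ss B C', rfl⟩

theorem Unfold.fill {φ} {Q : Proc} {c} (hQ : Q.head = some c) : ∀ (C : RCtx) {s P'},
    Unfold φ s (C.fill Q) P' → ∃ C' : RCtx, P' = C'.fill Q := by
  intro C
  induction C with
  | hole =>
    intro s P' h
    change Unfold φ s Q P' at h
    cases h <;> cases hQ
  | par C R ih =>
    intro s P' h
    cases h with
    | parL h => obtain ⟨C', rfl⟩ := ih h; exact ⟨.par C' R, rfl⟩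
    | parR h => exact ⟨.par C _, rfl⟩
  | res A C ih =>
    intro s P' h
    cases h with
    | res h => obtain ⟨C', rfl⟩ := ih h; exact ⟨.res A C', rfl⟩
  | defn Ss B C ih =>
    intro s P' h
    cases h with
    | here _ h => obtain ⟨C', rfl⟩ := h.fill hQ; exact ⟨.defn Ss B (.par C' _), rfl⟩
    | defn h => obtain ⟨C', rfl⟩ := ih h; exact ⟨.defn Ss B C', rfl⟩

section Typing

variable {g : Prop}

theorem J_fill {Q : Proc} : ∀ (C : RCtx) {w s D Θ L}, L.Closed →
    J g w s D Θ VSet.empty L (C.fill Q) → ∃ D' Θ' L₀, L₀.Closed ∧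
      J g w (C.level s) D' Θ' VSet.empty L₀ Q ∧ ∀ k U, L₀ k = some U → L k = some U := by
  intro C
  induction C with
  | hole => intro w s D Θ L hL h; exact ⟨_, _, L, hL, h, fun _ _ h => h⟩
  | par C R ih =>
    rintro w s D Θ L hL ⟨L₁, L₂, h1, h2, hs⟩
    obtain ⟨D', Θ', L₀, h3, h4, h5⟩ := ih (hL.left hs) h1
    exact ⟨D', Θ', L₀, h3, h4, fun k U hU => (hs.some_left (h5 k U hU)).1⟩
  | res A C ih => intro w s D Θ L hL h; exact ih hL h
  | defn Ss B C ih => rintro w s D Θ L hL (⟨_, _, _, _, h⟩ | ⟨_, _, h⟩) <;> exact ih hL h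

theorem J_head {Q : Proc} {c w s D Θ L} (hL : L.Closed) (h : J g w s D Θ VSet.empty L Q)
    (hQ : Q.head = some c) : ∃ p, c = .ep s p ∧ L (.role p) ≠ none := by
  cases Q with
  | sel c' q l d P =>
    cases hQ
    obtain ⟨p, U, S, T, v, rfl, _, _, hU, _⟩ := J_sel_closed hL h
    exact ⟨p, rfl, by simp [hU]⟩
  | brn c' q n lab P =>
    cases hQ
    obtain ⟨p, U, S, T, rfl, _, hU, _⟩ := J_brn_closed hL h
    exact ⟨p, rfl, by simp [hU]⟩
  | _ => cases hQ

theorem J_fill_head {Q : Proc} {C : RCtx} {s' p w s D Θ L} (hL : L.Closed)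
    (h : J g w s D Θ VSet.empty L (C.fill Q)) (hQ : Q.head = some (.ep s' p)) :
    L (.role p) ≠ none := by
  obtain ⟨D', Θ', L₀, h1, h2, h3⟩ := J_fill C hL h
  obtain ⟨p', hp, h4⟩ := J_head h1 h2 hQ
  cases hp
  obtain ⟨U, hU⟩ := Option.ne_none_iff_exists'.1 h4
  simp [h3 _ _ hU]

/-- A transition of a filled context either involves the process in the hole or leaves it alone. -/
theorem J_lts_fill {Q : Proc} {s' p} (hQ : Q.head = some (.ep s' p)) : ∀ (C : RCtx) {w s D Θ L a P'},
    L.Closed → J g w s D Θ VSet.empty L (C.fill Q) → Lts s a (C.fill Q) P' →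
    (a.subj ≠ p ∧ ∃ C' : RCtx, P' = C'.fill Q) ∨
      ∃ (C' : RCtx) (t : ℕ) (Q' : Proc), Leaf t a Q Q' ∧ P' = C'.fill Q' := by
  intro C
  induction C with
  | hole =>
    intro w s D Θ L a P' _ _ h
    change Lts s a Q P' at h
    cases h with
    | leaf h => exact .inr ⟨.hole, s, P', h, rfl⟩
    | _ => cases hQ
  | par C R ih =>
    rintro w s D Θ L a P' hL ⟨L₁, L₂, h1, h2, hs⟩ h
    cases h with
    | leaf h => cases h
    | parL h =>
      rcases ih (hL.left hs) h1 h with ⟨h3, C', rfl⟩ | ⟨C', t, Q', h3, rfl⟩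
      · exact .inl ⟨h3, .par C' R, rfl⟩
      · exact .inr ⟨.par C' R, t, Q', h3, rfl⟩
    | parR h =>
      refine .inl ⟨fun he => ?_, .par C _, rfl⟩
      have h3 := J_lts_ne_none h (hL.right hs) h2
      have h4 := J_fill_head (hL.left hs) h1 hQ
      rw [he] at h3
      exact (hs _).elim (fun h => h4 h.1) fun h => h3 h.1
  | res A C ih =>
    intro w s D Θ L a P' hL hJ h
    cases h with
    | leaf h => cases h
    | res h =>
      rcases ih hL hJ h with ⟨h3, C', rfl⟩ | ⟨C', t, Q', h3, rfl⟩
      · exact .inl ⟨h3, .res A C', rfl⟩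
      · exact .inr ⟨.res A C', t, Q', h3, rfl⟩
  | defn Ss B C ih =>
    intro w s D Θ L a P' hL hJ h
    cases h with
    | leaf h => cases h
    | defn h =>
      obtain ⟨_, _, hJ⟩ : ∃ D' Θ', J g w s D' Θ' VSet.empty L (C.fill Q) := by
        rcases hJ with ⟨_, _, _, _, hJ⟩ | ⟨_, _, hJ⟩
        · exact ⟨_, _, hJ⟩
        · exact ⟨_, _, hJ⟩
      rcases ih hL hJ h with ⟨h3, C', rfl⟩ | ⟨C', t, Q', h3, rfl⟩
      · exact .inl ⟨h3, .defn Ss B C', rfl⟩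
      · exact .inr ⟨.defn Ss B C', t, Q', h3, rfl⟩

/-- By linearity the prefix in the hole is the only thread that can act as `p`. A synchronization in
which the prefix takes no part thus does not involve role `p`, and it leaves the prefix in a hole.
-/
theorem J_sync_fill {Q : Proc} {s' p} (hQ : Q.head = some (.ep s' p)) :
    ∀ (C : RCtx) {w s D Θ L a b P'},
    L.Closed → J g w s D Θ VSet.empty L (C.fill Q) → Sync s a b (C.fill Q) P' →
    (a.subj ≠ p ∧ b.subj ≠ p ∧ ∃ C' : RCtx, P' = C'.fill Q) ∨
      ∃ (C' : RCtx) (t : ℕ) (e : LAct) (Q' : Proc), Leaf t e Q Q' ∧ P' = C'.fill Q' := by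
  intro C
  induction C with
  | hole =>
    intro w s D Θ L a b P' _ _ h
    change Sync s a b Q P' at h
    cases h <;> cases hQ
  | par C R ih =>
    rintro w s D Θ L a b P' hL ⟨L₁, L₂, h1, h2, hs⟩ h
    have hR : ∀ {e R'}, Lts s e R R' → e.subj ≠ p := by
      intro e R' h he
      have h3 := J_lts_ne_none h (hL.right hs) h2
      have h4 := J_fill_head (hL.left hs) h1 hQ
      rw [he] at h3
      exact (hs _).elim (fun h => h4 h.1) fun h => h3 h.1
    cases h with
    | lr h h' =>
      rcases J_lts_fill hQ C (hL.left hs) h1 h with ⟨h3, C', rfl⟩ | ⟨C', t, Q', h3, rfl⟩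
      · exact .inl ⟨h3, hR h', .par C' _, rfl⟩
      · exact .inr ⟨.par C' _, t, _, Q', h3, rfl⟩
    | rl h h' =>
      rcases J_lts_fill hQ C (hL.left hs) h1 h with ⟨h3, C', rfl⟩ | ⟨C', t, Q', h3, rfl⟩
      · exact .inl ⟨hR h', h3, .par C' _, rfl⟩
      · exact .inr ⟨.par C' _, t, _, Q', h3, rfl⟩
    | parL h =>
      rcases ih (hL.left hs) h1 h with ⟨h3, h4, C', rfl⟩ | ⟨C', t, e, Q', h3, rfl⟩
      · exact .inl ⟨h3, h4, .par C' R, rfl⟩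
      · exact .inr ⟨.par C' R, t, e, Q', h3, rfl⟩
    | parR h =>
      obtain ⟨_, h3, _⟩ := h.seq
      obtain ⟨_, h4, _⟩ := h.seq'
      exact .inl ⟨hR h3, hR h4, .par C _, rfl⟩
  | res A C ih =>
    intro w s D Θ L a b P' hL hJ h
    cases h with
    | res h =>
      rcases ih hL hJ h with ⟨h3, h4, C', rfl⟩ | ⟨C', t, e, Q', h3, rfl⟩
      · exact .inl ⟨h3, h4, .res A C', rfl⟩
      · exact .inr ⟨.res A C', t, e, Q', h3, rfl⟩
  | defn Ss B C ih =>
    intro w s D Θ L a b P' hL hJ h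
    cases h with
    | defn h =>
      obtain ⟨_, _, hJ⟩ : ∃ D' Θ', J g w s D' Θ' VSet.empty L (C.fill Q) := by
        rcases hJ with ⟨_, _, _, _, hJ⟩ | ⟨_, _, hJ⟩
        · exact ⟨_, _, hJ⟩
        · exact ⟨_, _, hJ⟩
      rcases ih hL hJ h with ⟨h3, h4, C', rfl⟩ | ⟨C', t, e, Q', h3, rfl⟩
      · exact .inl ⟨h3, h4, .defn Ss B C', rfl⟩
      · exact .inr ⟨.defn Ss B C', t, e, Q', h3, rfl⟩

end Typing
/-! ## Liveness -/

theorem Proc.Red.with_crashes {b P P'} (h : Proc.Red b P P') : Proc.Red true P P' := by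
  induction h with
  | comm k h hw => exact .comm k h hw
  | errLabel h hw => exact .errLabel h hw
  | call h hw => exact .call h hw
  | ctxPar _ ih => exact .ctxPar ih
  | ctxRes _ ih => exact .ctxRes ih
  | ctxDefn _ ih => exact .ctxDefn ih
  | congr h _ h' ih => exact .congr h ih h'
  | crashSel L hw hn h => exact .crashSel L hw hn h
  | crashBrn L hn h => exact .crashBrn L hn h
  | lostVal => exact .lostVal
  | lostChan => exact .lostChan
  | detect k h => exact .detect k h

/-- The process `Q`, in the hole of a context of `P`, can perform an action at some time. -/
def Fires (P Q : Proc) : Prop :=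
  ∃ (C : RCtx) (t : ℕ) (e : LAct) (Q' : Proc), Leaf t e Q Q' ∧
    Relation.TransGen (Proc.Red false) P (C.fill Q')

/-- At least one reduction takes place, and its closure under congruence absorbs the passage from
`P'` to `P`. This is why `Fires` asks for a non-empty sequence. -/
theorem Fires.exists_steps {P P' Q} (h : Fires P Q) (hc : Proc.Cong P' P) :
    ∃ (C : RCtx) (t : ℕ) (e : LAct) (Q' : Proc), Leaf t e Q Q' ∧
      Relation.ReflTransGen (Proc.Red true) P' (C.fill Q') := by
  obtain ⟨C, t, e, Q', hl, h⟩ := h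
  obtain ⟨R, hR, h⟩ := Relation.TransGen.head'_iff.1 h
  exact ⟨C, t, e, Q', hl, .head (.congr hc hR.with_crashes (.refl _))
    (Relation.ReflTransGen.mono (fun _ _ h => h.with_crashes) _ _ h)⟩

/-- A state of a simulation in which the process `Q` waits in the hole of a context. -/
structure LiveState (s : ℕ) (Ses : Set ℕ) (R : Set Role) (P₀ Q : Proc) where
  ctx : Ctx
  lin : LCtx
  rctx : RCtx
  conforms : Conforms False s Ses ctx lin (rctx.fill Q)
  safe : ctx.Safe s R
  reach : Relation.ReflTransGen (Proc.Red false) P₀ (rctx.fill Q)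

namespace LiveState

variable {s : ℕ} {Ses : Set ℕ} {R : Set Role} {P₀ Q : Proc}

/-- The task `t` is performed by the context. -/
def Step (x : LiveState s Ses R P₀ Q) (t : Bool × Role × Role) (x' : LiveState s Ses R P₀ Q) : Prop :=
  ∃ β H', β.task = some t ∧ Move (x.ctx.conf s) β H' ∧ x'.ctx = x.ctx.withConf s H'

/-- The calls that pass given roles can be unfolded. -/
theorem exists_no_calls {c} (hQ : Q.head = some c) (x : LiveState s Ses R P₀ Q) (l : List Role) :
    ∃ x' : LiveState s Ses R P₀ Q, x'.ctx = x.ctx ∧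
      ∀ p ∈ l, ¬ ActCall (Passes p) s (x'.rctx.fill Q) := by
  induction l with
  | nil => exact ⟨x, rfl, by simp⟩
  | cons p l ih =>
    obtain ⟨y, hy, hl⟩ := ih
    by_cases ha : ActCall (Passes p) s (y.rctx.fill Q)
    · obtain ⟨P', hu⟩ := y.conforms.exists_unfold Passes.of_renS ha
      obtain ⟨C', rfl⟩ := hu.fill hQ
      obtain ⟨hr, h1, h2, L', hco, hJ⟩ := J_unfold hu y.conforms.closed y.conforms.typed
      have hconf := y.conforms.of_local (.inl rfl) (hco.closed y.conforms.closed) hJ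
        (hco.local y.conforms.agree)
      rw [Ctx.withConf_conf] at hconf
      refine ⟨⟨y.ctx, L', C', hconf, y.safe, y.reach.tail hr⟩, hy, fun q hq => ?_⟩
      rcases List.mem_cons.1 hq with rfl | hq
      · exact h1 q fun _ _ h => h
      -- An unfolding never makes a further endpoint be passed by an active call, so the roles
      -- treated before stay clear.
      · exact fun h => hl q hq (h2 q h)
    · refine ⟨y, hy, fun q hq => ?_⟩
      rcases List.mem_cons.1 hq with rfl | hq
      · exact ha
      · exact hl q hq

/-- Enabled tasks can be followed by the process. -/
theorem exists_step {s' p} (hQ : Q.head = some (.ep s' p)) (x : LiveState s Ses R P₀ Q) {t}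
    (ht : (x.ctx.conf s).Enabled t) :
    Fires P₀ Q ∨ (t.2.1 ≠ p ∧ t.2.2 ≠ p ∧ ∃ x', x.Step t x') := by
  obtain ⟨β, H', hβ, hm⟩ := ht
  obtain ⟨y, hy, hl⟩ := x.exists_no_calls hQ [t.2.1, t.2.2]
  simp only [List.mem_cons, List.not_mem_nil, or_false, forall_eq_or_imp, forall_eq] at hl
  have hm' := hm
  rw [← hy] at hm'
  have hsafe := y.safe.now y.conforms.wf
  rcases y.conforms.exists_sync hsafe hm' with ⟨q, rfl⟩ | ⟨q, ha, h⟩ | ⟨a, b, P', hc, hsync, h⟩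
  · cases hβ
  · rcases h with ⟨_, _, rfl⟩ | ⟨_, _, rfl⟩ | ⟨_, rfl⟩ <;> cases hβ
    · exact absurd ha hl.1
    · exact absurd ha hl.2
    · exact absurd ha hl.1
  · rcases J_sync_fill hQ _ y.conforms.closed y.conforms.typed hsync with
      ⟨h1, h2, C', rfl⟩ | ⟨C', t', e, Q', h1, rfl⟩
    · obtain ⟨K, L', hmove, hL', hJ', hloc⟩ := J_sync hc hsync y.conforms.closed y.conforms.typed
        y.conforms.agree hsafe
      have htask : a.move.task = some t := by
        rcases h with h | ⟨_, _, _, _, rfl, h⟩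
        · rw [h, hβ]
        · rw [h]; exact hβ
      have hne : t.2.1 ≠ p ∧ t.2.2 ≠ p := by
        cases hc <;> cases htask
        · exact ⟨h1, h2⟩
        · exact ⟨h1, h2⟩
        · exact ⟨h1, h2⟩
      have hred : Ctx.RedOn s R y.ctx (y.ctx.withConf s K) :=
        (Ctx.redOn_iff y.conforms.wf).2 ⟨_, K, hmove, rfl, fun q hq => by
          rw [hq] at htask
          cases htask⟩
      refine .inr ⟨hne.1, hne.2, ⟨y.ctx.withConf s K, L', C',
        y.conforms.of_local (.inr ⟨_, hmove⟩) hL' hJ' hloc, y.safe.redOn hred,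
        y.reach.tail (hsync.red hc)⟩, a.move, K, htask, hy ▸ hmove, ?_⟩
      rw [← hy]
    · exact .inl ⟨C', t', e, Q', h1, .tail' y.reach (hsync.red hc)⟩

/-- In a live context, a waiting process does not wait forever for communications on which the
context insists. -/
theorem fires {s' p} (hQ : Q.head = some (.ep s' p)) (x : LiveState s Ses R P₀ Q)
    (hlive : ∀ N f, Ctx.IsPath N f → f 0 = x.ctx → Ctx.FairFor s N f → Ctx.LiveFor s N f)
    (hx : (∃ q l S T, Out (x.ctx.conf s) p q l S T) ∨
      ∃ q l S T, Inp (x.ctx.conf s) p q l S T ∧ l ≠ .crash) : Fires P₀ Q := by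
  -- If the prefix never fires, every enabled task can be imitated with the prefix still waiting. A
  -- fair run of these states therefore exists.
  by_contra hF
  have hstep := fun (y : LiveState s Ses R P₀ Q) t (ht : (y.ctx.conf s).Enabled t) =>
    (y.exists_step hQ ht).resolve_left hF
  obtain ⟨f, h0, hf, hfair⟩ := exists_fair_run
    (fun (y : LiveState s Ses R P₀ Q) t => (y.ctx.conf s).Enabled t) Step
    (fun y t ht => (hstep y t ht).2.2)
    (by
      rintro y t y' u ⟨β, H', hβ, hm, hy'⟩ hu hne
      simp only [hy', Ctx.conf_withConf]
      exact hu.move hm hβ hne) x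
  have hact : ∀ {n t}, Step (f n) t (f (n + 1)) → ∃ β : MAct, β.task = some t ∧
      Ctx.Step (f n).ctx (β.act s) (f (n + 1)).ctx := by
    rintro n t ⟨β, H', hβ, hm, h⟩
    exact ⟨β, hβ, h ▸ Ctx.step_of_move (f n).conforms.wf.fin hm⟩
  -- The path ends where no task is enabled any more. Beyond that point the run is meaningless.
  let N : Set ℕ := {n | ∀ i < n, ∃ t, ((f i).ctx.conf s).Enabled t}
  have hN : ∀ {n k t}, n ∈ N → (∀ i, n ≤ i → i ≤ k → ((f i).ctx.conf s).Enabled t) → k + 1 ∈ N := by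
    intro n k t hn h i hi
    rcases lt_or_ge i n with h' | h'
    · exact hn i h'
    · exact ⟨t, h i h' (by omega)⟩
  have hpath : Ctx.IsPath N fun n => (f n).ctx := by
    refine ⟨fun i hi => absurd hi (Nat.not_lt_zero i), fun n hn i hi => hn i (by omega), fun n hn => ?_⟩
    obtain ⟨t, β, H', hβ, hm, h⟩ := hf n (hn n (Nat.lt_succ_self n))
    simp only [h]
    exact Ctx.red_of_move (f n).conforms.wf hm fun p hp => by rw [hp] at hβ; cases hβ
  have hfairFor : Ctx.FairFor s N fun n => (f n).ctx := by
    intro n hn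
    refine ⟨fun p q l hl => ?_, fun q p hl => ?_⟩
    · obtain ⟨H', hm⟩ := (Ctx.can_move (f n).conforms.wf (β := .comm p q l)).1 hl
      obtain ⟨k, hk, hst, hen⟩ := hfair n (true, p, q) (enabled_comm.2 ⟨l, H', hm⟩)
      obtain ⟨β | β | β, hβ, h⟩ := hact hst <;> cases hβ
      exact ⟨k, _, hk, hN hn hen, h⟩
    · obtain ⟨H', hm⟩ := (Ctx.can_move (f n).conforms.wf (β := .detect q p)).1 hl
      obtain ⟨k, hk, hst, hen⟩ := hfair n (false, q, p) (enabled_detect.2 ⟨H', hm⟩)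
      obtain ⟨β | β | β, hβ, h⟩ := hact hst <;> cases hβ
      exact ⟨k, hk, hN hn hen, h⟩
  have hl := hlive N _ hpath (by simp only [h0]) hfairFor 0 fun i hi => absurd hi (Nat.not_lt_zero i)
  -- No transmission possible along the run involves `p`, as imitating it would have fired the
  -- prefix. Liveness demands a transmission or detection by `p`, which is the contradiction.
  have hcomm : ∀ {k q r l Γ'}, Ctx.Step (f k).ctx (.comm s q r l) Γ' → q ≠ p ∧ r ≠ p := by
    intro k q r l Γ' h
    obtain ⟨H', hm⟩ := (Ctx.can_move (f k).conforms.wf (β := .comm q r l)).1 ⟨_, h⟩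
    obtain ⟨h1, h2, _⟩ := hstep (f k) (true, q, r) (enabled_comm.2 ⟨l, H', hm⟩)
    exact ⟨h1, h2⟩
  have hdetect : ∀ {k q r Γ'}, Ctx.Step (f k).ctx (.detect s q r) Γ' → q ≠ p := by
    intro k q r Γ' h
    obtain ⟨H', hm⟩ := (Ctx.can_move (f k).conforms.wf (β := .detect q r)).1 ⟨_, h⟩
    exact (hstep (f k) (false, q, r) (enabled_detect.2 ⟨H', hm⟩)).1
  rcases hx with ⟨q, l, S, T, ho⟩ | ⟨q, l, S, T, hi, hne⟩
  · obtain ⟨k, l', _, _, h⟩ := hl.1 p q l S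
      (by simp only [h0]; exact (Ctx.can_out x.conforms.wf).2 ⟨T, ho⟩)
    exact (hcomm h).1 rfl
  · obtain ⟨k, _, _, ⟨l', h⟩ | h⟩ := hl.2 q p l S
      (by simp only [h0]; exact (Ctx.can_inp x.conforms.wf).2 ⟨T, hi⟩) hne
    · exact (hcomm h).2 rfl
    · exact hdetect h rfl

end LiveState

theorem Conforms.live {s : ℕ} {Ses : Set ℕ} {Γ : Ctx} {L : LCtx} {P : Proc} {Rel : ℕ → Set Role}
    (h : Conforms False s Ses Γ L P) (hs : Γ.Safe s (Rel s)) (hl : Γ.Live s (Rel s)) :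
    P.Live Ses Rel := by
  intro P' hr C
  obtain ⟨Γ', L', h', hs', hΓ⟩ := h.steps hs hr
  have hfill : ∀ {Q}, Proc.Cong P' (C.fill Q) → Conforms False s Ses Γ' L' (C.fill Q) := fun hc =>
    ⟨h'.wf, h'.only, h'.ses, h'.closed, (J_cong hc _ _ _ _ _ _).1 h'.typed, h'.ok⟩
  refine ⟨fun c q l w Q' _ hc => ?_, fun c q n lab Q' hc hlab => ?_⟩
  · have hx := hfill hc
    obtain ⟨D, Θ, L₀, hL₀, hJ, hsub⟩ := J_fill _ hx.closed hx.typed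
    obtain ⟨p, U, S, T, v, rfl, rfl, _, hU, hUs, _⟩ := J_sel_closed hL₀ hJ
    obtain ⟨S', T', ho, _⟩ := hx.agree.out (hsub _ _ hU) hUs
    obtain ⟨C', t, e, Q'', hleaf, hsteps⟩ :=
      (LiveState.fires (x := ⟨Γ', L', C, hx, hs', .refl⟩) rfl (hl _ hΓ) (.inl ⟨_, _, _, _, ho⟩)).exists_steps hc
    cases hleaf
    exact ⟨C', hsteps⟩
  · have hx := hfill hc
    obtain ⟨D, Θ, L₀, hL₀, hJ, hsub⟩ := J_fill _ hx.closed hx.typed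
    obtain ⟨p, U, S, T, rfl, _, hU, hUs, _⟩ := J_brn_closed hL₀ hJ
    obtain ⟨U', hU', hs₁⟩ := hx.agree p U (hsub _ _ hU)
    obtain ⟨n', lab', S', T', hu, hi, hone⟩ := (hs₁.trans hUs).brn_inv
    have hwf := ((hs₁.trans hUs).1.unf hu).sess_brn
    -- The type in the context may have fewer branches than the process. If only the crash branch
    -- were left, the side condition of subtyping would force the process to be a pure crash
    -- recovery, which is excluded.
    have hex : ∃ i, lab' i ≠ .crash := by
      by_contra hn
      push Not at hn
      have h0 : 0 < n' := Nat.pos_of_ne_zero hwf.1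
      have h1 : n' = 1 := by
        by_contra hne
        have := hwf.2.1 ((hn ⟨0, h0⟩).trans (hn ⟨1, by omega⟩).symm)
        simp at this
      have h2 := (hone h1).resolve_left fun h => h ⟨0, h0⟩ (hn _)
      obtain ⟨j, hj, _⟩ := hi ⟨0, h0⟩
      subst h2
      refine hlab (Set.ext fun a => ⟨?_, fun ha => ⟨j, ?_⟩⟩)
      · rintro ⟨i, rfl⟩
        rw [Subsingleton.elim i j, ← hj]
        exact hn _
      · rw [← hj, hn]
        exact ha.symm
    obtain ⟨i, hi'⟩ := hex
    obtain ⟨C', t, e, Q'', hleaf, hsteps⟩ := (LiveState.fires (x := ⟨Γ', L', C, hx, hs', .refl⟩) rfl (hl _ hΓ)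
      (.inr ⟨_, _, _, _, ⟨U', n', lab', S', T', i, hU', hu, rfl, rfl, rfl⟩, hi'⟩)).exists_steps hc
    cases hleaf with
    | brn k v => exact ⟨C', k, .val v, trivial, hsteps⟩

end MPST

/-! ### Assembly of the four statements -/

theorem mainTheorem4 (s : ℕ) (R : Set Role) (Γ : Ctx) (P : Proc)
    (I : Finset Role) (Γr : Role → Ctx) (Pr : Role → Proc)
    (hP : Typed [] Γ P) (hsafe : Γ.Safe s R)
    (hcong : Proc.Cong P (Proc.bigPar (I.toList.map Pr)))
    (hΓ : ∀ c U, Γ c = some U ↔ ∃ p ∈ I, Γr p c = some U)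
    (htyped : ∀ p ∈ I, Typed [] (Γr p) (Pr p))
    (hplays : ∀ p ∈ I, Proc.Cong (Pr p) .nil ∨ (Pr p).OnlyPlays s p (Γr p))
    (Rel : ℕ → Set Role) (hRel : Rel s = R)
    (hsafeAll : ∀ s' ∈ Γ.sessions, Γ.Safe s' (Rel s')) :
    (Γ.DeadlockFree s R → P.DeadlockFree Γ.sessions Rel) ∧
    (Γ.Terminating s R → (∀ p ∈ I, Proc.Cong (Pr p) .nil ∨ (Pr p).GuardedRec) →
      P.Terminating Γ.sessions Rel) ∧
    (Γ.NeverTerminating s R → P.NeverTerminating Γ.sessions Rel) ∧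
    (Γ.Live s R → P.Live Γ.sessions Rel) := by
  -- Guarded recursion is assumed only for termination, so conformance is established twice: without
  -- the guardedness flag here, and with it for the second statement.
  obtain ⟨L, hc⟩ := conforms_init (g := False) hP hcong hΓ htyped hplays fun h => h.elim
  subst hRel
  refine ⟨hc.deadlockFree hsafe, fun ht hg => ?_, hc.neverTerminating hsafe, hc.live hsafe⟩
  obtain ⟨L', hc'⟩ := conforms_init (g := True) hP hcong hΓ htyped hplays fun _ => hg
  exact hc'.terminating hsafe ht (hc'.deadlockFree hsafe ht.1)
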